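/- **Setting.** Let $C=(C_{i,j})_{i,j\in I}$ be a symmetrizable generalized Cartan matrix with symmetrization $D=\mathrm{diag}(r_i)$ ($r_i\ge 1$ integers), $B=DC$, and let $(\mathfrak h,\{\alpha_i\},\{\alpha_i^\vee\})$ be a realization of $C$ over $\mathbb Q$. Let $q\in\mathbb C^*$ be not a root of unity, $q_i=q^{r_i}$, and fix a logarithm $\hbar$ of $q$, so that $q^x=e^{\hbar x}$ for $x\in\mathbb Q$. The quantum affinization $\mathcal U=\mathcal U_q(\hat{\mathfrak g})$ is the $\mathbb C$-algebra with generators $x^\pm_{i,r}$ ($r\in\mathbb Z$), $k_h$ ($h\in\mathfrak h$), $h_{i,m}$ ($m\in\mathbb Z\setminus\{0\}$) and Drinfeld's relations: $k_0=1$, $k_hk_{h'}=k_{h+h'}$; the $k_h$ and $h_{i,m}$ commute; $k_hx^\pm_{j,r}=q^{\pm\alpha_j(h)}x^\pm_{j,r}k_h$; $[h_{i,m},x^\pm_{j,r}]=\pm\frac1m[mB_{i,j}]_q\,x^\pm_{j,m+r}$; $[x^+_{i,r},x^-_{j,s}]=\delta_{i,j}\frac{\phi^+_{i,r+s}-\phi^-_{i,r+s}}{q_i-q_i^{-1}}$;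 $x^\pm_{i,r}x^\pm_{j,s-1}-q^{\pm B_{i,j}}x^\pm_{i,r-1}x^\pm_{j,s}=q^{\pm B_{i,j}}x^\pm_{j,s-1}x^\pm_{i,r}-x^\pm_{j,s}x^\pm_{i,r-1}$; and, if $C_{i,j}C_{j,i}\le 3$ for all $i\ne j$, the affine quantum Serre relations $\sum_{\pi\in\Sigma_s}\sum_{k=0}^{s}(-1)^k\binom{s}{k}_{q_i}x^\pm_{i,l_{\pi(1)}}\cdots x^\pm_{i,l_{\pi(k)}}x^\pm_{j,m}x^\pm_{i,l_{\pi(k+1)}}\cdots x^\pm_{i,l_{\pi(s)}}=0$ for $i\ne j$, $s=1-C_{i,j}$, $l_1,\dots,l_s,m\in\mathbb Z$ (otherwise these are not imposed). Here $[n]_q=\frac{q^n-q^{-n}}{q-q^{-1}}$ and $\binom{s}{k}_{q_i}$ are the corresponding binomial coefficients. Moreover $\sum_{m\ge0}\phi^\pm_{i,\pm m}z^{\pm m}=k_{\pm r_i\alpha_i^\vee}\exp\bigl(\pm(q-q^{-1})\sum_{m\ge1}h_{i,\pm m}z^{\pm m}\bigr)$, and $\phi^\pm_{i,\pm m}=0$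 for $m<0$. For $C$ of finite type, $\mathcal U$ is a quantum affine algebra. For a $\mathcal U$-module $V$ and $\omega\in\mathfrak h^*$ let $V_\omega=\{v: k_hv=q^{\omega(h)}v\ \forall h\in\mathfrak h\}$. Let $\mathrm{Modf}(\mathcal U)$ be the category of finite dimensional $\mathcal U$-modules that are integrable ($V=\bigoplus_\omega V_\omega$, all $V_\omega$ finite dimensional, and for all $\omega$, $i$ one has $V_{\omega\pm r\alpha_i}=0$ for $r$ large) and in category $\mathcal O$ (moreover all weights lie in $\bigcup_{j=1}^s(\lambda_j-\sum_i\mathbb N\alpha_i)$ for some $\lambda_1,\dots,\lambda_s$). Morphisms are the $\mathcal U$-linear maps. Let $\mathcal A\subset\mathbb C(u)$ be the ring of rational functions without pole at $u=1$. For $V_1,V_2\in\mathrm{Modf}(\mathcal U)$ consider the deformed Drinfeld coproduct $$\Delta_u(x^+_{i,r})=x^+_{i,r}\otimes1+\sum_{s\ge0}u^{r+s}\phi^-_{i,-s}\otimes x^+_{i,r+s},\qquad \Delta_u(x^-_{i,r})=u^r(1\otimes x^-_{i,r})+\sum_{s\ge0}u^s x^-_{i,r-s}\otimes\phi^+_{i,s},$$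 $$\Delta_u(\phi^\pm_{i,\pm m})=\sum_{0\le s\le m}u^{\pm s}\phi^\pm_{i,\pm(m-s)}\otimes\phi^\pm_{i,\pm s},\qquad \Delta_u(k_h)=k_h\otimes k_h,$$ acting on $V_1\otimes_{\mathbb C}V_2$ with values in $(V_1\otimes_{\mathbb C} V_2)((u))$. **Theorem.** 1. For all $V_1,V_2\in\mathrm{Modf}(\mathcal U)$ there is exactly one $\mathbb C(u)$-linear action of $\mathcal U$ on $X=(V_1\otimes_{\mathbb C}V_2)\otimes_{\mathbb C}\mathbb C(u)$ such that the generators $x^\pm_{i,r},\phi^\pm_{i,\pm m},k_h$ act on $V_1\otimes_{\mathbb C} V_2$ by $\Delta_u$ (after expansion at $u=0$). Put $\mathcal U^u=\mathcal U\otimes_{\mathbb C}\mathcal A$. Then $L=\mathcal U^u\cdot(V_1\otimes_{\mathbb C}V_2)\subset X$ is an $\mathcal A$-form of $X$: it is a $\mathcal U^u$-submodule, it spans $X$ over $\mathbb C(u)$, and its intersection with each weight space of $X$ is a finitely generated $\mathcal A$-module. Put $V_1\otimes_dV_2=L/(u-1)L$, a $\mathcal U$-module. Then $\otimes_d$ defines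 a bifunctor $$\otimes_d:\mathrm{Modf}(\mathcal U)\times\mathrm{Modf}(\mathcal U)\to\mathrm{Modf}(\mathcal U),$$ where $f_1\otimes_df_2$ is induced by the $\mathbb C(u)$-linear extension of $f_1\otimes f_2$, which maps $\mathcal U^u\cdot(V_1\otimes_{\mathbb C} V_2)$ into $\mathcal U^u\cdot(V_1'\otimes_{\mathbb C} V_2')$. 2. In general $\otimes_d$ is non-commutative and differs from $*_f$, where for $l$-highest weight modules $V_1,V_2$ with $l$-highest weight vectors $v_1,v_2$ one puts $V_1*_fV_2=M/(u-1)M$, $M=\mathcal U^u\cdot(v_1\otimes v_2)$. Namely, for $C=(2)$, $D=(1)$ (so that $\mathcal U=\mathcal U_q(\hat{\mathfrak{sl}}_2)$) and the simple $l$-highest weight modules $V_1,V_2\in\mathrm{Modf}(\mathcal U)$ with Drinfeld polynomials $1-z$ and $1-q^2z$, the $\mathcal U$-modules $V_1\otimes_dV_2$ and $V_2\otimes_dV_1$ are not isomorphic, and $V_1\otimes_dV_2$ and $V_1*_fV_2$ are not isomorphic. Here $V$ has Drinfeld polynomial $P$, $P(0)=1$, if it is generated by a vector $v\ne 0$ of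 integral weight with $x^+_{1,r}v=0$ and $\phi^\pm_{1,\pm m}v=\Psi^\pm_{\pm m}v$, where $\sum_{m\ge0}\Psi^\pm_{\pm m}z^{\pm m}$ is the expansion of $q^{\deg P}P(zq^{-1})/P(zq)$ in $z^{\pm1}$. -/

import Mathlib

open CategoryTheory TensorProduct
open scoped ModuleCat Polynomial

universe v w₁ w₂

namespace QAff

/-- A symmetrizable generalized Cartan matrix `C` together with a fixed symmetrization
`D = diag(r_i)` and a realization `(𝔥, Π, Π^∨)` of `C` over `ℚ`. -/
structure CartanDatum (ι : Type w₁) [Fintype ι] [DecidableEq ι]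
    (𝔥 : Type w₂) [AddCommGroup 𝔥] [Module ℚ 𝔥] where
  C : Matrix ι ι ℤ
  diag : ∀ i, C i i = 2
  nonpos : ∀ i j, i ≠ j → C i j ≤ 0
  zero_iff : ∀ i j, C i j = 0 ↔ C j i = 0
  r : ι → ℕ
  r_pos : ∀ i, 0 < r i
  symm : ∀ i j, (r i : ℤ) * C i j = (r j : ℤ) * C j i
  root : ι → Module.Dual ℚ 𝔥
  coroot : ι → 𝔥
  root_indep : LinearIndependent ℚ root
  coroot_indep : LinearIndependent ℚ coroot
  pairing : ∀ i j, root j (coroot i) = (C i j : ℚ)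
  finite : Module.Finite ℚ 𝔥
  finrank_eq : Module.finrank ℚ 𝔥 + (C.map (Int.cast : ℤ → ℚ)).rank = 2 * Fintype.card ι

/-- The datum of type `A_1`: `C = (2)`, `D = (1)`, `𝔥 = ℚ α^∨`. -/
noncomputable def sl2Datum : CartanDatum (Fin 1) ℚ where
  C := !![2]
  diag := fun i => by rw [Subsingleton.elim i 0]; rfl
  nonpos := fun i j h => absurd (Subsingleton.elim i j) h
  zero_iff := fun i j => by rw [Subsingleton.elim i j]
  r := fun _ => 1
  r_pos := fun _ => Nat.one_pos
  symm := fun i j => by rw [Subsingleton.elim i j]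
  root := fun _ => (2 : ℚ) • LinearMap.id
  coroot := fun _ => 1
  root_indep := by
    refine LinearIndependent.of_subsingleton (0 : Fin 1) ?_
    intro h
    have := LinearMap.congr_fun h (1 : ℚ)
    simp at this
  coroot_indep := LinearIndependent.of_subsingleton (0 : Fin 1) one_ne_zero
  pairing := fun i j => by simp [Subsingleton.elim i 0, Subsingleton.elim j 0]
  finite := inferInstance
  finrank_eq := by
    rw [Matrix.rank_of_isUnit]
    · simp
    · rw [Matrix.isUnit_iff_isUnit_det]
      simp [Matrix.map_apply]

/-! ### q-numbers; `q = exp ħ`, and `q ^ x = exp (ħ x)` for rational `x` -/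

/-- `q ^ x` for a rational exponent `x`, where `q = exp ħ`. -/
noncomputable def qPow (ħ : ℂ) (x : ℚ) : ℂ := Complex.exp (ħ * (x : ℂ))

/-- `[n]_q = (q ^ n - q ^ (-n)) / (q - q⁻¹)` for `q = exp ħ`. -/
noncomputable def qInt (ħ : ℂ) (n : ℤ) : ℂ :=
  (qPow ħ n - qPow ħ (-n)) / (qPow ħ 1 - qPow ħ (-1))

noncomputable def qFact (ħ : ℂ) (n : ℕ) : ℂ := ∏ a ∈ Finset.range n, qInt ħ ((a : ℤ) + 1)

noncomputable def qBinom (ħ : ℂ) (n k : ℕ) : ℂ := qFact ħ n / (qFact ħ k * qFact ħ (n - k))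

/-! ### The quantum affinization -/

/-- Generators `x^±_{i,r}` (the sign is an element of `ℤˣ = {1, -1}`), `k_h` and
`h_{i,m}` (`m ≠ 0`). -/
inductive Gen (ι : Type w₁) (𝔥 : Type w₂) : Type (max w₁ w₂) where
  | x (ε : ℤˣ) (i : ι) (r : ℤ) : Gen ι 𝔥
  | k (h : 𝔥) : Gen ι 𝔥
  | h (i : ι) (m : {m : ℤ // m ≠ 0}) : Gen ι 𝔥

section Algebra

variable {ι : Type w₁} [Fintype ι] [DecidableEq ι] {𝔥 : Type w₂} [AddCommGroup 𝔥] [Module ℚ 𝔥]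
variable (D : CartanDatum ι 𝔥) (ħ : ℂ)

/-- The free algebra on the generators. -/
abbrev Free (ι : Type w₁) (𝔥 : Type w₂) : Type (max w₁ w₂) := FreeAlgebra ℂ (Gen ι 𝔥)

abbrev fx (ε : ℤˣ) (i : ι) (r : ℤ) : Free ι 𝔥 := FreeAlgebra.ι ℂ (Gen.x ε i r)
abbrev fk (h : 𝔥) : Free ι 𝔥 := FreeAlgebra.ι ℂ (Gen.k h)
abbrev fh (i : ι) (m : {m : ℤ // m ≠ 0}) : Free ι 𝔥 := FreeAlgebra.ι ℂ (Gen.h i m)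

/-- The formal power series `∑_{m ≥ 1} h_{i, ε m} t ^ m`, where `t = z ^ ε`. -/
noncomputable def hSeries (𝔥 : Type w₂) (ε : ℤˣ) (i : ι) : PowerSeries (Free ι 𝔥) :=
  PowerSeries.mk fun m =>
    if hm : m = 0 then 0
    else fh i ⟨(ε : ℤ) * (m : ℤ), mul_ne_zero ε.ne_zero (Int.natCast_ne_zero.mpr hm)⟩

/-- `φ^ε_{i, ε m}` for `m ≥ 0`: the coefficient of `z ^ (ε m)` in
`k_{ε r_i α_i^∨} exp (ε (q - q⁻¹) ∑_{m' ≥ 1} h_{i, ε m'} z ^ (ε m'))`. As the series in the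
exponential has no constant term, its `n`-th power does not contribute for `n > m`. -/
noncomputable def fphi (ε : ℤˣ) (i : ι) (m : ℕ) : Free ι 𝔥 :=
  fk ((((ε : ℤ) : ℚ) * (D.r i : ℚ)) • D.coroot i) *
    ∑ n ∈ Finset.range (m + 1),
      ((((ε : ℤ) : ℂ) * (qPow ħ 1 - qPow ħ (-1))) ^ n / (n.factorial : ℂ)) •
        PowerSeries.coeff m (hSeries 𝔥 ε i ^ n)

/-- `φ^ε_{i, m}` for all integers `m`; it vanishes if `ε m < 0`. -/
noncomputable def fphiZ (ε : ℤˣ) (i : ι) (m : ℤ) : Free ι 𝔥 :=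
  if 0 ≤ (ε : ℤ) * m then fphi D ħ ε i ((ε : ℤ) * m).toNat else 0

/-- `C_{i,j} C_{j,i} ≤ 3` for all `i ≠ j`. This holds for all `C` of finite type. -/
def CartanDatum.IsSmall : Prop := ∀ i j, i ≠ j → D.C i j * D.C j i ≤ 3

/-- The left-hand side of the affine quantum Serre relation: the coefficient of
`w_1 ^ {l_1} ⋯ w_s ^ {l_s} z ^ m` in
`∑_π ∑_k (-1)^k [s choose k] x_i(w_{π 1}) ⋯ x_i(w_{π k}) x_j(z) x_i(w_{π (k+1)}) ⋯ x_i(w_{π s})`,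
where `s = 1 - C_{i,j}`. -/
noncomputable def fserre (ε : ℤˣ) (i j : ι) (l : Fin (1 - D.C i j).toNat → ℤ) (m : ℤ) :
    Free ι 𝔥 :=
  ∑ π : Equiv.Perm (Fin (1 - D.C i j).toNat), ∑ k ∈ Finset.range ((1 - D.C i j).toNat + 1),
    ((-1 : ℂ) ^ k * qBinom (ħ * (D.r i : ℂ)) (1 - D.C i j).toNat k) •
      (((List.ofFn fun a => (fx ε i (l (π a)) : Free ι 𝔥)).take k).prod * fx ε j m *
        ((List.ofFn fun a => (fx ε i (l (π a)) : Free ι 𝔥)).drop k).prod)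

/-- The defining relations of the quantum affinization, mode by mode. The affine quantum Serre
relations are imposed if `C_{i,j} C_{j,i} ≤ 3` for all `i ≠ j`, and not imposed otherwise. -/
inductive Rel : Free ι 𝔥 → Free ι 𝔥 → Prop
  | k_zero : Rel (fk 0) 1
  | k_add (h h' : 𝔥) : Rel (fk h * fk h') (fk (h + h'))
  | k_h (h : 𝔥) (i : ι) (m : {m : ℤ // m ≠ 0}) : Rel (fk h * fh i m) (fh i m * fk h)
  | h_h (i j : ι) (m m' : {m : ℤ // m ≠ 0}) : Rel (fh i m * fh j m') (fh j m' * fh i m)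
  | k_x (h : 𝔥) (ε : ℤˣ) (j : ι) (r : ℤ) :
      Rel (fk h * fx ε j r) (qPow ħ (((ε : ℤ) : ℚ) * D.root j h) • (fx ε j r * fk h))
  | h_x (i : ι) (m : {m : ℤ // m ≠ 0}) (ε : ℤˣ) (j : ι) (r : ℤ) :
      Rel (fh i m * fx ε j r - fx ε j r * fh i m)
        ((((ε : ℤ) : ℂ) * (1 / ((m : ℤ) : ℂ)) * qInt ħ ((m : ℤ) * ((D.r i : ℤ) * D.C i j))) •
          fx ε j ((m : ℤ) + r))
  | x_x_same (i : ι) (r s : ℤ) :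
      Rel (fx 1 i r * fx (-1) i s - fx (-1) i s * fx 1 i r)
        ((1 / (qPow ħ (D.r i : ℚ) - qPow ħ (-(D.r i : ℚ)))) •
          (fphiZ D ħ 1 i (r + s) - fphiZ D ħ (-1) i (r + s)))
  | x_x_ne (i j : ι) (hij : i ≠ j) (r s : ℤ) : Rel (fx 1 i r * fx (-1) j s) (fx (-1) j s * fx 1 i r)
  | x_x (ε : ℤˣ) (i j : ι) (r s : ℤ) :
      Rel (fx ε i r * fx ε j (s - 1) -
          qPow ħ (((ε : ℤ) : ℚ) * ((D.r i : ℚ) * (D.C i j : ℚ))) • (fx ε i (r - 1) * fx ε j s))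
        (qPow ħ (((ε : ℤ) : ℚ) * ((D.r i : ℚ) * (D.C i j : ℚ))) • (fx ε j (s - 1) * fx ε i r) -
          fx ε j s * fx ε i (r - 1))
  | serre (hD : D.IsSmall) (ε : ℤˣ) (i j : ι) (hij : i ≠ j)
      (l : Fin (1 - D.C i j).toNat → ℤ) (m : ℤ) : Rel (fserre D ħ ε i j l m) 0

/-- The quantum affinization `𝒰_q(ĝ)`, `q = exp ħ`. -/
def U : Type (max w₁ w₂) := RingQuot (Rel D ħ)

noncomputable instance : Ring (U D ħ) := inferInstanceAs (Ring (RingQuot (Rel D ħ)))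

noncomputable instance : Algebra ℂ (U D ħ) := inferInstanceAs (Algebra ℂ (RingQuot (Rel D ħ)))

/-- The projection from the free algebra. -/
noncomputable def U.mk : Free ι 𝔥 →ₐ[ℂ] U D ħ := RingQuot.mkAlgHom ℂ (Rel D ħ)

/-- `x^ε_{i,r}` in `𝒰_q(ĝ)`. -/
noncomputable def U.x (ε : ℤˣ) (i : ι) (r : ℤ) : U D ħ := U.mk D ħ (fx ε i r)

/-- `k_h` in `𝒰_q(ĝ)`. -/
noncomputable def U.k (h : 𝔥) : U D ħ := U.mk D ħ (fk h)

/-- `φ^ε_{i, ε m}` (`m ≥ 0`) in `𝒰_q(ĝ)`. -/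
noncomputable def U.phi (ε : ℤˣ) (i : ι) (m : ℕ) : U D ħ := U.mk D ħ (fphi D ħ ε i m)

/-! ### Modules -/

section Modules

variable (V : Type v) [AddCommGroup V] [Module ℂ V] [Module (U D ħ) V] [IsScalarTower ℂ (U D ħ) V]

/-- The weight space `V_ω = {v | ∀ h, k_h v = q ^ ω(h) v}`. -/
noncomputable def weightSpace (ω : Module.Dual ℚ 𝔥) : Submodule ℂ V where
  carrier := {v | ∀ h : 𝔥, U.k D ħ h • v = qPow ħ (ω h) • v}
  add_mem' := fun ha hb h => by rw [smul_add, smul_add, ha h, hb h]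
  zero_mem' := fun h => by rw [smul_zero, smul_zero]
  smul_mem' := fun c a ha h => by
    rw [smul_comm (U.k D ħ h) c a, ha h, smul_comm c]

/-- `V` is the direct sum of its weight spaces. -/
def IsDiagonalizable : Prop :=
  iSupIndep (weightSpace D ħ V) ∧ ⨆ ω, weightSpace D ħ V ω = ⊤

/-- Integrable modules. -/
def IsIntegrable : Prop :=
  IsDiagonalizable D ħ V ∧
  (∀ ω, FiniteDimensional ℂ (weightSpace D ħ V ω)) ∧
  ∀ (ω : Module.Dual ℚ 𝔥) (i : ι), ∃ R : ℕ, ∀ r : ℕ, R ≤ r →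
    weightSpace D ħ V (ω + r • D.root i) = ⊥ ∧ weightSpace D ħ V (ω - r • D.root i) = ⊥

/-- The order on weights: `μ ≤ ω` if and only if `ω - μ ∈ Q⁺ = ∑ ℕ α_i`. -/
def WeightLE (μ ω : Module.Dual ℚ 𝔥) : Prop := ∃ c : ι → ℕ, ω - μ = ∑ i, c i • D.root i

/-- The modules of the category `𝒪`. -/
def InCategoryO : Prop :=
  IsDiagonalizable D ħ V ∧
  (∀ ω, FiniteDimensional ℂ (weightSpace D ħ V ω)) ∧
  ∃ S : Finset (Module.Dual ℚ 𝔥), ∀ ω, weightSpace D ħ V ω ≠ ⊥ → ∃ μ ∈ S, WeightLE D ω μ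

/-- `v` is an `l`-highest weight vector generating `V`, of `l`-highest weight `(ω, Ψ)`;
here `Ψ ε i m` stands for `Ψ^ε_{i, ε m}`, and `ω` is an integral weight. -/
def IsLHighestWeightVector (ω : Module.Dual ℚ 𝔥) (Ψ : ℤˣ → ι → ℕ → ℂ) (v : V) : Prop :=
  v ≠ 0 ∧ (∀ i, ∃ n : ℤ, ω (D.coroot i) = n) ∧ v ∈ weightSpace D ħ V ω ∧
  Submodule.span (U D ħ) {v} = ⊤ ∧
  (∀ i r, U.x D ħ 1 i r • v = 0) ∧
  ∀ ε i m, U.phi D ħ ε i m • v = Ψ ε i m • v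

/-- `Ψ` is given by the Drinfeld polynomials `P_i`, `P_i(0) = 1`: the series
`∑_m Ψ^±_{i, ± m} z ^ {± m}` is the expansion of `q_i ^ {deg P_i} P_i(z q_i⁻¹) / P_i(z q_i)`
in `z`, respectively in `z⁻¹`. For the latter, numerator and denominator are multiplied by
`z ^ {- deg P_i}`, that is, the two polynomials are reversed. -/
def HasDrinfeldPolynomials (Ψ : ℤˣ → ι → ℕ → ℂ) (P : ι → ℂ[X]) : Prop :=
  ∀ i, (P i).coeff 0 = 1 ∧
    PowerSeries.mk (Ψ 1 i) *
        (((P i).comp (Polynomial.C (qPow ħ (D.r i : ℚ)) * Polynomial.X) : ℂ[X]) :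
          PowerSeries ℂ) =
      ((Polynomial.C (qPow ħ (D.r i : ℚ) ^ (P i).natDegree) *
        (P i).comp (Polynomial.C (qPow ħ (-(D.r i : ℚ))) * Polynomial.X) : ℂ[X]) :
          PowerSeries ℂ) ∧
    PowerSeries.mk (Ψ (-1) i) *
        (((P i).comp (Polynomial.C (qPow ħ (D.r i : ℚ)) * Polynomial.X)).reverse :
          PowerSeries ℂ) =
      ((Polynomial.C (qPow ħ (D.r i : ℚ) ^ (P i).natDegree) *
        ((P i).comp (Polynomial.C (qPow ħ (-(D.r i : ℚ))) * Polynomial.X)).reverse : ℂ[X]) :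
          PowerSeries ℂ)

end Modules

/-- The finite dimensional modules in `Mod(𝒰_q(ĝ))`, that is, those that are integrable and in
the category `𝒪`. -/
def isModf : ObjectProperty (ModuleCat.{v} (U D ħ)) := fun V =>
  IsIntegrable D ħ V ∧ InCategoryO D ħ V ∧ FiniteDimensional ℂ V

/-- The category of finite dimensional modules in `Mod(𝒰_q(ĝ))`; morphisms are the
`𝒰_q(ĝ)`-linear maps. -/
abbrev Modf : Type _ := (isModf.{v} D ħ).FullSubcategory

/-! ### The field `ℂ(u)`, the ring `𝒜`, and modules over `𝒰_q(ĝ) ⊗ ℂ(u)` -/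

/-- The field `ℂ(u)`. -/
abbrev K : Type := RatFunc ℂ

/-- `𝒜`: the rational functions `f / g` with `g(1) ≠ 0`. -/
noncomputable def regularAtOne : Subalgebra ℂ K where
  carrier := {a | ∃ f g : ℂ[X], g.eval 1 ≠ 0 ∧ a = algebraMap ℂ[X] K f / algebraMap ℂ[X] K g}
  mul_mem' := by
    rintro _ _ ⟨f, g, hg, rfl⟩ ⟨f', g', hg', rfl⟩
    refine ⟨f * f', g * g', by simp [hg, hg'], ?_⟩
    rw [map_mul, map_mul, div_mul_div_comm]
  add_mem' := by
    rintro _ _ ⟨f, g, hg, rfl⟩ ⟨f', g', hg', rfl⟩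
    refine ⟨f * g' + g * f', g * g', by simp [hg, hg'], ?_⟩
    have h1 : algebraMap ℂ[X] K g ≠ 0 := RatFunc.algebraMap_ne_zero (by rintro rfl; simp at hg)
    have h2 : algebraMap ℂ[X] K g' ≠ 0 := RatFunc.algebraMap_ne_zero (by rintro rfl; simp at hg')
    rw [map_add, map_mul, map_mul, map_mul, div_add_div _ _ h1 h2]
  algebraMap_mem' := fun c => ⟨Polynomial.C c, 1, by simp, by
    rw [map_one, div_one]
    exact IsScalarTower.algebraMap_apply ℂ ℂ[X] K c⟩

variable {D ħ}

section RepSpace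

variable {X : Type v} [AddCommGroup X] [Module ℂ X] [Module K X] [IsScalarTower ℂ K X]

/-- A `ℂ(u)`-vector space with an algebra map `𝒰_q(ĝ) → End_{ℂ(u)}(X)` (in other words, a module
over `𝒰_q(ĝ) ⊗ ℂ(u)`), considered as a `𝒰_q(ĝ)`-module. -/
def RepSpace (_ρ : U D ħ →ₐ[ℂ] Module.End K X) : Type v := X

variable (ρ : U D ħ →ₐ[ℂ] Module.End K X)

instance : AddCommGroup (RepSpace ρ) := inferInstanceAs (AddCommGroup X)

instance : Module K (RepSpace ρ) := inferInstanceAs (Module K X)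

noncomputable instance : Module (U D ħ) (RepSpace ρ) := Module.compHom X (ρ : U D ħ →+* Module.End K X)

theorem RepSpace.smul_def (g : U D ħ) (x : RepSpace ρ) : g • x = (ρ g (show X from x) : X) := rfl

/-- Multiplication by `u - 1`. -/
noncomputable def mulUSubOne : RepSpace ρ →ₗ[U D ħ] RepSpace ρ where
  toFun x := ((RatFunc.X - 1 : K)) • x
  map_add' := smul_add _
  map_smul' := fun g x => ((ρ g).map_smul (RatFunc.X - 1 : K) x).symm

/-- `𝒰_q^u(ĝ) · S`, where `𝒰_q^u(ĝ) = 𝒰_q(ĝ) ⊗ 𝒜`: as the actions of `𝒜` and `𝒰_q(ĝ)` commute, this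
is the `𝒰_q(ĝ)`-submodule generated by `𝒜 · S`. -/
noncomputable def lattice (S : Set X) : Submodule (U D ħ) (RepSpace ρ) :=
  Submodule.span (U D ħ) {y | ∃ a ∈ regularAtOne, ∃ s ∈ S, y = (a • s : X)}

/-- `L` is an `𝒜`-form of `X`: an `𝒜`-submodule, stable under `𝒰_q(ĝ)`, generating `X` over `ℂ(u)`,
whose intersection with each weight space is a finitely generated `𝒜`-module. -/
def IsAForm (L : Submodule (U D ħ) (RepSpace ρ)) : Prop :=
  (∀ a ∈ regularAtOne, ∀ x ∈ L, a • x ∈ L) ∧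
  Submodule.span K (L : Set (RepSpace ρ)) = ⊤ ∧
  ∀ ω : Module.Dual ℚ 𝔥, ∃ T : Set X, T.Finite ∧
    ((Submodule.span regularAtOne T : Submodule regularAtOne X) : Set X) =
      {x : X | (show RepSpace ρ from x) ∈ L ∧
        ∀ h : 𝔥, ρ (U.k D ħ h) x = algebraMap ℂ K (qPow ħ (ω h)) • x}

/-- The specialization `L_{u = 1} = L / (u - 1) L`, a `𝒰_q(ĝ)`-module. -/
abbrev Specialization (L : Submodule (U D ħ) (RepSpace ρ)) : Type v :=
  L ⧸ (L.map (mulUSubOne ρ)).comap L.subtype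

end RepSpace

/-! ### The fusion of two modules -/

open scoped RatFunc in
/-- The coefficient of `u ^ n` in the Laurent series expansion at `u = 0` of a rational
function. -/
noncomputable def ratCoeff (F : Type*) [Field F] (n : ℤ) : RatFunc F →ₗ[F] F where
  toFun f := (algebraMap (RatFunc F) (LaurentSeries F) f).coeff n
  map_add' f g := by rw [map_add, HahnSeries.coeff_add]
  map_smul' c f := by
    rw [Algebra.smul_def, map_mul, IsScalarTower.algebraMap_apply F F[X] (RatFunc F),
      ← IsScalarTower.algebraMap_apply F[X] (RatFunc F) (LaurentSeries F)]
    simp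

/-- The coefficient of `u ^ n` in the expansion at `u = 0` of an element of
`W ⊗ ℂ(u) ⊆ W((u))`. -/
noncomputable def expandCoeff (W : Type v) [AddCommGroup W] [Module ℂ W] (n : ℤ) :
    K ⊗[ℂ] W →ₗ[ℂ] W :=
  (TensorProduct.lid ℂ W).toLinearMap ∘ₗ LinearMap.rTensor W (ratCoeff ℂ n)

section Fusion

variable (V₁ V₂ : Type v)
  [AddCommGroup V₁] [Module ℂ V₁] [Module (U D ħ) V₁] [IsScalarTower ℂ (U D ħ) V₁]
  [AddCommGroup V₂] [Module ℂ V₂] [Module (U D ħ) V₂] [IsScalarTower ℂ (U D ħ) V₂]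

/-- The space `i(V₁) ⊗_{ℂ(u)} i(V₂) = (V₁ ⊗_ℂ V₂) ⊗_ℂ ℂ(u)`. -/
abbrev FusionSpace : Type v := K ⊗[ℂ] (V₁ ⊗[ℂ] V₂)

variable {V₁ V₂}

/-- The coefficient of `u ^ n` in `Δ_u(x^+_{i,r}) (v₁ ⊗ v₂)`, where
`Δ_u(x^+_{i,r}) = x^+_{i,r} ⊗ 1 + ∑_{s ≥ 0} u ^ (r + s) φ^-_{i,-s} ⊗ x^+_{i,r+s}`. -/
noncomputable def deltaXPlus (i : ι) (r : ℤ) (v₁ : V₁) (v₂ : V₂) (n : ℤ) : V₁ ⊗[ℂ] V₂ :=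
  (if n = 0 then (U.x D ħ 1 i r • v₁) ⊗ₜ[ℂ] v₂ else 0) +
  (if r ≤ n then (U.phi D ħ (-1) i (n - r).toNat • v₁) ⊗ₜ[ℂ] (U.x D ħ 1 i n • v₂) else 0)

/-- The coefficient of `u ^ n` in `Δ_u(x^-_{i,r}) (v₁ ⊗ v₂)`, where
`Δ_u(x^-_{i,r}) = u ^ r (1 ⊗ x^-_{i,r}) + ∑_{s ≥ 0} u ^ s x^-_{i,r-s} ⊗ φ^+_{i,s}`. -/
noncomputable def deltaXMinus (i : ι) (r : ℤ) (v₁ : V₁) (v₂ : V₂) (n : ℤ) : V₁ ⊗[ℂ] V₂ :=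
  (if n = r then v₁ ⊗ₜ[ℂ] (U.x D ħ (-1) i r • v₂) else 0) +
  (if 0 ≤ n then (U.x D ħ (-1) i (r - n) • v₁) ⊗ₜ[ℂ] (U.phi D ħ 1 i n.toNat • v₂) else 0)

/-- `ρ` is the action of `𝒰_q(ĝ) ⊗ ℂ(u)` on `i(V₁) ⊗_f i(V₂)`: on `V₁ ⊗ V₂` each generator `g` acts,
inside `(V₁ ⊗ V₂)((u))`, by the deformed Drinfeld coproduct `Δ_u(g)`. -/
structure IsFusionAction (ρ : U D ħ →ₐ[ℂ] Module.End K (FusionSpace V₁ V₂)) : Prop where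
  x_plus : ∀ i r (v₁ : V₁) (v₂ : V₂) n,
    expandCoeff (V₁ ⊗[ℂ] V₂) n (ρ (U.x D ħ 1 i r) (1 ⊗ₜ (v₁ ⊗ₜ v₂))) =
      deltaXPlus (D := D) (ħ := ħ) i r v₁ v₂ n
  x_minus : ∀ i r (v₁ : V₁) (v₂ : V₂) n,
    expandCoeff (V₁ ⊗[ℂ] V₂) n (ρ (U.x D ħ (-1) i r) (1 ⊗ₜ (v₁ ⊗ₜ v₂))) =
      deltaXMinus (D := D) (ħ := ħ) i r v₁ v₂ n
  phi : ∀ (ε : ℤˣ) i (m : ℕ) (v₁ : V₁) (v₂ : V₂),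
    ρ (U.phi D ħ ε i m) (1 ⊗ₜ (v₁ ⊗ₜ v₂)) =
      ∑ s ∈ Finset.range (m + 1), (RatFunc.X ^ ((ε : ℤ) * (s : ℤ)) : K) ⊗ₜ[ℂ]
        ((U.phi D ħ ε i (m - s) • v₁) ⊗ₜ[ℂ] (U.phi D ħ ε i s • v₂))
  k : ∀ (h : 𝔥) (v₁ : V₁) (v₂ : V₂),
    ρ (U.k D ħ h) (1 ⊗ₜ (v₁ ⊗ₜ v₂)) = 1 ⊗ₜ ((U.k D ħ h • v₁) ⊗ₜ (U.k D ħ h • v₂))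

/-- `𝒰_q^u(ĝ) · (V₁ ⊗_ℂ V₂)`. -/
noncomputable def tensorLattice (ρ : U D ħ →ₐ[ℂ] Module.End K (FusionSpace V₁ V₂)) :
    Submodule (U D ħ) (RepSpace ρ) :=
  lattice ρ (Set.range fun t : V₁ ⊗[ℂ] V₂ => (1 : K) ⊗ₜ[ℂ] t)

/-- `V₁ ⊗_d V₂ = (𝒰_q^u(ĝ) · (V₁ ⊗_ℂ V₂))_{u = 1}`. -/
abbrev TensorD (ρ : U D ħ →ₐ[ℂ] Module.End K (FusionSpace V₁ V₂)) : Type v :=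
  Specialization ρ (tensorLattice ρ)

/-- `V₁ *_f V₂ = (𝒰_q^u(ĝ) · (v₁ ⊗ v₂))_{u = 1}`, for `l`-highest weight modules `V₁`, `V₂` with
`l`-highest weight vectors `v₁`, `v₂`. -/
abbrev FusionProduct (ρ : U D ħ →ₐ[ℂ] Module.End K (FusionSpace V₁ V₂)) (v₁ : V₁) (v₂ : V₂) :
    Type v :=
  Specialization ρ (lattice ρ {(1 : K) ⊗ₜ[ℂ] (v₁ ⊗ₜ[ℂ] v₂)})

/-- The `ℂ(u)`-linear extension of `f₁ ⊗ f₂`. -/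
noncomputable def fusionMap {V₁' V₂' : Type v}
    [AddCommGroup V₁'] [Module ℂ V₁'] [Module (U D ħ) V₁'] [IsScalarTower ℂ (U D ħ) V₁']
    [AddCommGroup V₂'] [Module ℂ V₂'] [Module (U D ħ) V₂'] [IsScalarTower ℂ (U D ħ) V₂']
    (f₁ : V₁ →ₗ[U D ħ] V₁') (f₂ : V₂ →ₗ[U D ħ] V₂') :
    FusionSpace V₁ V₂ →ₗ[K] FusionSpace V₁' V₂' :=
  (TensorProduct.map (f₁.restrictScalars ℂ) (f₂.restrictScalars ℂ)).baseChange K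

end Fusion

end Algebra

end QAff

set_option linter.unusedSectionVars false

namespace QAff

/-! ### Expansion at `u = 0` -/

section Expansion

open scoped RatFunc

/-! Existence of the action. Let `E = End (V₁ ⊗ V₂)`, with its two commuting actions of the algebra.
The coproduct is constructed with values in `K ⊗ E`, which embeds as an algebra into `E((u))` by
expansion at `u = 0` (`expand_injective`), so identities may be tested on coefficients. The first
issue is rationality of `∑ u ^ a φ_a ⊗ x_{r+a}`. Commutators with the `h_{i,±1}` shift the index of
`x`, so `∑ u ^ n x_{-n} ⊗ x_{r+n}` is a geometric series `(1 - u S)⁻¹` with `S` acting on the finite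
dimensional `E`, and a commutator with `x_0` turns the first factors into `φ` (`exists_geometric`,
`exists_current`).

All relations except Serre are then formal. The quadratic ones split into four pieces
(`CurrentData.total_total`); those involving `φ` follow from the first order differential equation
that characterizes an exponential (`eq_of_euler_eq`, `CartanCommute.euler_phi`). For Serre,
commutators with the images of `h_{i,p}` and `h_{j,p}` give two linear equations whose determinant
is nonzero when `C_{i,j} C_{j,i} ≤ 3` (`hxCoeff_det`), so the relation in degree zero forces it in
all degrees (`serreSum_eq_zero`). In degree zero, `x_{j,0}` is a lowest weight vector for a quantum
adjoint action of `U_q(sl_2)` on `K ⊗ E`, which is finite dimensional over `K`, and the standard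
weight argument kills the right iterated `q`-commutator (`qCommutator_eq_zero`). Uniqueness holds
because the `x`, `k`, `φ` generate the algebra when `q` is not a root of unity (`U.eq_top_of_phi`).

The lattice. The poles at `u = 1` of all operators have bounded order
(`exists_delta_mem_poleFiltration`). By triangular decomposition it suffices to treat the three
parts separately: the Cartan part has no pole; commutators with the regular elements `Δ(h)` show
that the pole order of `Δ(x_r)` does not depend on `r`; and long words in the `x^+`, or in the
`x^-`, vanish because their weights are distinct. Hence `(u - 1) ^ N L` lies in `𝒜 ⊗ V₁ ⊗ V₂`, and
`L` is finitely generated as `𝒜` is Noetherian. The specialization is finite dimensional and spanned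
by weight vectors, which already implies integrability and membership in category `𝒪`. Functoriality
is checked on generators.

The example. For evaluation modules with parameters `b₁`, `b₂`, put `β = b₂ / b₁` and let `w_{ij}`
be the tensor basis. The currents `x^-` lead from `w_{00}` to `w_{10}` only with the factor `F = (q
- q⁻¹ β u) / (1 - β u)`. If `β = q²` then `F` vanishes at `u = 1`, and `w_{00}, w_{01}, w_{11}, (u -
1) w_{10}` span an invariant `𝒜`-module, so no vector of nonzero weight generates the specialization
(`not_isGeneratedInWeight_tensorD`). If `β = q⁻²` then `F` is a unit of `𝒜` and `w_{00}` generates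
the whole lattice (`tensorLattice_eq_lattice`). A fusion product `*_f` is generated by the image of
`w_{00}` by construction. Being generated in the weight of `w_{00}` is thus the invariant that
separates the modules. -/

theorem ratCoeff_injective {f : K} (h : ∀ n, ratCoeff ℂ n f = 0) : f = 0 := by
  have : algebraMap K (LaurentSeries ℂ) f = 0 := by
    ext n
    exact h n
  exact (map_eq_zero_iff _ (algebraMap K (LaurentSeries ℂ)).injective).1 this

theorem algebraMap_X_zpow (m : ℤ) :
    algebraMap K (LaurentSeries ℂ) (RatFunc.X ^ m) = HahnSeries.single m 1 := by
  have h := RatFunc.coe_X (F := ℂ)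
  rw [map_zpow₀, h, ← RatFunc.single_zpow]

theorem ratCoeff_zpow_mul (n m : ℤ) (f : K) :
    ratCoeff ℂ n (RatFunc.X ^ m * f) = ratCoeff ℂ (n - m) f := by
  change (algebraMap K (LaurentSeries ℂ) (RatFunc.X ^ m * f)).coeff n = _
  rw [map_mul, algebraMap_X_zpow, HahnSeries.coeff_single_mul, one_mul]
  rfl

theorem ratCoeff_one (n : ℤ) : ratCoeff ℂ n 1 = if n = 0 then 1 else 0 := by
  change (algebraMap K (LaurentSeries ℂ) 1).coeff n = _
  rw [map_one, HahnSeries.coeff_one]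
  congr

theorem ratCoeff_zpow (n m : ℤ) :
    ratCoeff ℂ n (RatFunc.X ^ m) = if n = m then 1 else 0 := by
  rw [← mul_one (RatFunc.X ^ m : K), ratCoeff_zpow_mul, ratCoeff_one]
  simp [sub_eq_zero]

theorem ratCoeff_eq_zero_of_lt (f : K) : ∃ N : ℤ, ∀ n < N, ratCoeff ℂ n f = 0 :=
  ⟨(algebraMap K (LaurentSeries ℂ) f).order, fun _ hn => HahnSeries.coeff_eq_zero_of_lt_order hn⟩

variable {W : Type*} [AddCommGroup W] [Module ℂ W]

theorem expandCoeff_tmul (n : ℤ) (f : K) (w : W) :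
    expandCoeff W n (f ⊗ₜ w) = ratCoeff ℂ n f • w := by
  simp [expandCoeff]

theorem expandCoeff_natural {W' : Type*} [AddCommGroup W'] [Module ℂ W'] (g : W →ₗ[ℂ] W') (n : ℤ)
    (y : K ⊗[ℂ] W) :
    expandCoeff W' n (g.baseChange K y) = g (expandCoeff W n y) := by
  induction y with
  | zero => simp
  | tmul f w => simp [expandCoeff_tmul]
  | add a b ha hb => simp [ha, hb]

theorem expandCoeff_zpow_smul (n m : ℤ) (y : K ⊗[ℂ] W) :
    expandCoeff W n ((RatFunc.X ^ m : K) • y) = expandCoeff W (n - m) y := by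
  induction y with
  | zero => simp
  | tmul f w => rw [smul_tmul', smul_eq_mul, expandCoeff_tmul, expandCoeff_tmul, ratCoeff_zpow_mul]
  | add a b ha hb => simp [ha, hb]

theorem expandCoeff_X_smul (n : ℤ) (y : K ⊗[ℂ] W) :
    expandCoeff W n ((RatFunc.X : K) • y) = expandCoeff W (n - 1) y := by
  simpa using expandCoeff_zpow_smul n 1 y

theorem expandCoeff_eq_zero {y : K ⊗[ℂ] W} (h : ∀ n, expandCoeff W n y = 0) : y = 0 := by
  classical
  -- Taking coordinates commutes with expansion, so the claim reduces to rational functions.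
  let b := Module.Basis.ofVectorSpace ℂ W
  apply (TensorProduct.equivFinsuppOfBasisRight (M := K) b).injective
  rw [map_zero]
  ext1 i
  rw [Finsupp.zero_apply]
  apply ratCoeff_injective
  intro n
  have key : ratCoeff ℂ n (TensorProduct.equivFinsuppOfBasisRight (M := K) b y i) =
      b.coord i (expandCoeff W n y) := by
    clear h
    induction y with
    | zero => simp
    | tmul f w =>
      simp [expandCoeff_tmul, mul_comm]
    | add p q hp hq => simp only [map_add, Finsupp.add_apply, hp, hq]
  rw [key, h, map_zero]

theorem expandCoeff_ext {y y' : K ⊗[ℂ] W} (h : ∀ n, expandCoeff W n y = expandCoeff W n y') :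
    y = y' :=
  sub_eq_zero.1 (expandCoeff_eq_zero fun n => by rw [map_sub, h, sub_self])

theorem expandCoeff_eq_zero_of_lt (y : K ⊗[ℂ] W) :
    ∃ N : ℤ, ∀ n < N, expandCoeff W n y = 0 := by
  induction y with
  | zero => exact ⟨0, by simp⟩
  | tmul f w =>
    obtain ⟨N, hN⟩ := ratCoeff_eq_zero_of_lt f
    exact ⟨N, fun n hn => by rw [expandCoeff_tmul, hN n hn, zero_smul]⟩
  | add a b ha hb =>
    obtain ⟨N, hN⟩ := ha
    obtain ⟨N', hN'⟩ := hb
    exact ⟨min N N', fun n hn => by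
      rw [map_add, hN n (lt_of_lt_of_le hn (min_le_left _ _)),
        hN' n (lt_of_lt_of_le hn (min_le_right _ _)), add_zero]⟩

/-- The geometric series `∑ uⁿ Sⁿ w` is rational if `W` is finite dimensional. -/
theorem exists_geometric [FiniteDimensional ℂ W] (S : Module.End ℂ W) (w : W) :
    ∃ y : K ⊗[ℂ] W, ∀ n : ℤ,
      expandCoeff W n y = if 0 ≤ n then (S ^ n.toNat) w else 0 := by
  -- The series is `(1 - u S)⁻¹ w`. On coefficients `1 - u S` is visibly injective; by finite
  -- dimension over `K` it is surjective, and a preimage of `w` is the rational function sought.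
  let T : Module.End K (K ⊗[ℂ] W) := 1 - (RatFunc.X : K) • S.baseChange K
  have hT (n : ℤ) (y) : expandCoeff W n (T y) = expandCoeff W n y - S (expandCoeff W (n - 1) y) := by
    simp only [T, LinearMap.sub_apply, Module.End.one_apply, LinearMap.smul_apply, map_sub,
      expandCoeff_X_smul, expandCoeff_natural]
  -- An element of `K ⊗ W` has only finitely many polar terms; starting below them, `y_n = S
  -- y_{n-1}` propagates zero up to degree `-1`.
  have hrec (y : K ⊗[ℂ] W) (h : ∀ n < 0, expandCoeff W n (T y) = 0) (n : ℤ) (hn : n < 0) :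
      expandCoeff W n y = 0 := by
    obtain ⟨N, hN⟩ := expandCoeff_eq_zero_of_lt y
    have : ∀ k : ℕ, N - 1 + k < 0 → expandCoeff W (N - 1 + k) y = 0 := by
      intro k
      induction k with
      | zero => intro _; exact hN _ (by simp)
      | succ k ih =>
        intro hk
        have h1 := hT (N - 1 + (k + 1 : ℕ)) y
        rw [h _ hk, show N - 1 + ((k + 1 : ℕ) : ℤ) - 1 = N - 1 + k by push_cast; ring,
          ih (by push_cast at hk; omega), map_zero, sub_zero] at h1
        exact h1.symm
    rcases lt_or_ge n N with h' | h'
    · exact hN n h'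
    · have := this (n - (N - 1)).toNat
      rw [show N - 1 + ((n - (N - 1)).toNat : ℤ) = n by omega] at this
      exact this hn
  have hpos (y : K ⊗[ℂ] W) (w : W)
      (h : ∀ n, expandCoeff W n (T y) = if n = 0 then w else 0) (n : ℕ) :
      expandCoeff W n y = (S ^ n) w := by
    induction n with
    | zero =>
      have h1 := hT 0 y
      rw [h, hrec y (fun n hn => by rw [h, if_neg hn.ne]) (0 - 1) (by norm_num), map_zero,
        sub_zero, if_pos rfl] at h1
      exact h1.symm
    | succ n ih =>
      have h1 := hT (n + 1 : ℕ) y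
      rw [h, show (((n + 1 : ℕ) : ℤ) - 1) = n by push_cast; ring, ih, if_neg (by omega)] at h1
      rw [pow_succ', Module.End.mul_apply]
      exact sub_eq_zero.1 h1.symm
  have hinj : Function.Injective T := by
    rw [injective_iff_map_eq_zero]
    intro y hy
    apply expandCoeff_eq_zero
    intro n
    rcases lt_or_ge n 0 with h | h
    · exact hrec y (by simp [hy]) n h
    · have := hpos y 0 (by simp [hy]) n.toNat
      rwa [Int.toNat_of_nonneg h, map_zero] at this
  obtain ⟨y, hy⟩ := LinearMap.surjective_of_injective hinj (1 ⊗ₜ w)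
  have hy' (n : ℤ) : expandCoeff W n (T y) = if n = 0 then w else 0 := by
    rw [hy, expandCoeff_tmul, ratCoeff_one]; split_ifs <;> simp
  refine ⟨y, fun n => ?_⟩
  split_ifs with h
  · have := hpos y w hy' n.toNat
    rwa [Int.toNat_of_nonneg h] at this
  · exact hrec y (fun n hn => by rw [hy', if_neg hn.ne]) n (not_le.1 h)

end Expansion

/-! ### Expansion at `u = 0` as an injective algebra map -/

section ExpansionAlgebra

open scoped RatFunc

variable {E : Type*} [Ring E] [Algebra ℂ E]

/-- The map of Laurent series induced by `ℂ → E`. -/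
noncomputable def laurentMap (E : Type*) [Ring E] [Algebra ℂ E] :
    LaurentSeries ℂ →+* LaurentSeries E where
  toFun f := f.map (algebraMap ℂ E)
  map_one' := by ext n; simp [HahnSeries.coeff_one, apply_ite (algebraMap ℂ E)]
  map_zero' := by ext; simp
  map_mul' f g := HahnSeries.map_mul (algebraMap ℂ E : ℂ →ₙ+* E)
  map_add' f g := by ext; simp

/-- Expansion at `u = 0`, as a homomorphism of algebras. -/
noncomputable def expand (E : Type*) [Ring E] [Algebra ℂ E] : K ⊗[ℂ] E →ₐ[ℂ] LaurentSeries E :=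
  Algebra.TensorProduct.lift
    { (laurentMap E).comp (algebraMap K (LaurentSeries ℂ)) with
      commutes' := fun c => by
        ext n
        change algebraMap ℂ E (ratCoeff ℂ n (algebraMap ℂ K c)) = _
        rw [Algebra.algebraMap_eq_smul_one (A := K), map_smul, ratCoeff_one, HahnSeries.algebraMap_apply,
          HahnSeries.C_apply, HahnSeries.coeff_single]
        split_ifs <;> simp }
    { (HahnSeries.C : E →+* HahnSeries ℤ E) with
      commutes' := fun c => (HahnSeries.algebraMap_apply).symm }
    (fun f e => by
      ext n
      change (HahnSeries.map (algebraMap K (LaurentSeries ℂ) f) (algebraMap ℂ E) *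
          HahnSeries.C e).coeff n =
        (HahnSeries.C e * HahnSeries.map (algebraMap K (LaurentSeries ℂ) f)
          (algebraMap ℂ E)).coeff n
      rw [HahnSeries.C_apply, HahnSeries.coeff_mul_single_zero, HahnSeries.coeff_single_zero_mul,
        HahnSeries.map_coeff]
      exact Algebra.commutes _ _)

theorem expand_coeff (y : K ⊗[ℂ] E) (n : ℤ) : (expand E y).coeff n = expandCoeff E n y := by
  induction y with
  | zero => simp
  | tmul f e =>
    rw [expandCoeff_tmul]
    change (HahnSeries.map (algebraMap K (LaurentSeries ℂ) f) (algebraMap ℂ E) *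
      HahnSeries.C e).coeff n = _
    rw [HahnSeries.C_apply, HahnSeries.coeff_mul_single_zero, HahnSeries.map_coeff,
      Algebra.smul_def]
    rfl
  | add a b ha hb => simp [ha, hb]

theorem expand_injective : Function.Injective (expand E) := fun y y' h =>
  expandCoeff_ext fun n => by rw [← expand_coeff, ← expand_coeff, h]

/-- An element of `K ⊗ E` acts on `1 ⊗ w` coefficientwise. -/
theorem expandCoeff_tensorProductEnd {W : Type*} [AddCommGroup W] [Module ℂ W]
    (y : K ⊗[ℂ] Module.End ℂ W) (w : W) (n : ℤ) :
    expandCoeff W n (LinearMap.tensorProductEnd ℂ K W y (1 ⊗ₜ w)) =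
      expandCoeff (Module.End ℂ W) n y w := by
  induction y with
  | zero => simp
  | tmul f e =>
    have : LinearMap.tensorProductEnd ℂ K W (f ⊗ₜ e) (1 ⊗ₜ w) = f ⊗ₜ e w := by
      change (f • LinearMap.baseChange K e) (1 ⊗ₜ w) = _
      rw [LinearMap.smul_apply, LinearMap.baseChange_tmul, smul_tmul', smul_eq_mul, mul_one]
    rw [this, expandCoeff_tmul, expandCoeff_tmul, LinearMap.smul_apply]
  | add a b ha hb =>
    rw [map_add, LinearMap.add_apply, map_add, map_add, LinearMap.add_apply, ha, hb]

end ExpansionAlgebra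

end QAff

namespace QAff

/-! ### Exponentials of commuting series -/

section EulerDerivation

variable {R : Type*} [Ring R] [Algebra ℂ R]

/-- The Euler derivation `t d/dt` of power series. -/
noncomputable def euler (f : PowerSeries R) : PowerSeries R :=
  PowerSeries.mk fun m => (m : ℂ) • PowerSeries.coeff m f

theorem coeff_euler (f : PowerSeries R) (m : ℕ) :
    PowerSeries.coeff m (euler f) = (m : ℂ) • PowerSeries.coeff m f :=
  PowerSeries.coeff_mk _ _

theorem euler_mul (f g : PowerSeries R) : euler (f * g) = euler f * g + f * euler g := by
  ext m
  simp only [coeff_euler, PowerSeries.coeff_mul, map_add, Finset.smul_sum,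
    ← Finset.sum_add_distrib]
  refine Finset.sum_congr rfl fun p hp => ?_
  rw [smul_mul_assoc, mul_smul_comm, ← add_smul, ← Nat.cast_add, Finset.HasAntidiagonal.mem_antidiagonal.1 hp]

theorem euler_C (a : R) : euler (PowerSeries.C a) = 0 := by
  ext m
  rw [coeff_euler, PowerSeries.coeff_C]
  split_ifs with h <;> simp [h]

theorem commute_of_coeff {R : Type*} [Ring R] {f g : PowerSeries R}
    (h : ∀ m n, Commute (PowerSeries.coeff m f) (PowerSeries.coeff n g)) : Commute f g := by
  ext m
  rw [PowerSeries.coeff_mul, PowerSeries.coeff_mul, ← Finset.Nat.sum_antidiagonal_swap]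
  exact Finset.sum_congr rfl fun p _ => (h _ _).eq

theorem euler_pow {f : PowerSeries R} (h : Commute f (euler f)) (n : ℕ) :
    euler (f ^ (n + 1)) = ((n + 1 : ℕ) : ℂ) • (euler f * f ^ n) := by
  induction n with
  | zero => simp
  | succ n ih =>
    rw [pow_succ f (n + 1), euler_mul, ih, smul_mul_assoc, mul_assoc, ← pow_succ,
      (h.pow_left (n + 1)).eq, Nat.cast_succ (n + 1), add_smul, one_smul]

/-- A first order linear differential equation has at most one solution. -/
theorem eq_of_euler_eq {f g a : PowerSeries R} (ha : PowerSeries.coeff 0 a = 0)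
    (hf : euler f = a * f) (hg : euler g = a * g)
    (h0 : PowerSeries.coeff 0 f = PowerSeries.coeff 0 g) : f = g := by
  ext m
  induction m using Nat.strong_induction_on with
  | _ m ih =>
    rcases Nat.eq_zero_or_pos m with rfl | hm
    · exact h0
    · have h1 : (m : ℂ) • PowerSeries.coeff m f = (m : ℂ) • PowerSeries.coeff m g := by
        rw [← coeff_euler, ← coeff_euler, hf, hg, PowerSeries.coeff_mul, PowerSeries.coeff_mul]
        refine Finset.sum_congr rfl fun p hp => ?_
        have hp := Finset.HasAntidiagonal.mem_antidiagonal.1 hp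
        -- As `a` has no constant term, the coefficient of degree `m` of `a * f` only involves
        -- coefficients of `f` of lower degree.
        rcases Nat.eq_zero_or_pos p.1 with h | h
        · rw [h, ha, zero_mul, zero_mul]
        · rw [ih p.2 (by omega)]
      exact smul_right_injective R (Nat.cast_ne_zero.2 hm.ne' : (m : ℂ) ≠ 0) h1

/-- The exponential `exp (c f)` of a series without constant term. -/
noncomputable def expSeries (c : ℂ) (f : PowerSeries R) : PowerSeries R :=
  PowerSeries.mk fun m => ∑ n ∈ Finset.range (m + 1),
    (c ^ n / (n.factorial : ℂ)) • PowerSeries.coeff m (f ^ n)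

theorem coeff_pow_eq_zero {R : Type*} [Ring R] {f : PowerSeries R} (h0 : PowerSeries.coeff 0 f = 0) {m n : ℕ}
    (h : m < n) : PowerSeries.coeff m (f ^ n) = 0 := by
  induction n generalizing m with
  | zero => omega
  | succ n ih =>
    rw [pow_succ, PowerSeries.coeff_mul]
    refine Finset.sum_eq_zero fun p hp => ?_
    have hp := Finset.HasAntidiagonal.mem_antidiagonal.1 hp
    rcases Nat.eq_zero_or_pos p.2 with h2 | h2
    · rw [h2, h0, mul_zero]
    · rw [ih (by omega), zero_mul]

theorem coeff_expSeries {f : PowerSeries R} (h0 : PowerSeries.coeff 0 f = 0) (c : ℂ) {m N : ℕ}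
    (h : m ≤ N) : PowerSeries.coeff m (expSeries c f) = ∑ n ∈ Finset.range (N + 1),
      (c ^ n / (n.factorial : ℂ)) • PowerSeries.coeff m (f ^ n) := by
  rw [expSeries, PowerSeries.coeff_mk]
  refine Finset.sum_subset (Finset.range_mono (by omega)) fun n _ hn => ?_
  rw [coeff_pow_eq_zero h0 (by simpa using hn), smul_zero]

theorem coeff_zero_expSeries (c : ℂ) (f : PowerSeries R) :
    PowerSeries.coeff 0 (expSeries c f) = 1 := by
  simp [expSeries]

/-- Term by term differentiation of the exponential. Commutation of `f` with its derivative is what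
gives the power rule in a noncommutative ring; the truncation bounds are made uniform by
`coeff_expSeries`. -/
theorem euler_expSeries {f : PowerSeries R} (h0 : PowerSeries.coeff 0 f = 0)
    (h : Commute f (euler f)) (c : ℂ) :
    euler (expSeries c f) = (c • euler f) * expSeries c f := by
  ext m
  rw [coeff_euler, PowerSeries.coeff_mul]
  rcases Nat.eq_zero_or_pos m with rfl | hm
  · simp [coeff_euler]
  obtain ⟨m, rfl⟩ := Nat.exists_eq_succ_of_ne_zero hm.ne'
  have h1 : ∀ p ∈ Finset.HasAntidiagonal.antidiagonal (m + 1),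
      PowerSeries.coeff p.1 (c • euler f) * PowerSeries.coeff p.2 (expSeries c f) =
      ∑ n ∈ Finset.range (m + 1), (c ^ (n + 1) / (n.factorial : ℂ)) •
        (PowerSeries.coeff p.1 (euler f) * PowerSeries.coeff p.2 (f ^ n)) := by
    intro p hp
    have hp := Finset.HasAntidiagonal.mem_antidiagonal.1 hp
    rcases Nat.eq_zero_or_pos p.1 with h' | h'
    · have h2 : PowerSeries.coeff 0 (euler f) = 0 := by simp [coeff_euler]
      simp [h', h2]
    · rw [coeff_expSeries h0 c (show p.2 ≤ m by omega), Finset.mul_sum]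
      refine Finset.sum_congr rfl fun n _ => ?_
      rw [PowerSeries.coeff_smul, smul_mul_assoc, mul_smul_comm, smul_smul, pow_succ]
      congr 1
      ring
  rw [Finset.sum_congr rfl h1, Finset.sum_comm, coeff_expSeries h0 c le_rfl,
    Finset.sum_range_succ', smul_add, Finset.smul_sum]
  have h3 : (((m + 1 : ℕ) : ℂ)) • (c ^ 0 / ((0 : ℕ).factorial : ℂ)) •
      PowerSeries.coeff (m + 1) (f ^ 0) = 0 := by
    simp [PowerSeries.coeff_one]
  rw [show m.succ = m + 1 from rfl, h3, add_zero]
  refine Finset.sum_congr rfl fun n _ => ?_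
  rw [← Finset.smul_sum, ← PowerSeries.coeff_mul, smul_comm, ← coeff_euler, euler_pow h,
    PowerSeries.coeff_smul, smul_smul, Nat.factorial_succ]
  congr 1
  have : ((n + 1 : ℕ) : ℂ) ≠ 0 := Nat.cast_ne_zero.2 n.succ_ne_zero
  have : (n.factorial : ℂ) ≠ 0 := Nat.cast_ne_zero.2 n.factorial_ne_zero
  push_cast at *
  field_simp

/-- The expansion of `(κ - t) / (1 - κ t)`. -/
noncomputable def gam (κ : ℂ) : ℕ → ℂ
  | 0 => κ
  | b + 1 => κ ^ (b + 2) - κ ^ b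

/-- The logarithmic derivative `t d/dt` of `(κ - t) / (1 - κ t)` is `∑ (κ ^ p - κ ^ (-p)) t ^ p`. -/
theorem gam_rec {κ : ℂ} (hκ : κ ≠ 0) (n : ℕ) :
    ∑ p ∈ Finset.HasAntidiagonal.antidiagonal n, (κ ^ p.1 - κ⁻¹ ^ p.1) * gam κ p.2 = n * gam κ n := by
  have step (n : ℕ) : ∑ p ∈ Finset.HasAntidiagonal.antidiagonal (n + 1), (κ ^ p.1 - κ⁻¹ ^ p.1) * gam κ p.2 =
      κ * ∑ p ∈ Finset.HasAntidiagonal.antidiagonal n, (κ ^ p.1 - κ⁻¹ ^ p.1) * gam κ p.2 +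
        (κ ^ (n + 2) - κ ^ n) := by
    rw [Finset.Nat.sum_antidiagonal_succ', Finset.mul_sum]
    -- From index `1` on, `gam κ` is geometric of ratio `κ`; the only defect is `gam κ 1 = κ * gam κ
    -- 0 - 1`, which the term at `p = (n, 0)` records.
    have h1 : ∑ p ∈ Finset.HasAntidiagonal.antidiagonal n, (κ ^ p.1 - κ⁻¹ ^ p.1) * gam κ (p.2 + 1) =
        ∑ p ∈ Finset.HasAntidiagonal.antidiagonal n, (κ * ((κ ^ p.1 - κ⁻¹ ^ p.1) * gam κ p.2) -
          if p = (n, 0) then (κ ^ n - κ⁻¹ ^ n) else 0) := by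
      refine Finset.sum_congr rfl fun p hp => ?_
      obtain ⟨a, b⟩ := p
      have hp : a + b = n := Finset.HasAntidiagonal.mem_antidiagonal.1 hp
      rcases b with _ | b
      · obtain rfl : a = n := by omega
        simp [gam]
        ring
      · simp [gam]
        ring
    rw [h1, Finset.sum_sub_distrib, Finset.sum_ite_eq' (Finset.HasAntidiagonal.antidiagonal n), if_pos (by simp)]
    simp only [gam, pow_succ κ⁻¹]
    field_simp
    ring
  induction n with
  | zero => simp
  | succ n ih =>
    rw [step, ih]
    rcases n with _ | n
    · simp [gam]
    · simp only [gam]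
      push_cast
      ring

/-- Commutation of the exponential of a Heisenberg series with a current. -/
theorem mul_current {Φ H : PowerSeries R} {c : ℂ} (hΦ : euler Φ = (c • euler H) * Φ) {κ : ℂ}
    (hκ : κ ≠ 0) (x : ℕ → R)
    (h0 : PowerSeries.coeff 0 Φ * x 0 = κ • (x 0 * PowerSeries.coeff 0 Φ))
    (hx : ∀ p b : ℕ, c • (p : ℂ) • (PowerSeries.coeff p H * x b - x b * PowerSeries.coeff p H) =
      (κ ^ p - κ⁻¹ ^ p) • x (b + p)) :
    Φ * PowerSeries.C (x 0) = PowerSeries.mk (fun b => gam κ b • x b) * Φ := by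
  -- Both sides solve the same first order equation. For the right-hand side, moving `euler H` past
  -- the current produces exactly the derivative of the coefficients `gam κ b`, by `gam_rec`.
  refine eq_of_euler_eq (a := c • euler H) (by simp [coeff_euler]) ?_ ?_ ?_
  · rw [euler_mul, euler_C, mul_zero, add_zero, hΦ, mul_assoc]
  · have : euler (PowerSeries.mk fun b => gam κ b • x b) +
        PowerSeries.mk (fun b => gam κ b • x b) * (c • euler H) =
        (c • euler H) * PowerSeries.mk (fun b => gam κ b • x b) := by
      rw [← eq_sub_iff_add_eq]
      ext m
      rw [map_sub, PowerSeries.coeff_mul, PowerSeries.coeff_mul,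
        ← Finset.Nat.sum_antidiagonal_swap (n := m) (f := fun p =>
          PowerSeries.coeff p.1 (PowerSeries.mk fun b => gam κ b • x b) *
            PowerSeries.coeff p.2 (c • euler H)), ← Finset.sum_sub_distrib, coeff_euler,
        PowerSeries.coeff_mk, smul_smul, ← gam_rec hκ, Finset.sum_smul]
      refine Finset.sum_congr rfl fun p hp => ?_
      have h1 := hx p.1 p.2
      rw [add_comm p.2, Finset.HasAntidiagonal.mem_antidiagonal.1 hp] at h1
      rw [mul_comm, mul_smul, ← h1]
      simp only [PowerSeries.coeff_smul, coeff_euler, PowerSeries.coeff_mk, Prod.fst_swap,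
        Prod.snd_swap, smul_mul_assoc, mul_smul_comm, smul_sub]
      congr 1
      · rw [smul_comm, smul_comm (gam κ p.2) (p.1 : ℂ)]
    rw [euler_mul, hΦ, ← mul_assoc, ← add_mul, this, mul_assoc]
  · simpa [gam, PowerSeries.coeff_mul] using h0

theorem coeff_mul_current {Φ H : PowerSeries R} {c : ℂ} (hΦ : euler Φ = (c • euler H) * Φ) {κ : ℂ}
    (hκ : κ ≠ 0) (x : ℕ → R)
    (h0 : ∀ b, PowerSeries.coeff 0 Φ * x b = κ • (x b * PowerSeries.coeff 0 Φ))
    (hx : ∀ p b : ℕ, c • (p : ℂ) • (PowerSeries.coeff p H * x b - x b * PowerSeries.coeff p H) =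
      (κ ^ p - κ⁻¹ ^ p) • x (b + p)) (m : ℕ) :
    PowerSeries.coeff m Φ * x 0 =
      ∑ p ∈ Finset.HasAntidiagonal.antidiagonal m, gam κ p.1 • (x p.1 * PowerSeries.coeff p.2 Φ) := by
  have := congrArg (PowerSeries.coeff m) (mul_current hΦ hκ x (h0 0) hx)
  rw [PowerSeries.coeff_mul_C, PowerSeries.coeff_mul] at this
  simpa using this

end EulerDerivation

end QAff

namespace QAff

/-! ### `q`-numbers -/

section QNumbers

variable {ħ : ℂ}

theorem qPow_zero : qPow ħ 0 = 1 := by simp [qPow]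

theorem qPow_add (x y : ℚ) : qPow ħ (x + y) = qPow ħ x * qPow ħ y := by
  simp [qPow, mul_add, Complex.exp_add]

theorem qPow_ne_zero (x : ℚ) : qPow ħ x ≠ 0 := Complex.exp_ne_zero _

theorem qPow_neg (x : ℚ) : qPow ħ (-x) = (qPow ħ x)⁻¹ := by
  simp [qPow, Complex.exp_neg]

theorem qPow_sub (x y : ℚ) : qPow ħ (x - y) = qPow ħ x * (qPow ħ y)⁻¹ := by
  rw [sub_eq_add_neg, qPow_add, qPow_neg]

theorem qPow_pow (x : ℚ) (n : ℕ) : qPow ħ x ^ n = qPow ħ (n * x) := by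
  rw [qPow, qPow, ← Complex.exp_nat_mul]
  congr 1
  push_cast
  ring

/-- Raising to the power `x.den` clears the denominator and leaves an integral power of `q`. -/
theorem qPow_eq_one (hq : ∀ n : ℕ, n ≠ 0 → Complex.exp ħ ^ n ≠ 1) {x : ℚ} (h : qPow ħ x = 1) :
    x = 0 := by
  by_contra hx
  have h1 : qPow ħ x ^ x.den = 1 := by rw [h, one_pow]
  rw [qPow_pow, mul_comm, Rat.mul_den_eq_num] at h1
  have h2 : qPow ħ (x.num.natAbs : ℕ) = 1 := by
    rcases Int.natAbs_eq x.num with h' | h'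
    · rw [h'] at h1
      simpa using h1
    · rw [h'] at h1
      have : qPow ħ (-((x.num.natAbs : ℕ) : ℚ)) = 1 := by simpa using h1
      rw [qPow_neg] at this
      exact inv_eq_one.1 this
  refine hq x.num.natAbs (by simpa using hx) ?_
  rw [← Complex.exp_nat_mul, mul_comm]
  rw [qPow, Rat.cast_natCast] at h2
  exact h2

theorem qPow_injective (hq : ∀ n : ℕ, n ≠ 0 → Complex.exp ħ ^ n ≠ 1) :
    Function.Injective (qPow ħ) := fun x y h => by
  have : qPow ħ (x - y) = 1 := by rw [qPow_sub, h, mul_inv_cancel₀ (qPow_ne_zero _)]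
  exact sub_eq_zero.1 (qPow_eq_one hq this)

theorem qPow_sub_qPow_neg_ne_zero (hq : ∀ n : ℕ, n ≠ 0 → Complex.exp ħ ^ n ≠ 1) {x : ℚ}
    (hx : x ≠ 0) : qPow ħ x - qPow ħ (-x) ≠ 0 := fun h => hx (by
  have := qPow_injective hq (sub_eq_zero.1 h)
  linarith)

theorem qInt_ne_zero (hq : ∀ n : ℕ, n ≠ 0 → Complex.exp ħ ^ n ≠ 1) {n : ℤ} (hn : n ≠ 0) :
    qInt ħ n ≠ 0 :=
  div_ne_zero (qPow_sub_qPow_neg_ne_zero hq (Int.cast_ne_zero.2 hn))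
    (qPow_sub_qPow_neg_ne_zero hq one_ne_zero)

theorem mul_qInt (hq : ∀ n : ℕ, n ≠ 0 → Complex.exp ħ ^ n ≠ 1) (n : ℤ) :
    (qPow ħ 1 - qPow ħ (-1)) * qInt ħ n = qPow ħ n - qPow ħ (-n) :=
  mul_div_cancel₀ _ (qPow_sub_qPow_neg_ne_zero hq one_ne_zero)

end QNumbers

/-! ### Consequences of the defining relations: the currents `φ` and their commutation with `x` -/

section Structure

variable {ι : Type w₁} [Fintype ι] [DecidableEq ι] {𝔥 : Type w₂} [AddCommGroup 𝔥] [Module ℚ 𝔥]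
variable (D : CartanDatum ι 𝔥) (ħ : ℂ)

/-- The factor `q ^ (τ B_{i,j})`. -/
noncomputable def kap (τ : ℤˣ) (i j : ι) : ℂ :=
  qPow ħ (((τ : ℤ) : ℚ) * ((D.r i : ℚ) * (D.C i j : ℚ)))

theorem kap_ne_zero (τ : ℤˣ) (i j : ι) : kap D ħ τ i j ≠ 0 := qPow_ne_zero _

theorem kap_symm (τ : ℤˣ) (i j : ι) : kap D ħ τ i j = kap D ħ τ j i := by
  have := D.symm i j
  have h : (D.r i : ℚ) * (D.C i j : ℚ) = (D.r j : ℚ) * (D.C j i : ℚ) := by exact_mod_cast this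
  rw [kap, kap, h]

theorem kap_neg (τ : ℤˣ) (i j : ι) : kap D ħ (-τ) i j = (kap D ħ τ i j)⁻¹ := by
  rw [kap, kap, ← qPow_neg]
  simp

/-- The structure constant of `[h_{i,m}, x^ε_{j,r}]`. -/
noncomputable def hxCoeff (m : ℤ) (ε : ℤˣ) (i j : ι) : ℂ :=
  ((ε : ℤ) : ℂ) * (1 / (m : ℂ)) * qInt ħ (m * ((D.r i : ℤ) * D.C i j))

variable {D ħ}

theorem hxCoeff_self_ne_zero (hq : ∀ n : ℕ, n ≠ 0 → Complex.exp ħ ^ n ≠ 1) {m : ℤ} (hm : m ≠ 0)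
    (ε : ℤˣ) (i : ι) : hxCoeff D ħ m ε i i ≠ 0 := by
  refine mul_ne_zero (mul_ne_zero ?_ ?_) (qInt_ne_zero hq ?_)
  · exact Int.cast_ne_zero.2 ε.ne_zero
  · exact one_div_ne_zero (Int.cast_ne_zero.2 hm)
  · rw [D.diag]
    have := D.r_pos i
    exact mul_ne_zero hm (by omega)

/-- The scalar of the bracket `[h, x]`, multiplied by the constants from differentiating the
exponential, is the logarithmic derivative coefficient of `(κ - t) / (1 - κ t)`; this is the
hypothesis `hx` of `mul_current`. -/
theorem heisenberg_factor (hq : ∀ n : ℕ, n ≠ 0 → Complex.exp ħ ^ n ≠ 1) (ε σ : ℤˣ) (i j : ι)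
    (p : ℕ) :
    (((ε : ℤ) : ℂ) * (qPow ħ 1 - qPow ħ (-1))) * ((p : ℂ) * hxCoeff D ħ ((ε : ℤ) * p) σ i j) =
      kap D ħ (ε * σ) i j ^ p - (kap D ħ (ε * σ) i j)⁻¹ ^ p := by
  rcases Nat.eq_zero_or_pos p with rfl | hp
  · simp
  have hp' : (p : ℂ) ≠ 0 := Nat.cast_ne_zero.2 hp.ne'
  have h1 : (((ε : ℤ) : ℂ) * (qPow ħ 1 - qPow ħ (-1))) *
      ((p : ℂ) * hxCoeff D ħ ((ε : ℤ) * p) σ i j) =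
      ((σ : ℤ) : ℂ) * ((qPow ħ 1 - qPow ħ (-1)) *
        qInt ħ (((ε : ℤ) * p) * ((D.r i : ℤ) * D.C i j))) := by
    have h2 : (((ε : ℤ) : ℂ)) ≠ 0 := Int.cast_ne_zero.2 ε.ne_zero
    rw [hxCoeff]
    push_cast
    field_simp
  rw [h1, mul_qInt hq, inv_pow, kap, qPow_pow, ← qPow_neg]
  rcases Int.units_eq_one_or ε with rfl | rfl <;> rcases Int.units_eq_one_or σ with rfl | rfl <;>
    simp

theorem Free.coeff_map_hSeries {R : Type*} [Ring R] [Algebra ℂ R] (θ : Free ι 𝔥 →ₐ[ℂ] R)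
    (ε : ℤˣ) (i : ι) (p : ℕ) (hp : (ε : ℤ) * (p : ℤ) ≠ 0) :
    PowerSeries.coeff p (PowerSeries.map (θ : Free ι 𝔥 →+* R) (hSeries 𝔥 ε i)) =
      θ (fh i ⟨(ε : ℤ) * p, hp⟩) := by
  have : p ≠ 0 := by rintro rfl; simp at hp
  simp [hSeries, this]

theorem Free.coeff_zero_map_hSeries {R : Type*} [Ring R] [Algebra ℂ R]
    (θ : Free ι 𝔥 →ₐ[ℂ] R) (ε : ℤˣ) (i : ι) :
    PowerSeries.coeff 0 (PowerSeries.map (θ : Free ι 𝔥 →+* R) (hSeries 𝔥 ε i)) = 0 := by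
  rw [PowerSeries.coeff_map, hSeries, PowerSeries.coeff_mk, dif_pos rfl, map_zero]

theorem Free.mk_fphi {R : Type*} [Ring R] [Algebra ℂ R] (θ : Free ι 𝔥 →ₐ[ℂ] R)
    (ε : ℤˣ) (i : ι) :
    (PowerSeries.mk fun m => θ (fphi D ħ ε i m)) =
      PowerSeries.C (θ (fk ((((ε : ℤ) : ℚ) * (D.r i : ℚ)) • D.coroot i))) *
        expSeries (((ε : ℤ) : ℂ) * (qPow ħ 1 - qPow ħ (-1)))
          (PowerSeries.map (θ : Free ι 𝔥 →+* R) (hSeries 𝔥 ε i)) := by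
  ext m
  rw [PowerSeries.coeff_mk, PowerSeries.coeff_C_mul, expSeries, PowerSeries.coeff_mk, fphi, map_mul,
    map_sum]
  congr 1
  refine Finset.sum_congr rfl fun n _ => ?_
  rw [map_smul, ← map_pow, PowerSeries.coeff_map]
  rfl

/-- The commutation relations of the Cartan part, for a family of elements indexed by the
generators. -/
structure CartanCommute {R : Type*} [Ring R] [Algebra ℂ R] (θ : Free ι 𝔥 →ₐ[ℂ] R) : Prop where
  k_h : ∀ h i m, Commute (θ (fk h)) (θ (fh i m))
  h_h : ∀ i j m m', Commute (θ (fh i m)) (θ (fh j m'))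

/-- The differential equation of the exponential characterizes the series of the `φ`. It is stated
for maps out of the free algebra because it is applied to the coproduct and to the evaluation
matrices before they are known to satisfy the relations. -/
theorem CartanCommute.euler_phi {R : Type*} [Ring R] [Algebra ℂ R] {θ : Free ι 𝔥 →ₐ[ℂ] R}
    (hθ : CartanCommute θ) (ε : ℤˣ) (i : ι) :
    euler (PowerSeries.mk fun m => θ (fphi D ħ ε i m)) =
      ((((ε : ℤ) : ℂ) * (qPow ħ 1 - qPow ħ (-1))) •
        euler (PowerSeries.map (θ : Free ι 𝔥 →+* R) (hSeries 𝔥 ε i))) *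
        PowerSeries.mk fun m => θ (fphi D ħ ε i m) := by
  have hcoeff (p : ℕ) : PowerSeries.coeff p (PowerSeries.map (θ : Free ι 𝔥 →+* R) (hSeries 𝔥 ε i)) =
      if hp : p = 0 then 0 else
        θ (fh i ⟨(ε : ℤ) * (p : ℤ), mul_ne_zero ε.ne_zero (Int.natCast_ne_zero.mpr hp)⟩) := by
    split_ifs with hp
    · rw [hp, Free.coeff_zero_map_hSeries]
    · rw [Free.coeff_map_hSeries]
  have h1 : Commute (PowerSeries.map (θ : Free ι 𝔥 →+* R) (hSeries 𝔥 ε i))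
      (euler (PowerSeries.map (θ : Free ι 𝔥 →+* R) (hSeries 𝔥 ε i))) := by
    refine commute_of_coeff fun m n => ?_
    rw [coeff_euler]
    refine Commute.smul_right ?_ _
    rw [hcoeff, hcoeff]
    split_ifs
    · exact Commute.zero_left _
    · exact Commute.zero_left _
    · exact Commute.zero_right _
    · exact hθ.h_h _ _ _ _
  have h2 (a : 𝔥) : Commute (PowerSeries.C (θ (fk a)))
      (euler (PowerSeries.map (θ : Free ι 𝔥 →+* R) (hSeries 𝔥 ε i))) := by
    refine commute_of_coeff fun m n => ?_
    rw [coeff_euler, PowerSeries.coeff_C]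
    refine Commute.smul_right ?_ _
    rw [hcoeff]
    split_ifs
    · exact Commute.zero_right _
    · exact hθ.k_h _ _ _
    · exact Commute.zero_left _
    · exact Commute.zero_left _
  rw [Free.mk_fphi, euler_mul, euler_C, zero_mul, zero_add,
    euler_expSeries (Free.coeff_zero_map_hSeries θ ε i) h1, ← mul_assoc, ← mul_assoc]
  congr 1
  rw [mul_smul_comm, smul_mul_assoc, (h2 _).eq]

theorem Free.map_fphi_zero {R : Type*} [Ring R] [Algebra ℂ R] (θ : Free ι 𝔥 →ₐ[ℂ] R)
    (ε : ℤˣ) (i : ι) :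
    θ (fphi D ħ ε i 0) = θ (fk ((((ε : ℤ) : ℚ) * (D.r i : ℚ)) • D.coroot i)) := by
  have := congrArg (PowerSeries.coeff 0) (Free.mk_fphi (D := D) (ħ := ħ) θ ε i)
  rwa [PowerSeries.coeff_mk, PowerSeries.coeff_C_mul, coeff_zero_expSeries, mul_one] at this

variable (D ħ)

/-- `h_{i,m}` in `𝒰_q(ĝ)`. -/
noncomputable def U.h (i : ι) (m : {m : ℤ // m ≠ 0}) : U D ħ := U.mk D ħ (fh i m)

variable {D ħ}

theorem U.mk_rel {a b : Free ι 𝔥} (h : Rel D ħ a b) : U.mk D ħ a = U.mk D ħ b :=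
  RingQuot.mkAlgHom_rel ℂ h

theorem U.mk_surjective : Function.Surjective (U.mk D ħ) := RingQuot.mkAlgHom_surjective ℂ _

theorem U.k_zero : U.k D ħ 0 = 1 := (U.mk_rel Rel.k_zero).trans (map_one _)

theorem U.k_add (h h' : 𝔥) : U.k D ħ (h + h') = U.k D ħ h * U.k D ħ h' := by
  have := U.mk_rel (D := D) (ħ := ħ) (Rel.k_add h h')
  rw [map_mul] at this
  exact this.symm

theorem U.k_mul_h (h : 𝔥) (i : ι) (m) : Commute (U.k D ħ h) (U.h D ħ i m) := by
  have := U.mk_rel (D := D) (ħ := ħ) (Rel.k_h h i m)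
  rwa [map_mul, map_mul] at this

theorem U.h_mul_h (i j : ι) (m m') : Commute (U.h D ħ i m) (U.h D ħ j m') := by
  have := U.mk_rel (D := D) (ħ := ħ) (Rel.h_h i j m m')
  rwa [map_mul, map_mul] at this

theorem U.k_mul_k (h h' : 𝔥) : Commute (U.k D ħ h) (U.k D ħ h') := by
  rw [Commute, SemiconjBy, ← U.k_add, ← U.k_add, add_comm]

theorem U.k_mul_x (h : 𝔥) (ε : ℤˣ) (j : ι) (r : ℤ) :
    U.k D ħ h * U.x D ħ ε j r = qPow ħ (((ε : ℤ) : ℚ) * D.root j h) • (U.x D ħ ε j r * U.k D ħ h) := by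
  have := U.mk_rel (D := D) (ħ := ħ) (Rel.k_x h ε j r)
  rwa [map_mul, map_smul, map_mul] at this

theorem U.h_x (i : ι) (m : {m : ℤ // m ≠ 0}) (ε : ℤˣ) (j : ι) (r : ℤ) :
    U.h D ħ i m * U.x D ħ ε j r - U.x D ħ ε j r * U.h D ħ i m =
      hxCoeff D ħ m ε i j • U.x D ħ ε j (m + r) := by
  have := U.mk_rel (D := D) (ħ := ħ) (Rel.h_x i m ε j r)
  rwa [map_sub, map_mul, map_mul, map_smul] at this

variable (D ħ) in
/-- `φ^ε_{i,m}` for all integers `m`. -/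
noncomputable def U.phiZ (ε : ℤˣ) (i : ι) (m : ℤ) : U D ħ :=
  if 0 ≤ (ε : ℤ) * m then U.phi D ħ ε i ((ε : ℤ) * m).toNat else 0

theorem U.mk_fphiZ (ε : ℤˣ) (i : ι) (m : ℤ) : U.mk D ħ (fphiZ D ħ ε i m) = U.phiZ D ħ ε i m := by
  rw [fphiZ, U.phiZ, apply_ite (U.mk D ħ), map_zero]
  rfl

theorem U.x_x_same (i : ι) (r s : ℤ) :
    U.x D ħ 1 i r * U.x D ħ (-1) i s - U.x D ħ (-1) i s * U.x D ħ 1 i r =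
      (1 / (qPow ħ (D.r i : ℚ) - qPow ħ (-(D.r i : ℚ)))) •
        (U.phiZ D ħ 1 i (r + s) - U.phiZ D ħ (-1) i (r + s)) := by
  have := U.mk_rel (D := D) (ħ := ħ) (Rel.x_x_same i r s)
  rwa [map_sub, map_mul, map_mul, map_smul, map_sub, U.mk_fphiZ, U.mk_fphiZ] at this

theorem U.x_x_ne {i j : ι} (hij : i ≠ j) (r s : ℤ) :
    U.x D ħ 1 i r * U.x D ħ (-1) j s = U.x D ħ (-1) j s * U.x D ħ 1 i r := by
  have := U.mk_rel (D := D) (ħ := ħ) (Rel.x_x_ne i j hij r s)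
  rwa [map_mul, map_mul] at this

theorem U.x_x (ε : ℤˣ) (i j : ι) (r s : ℤ) :
    U.x D ħ ε i r * U.x D ħ ε j (s - 1) - kap D ħ ε i j • (U.x D ħ ε i (r - 1) * U.x D ħ ε j s) =
      kap D ħ ε i j • (U.x D ħ ε j (s - 1) * U.x D ħ ε i r) -
        U.x D ħ ε j s * U.x D ħ ε i (r - 1) := by
  have := U.mk_rel (D := D) (ħ := ħ) (Rel.x_x ε i j r s)
  rwa [map_sub, map_sub, map_smul, map_smul, map_mul, map_mul, map_mul, map_mul] at this

theorem U.cartanCommute : CartanCommute (U.mk D ħ) := ⟨U.k_mul_h, U.h_mul_h⟩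

theorem U.phi_zero (ε : ℤˣ) (i : ι) :
    U.phi D ħ ε i 0 = U.k D ħ ((((ε : ℤ) : ℚ) * (D.r i : ℚ)) • D.coroot i) :=
  Free.map_fphi_zero _ _ _

/-- A subalgebra containing the generators is everything. -/
theorem U.eq_top_of_gen {S : Subalgebra ℂ (U D ħ)} (hx : ∀ ε i r, U.x D ħ ε i r ∈ S)
    (hk : ∀ h, U.k D ħ h ∈ S) (hh : ∀ i m, U.h D ħ i m ∈ S) : S = ⊤ := by
  rw [eq_top_iff]
  rintro g -
  obtain ⟨a, rfl⟩ := U.mk_surjective g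
  induction a using FreeAlgebra.induction with
  | grade0 c => rw [AlgHom.commutes]; exact S.algebraMap_mem c
  | grade1 g =>
    rcases g with ⟨ε, i, r⟩ | h | ⟨i, m⟩
    · exact hx ε i r
    · exact hk h
    · exact hh i m
  | mul a b ha hb => rw [map_mul]; exact S.mul_mem ha hb
  | add a b ha hb => rw [map_add]; exact S.add_mem ha hb

/-- The coefficients of the Euler equation: a recursion that expresses the `φ` through the `h`, and
that can also be solved for the `h`. -/
theorem U.smul_phi_succ (ε : ℤˣ) (i : ι) (m : ℕ) :
    ((m + 1 : ℕ) : ℂ) • U.phi D ħ ε i (m + 1) =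
      ∑ p ∈ Finset.HasAntidiagonal.antidiagonal m,
        ((((ε : ℤ) : ℂ) * (qPow ħ 1 - qPow ħ (-1))) * ((p.1 + 1 : ℕ) : ℂ)) •
          (U.h D ħ i ⟨(ε : ℤ) * ((p.1 + 1 : ℕ) : ℤ), mul_ne_zero ε.ne_zero (by omega)⟩ *
            U.phi D ħ ε i p.2) := by
  have := congrArg (PowerSeries.coeff (m + 1))
    ((U.cartanCommute (D := D) (ħ := ħ)).euler_phi (D := D) (ħ := ħ) ε i)
  rw [coeff_euler, PowerSeries.coeff_mk, PowerSeries.coeff_mul,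
    Finset.Nat.sum_antidiagonal_succ] at this
  refine this.trans ?_
  rw [PowerSeries.coeff_smul, coeff_euler, Nat.cast_zero, zero_smul, smul_zero, zero_mul, zero_add]
  refine Finset.sum_congr rfl fun p _ => ?_
  rw [PowerSeries.coeff_smul, coeff_euler, PowerSeries.coeff_mk, smul_smul, smul_mul_assoc,
    Free.coeff_map_hSeries _ _ _ _ (mul_ne_zero ε.ne_zero (by omega))]
  rfl

theorem U.phi_mem {S : Subalgebra ℂ (U D ħ)} (hk : ∀ h, U.k D ħ h ∈ S)
    (hh : ∀ i m, U.h D ħ i m ∈ S) (ε : ℤˣ) (i : ι) (m : ℕ) : U.phi D ħ ε i m ∈ S := by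
  induction m using Nat.strong_induction_on with
  | _ m ih =>
    rcases m with _ | m
    · rw [U.phi_zero]
      exact hk _
    · have h0 : ((m + 1 : ℕ) : ℂ) ≠ 0 := Nat.cast_ne_zero.2 m.succ_ne_zero
      rw [← inv_smul_smul₀ h0 (U.phi D ħ ε i (m + 1)), U.smul_phi_succ]
      refine S.smul_mem (S.sum_mem fun p hp => S.smul_mem (S.mul_mem (hh _ _) (ih _ ?_)) _) _
      have := Finset.HasAntidiagonal.mem_antidiagonal.1 hp
      omega

/-- The algebra is also generated by the `x^±_{i,r}`, `k_h` and `φ^±_{i,m}`. -/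
theorem U.eq_top_of_phi (hq : ∀ n : ℕ, n ≠ 0 → Complex.exp ħ ^ n ≠ 1) {S : Subalgebra ℂ (U D ħ)}
    (hx : ∀ ε i r, U.x D ħ ε i r ∈ S) (hk : ∀ h, U.k D ħ h ∈ S)
    (hphi : ∀ ε i m, U.phi D ħ ε i m ∈ S) : S = ⊤ := by
  refine U.eq_top_of_gen hx hk fun i m => ?_
  have key (ε : ℤˣ) (m : ℕ) : U.h D ħ i ⟨(ε : ℤ) * ((m + 1 : ℕ) : ℤ),
      mul_ne_zero ε.ne_zero (by omega)⟩ ∈ S := by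
    induction m using Nat.strong_induction_on with
    | _ m ih =>
      have h1 := U.smul_phi_succ (D := D) (ħ := ħ) ε i m
      -- The last summand is a nonzero multiple of `h_{ε(m+1)} φ_0`, and `φ_0` is some `k_h`, hence
      -- invertible; all other `h` in the recursion have smaller index.
      rw [Finset.Nat.sum_antidiagonal_eq_sum_range_succ_mk, Finset.sum_range_succ] at h1
      have h2 := sub_eq_iff_eq_add'.2 h1
      simp only [Nat.sub_self, U.phi_zero] at h2
      have h3 : ((((ε : ℤ) : ℂ) * (qPow ħ 1 - qPow ħ (-1))) * ((m + 1 : ℕ) : ℂ)) ≠ 0 :=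
        mul_ne_zero (mul_ne_zero (Int.cast_ne_zero.2 ε.ne_zero)
          (qPow_sub_qPow_neg_ne_zero hq one_ne_zero)) (Nat.cast_ne_zero.2 m.succ_ne_zero)
      have h4 : U.h D ħ i ⟨(ε : ℤ) * ((m + 1 : ℕ) : ℤ), mul_ne_zero ε.ne_zero (by omega)⟩ *
          U.k D ħ ((((ε : ℤ) : ℚ) * (D.r i : ℚ)) • D.coroot i) ∈ S := by
        rw [← inv_smul_smul₀ h3 (_ * _), ← h2]
        refine S.smul_mem (S.sub_mem (S.smul_mem (hphi _ _ _) _) (S.sum_mem fun p hp =>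
          S.smul_mem (S.mul_mem (ih _ (Finset.mem_range.1 hp)) (hphi _ _ _)) _)) _
      have h5 := S.mul_mem h4 (hk (-((((ε : ℤ) : ℚ) * (D.r i : ℚ)) • D.coroot i)))
      rwa [mul_assoc, ← U.k_add, add_neg_cancel, U.k_zero, mul_one] at h5
  obtain ⟨m, hm⟩ := m
  rcases lt_or_gt_of_ne hm with h | h
  · have := key (-1) (m.natAbs - 1)
    convert this using 3
    simp only [Units.val_neg, Units.val_one]
    omega
  · have := key 1 (m.natAbs - 1)
    convert this using 3
    simp only [Units.val_one]
    omega

theorem U.phi_zero_mul_x (ε σ : ℤˣ) (i j : ι) (r : ℤ) :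
    U.phi D ħ ε i 0 * U.x D ħ σ j r =
      kap D ħ (ε * σ) i j • (U.x D ħ σ j r * U.phi D ħ ε i 0) := by
  rw [U.phi_zero, U.k_mul_x, kap, map_smul, D.pairing]
  congr 2
  push_cast
  simp only [smul_eq_mul]
  ring

theorem U.phi_mul_x (hq : ∀ n : ℕ, n ≠ 0 → Complex.exp ħ ^ n ≠ 1) (ε σ : ℤˣ) (i j : ι) (m : ℕ)
    (r : ℤ) :
    U.phi D ħ ε i m * U.x D ħ σ j r =
      ∑ p ∈ Finset.HasAntidiagonal.antidiagonal m, gam (kap D ħ (ε * σ) i j) p.1 •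
        (U.x D ħ σ j (r + (ε : ℤ) * p.1) * U.phi D ħ ε i p.2) := by
  have := coeff_mul_current ((U.cartanCommute (D := D) (ħ := ħ)).euler_phi (D := D) (ħ := ħ) ε i)
    (kap_ne_zero D ħ (ε * σ) i j) (fun b => U.x D ħ σ j (r + (ε : ℤ) * b)) (fun b => ?_)
    (fun p b => ?_) m
  · simpa [U.phi] using this
  · rw [PowerSeries.coeff_mk]
    exact U.phi_zero_mul_x _ _ _ _ _
  · rcases Nat.eq_zero_or_pos p with rfl | hp
    · simp
    · rw [Free.coeff_map_hSeries _ _ _ _ (mul_ne_zero ε.ne_zero (by omega))]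
      change _ • _ • (U.h D ħ i _ * _ - _ * U.h D ħ i _) = _
      rw [U.h_x, smul_smul, smul_smul, ← heisenberg_factor hq]
      congr 1
      · ring
      · congr 1
        push_cast
        ring

/-- Together with `gam_sub_succ` this says `(1 - κ t) ∑ gam κ n t ^ n = κ - t`. -/
theorem gam_sub_zero (κ : ℂ) : gam κ 1 - κ * gam κ 0 = -1 := by
  simp [gam]
  ring

theorem gam_sub_succ (κ : ℂ) (n : ℕ) : gam κ (n + 2) - κ * gam κ (n + 1) = 0 := by
  simp [gam]
  ring

/-- The polynomial form of the commutation of `φ` and `x`. -/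
theorem U.phi_succ_mul_x (hq : ∀ n : ℕ, n ≠ 0 → Complex.exp ħ ^ n ≠ 1) (ε σ : ℤˣ) (i j : ι) (m : ℕ)
    (r : ℤ) :
    U.phi D ħ ε i (m + 1) * U.x D ħ σ j r -
        kap D ħ (ε * σ) i j • (U.phi D ħ ε i m * U.x D ħ σ j (r + ε)) =
      kap D ħ (ε * σ) i j • (U.x D ħ σ j r * U.phi D ħ ε i (m + 1)) -
        U.x D ħ σ j (r + ε) * U.phi D ħ ε i m := by
  set κ := kap D ħ (ε * σ) i j
  rw [U.phi_mul_x hq, U.phi_mul_x hq, Finset.Nat.sum_antidiagonal_succ, Finset.smul_sum,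
    add_sub_assoc, ← Finset.sum_sub_distrib, sub_eq_add_neg (κ • _)]
  congr 1
  · simp [gam, κ]
  · have h (p : ℕ × ℕ) : gam κ (p.1 + 1) • (U.x D ħ σ j (r + (ε : ℤ) * ((p.1 + 1 : ℕ) : ℤ)) *
          U.phi D ħ ε i p.2) - κ • gam κ p.1 • (U.x D ħ σ j (r + ε + (ε : ℤ) * p.1) *
            U.phi D ħ ε i p.2) = (gam κ (p.1 + 1) - κ * gam κ p.1) •
        (U.x D ħ σ j (r + ε + (ε : ℤ) * p.1) * U.phi D ħ ε i p.2) := by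
      rw [sub_smul, mul_smul]
      congr 4
      push_cast
      ring
    rw [Finset.sum_congr rfl fun p _ => h p,
      Finset.Nat.sum_antidiagonal_eq_sum_range_succ_mk, Finset.sum_range_succ']
    simp only [gam_sub_succ, zero_smul, Finset.sum_const_zero, zero_add, gam_sub_zero, neg_smul,
      one_smul, Nat.sub_zero, Nat.cast_zero, mul_zero, add_zero]

/-- The centralizer of `g` is a subalgebra, and the `φ` lie in every subalgebra containing the `k`
and the `h`. -/
theorem U.commute_of_mem_adjoin {g : U D ħ} (hk : ∀ h, Commute g (U.k D ħ h))
    (hh : ∀ i m, Commute g (U.h D ħ i m)) (ε : ℤˣ) (i : ι) (m : ℕ) :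
    Commute g (U.phi D ħ ε i m) := by
  have := U.phi_mem (S := Subalgebra.centralizer ℂ {g}) (fun h => ?_) (fun i m => ?_) ε i m
  · exact Subalgebra.mem_centralizer_iff ℂ |>.1 this g rfl
  · exact Subalgebra.mem_centralizer_iff ℂ |>.2 fun a ha => by rw [Set.mem_singleton_iff.1 ha]; exact hk h
  · exact Subalgebra.mem_centralizer_iff ℂ |>.2 fun a ha => by
      rw [Set.mem_singleton_iff.1 ha]; exact hh i m

theorem U.h_mul_phi (j : ι) (n) (ε : ℤˣ) (i : ι) (m : ℕ) :
    Commute (U.h D ħ j n) (U.phi D ħ ε i m) :=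
  U.commute_of_mem_adjoin (fun h => (U.k_mul_h h j n).symm) (fun i m => U.h_mul_h j i n m) ε i m

theorem U.k_mul_phi (h : 𝔥) (ε : ℤˣ) (i : ι) (m : ℕ) :
    Commute (U.k D ħ h) (U.phi D ħ ε i m) :=
  U.commute_of_mem_adjoin (fun h' => U.k_mul_k h h') (fun i m => U.k_mul_h h i m) ε i m

theorem U.phi_mul_phi (σ : ℤˣ) (j : ι) (n : ℕ) (ε : ℤˣ) (i : ι) (m : ℕ) :
    Commute (U.phi D ħ σ j n) (U.phi D ħ ε i m) :=
  U.commute_of_mem_adjoin (fun h' => (U.k_mul_phi h' σ j n).symm)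
    (fun i m => (U.h_mul_phi i m σ j n).symm) ε i m

end Structure

end QAff

namespace QAff

/-! ### Deformed currents -/

section AbstractCurrent

variable {E : Type*} [Ring E] [Algebra ℂ E]

/-- The variable `u ^ m` in the ring of Laurent series. -/
noncomputable def uPow (E : Type*) [Ring E] (m : ℤ) : LaurentSeries E := HahnSeries.single m 1

theorem uPow_add (m n : ℤ) : uPow E (m + n) = uPow E m * uPow E n := by
  simp [uPow]

theorem commute_uPow (m : ℤ) (f : LaurentSeries E) : Commute (uPow E m) f := by
  ext n
  rw [uPow, HahnSeries.coeff_single_mul, HahnSeries.coeff_mul_single, one_mul, mul_one]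

theorem expand_zpow_smul (m : ℤ) (y : K ⊗[ℂ] E) :
    expand E ((RatFunc.X ^ m : K) • y) = uPow E m * expand E y := by
  ext n
  rw [expand_coeff, expandCoeff_zpow_smul, uPow, HahnSeries.coeff_single_mul, one_mul, expand_coeff]

theorem expand_one_tmul (e : E) : expand E (1 ⊗ₜ e) = HahnSeries.C e := by
  ext n
  rw [expand_coeff, expandCoeff_tmul, ratCoeff_one, HahnSeries.C_apply, HahnSeries.coeff_single]
  split_ifs <;> simp

theorem coeff_ofPowerSeries (f : PowerSeries E) (n : ℤ) :
    (HahnSeries.ofPowerSeries ℤ E f).coeff n = if 0 ≤ n then PowerSeries.coeff n.toNat f else 0 := by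
  rcases lt_or_ge n 0 with h | h
  · rw [if_neg (by omega)]
    rw [HahnSeries.ofPowerSeries_apply, HahnSeries.embDomain_of_notMem_range]
    rintro ⟨m, hm⟩
    simp at hm
    omega
  · rw [if_pos h]
    obtain ⟨m, rfl⟩ := Int.eq_ofNat_of_zero_le h
    rw [HahnSeries.ofPowerSeries_apply_coeff]
    rfl

theorem uPow_one_eq : uPow E 1 = HahnSeries.ofPowerSeries ℤ E PowerSeries.X := by
  rw [HahnSeries.ofPowerSeries_X]
  rfl

theorem ofPowerSeries_smul (c : ℂ) (f : PowerSeries E) :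
    HahnSeries.ofPowerSeries ℤ E (c • f) = c • HahnSeries.ofPowerSeries ℤ E f := by
  ext n
  rw [HahnSeries.coeff_smul, coeff_ofPowerSeries, coeff_ofPowerSeries]
  split_ifs <;> simp

theorem C_smul (c : ℂ) (e : E) : (HahnSeries.C (c • e) : LaurentSeries E) = c • HahnSeries.C e := by
  ext n
  by_cases h : n = 0 <;> simp [HahnSeries.C_apply, h]

variable {ι : Type*}

/-- Two commuting families of currents `A`, `b`, with Cartan currents `φ` acting on the first one,
in a form suitable for the Drinfeld coproduct `A(z) + φ(z) b(z u)`. -/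
structure CurrentData (A b : ι → ℤ → E) (φ : ι → ℕ → E) (κ : ι → ι → ℂ) : Prop where
  symm : ∀ i j, κ i j = κ j i
  A_b : ∀ i j r s, Commute (A i r) (b j s)
  φ_b : ∀ i j m s, Commute (φ i m) (b j s)
  φ_φ : ∀ i j m n, Commute (φ i m) (φ j n)
  A_A : ∀ i j r s, A i r * A j (s - 1) - κ i j • (A i (r - 1) * A j s) =
    κ i j • (A j (s - 1) * A i r) - A j s * A i (r - 1)
  b_b : ∀ i j r s, b i r * b j (s - 1) - κ i j • (b i (r - 1) * b j s) =
    κ i j • (b j (s - 1) * b i r) - b j s * b i (r - 1)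
  A_φ_zero : ∀ i j r, A i r * φ j 0 = κ i j • (φ j 0 * A i r)
  A_φ_succ : ∀ i j r m, A i r * φ j (m + 1) - κ i j • (A i (r - 1) * φ j m) =
    κ i j • (φ j (m + 1) * A i r) - φ j m * A i (r - 1)

namespace CurrentData

/-- The power series `∑_a t ^ a φ_a b_{r+a}`. -/
noncomputable def series (b : ι → ℤ → E) (φ : ι → ℕ → E) (i : ι) (r : ℤ) : PowerSeries E :=
  PowerSeries.mk fun a => φ i a * b i (r + a)

variable {A b : ι → ℤ → E} {φ : ι → ℕ → E} {κ : ι → ι → ℂ}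

/-- Since `b` commutes with `A`, each coefficient is the relation between `A` and `φ` multiplied on
the right by one mode of `b`. The degree zero coefficient uses `A_φ_zero`, the others `A_φ_succ`. -/
theorem mixed_series (h : CurrentData A b φ κ) (i j : ι) (r s : ℤ) :
    PowerSeries.C (A i r) * series b φ j (s - 1) -
        κ i j • (PowerSeries.C (A i (r - 1)) * (PowerSeries.X * series b φ j s)) =
      κ i j • (series b φ j (s - 1) * PowerSeries.C (A i r)) -
        PowerSeries.X * series b φ j s * PowerSeries.C (A i (r - 1)) := by
  have e (r : ℤ) (n : ℕ) (t : ℤ) : φ j n * b j t * A i r = φ j n * A i r * b j t := by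
    rw [mul_assoc, mul_assoc, (h.A_b i j r t).eq]
  ext n
  rcases n with _ | n
  · simp only [map_sub, PowerSeries.coeff_smul, PowerSeries.coeff_C_mul, PowerSeries.coeff_mul_C,
      PowerSeries.coeff_zero_X_mul, mul_zero, zero_mul, smul_zero, sub_zero]
    simp only [series, PowerSeries.coeff_mk, e, ← mul_assoc, h.A_φ_zero, smul_mul_assoc]
  · simp only [map_sub, PowerSeries.coeff_smul, PowerSeries.coeff_C_mul, PowerSeries.coeff_mul_C,
      PowerSeries.coeff_succ_X_mul]
    simp only [series, PowerSeries.coeff_mk, e, ← mul_assoc]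
    rw [show s - 1 + ((n + 1 : ℕ) : ℤ) = s + n by push_cast; ring]
    have := congrArg (· * b j (s + n)) (h.A_φ_succ i j r n)
    simpa only [sub_mul, smul_mul_assoc] using this

/-- The `φ` commute with the `b` and among themselves, so they can be collected on the left, where
each coefficient becomes a sum of quadratic relations for `b`. -/
theorem series_series (h : CurrentData A b φ κ) (i j : ι) (r s : ℤ) :
    series b φ i r * series b φ j (s - 1) - κ i j • (series b φ i (r - 1) * series b φ j s) =
      κ i j • (series b φ j (s - 1) * series b φ i r) - series b φ j s * series b φ i (r - 1) := by
  have e (i j : ι) (m n : ℕ) (s t : ℤ) :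
      φ i m * b i s * (φ j n * b j t) = φ i m * φ j n * (b i s * b j t) := by
    rw [mul_assoc, mul_assoc, ← mul_assoc (b i s), (h.φ_b j i n s).symm.eq, mul_assoc]
  ext N
  simp only [map_sub, PowerSeries.coeff_smul, PowerSeries.coeff_mul]
  rw [← Finset.Nat.sum_antidiagonal_swap (n := N) (f := fun p =>
      PowerSeries.coeff p.1 (series b φ j (s - 1)) * PowerSeries.coeff p.2 (series b φ i r)),
    ← Finset.Nat.sum_antidiagonal_swap (n := N) (f := fun p =>
      PowerSeries.coeff p.1 (series b φ j s) * PowerSeries.coeff p.2 (series b φ i (r - 1))),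
    Finset.smul_sum, Finset.smul_sum, ← Finset.sum_sub_distrib, ← Finset.sum_sub_distrib]
  refine Finset.sum_congr rfl fun p _ => ?_
  simp only [series, PowerSeries.coeff_mk, Prod.fst_swap, Prod.snd_swap, e,
    (h.φ_φ j i p.2 p.1).eq]
  have := congrArg (φ i p.1 * φ j p.2 * ·) (h.b_b i j (r + p.1) (s + p.2))
  simp only [mul_sub, mul_smul_comm] at this
  rwa [show r - 1 + (p.1 : ℤ) = r + p.1 - 1 by ring, show s - 1 + (p.2 : ℤ) = s + p.2 - 1 by ring]

/-- The Drinfeld coproduct of a current. -/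
noncomputable def total (A b : ι → ℤ → E) (φ : ι → ℕ → E) (i : ι) (r : ℤ) : LaurentSeries E :=
  HahnSeries.C (A i r) + uPow E r * HahnSeries.ofPowerSeries ℤ E (series b φ i r)

theorem mixed (h : CurrentData A b φ κ) (i j : ι) (r s : ℤ) :
    (HahnSeries.C (A i r) : LaurentSeries E) *
          (uPow E (s - 1) * HahnSeries.ofPowerSeries ℤ E (series b φ j (s - 1))) -
        κ i j • ((HahnSeries.C (A i (r - 1)) : LaurentSeries E) *
          (uPow E s * HahnSeries.ofPowerSeries ℤ E (series b φ j s))) =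
      κ i j • ((uPow E (s - 1) * HahnSeries.ofPowerSeries ℤ E (series b φ j (s - 1))) *
          (HahnSeries.C (A i r) : LaurentSeries E)) -
        (uPow E s * HahnSeries.ofPowerSeries ℤ E (series b φ j s)) *
          (HahnSeries.C (A i (r - 1)) : LaurentSeries E) := by
  -- The extra variable `X` in `mixed_series` is what raises `u ^ (s - 1)` to `u ^ s`.
  have e := congrArg (fun f => uPow E (s - 1) * HahnSeries.ofPowerSeries ℤ E f)
    (h.mixed_series i j r s)
  simp only [map_sub, map_mul, ofPowerSeries_smul, HahnSeries.ofPowerSeries_C, ← uPow_one_eq,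
    mul_sub, mul_smul_comm, ← mul_assoc] at e
  rw [(commute_uPow (s - 1) (HahnSeries.C (A i r))).eq,
    (commute_uPow (s - 1) (HahnSeries.C (A i (r - 1)))).eq,
    mul_assoc (HahnSeries.C (A i (r - 1))), ← uPow_add, sub_add_cancel] at e
  simpa only [← mul_assoc] using e

/-- After expansion each of the four types of products satisfies the quadratic relation on its own:
`A` with `A`, `φ b` with `φ b`, and the two mixed ones. The second mixed relation is the first with
the roles of `(i, r)` and `(j, s)` exchanged, since the quadratic relation is invariant under this
exchange. -/
theorem total_total (h : CurrentData A b φ κ) (i j : ι) (r s : ℤ) :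
    total A b φ i r * total A b φ j (s - 1) - κ i j • (total A b φ i (r - 1) * total A b φ j s) =
      κ i j • (total A b φ j (s - 1) * total A b φ i r) -
        total A b φ j s * total A b φ i (r - 1) := by
  have e1 := congrArg (HahnSeries.C : E →+* LaurentSeries E) (h.A_A i j r s)
  simp only [map_sub, map_mul, C_smul] at e1
  have e2 := h.mixed i j r s
  have e3 := h.mixed j i s r
  have e4 := congrArg (fun f => uPow E (r + s - 1) * HahnSeries.ofPowerSeries ℤ E f)
    (h.series_series i j r s)
  have e5 (m n : ℤ) (f g : LaurentSeries E) :
      uPow E m * f * (uPow E n * g) = uPow E (m + n) * (f * g) := by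
    rw [mul_assoc, ← mul_assoc f, ← (commute_uPow n f).eq, mul_assoc, ← mul_assoc, ← uPow_add]
  simp only [map_sub, map_mul, ofPowerSeries_smul, mul_sub, mul_smul_comm] at e4
  rw [← h.symm i j] at e3
  simp only [total, add_mul, mul_add, smul_add, e5]
  rw [show r + (s - 1) = r + s - 1 by ring, show r - 1 + s = r + s - 1 by ring,
    show s - 1 + r = r + s - 1 by ring, show s + (r - 1) = r + s - 1 by ring]
  linear_combination (norm := module) e1 + e2 + e3 + e4

end CurrentData

end AbstractCurrent

end QAff

namespace QAff

/-! ### Currents from two commuting actions, and their rationality -/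

section CommutingPair

variable {ι : Type w₁} [Fintype ι] [DecidableEq ι] {𝔥 : Type w₂} [AddCommGroup 𝔥] [Module ℚ 𝔥]
variable {D : CartanDatum ι 𝔥} {ħ : ℂ}
variable {E : Type*} [Ring E] [Algebra ℂ E]

theorem units_neg_mul_self (σ : ℤˣ) : -σ * σ = -1 := by
  rcases Int.units_eq_one_or σ with rfl | rfl <;> rfl

theorem units_coe_mul_coe (σ : ℤˣ) : (σ : ℤ) * σ = 1 := by
  rcases Int.units_eq_one_or σ with rfl | rfl <;> rfl

theorem kap_one_mul_kap_neg_one (i j : ι) : kap D ħ 1 i j * kap D ħ (-1) i j = 1 := by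
  rw [kap_neg, mul_inv_cancel₀ (kap_ne_zero _ _ _ _ _)]

/-- Reversing the index of `x^-` replaces its factor by the inverse. After this both signs obey the
same quadratic relation, and one abstract computation covers `x^+` and `x^-`. -/
theorem U.x_x_signed (σ : ℤˣ) (i j : ι) (r s : ℤ) :
    U.x D ħ σ i (σ * r) * U.x D ħ σ j (σ * (s - 1)) -
        kap D ħ 1 i j • (U.x D ħ σ i (σ * (r - 1)) * U.x D ħ σ j (σ * s)) =
      kap D ħ 1 i j • (U.x D ħ σ j (σ * (s - 1)) * U.x D ħ σ i (σ * r)) -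
        U.x D ħ σ j (σ * s) * U.x D ħ σ i (σ * (r - 1)) := by
  rcases Int.units_eq_one_or σ with rfl | rfl
  · simpa using U.x_x (D := D) (ħ := ħ) 1 i j r s
  · have := congrArg (kap D ħ 1 i j • ·) (U.x_x (D := D) (ħ := ħ) (-1) i j (-r + 1) (-s + 1))
    simp only [smul_sub, smul_smul, kap_one_mul_kap_neg_one, one_smul, add_sub_cancel_right] at this
    simp only [Units.val_neg, Units.val_one, neg_mul, one_mul, neg_sub]
    rw [show 1 - s = -s + 1 by ring, show 1 - r = -r + 1 by ring]
    linear_combination (norm := module) -this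

theorem currentData (hq : ∀ n : ℕ, n ≠ 0 → Complex.exp ħ ^ n ≠ 1) {π π' : U D ħ →ₐ[ℂ] E}
    (hc : ∀ a b, Commute (π a) (π' b)) (σ : ℤˣ) :
    CurrentData (fun i r => π (U.x D ħ σ i (σ * r))) (fun i r => π' (U.x D ħ σ i (σ * r)))
      (fun i m => π (U.phi D ħ (-σ) i m)) (kap D ħ 1) where
  symm := kap_symm D ħ 1
  A_b _ _ _ _ := hc _ _
  φ_b _ _ _ _ := hc _ _
  φ_φ i j m n := (U.phi_mul_phi _ _ _ _ _ _).map π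
  A_A i j r s := by
    simpa only [map_sub, map_mul, map_smul] using congrArg π (U.x_x_signed (D := D) (ħ := ħ) σ i j r s)
  b_b i j r s := by
    simpa only [map_sub, map_mul, map_smul] using congrArg π' (U.x_x_signed (D := D) (ħ := ħ) σ i j r s)
  A_φ_zero i j r := by
    have := U.phi_zero_mul_x (D := D) (ħ := ħ) (-σ) σ j i (σ * r)
    rw [← map_mul, ← map_mul, ← map_smul, this, smul_smul, units_neg_mul_self, kap_symm D ħ 1,
      kap_one_mul_kap_neg_one, one_smul]
  A_φ_succ i j r m := by
    have := congrArg (kap D ħ 1 i j • ·)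
      (U.phi_succ_mul_x (D := D) (ħ := ħ) hq (-σ) σ j i m (σ * r))
    simp only [units_neg_mul_self, kap_symm D ħ (-1) j i, smul_sub, smul_smul,
      kap_one_mul_kap_neg_one, one_smul] at this
    rw [Units.val_neg, show (σ : ℤ) * r + -σ = σ * (r - 1) by ring] at this
    simpa only [map_sub, map_mul, map_smul] using congrArg π this.symm

theorem q_sub_ne_zero (hq : ∀ n : ℕ, n ≠ 0 → Complex.exp ħ ^ n ≠ 1) (i : ι) :
    qPow ħ (D.r i : ℚ) - qPow ħ (-(D.r i : ℚ)) ≠ 0 :=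
  qPow_sub_qPow_neg_ne_zero hq (Nat.cast_ne_zero.2 (D.r_pos i).ne')

/-- At a nonzero total degree only one of `φ^+`, `φ^-` survives in the commutator of `x^+` and
`x^-`, so it can be solved for. -/
theorem U.phi_succ_eq (hq : ∀ n : ℕ, n ≠ 0 → Complex.exp ħ ^ n ≠ 1) (σ : ℤˣ) (i : ι) (m : ℕ) :
    U.phi D ħ (-σ) i (m + 1) = (-(qPow ħ (D.r i : ℚ) - qPow ħ (-(D.r i : ℚ)))) •
      (U.x D ħ σ i 0 * U.x D ħ (-σ) i (-σ * (m + 1 : ℕ)) -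
        U.x D ħ (-σ) i (-σ * (m + 1 : ℕ)) * U.x D ħ σ i 0) := by
  have h0 := q_sub_ne_zero (D := D) hq i
  rcases Int.units_eq_one_or σ with rfl | rfl
  · simp only [Units.val_one]
    rw [U.x_x_same, smul_smul, U.phiZ, U.phiZ, if_neg (by simp; omega), if_pos (by simp; omega),
      zero_sub, smul_neg, neg_mul, mul_one_div_cancel h0, neg_smul, one_smul, neg_neg]
    congr 1
    simp
  · rw [← neg_sub (U.x D ħ (- -1) i _ * _), smul_neg, neg_neg]
    simp only [neg_neg, Units.val_neg, Units.val_one, one_mul]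
    rw [U.x_x_same, smul_smul, U.phiZ, U.phiZ, if_pos (by simp; omega), if_neg (by simp; omega),
      sub_zero, neg_mul, mul_one_div_cancel h0, neg_smul, one_smul, neg_neg]
    congr 1
    simp

theorem U.ad_h_x {ε : ℤˣ} (i : ι) (m : {m : ℤ // m ≠ 0}) (hm : hxCoeff D ħ m ε i i ≠ 0) (r : ℤ) :
    (hxCoeff D ħ m ε i i)⁻¹ • (U.h D ħ i m * U.x D ħ ε i r - U.x D ħ ε i r * U.h D ħ i m) =
      U.x D ħ ε i (m + r) := by
  rw [U.h_x, inv_smul_smul₀ hm]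

/-- The rationality of the Drinfeld coproduct. Replacing `φ` by `x^{-σ}` gives a geometric series
for the operator that shifts both indices; a commutator in the first factor then recovers `φ`. -/
theorem exists_current [FiniteDimensional ℂ E] (hq : ∀ n : ℕ, n ≠ 0 → Complex.exp ħ ^ n ≠ 1)
    {π π' : U D ħ →ₐ[ℂ] E} (hc : ∀ a b, Commute (π a) (π' b)) (σ : ℤˣ) (i : ι) (r : ℤ) :
    ∃ y : K ⊗[ℂ] E, ∀ n : ℤ, expandCoeff E n y =
      if 0 ≤ n then π (U.phi D ħ (-σ) i n.toNat) * π' (U.x D ħ σ i (σ * (r + n))) else 0 := by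
  let ad (a : E) : Module.End ℂ E := LinearMap.mulLeft ℂ a - LinearMap.mulRight ℂ a
  have had (a e : E) : ad a e = a * e - e * a := rfl
  have hσ : (σ : ℤ) ≠ 0 := σ.ne_zero
  have hσ' : ((-σ : ℤˣ) : ℤ) ≠ 0 := Units.ne_zero _
  -- `S` moves the first index by `-σ` and the second by `σ`. Normalizing the commutators requires
  -- `[2 r_i]_q ≠ 0`.
  let S : Module.End ℂ E := ((hxCoeff D ħ ((-σ : ℤˣ) : ℤ) (-σ) i i)⁻¹ • ad (π (U.h D ħ i ⟨_, hσ'⟩))) *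
    ((hxCoeff D ħ (σ : ℤ) σ i i)⁻¹ • ad (π' (U.h D ħ i ⟨_, hσ⟩)))
  have hS (a b : ℤ) : S (π (U.x D ħ (-σ) i a) * π' (U.x D ħ σ i b)) =
      π (U.x D ħ (-σ) i (-σ + a)) * π' (U.x D ħ σ i (σ + b)) := by
    have e1 : ad (π' (U.h D ħ i ⟨_, hσ⟩)) (π (U.x D ħ (-σ) i a) * π' (U.x D ħ σ i b)) =
        π (U.x D ħ (-σ) i a) * ad (π' (U.h D ħ i ⟨_, hσ⟩)) (π' (U.x D ħ σ i b)) := by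
      rw [had, had, mul_sub, ← mul_assoc, ← (hc _ _).eq, mul_assoc, mul_assoc]
    have e2 (c : E) (hcc : Commute (π (U.h D ħ i ⟨_, hσ'⟩)) c) :
        ad (π (U.h D ħ i ⟨_, hσ'⟩)) (π (U.x D ħ (-σ) i a) * c) =
        ad (π (U.h D ħ i ⟨_, hσ'⟩)) (π (U.x D ħ (-σ) i a)) * c := by
      rw [had, had, sub_mul, mul_assoc _ c, ← hcc.eq, mul_assoc, mul_assoc]
    have e3 : (hxCoeff D ħ (σ : ℤ) σ i i)⁻¹ • ad (π' (U.h D ħ i ⟨_, hσ⟩)) (π' (U.x D ħ σ i b)) =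
        π' (U.x D ħ σ i (σ + b)) := by
      rw [had, ← map_mul, ← map_mul, ← map_sub, ← map_smul,
        U.ad_h_x i ⟨_, hσ⟩ (hxCoeff_self_ne_zero hq hσ σ i)]
    have e4 : (hxCoeff D ħ ((-σ : ℤˣ) : ℤ) (-σ) i i)⁻¹ • ad (π (U.h D ħ i ⟨_, hσ'⟩)) (π (U.x D ħ (-σ) i a)) =
        π (U.x D ħ (-σ) i ((-σ : ℤˣ) + a)) := by
      rw [had, ← map_mul, ← map_mul, ← map_sub, ← map_smul,
        U.ad_h_x i ⟨_, hσ'⟩ (hxCoeff_self_ne_zero hq hσ' (-σ) i)]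
    rw [Module.End.mul_apply, LinearMap.smul_apply (x := π _ * _), e1, ← mul_smul_comm, e3, LinearMap.smul_apply,
      e2 _ (hc _ _), ← smul_mul_assoc, e4, Units.val_neg]
  have hSn (n : ℕ) (b : ℤ) : (S ^ n) (π (U.x D ħ (-σ) i 0) * π' (U.x D ħ σ i b)) =
      π (U.x D ħ (-σ) i (-σ * n)) * π' (U.x D ħ σ i (b + σ * n)) := by
    induction n with
    | zero => simp
    | succ n ih =>
      rw [pow_succ', Module.End.mul_apply, ih, hS]
      congr 3
      · push_cast; ring
      · push_cast; ring
  obtain ⟨y, hy⟩ := exists_geometric S (π (U.x D ħ (-σ) i 0) * π' (U.x D ħ σ i (σ * r)))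
  -- `T` turns `x^{-σ}` into `φ^{-σ}` in positive degrees only. In degree zero the commutator also
  -- involves `φ^σ`, so that coefficient is replaced by hand.
  let T : Module.End ℂ E :=
    (-(qPow ħ (D.r i : ℚ) - qPow ħ (-(D.r i : ℚ)))) • ad (π (U.x D ħ σ i 0))
  have hT (m : ℕ) (b : E) (hb : ∀ a, Commute (π a) b) :
      T (π (U.x D ħ (-σ) i (-σ * (m + 1 : ℕ))) * b) = π (U.phi D ħ (-σ) i (m + 1)) * b := by
    have e2 : ad (π (U.x D ħ σ i 0)) (π (U.x D ħ (-σ) i (-σ * (m + 1 : ℕ))) * b) =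
        ad (π (U.x D ħ σ i 0)) (π (U.x D ħ (-σ) i (-σ * (m + 1 : ℕ)))) * b := by
      rw [had, had, sub_mul, mul_assoc _ b, ← (hb _).eq, mul_assoc, mul_assoc]
    rw [U.phi_succ_eq hq, map_smul π, map_sub π, map_mul π, map_mul π, LinearMap.smul_apply, e2, had,
      smul_mul_assoc]
  have h0 : expandCoeff E 0 (T.baseChange K y) =
      T (π (U.x D ħ (-σ) i 0) * π' (U.x D ħ σ i (σ * r))) := by
    rw [expandCoeff_natural, hy, if_pos le_rfl]
    simp
  refine ⟨T.baseChange K y + 1 ⊗ₜ (π (U.phi D ħ (-σ) i 0) * π' (U.x D ħ σ i (σ * r)) -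
    T (π (U.x D ħ (-σ) i 0) * π' (U.x D ħ σ i (σ * r)))), fun n => ?_⟩
  rw [map_add, expandCoeff_tmul, ratCoeff_one]
  rcases lt_trichotomy n 0 with h | rfl | h
  · rw [if_neg h.ne, zero_smul, add_zero, expandCoeff_natural, hy, if_neg (by omega), if_neg (by omega),
      map_zero]
  · rw [h0, if_pos rfl, one_smul, if_pos le_rfl]
    simp
  · obtain ⟨m, rfl⟩ : ∃ m : ℕ, n = (m + 1 : ℕ) := ⟨(n - 1).toNat, by omega⟩
    rw [if_neg (by omega), zero_smul, add_zero, expandCoeff_natural, hy, if_pos (by omega),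
      if_pos (by omega), Int.toNat_natCast, hSn, hT _ _ fun a => hc _ _, mul_add]

end CommutingPair

end QAff

namespace QAff

/-! ### The action of the generators -/

section Coproduct

variable {ι : Type w₁} [Fintype ι] [DecidableEq ι] {𝔥 : Type w₂} [AddCommGroup 𝔥] [Module ℚ 𝔥]
variable {D : CartanDatum ι 𝔥} {ħ : ℂ}
variable {E : Type*} [Ring E] [Algebra ℂ E]

theorem expandCoeff_one_tmul_mul (e : E) (y : K ⊗[ℂ] E) (n : ℤ) :
    expandCoeff E n ((1 ⊗ₜ e) * y) = e * expandCoeff E n y := by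
  rw [← expand_coeff, map_mul, expand_one_tmul, HahnSeries.C_apply, HahnSeries.coeff_single_zero_mul,
    expand_coeff]

theorem expandCoeff_mul_one_tmul (e : E) (y : K ⊗[ℂ] E) (n : ℤ) :
    expandCoeff E n (y * (1 ⊗ₜ e)) = expandCoeff E n y * e := by
  rw [← expand_coeff, map_mul, expand_one_tmul, HahnSeries.C_apply, HahnSeries.coeff_mul_single_zero,
    expand_coeff]

theorem zpow_tmul (m : ℤ) (e : E) :
    ((RatFunc.X ^ m : K) ⊗ₜ[ℂ] e) = (RatFunc.X ^ m : K) • ((1 : K) ⊗ₜ[ℂ] e) := by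
  rw [smul_tmul', smul_eq_mul, mul_one]

theorem expandCoeff_one_tmul (e : E) (n : ℤ) :
    expandCoeff E n (1 ⊗ₜ e) = if n = 0 then e else 0 := by
  rw [expandCoeff_tmul, ratCoeff_one]
  split_ifs <;> simp

theorem expandCoeff_zpow_tmul (m : ℤ) (e : E) (n : ℤ) :
    expandCoeff E n ((RatFunc.X ^ m : K) ⊗ₜ[ℂ] e) = if n = m then e else 0 := by
  rw [expandCoeff_tmul, ratCoeff_zpow]
  split_ifs <;> simp

/-- The rational function `∑_{a ≥ 0} u ^ a φ_a x_{r+a}`, in terms of commuting actions `π`, `π'`. -/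
noncomputable def current (π π' : U D ħ →ₐ[ℂ] E) (σ : ℤˣ) (i : ι) (r : ℤ) : K ⊗[ℂ] E :=
  Classical.epsilon fun y : K ⊗[ℂ] E => ∀ n : ℤ, expandCoeff E n y =
    if 0 ≤ n then π (U.phi D ħ (-σ) i n.toNat) * π' (U.x D ħ σ i (σ * (r + n))) else 0

theorem expandCoeff_current [FiniteDimensional ℂ E]
    (hq : ∀ n : ℕ, n ≠ 0 → Complex.exp ħ ^ n ≠ 1)
    {π π' : U D ħ →ₐ[ℂ] E} (hc : ∀ a b, Commute (π a) (π' b)) (σ : ℤˣ) (i : ι) (r n : ℤ) :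
    expandCoeff E n (current π π' σ i r) =
      if 0 ≤ n then π (U.phi D ħ (-σ) i n.toNat) * π' (U.x D ħ σ i (σ * (r + n))) else 0 :=
  Classical.epsilon_spec (exists_current hq hc σ i r) n

theorem expandCoeff_current' [FiniteDimensional ℂ E]
    (hq : ∀ n : ℕ, n ≠ 0 → Complex.exp ħ ^ n ≠ 1)
    {π π' : U D ħ →ₐ[ℂ] E} (hc : ∀ a b, Commute (π a) (π' b)) (σ : ℤˣ) (i : ι) (r n : ℤ) :
    expandCoeff E n (current π π' σ i r) =
      π (U.phiZ D ħ (-σ) i (-σ * n)) * π' (U.x D ħ σ i (σ * (r + n))) := by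
  have h : ((-σ : ℤˣ) : ℤ) * (-σ * n) = n := by
    rw [Units.val_neg, ← mul_assoc, neg_mul_neg, units_coe_mul_coe, one_mul]
  rw [expandCoeff_current hq hc, U.phiZ, h]
  split_ifs <;> simp

/-- `x^σ_{σ r} ⊗ 1 + φ^{-σ} ⊗ x^σ`, where `π` and `π'` are the actions on the two factors. -/
noncomputable def signedCurrent (π π' : U D ħ →ₐ[ℂ] E) (σ : ℤˣ) (i : ι) (r : ℤ) : K ⊗[ℂ] E :=
  1 ⊗ₜ π (U.x D ħ σ i (σ * r)) + (RatFunc.X ^ r : K) • current π π' σ i r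

theorem expand_current [FiniteDimensional ℂ E]
    (hq : ∀ n : ℕ, n ≠ 0 → Complex.exp ħ ^ n ≠ 1)
    {π π' : U D ħ →ₐ[ℂ] E} (hc : ∀ a b, Commute (π a) (π' b)) (σ : ℤˣ) (i : ι) (r : ℤ) :
    expand E (current π π' σ i r) = HahnSeries.ofPowerSeries ℤ E
      (CurrentData.series (fun i r => π' (U.x D ħ σ i (σ * r)))
        (fun i m => π (U.phi D ħ (-σ) i m)) i r) := by
  ext n
  rw [expand_coeff, coeff_ofPowerSeries, expandCoeff_current hq hc]
  split_ifs with h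
  · rw [CurrentData.series, PowerSeries.coeff_mk, Int.toNat_of_nonneg h]
  · rfl

theorem expand_signedCurrent [FiniteDimensional ℂ E]
    (hq : ∀ n : ℕ, n ≠ 0 → Complex.exp ħ ^ n ≠ 1)
    {π π' : U D ħ →ₐ[ℂ] E} (hc : ∀ a b, Commute (π a) (π' b)) (σ : ℤˣ) (i : ι) (r : ℤ) :
    expand E (signedCurrent π π' σ i r) =
      CurrentData.total (fun i r => π (U.x D ħ σ i (σ * r))) (fun i r => π' (U.x D ħ σ i (σ * r)))
        (fun i m => π (U.phi D ħ (-σ) i m)) i r := by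
  rw [signedCurrent, map_add, expand_zpow_smul, expand_one_tmul, expand_current hq hc]
  rfl

theorem signedCurrent_x_x [FiniteDimensional ℂ E]
    (hq : ∀ n : ℕ, n ≠ 0 → Complex.exp ħ ^ n ≠ 1)
    {π π' : U D ħ →ₐ[ℂ] E} (hc : ∀ a b, Commute (π a) (π' b)) (σ : ℤˣ) (i j : ι) (r s : ℤ) :
    signedCurrent π π' σ i r * signedCurrent π π' σ j (s - 1) -
        kap D ħ 1 i j • (signedCurrent π π' σ i (r - 1) * signedCurrent π π' σ j s) =
      kap D ħ 1 i j • (signedCurrent π π' σ j (s - 1) * signedCurrent π π' σ i r) -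
        signedCurrent π π' σ j s * signedCurrent π π' σ i (r - 1) := by
  -- A rational identity may be verified after expansion, where it is the formal statement on
  -- currents.
  apply expand_injective
  simp only [map_sub, map_mul, map_smul, expand_signedCurrent hq hc]
  exact (currentData hq hc σ).total_total i j r s

/-- The action of `x^ε_{i,r}` through the deformed Drinfeld coproduct. -/
noncomputable def deltaX (π₁ π₂ : U D ħ →ₐ[ℂ] E) (ε : ℤˣ) (i : ι) (r : ℤ) : K ⊗[ℂ] E :=
  if ε = 1 then signedCurrent π₁ π₂ 1 i r
  else (RatFunc.X ^ r : K) • signedCurrent π₂ π₁ (-1) i (-r)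

/-- The action of `h_{i,m}` through the deformed Drinfeld coproduct. -/
noncomputable def deltaH (π₁ π₂ : U D ħ →ₐ[ℂ] E) (i : ι) (m : {m : ℤ // m ≠ 0}) : K ⊗[ℂ] E :=
  1 ⊗ₜ π₁ (U.h D ħ i m) + (RatFunc.X ^ (m : ℤ) : K) ⊗ₜ π₂ (U.h D ħ i m)

/-- The action of `k_h` through the deformed Drinfeld coproduct. -/
noncomputable def deltaK (π₁ π₂ : U D ħ →ₐ[ℂ] E) (h : 𝔥) : K ⊗[ℂ] E :=
  1 ⊗ₜ (π₁ (U.k D ħ h) * π₂ (U.k D ħ h))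

/-- The action of the free algebra through the deformed Drinfeld coproduct. -/
noncomputable def deltaFree (π₁ π₂ : U D ħ →ₐ[ℂ] E) : Free ι 𝔥 →ₐ[ℂ] K ⊗[ℂ] E :=
  FreeAlgebra.lift ℂ fun g => match g with
    | Gen.x ε i r => deltaX π₁ π₂ ε i r
    | Gen.k h => deltaK π₁ π₂ h
    | Gen.h i m => deltaH π₁ π₂ i m

section

variable (π₁ π₂ : U D ħ →ₐ[ℂ] E)

theorem deltaFree_x (ε : ℤˣ) (i : ι) (r : ℤ) :
    deltaFree π₁ π₂ (fx ε i r) = deltaX π₁ π₂ ε i r := FreeAlgebra.lift_ι_apply _ _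

theorem deltaFree_k (h : 𝔥) : deltaFree π₁ π₂ (fk h) = deltaK π₁ π₂ h := FreeAlgebra.lift_ι_apply _ _

theorem deltaFree_h (i : ι) (m) : deltaFree π₁ π₂ (fh i m) = deltaH π₁ π₂ i m :=
  FreeAlgebra.lift_ι_apply _ _

theorem deltaX_one (i : ι) (r : ℤ) : deltaX π₁ π₂ 1 i r =
    1 ⊗ₜ π₁ (U.x D ħ 1 i r) + (RatFunc.X ^ r : K) • current π₁ π₂ 1 i r := by
  rw [deltaX, if_pos rfl, signedCurrent, Units.val_one, one_mul]

theorem deltaX_neg_one (i : ι) (r : ℤ) : deltaX π₁ π₂ (-1) i r =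
    (RatFunc.X ^ r : K) • (1 ⊗ₜ π₂ (U.x D ħ (-1) i r)) + current π₂ π₁ (-1) i (-r) := by
  rw [deltaX, if_neg (by decide), signedCurrent, Units.val_neg, Units.val_one, neg_one_mul, neg_neg,
    smul_add, smul_smul, ← zpow_add₀ RatFunc.X_ne_zero, add_neg_cancel, zpow_zero, one_smul]

end

variable {π₁ π₂ : U D ħ →ₐ[ℂ] E}

theorem deltaX_x_x [FiniteDimensional ℂ E] (hq : ∀ n : ℕ, n ≠ 0 → Complex.exp ħ ^ n ≠ 1)
    (hc : ∀ a b, Commute (π₁ a) (π₂ b)) (ε : ℤˣ) (i j : ι) (r s : ℤ) :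
    deltaX π₁ π₂ ε i r * deltaX π₁ π₂ ε j (s - 1) -
        kap D ħ ε i j • (deltaX π₁ π₂ ε i (r - 1) * deltaX π₁ π₂ ε j s) =
      kap D ħ ε i j • (deltaX π₁ π₂ ε j (s - 1) * deltaX π₁ π₂ ε i r) -
        deltaX π₁ π₂ ε j s * deltaX π₁ π₂ ε i (r - 1) := by
  rcases Int.units_eq_one_or ε with rfl | rfl
  · simp only [deltaX, if_pos]
    exact signedCurrent_x_x hq hc 1 i j r s
  · have h1 := congrArg (fun y => kap D ħ (-1) i j • (RatFunc.X ^ (r + s - 1) : K) • y)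
      (signedCurrent_x_x hq (fun a b => (hc b a).symm) (-1) i j (-r + 1) (-s + 1))
    simp only [smul_sub, smul_comm _ (kap D ħ 1 i j), smul_smul, add_sub_cancel_right] at h1
    have hX (a b : ℤ) (y z : K ⊗[ℂ] E) : (RatFunc.X ^ a : K) • y * (RatFunc.X ^ b : K) • z =
        (RatFunc.X ^ (a + b) : K) • (y * z) := by
      rw [smul_mul_assoc, mul_smul_comm, smul_smul, zpow_add₀ RatFunc.X_ne_zero]
    simp only [deltaX, if_neg (show ¬ (-1 : ℤˣ) = 1 by decide), hX]
    rw [show r + (s - 1) = r + s - 1 by ring, show r - 1 + s = r + s - 1 by ring,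
      show s - 1 + r = r + s - 1 by ring, show s + (r - 1) = r + s - 1 by ring,
      show -(s - 1) = -s + 1 by ring, show -(r - 1) = -r + 1 by ring]
    have hk := kap_one_mul_kap_neg_one (D := D) (ħ := ħ) i j
    rw [hk, one_smul, one_smul] at h1
    rw [← neg_inj, neg_sub, neg_sub]
    exact h1

theorem deltaK_deltaX [FiniteDimensional ℂ E] (hq : ∀ n : ℕ, n ≠ 0 → Complex.exp ħ ^ n ≠ 1)
    (hc : ∀ a b, Commute (π₁ a) (π₂ b)) (h : 𝔥) (ε : ℤˣ) (j : ι) (r : ℤ) :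
    deltaK π₁ π₂ h * deltaX π₁ π₂ ε j r =
      qPow ħ (((ε : ℤ) : ℚ) * D.root j h) • (deltaX π₁ π₂ ε j r * deltaK π₁ π₂ h) := by
  have hc' : ∀ a b, Commute (π₂ a) (π₁ b) := fun a b => (hc b a).symm
  have key (π π' : U D ħ →ₐ[ℂ] E) (hcc : ∀ a b, Commute (π a) (π' b)) (a : U D ħ)
      (ha : Commute (U.k D ħ h) a) (s : ℤ) :
      (π (U.k D ħ h) * π' (U.k D ħ h)) * (π a * π' (U.x D ħ ε j s)) =
      qPow ħ (((ε : ℤ) : ℚ) * D.root j h) •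
        ((π a * π' (U.x D ħ ε j s)) * (π (U.k D ħ h) * π' (U.k D ħ h))) := by
    rw [(hcc a _).symm.mul_mul_mul_comm, (hcc (U.k D ħ h) _).symm.mul_mul_mul_comm, ← map_mul, ← map_mul, ← map_mul,
      ← map_mul, U.k_mul_x, ha.eq, map_smul, mul_smul_comm]
  have key1 (s : ℤ) := key π₁ π₂ hc 1 (Commute.one_right _) s
  have key2 (s : ℤ) := key π₂ π₁ hc' 1 (Commute.one_right _) s
  simp only [map_one, one_mul] at key1 key2
  apply expandCoeff_ext
  intro n
  rw [deltaK, map_smul, expandCoeff_one_tmul_mul, expandCoeff_mul_one_tmul]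
  rcases Int.units_eq_one_or ε with rfl | rfl
  · rw [deltaX_one, map_add, expandCoeff_zpow_smul, expandCoeff_current hq hc, expandCoeff_one_tmul,
      mul_add, add_mul, smul_add]
    congr 1
    · split_ifs
      · rw [(hc _ _).eq]; exact key2 _
      · simp
    · split_ifs
      · exact key π₁ π₂ hc _ (U.k_mul_phi _ _ _ _) _
      · simp
  · rw [deltaX_neg_one, map_add, expandCoeff_zpow_smul, expandCoeff_current hq hc',
      expandCoeff_one_tmul, mul_add, add_mul, smul_add]
    congr 1
    · split_ifs
      · exact key1 _
      · simp
    · split_ifs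
      · rw [(hc _ _).eq]; exact key π₂ π₁ hc' _ (U.k_mul_phi _ _ _ _) _
      · simp

/-- In every coefficient `h` acts by commutator on the factor carrying `x` and commutes with the one
carrying `φ` or `1`. The power `u ^ m` attached to `h` on the second factor matches the shift of the
powers of `u` between `x_r` and `x_{m+r}`. -/
theorem deltaH_deltaX [FiniteDimensional ℂ E] (hq : ∀ n : ℕ, n ≠ 0 → Complex.exp ħ ^ n ≠ 1)
    (hc : ∀ a b, Commute (π₁ a) (π₂ b)) (i : ι) (m : {m : ℤ // m ≠ 0}) (ε : ℤˣ) (j : ι) (r : ℤ) :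
    deltaH π₁ π₂ i m * deltaX π₁ π₂ ε j r - deltaX π₁ π₂ ε j r * deltaH π₁ π₂ i m =
      hxCoeff D ħ m ε i j • deltaX π₁ π₂ ε j (m + r) := by
  have hc' : ∀ a b, Commute (π₂ a) (π₁ b) := fun a b => (hc b a).symm
  have hx (π : U D ħ →ₐ[ℂ] E) (s : ℤ) : π (U.h D ħ i m) * π (U.x D ħ ε j s) -
      π (U.x D ħ ε j s) * π (U.h D ħ i m) = hxCoeff D ħ m ε i j • π (U.x D ħ ε j (m + s)) := by
    rw [← map_mul, ← map_mul, ← map_sub, U.h_x, map_smul]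
  have key1 (π π' : U D ħ →ₐ[ℂ] E) (hcc : ∀ a b, Commute (π a) (π' b)) (a : U D ħ)
      (ha : Commute (U.h D ħ i m) a) (s : ℤ) : π (U.h D ħ i m) * (π a * π' (U.x D ħ ε j s)) -
        (π a * π' (U.x D ħ ε j s)) * π (U.h D ħ i m) = 0 := by
    rw [mul_assoc (π a), ← (hcc (U.h D ħ i m) _).eq, ← mul_assoc, ← mul_assoc, ← map_mul, ← map_mul,
      ha.eq, sub_self]
  have key2 (π π' : U D ħ →ₐ[ℂ] E) (hcc : ∀ a b, Commute (π a) (π' b)) (a : U D ħ) (s : ℤ) :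
      π' (U.h D ħ i m) * (π a * π' (U.x D ħ ε j s)) -
        (π a * π' (U.x D ħ ε j s)) * π' (U.h D ħ i m) =
      hxCoeff D ħ m ε i j • (π a * π' (U.x D ħ ε j (m + s))) := by
    rw [← mul_assoc, ← (hcc a _).eq, mul_assoc, mul_assoc, ← mul_sub, hx, mul_smul_comm]
  apply expandCoeff_ext
  intro n
  rw [deltaH, zpow_tmul, add_mul, mul_add, map_sub, map_add, map_add, smul_mul_assoc, mul_smul_comm,
    expandCoeff_zpow_smul, expandCoeff_zpow_smul, expandCoeff_one_tmul_mul,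
    expandCoeff_one_tmul_mul, expandCoeff_mul_one_tmul, expandCoeff_mul_one_tmul, map_smul,
    add_sub_add_comm]
  rcases Int.units_eq_one_or ε with rfl | rfl
  · simp only [deltaX_one, map_add, expandCoeff_zpow_smul, expandCoeff_one_tmul,
      expandCoeff_current' hq hc]
    have e1 := key1 π₁ π₂ hc (U.phiZ D ħ (-1) i (-1 * (n - r)))
    have f1 (a : ℤ) : Commute (U.h D ħ i m) (U.phiZ D ħ (-1) j a) := by
      rw [U.phiZ]
      split_ifs
      · exact U.h_mul_phi _ _ _ _ _
      · exact Commute.zero_right _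
    have e2 : (π₁ (U.h D ħ i m) * if n = 0 then π₁ (U.x D ħ 1 j r) else 0) -
        (if n = 0 then π₁ (U.x D ħ 1 j r) else 0) * π₁ (U.h D ħ i m) =
        hxCoeff D ħ m 1 i j • if n = 0 then π₁ (U.x D ħ 1 j (m + r)) else 0 := by
      split_ifs
      · exact hx _ _
      · simp
    have e3 (p : Prop) [Decidable p] : (π₂ (U.h D ħ i m) * if p then π₁ (U.x D ħ 1 j r) else 0) -
        (if p then π₁ (U.x D ħ 1 j r) else 0) * π₂ (U.h D ħ i m) = 0 := by
      split_ifs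
      · rw [← (hc _ _).eq, sub_self]
      · simp
    rw [mul_add (π₁ (U.h D ħ i m)), add_mul, mul_add (π₂ (U.h D ħ i m)), add_mul, add_sub_add_comm,
      add_sub_add_comm (π₂ (U.h D ħ i m) * _), e2, e3,
      key1 π₁ π₂ hc _ (f1 _), key2 π₁ π₂ hc, add_zero, zero_add, smul_add]
    simp only [Units.val_one, one_mul]
    rw [show (m : ℤ) + (r + (n - m - r)) = m + r + (n - (m + r)) by ring,
      show n - m - r = n - (m + r) by ring]
  · simp only [deltaX_neg_one, map_add, expandCoeff_zpow_smul, expandCoeff_one_tmul,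
      expandCoeff_current' hq hc']
    have f1 (a : ℤ) : Commute (U.h D ħ i m) (U.phiZ D ħ (- -1) j a) := by
      rw [U.phiZ]
      split_ifs
      · exact U.h_mul_phi _ _ _ _ _
      · exact Commute.zero_right _
    have e2 : (π₂ (U.h D ħ i m) * if n - m - r = 0 then π₂ (U.x D ħ (-1) j r) else 0) -
        (if n - m - r = 0 then π₂ (U.x D ħ (-1) j r) else 0) * π₂ (U.h D ħ i m) =
        hxCoeff D ħ m (-1) i j • if n - m - r = 0 then π₂ (U.x D ħ (-1) j (m + r)) else 0 := by
      split_ifs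
      · exact hx _ _
      · simp
    have e3 (p : Prop) [Decidable p] : (π₁ (U.h D ħ i m) * if p then π₂ (U.x D ħ (-1) j r) else 0) -
        (if p then π₂ (U.x D ħ (-1) j r) else 0) * π₁ (U.h D ħ i m) = 0 := by
      split_ifs
      · rw [← (hc' _ _).eq, sub_self]
      · simp
    rw [mul_add (π₁ (U.h D ħ i m)), add_mul, mul_add (π₂ (U.h D ħ i m)), add_mul, add_sub_add_comm,
      add_sub_add_comm (π₂ (U.h D ħ i m) * _), e2, e3,
      key1 π₂ π₁ hc' _ (f1 _), key2 π₂ π₁ hc', add_zero, zero_add, smul_add, add_comm]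
    simp only [Units.val_neg, Units.val_one, neg_mul, one_mul, neg_neg]
    rw [show (m : ℤ) + -(-r + n) = -(-(m + r) + n) by ring,
      show n - m - r = n - (m + r) by ring]

theorem deltaH_deltaH (hc : ∀ a b, Commute (π₁ a) (π₂ b)) (i j : ι) (m m') :
    Commute (deltaH π₁ π₂ i m) (deltaH π₁ π₂ j m') := by
  have ht (f g : K) {a b : E} (h : Commute a b) : Commute (f ⊗ₜ[ℂ] a) (g ⊗ₜ[ℂ] b) := by
    rw [Commute, SemiconjBy, Algebra.TensorProduct.tmul_mul_tmul, Algebra.TensorProduct.tmul_mul_tmul,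
      h.eq, mul_comm]
  exact ((ht _ _ ((U.h_mul_h _ _ _ _).map π₁)).add_right (ht _ _ (hc _ _))).add_left
    ((ht _ _ (hc _ _).symm).add_right (ht _ _ ((U.h_mul_h _ _ _ _).map π₂)))

theorem deltaK_deltaH (hc : ∀ a b, Commute (π₁ a) (π₂ b)) (h : 𝔥) (j : ι) (m) :
    Commute (deltaK π₁ π₂ h) (deltaH π₁ π₂ j m) := by
  have ht (f g : K) {a b : E} (h : Commute a b) : Commute (f ⊗ₜ[ℂ] a) (g ⊗ₜ[ℂ] b) := by
    rw [Commute, SemiconjBy, Algebra.TensorProduct.tmul_mul_tmul, Algebra.TensorProduct.tmul_mul_tmul,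
      h.eq, mul_comm]
  exact (ht _ _ (((U.k_mul_h _ _ _).map π₁).mul_left (hc _ _).symm)).add_right
    (ht _ _ ((hc _ _).mul_left ((U.k_mul_h _ _ _).map π₂)))

theorem deltaFree_cartanCommute (hc : ∀ a b, Commute (π₁ a) (π₂ b)) :
    CartanCommute (deltaFree π₁ π₂) where
  k_h h i m := by
    rw [deltaFree_k, deltaFree_h]
    exact deltaK_deltaH hc h i m
  h_h i j m m' := by
    rw [deltaFree_h, deltaFree_h]
    exact deltaH_deltaH hc i j m m'

/-- The coproduct of `φ`. -/
theorem deltaFree_phi (hc : ∀ a b, Commute (π₁ a) (π₂ b)) (ε : ℤˣ) (i : ι) (m : ℕ) :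
    deltaFree π₁ π₂ (fphi D ħ ε i m) = ∑ p ∈ Finset.HasAntidiagonal.antidiagonal m,
      (RatFunc.X ^ ((ε : ℤ) * (p.2 : ℤ)) : K) ⊗ₜ[ℂ]
        (π₁ (U.phi D ħ ε i p.1) * π₂ (U.phi D ħ ε i p.2)) := by
  let c : ℂ := ((ε : ℤ) : ℂ) * (qPow ħ 1 - qPow ħ (-1))
  let F₁ : PowerSeries (K ⊗[ℂ] E) := PowerSeries.mk fun m => 1 ⊗ₜ π₁ (U.phi D ħ ε i m)
  let F₂ : PowerSeries (K ⊗[ℂ] E) := PowerSeries.mk fun m =>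
    (RatFunc.X ^ ((ε : ℤ) * (m : ℤ)) : K) ⊗ₜ π₂ (U.phi D ħ ε i m)
  let H : PowerSeries (U D ħ) := PowerSeries.map (U.mk D ħ : Free ι 𝔥 →+* U D ħ) (hSeries 𝔥 ε i)
  let H₁ : PowerSeries (K ⊗[ℂ] E) := PowerSeries.mk fun m => 1 ⊗ₜ π₁ (PowerSeries.coeff m H)
  let H₂ : PowerSeries (K ⊗[ℂ] E) := PowerSeries.mk fun m =>
    (RatFunc.X ^ ((ε : ℤ) * (m : ℤ)) : K) ⊗ₜ π₂ (PowerSeries.coeff m H)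
  have hH : ∀ m : ℕ, (m : ℂ) • U.phi D ħ ε i m = ∑ p ∈ Finset.HasAntidiagonal.antidiagonal m,
      (c * (p.1 : ℂ)) • (PowerSeries.coeff p.1 H * U.phi D ħ ε i p.2) := by
    intro m
    have := congrArg (PowerSeries.coeff m)
      ((U.cartanCommute (D := D) (ħ := ħ)).euler_phi (D := D) (ħ := ħ) ε i)
    rw [coeff_euler, PowerSeries.coeff_mk, PowerSeries.coeff_mul] at this
    refine this.trans (Finset.sum_congr rfl fun p _ => ?_)
    rw [PowerSeries.coeff_smul, coeff_euler, PowerSeries.coeff_mk, smul_smul, smul_mul_assoc]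
    rfl
  have e1 : euler F₁ = (c • euler H₁) * F₁ := by
    ext m
    rw [coeff_euler, PowerSeries.coeff_mul, PowerSeries.coeff_mk, ← tmul_smul, ← map_smul, hH, map_sum,
      tmul_sum]
    refine Finset.sum_congr rfl fun p _ => ?_
    rw [PowerSeries.coeff_smul, coeff_euler, PowerSeries.coeff_mk, PowerSeries.coeff_mk, smul_smul,
      smul_mul_assoc, Algebra.TensorProduct.tmul_mul_tmul, map_smul, map_mul, tmul_smul, one_mul]
  have e2 : euler F₂ = (c • euler H₂) * F₂ := by
    ext m
    rw [coeff_euler, PowerSeries.coeff_mul, PowerSeries.coeff_mk, ← tmul_smul, ← map_smul, hH, map_sum,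
      tmul_sum]
    refine Finset.sum_congr rfl fun p hp => ?_
    rw [PowerSeries.coeff_smul, coeff_euler, PowerSeries.coeff_mk, PowerSeries.coeff_mk, smul_smul,
      smul_mul_assoc, Algebra.TensorProduct.tmul_mul_tmul, map_smul, map_mul, tmul_smul,
      ← zpow_add₀ RatFunc.X_ne_zero, ← mul_add, ← Nat.cast_add,
      Finset.HasAntidiagonal.mem_antidiagonal.1 hp]
  have e3 : Commute F₁ (euler H₂) := by
    refine commute_of_coeff fun m n => ?_
    rw [coeff_euler]
    refine Commute.smul_right ?_ _
    rw [PowerSeries.coeff_mk, PowerSeries.coeff_mk, Commute, SemiconjBy,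
      Algebra.TensorProduct.tmul_mul_tmul, Algebra.TensorProduct.tmul_mul_tmul, (hc _ _).eq, mul_comm]
  have e4 : PowerSeries.map (deltaFree π₁ π₂ : Free ι 𝔥 →+* K ⊗[ℂ] E) (hSeries 𝔥 ε i) = H₁ + H₂ := by
    ext p
    rcases Nat.eq_zero_or_pos p with rfl | hp
    · rw [Free.coeff_zero_map_hSeries, map_add, PowerSeries.coeff_mk, PowerSeries.coeff_mk,
        Free.coeff_zero_map_hSeries]
      simp
    · have hp' : (ε : ℤ) * (p : ℤ) ≠ 0 := mul_ne_zero ε.ne_zero (by omega)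
      rw [Free.coeff_map_hSeries _ _ _ _ hp', map_add, PowerSeries.coeff_mk, PowerSeries.coeff_mk,
        Free.coeff_map_hSeries _ _ _ _ hp', deltaFree_h]
      rfl
  -- The exponential of `H₁ + H₂` is the product of the exponentials because `F₁` commutes with
  -- `H₂`; both sides solve the Euler equation with coefficient `H₁ + H₂` and the same constant
  -- term.
  have key : (PowerSeries.mk fun m => deltaFree π₁ π₂ (fphi D ħ ε i m)) = F₁ * F₂ := by
    refine eq_of_euler_eq (a := c • euler (H₁ + H₂)) (by simp [coeff_euler]) ?_ ?_ ?_
    · have := (deltaFree_cartanCommute (D := D) hc).euler_phi (D := D) (ħ := ħ) ε i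
      rwa [e4] at this
    · have : euler (H₁ + H₂) = euler H₁ + euler H₂ := by
        ext m
        simp only [coeff_euler, map_add, smul_add]
      rw [euler_mul, e1, e2, this, smul_add, add_mul, mul_assoc, ← mul_assoc F₁, mul_smul_comm, e3.eq]
      simp only [smul_mul_assoc, mul_assoc]
    · rw [PowerSeries.coeff_mk, Free.map_fphi_zero, deltaFree_k, PowerSeries.coeff_mul,
        Finset.Nat.antidiagonal_zero, Finset.sum_singleton, PowerSeries.coeff_mk, PowerSeries.coeff_mk,
        U.phi_zero]
      simp [deltaK]
  have := congrArg (PowerSeries.coeff m) key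
  rw [PowerSeries.coeff_mk, PowerSeries.coeff_mul] at this
  refine this.trans (Finset.sum_congr rfl fun p _ => ?_)
  rw [PowerSeries.coeff_mk, PowerSeries.coeff_mk, Algebra.TensorProduct.tmul_mul_tmul, one_mul]

/-- With the convention that `φ` vanishes outside its range of indices, the formula needs no
restriction on `m` and `n`. The proof only compares supports. -/
theorem expandCoeff_deltaFree_phiZ (hc : ∀ a b, Commute (π₁ a) (π₂ b)) (ε : ℤˣ) (i : ι) (m n : ℤ) :
    expandCoeff E n (deltaFree π₁ π₂ (fphiZ D ħ ε i m)) =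
      π₁ (U.phiZ D ħ ε i (m - n)) * π₂ (U.phiZ D ħ ε i n) := by
  rw [fphiZ]
  by_cases h : 0 ≤ (ε : ℤ) * m
  · rw [if_pos h, deltaFree_phi hc, map_sum]
    simp only [expandCoeff_zpow_tmul]
    by_cases h1 : 0 ≤ (ε : ℤ) * n ∧ (ε : ℤ) * n ≤ ε * m
    · have h2 : 0 ≤ (ε : ℤ) * (m - n) := by rw [mul_sub]; omega
      rw [Finset.sum_eq_single (((ε : ℤ) * (m - n)).toNat, ((ε : ℤ) * n).toNat)]
      · rw [U.phiZ, U.phiZ, if_pos h1.1, if_pos h2, if_pos]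
        rw [Int.toNat_of_nonneg h1.1, ← mul_assoc, units_coe_mul_coe, one_mul]
      · intro p hp hne
        refine if_neg fun hn => hne ?_
        have hp := Finset.HasAntidiagonal.mem_antidiagonal.1 hp
        have : (ε : ℤ) * n = p.2 := by rw [hn, ← mul_assoc, units_coe_mul_coe, one_mul]
        ext <;> simp only [mul_sub] <;> omega
      · intro hp
        exfalso
        apply hp
        rw [Finset.HasAntidiagonal.mem_antidiagonal]
        simp only [mul_sub] at *
        omega
    · rw [Finset.sum_eq_zero]
      · rw [U.phiZ, U.phiZ]
        by_cases h2 : 0 ≤ (ε : ℤ) * n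
        · rw [if_neg (c := 0 ≤ (ε : ℤ) * (m - n)) (by rw [mul_sub]; omega), map_zero, zero_mul]
        · rw [if_neg h2, map_zero, mul_zero]
      · intro p hp
        refine if_neg fun hn => h1 ?_
        have hp := Finset.HasAntidiagonal.mem_antidiagonal.1 hp
        have : (ε : ℤ) * n = p.2 := by rw [hn, ← mul_assoc, units_coe_mul_coe, one_mul]
        omega
  · rw [if_neg h, map_zero, map_zero, U.phiZ, U.phiZ]
    by_cases h2 : 0 ≤ (ε : ℤ) * n
    · rw [if_neg (c := 0 ≤ (ε : ℤ) * (m - n)) (by rw [mul_sub]; omega), map_zero, zero_mul]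
    · rw [if_neg h2, map_zero, mul_zero]

theorem sum_antidiagonal_assoc {M : Type*} [AddCommMonoid M] (N : ℕ) (f : ℕ → ℕ → ℕ → M) :
    ∑ p ∈ Finset.HasAntidiagonal.antidiagonal N,
      ∑ p' ∈ Finset.HasAntidiagonal.antidiagonal p.1, f p'.1 p'.2 p.2 =
    ∑ p ∈ Finset.HasAntidiagonal.antidiagonal N,
      ∑ p' ∈ Finset.HasAntidiagonal.antidiagonal p.2, f p'.1 p.1 p'.2 := by
  rw [Finset.sum_sigma', Finset.sum_sigma']
  refine Finset.sum_bij' (fun x _ => ⟨(x.2.2, x.2.1 + x.1.2), (x.2.1, x.1.2)⟩)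
    (fun x _ => ⟨(x.2.1 + x.1.1, x.2.2), (x.2.1, x.1.1)⟩) ?_ ?_ ?_ ?_ ?_ <;>
    rintro ⟨⟨a, b⟩, ⟨c, d⟩⟩ h <;>
    simp only [Finset.mem_sigma, Finset.HasAntidiagonal.mem_antidiagonal] at h ⊢ <;>
    obtain ⟨rfl, rfl⟩ := h <;> simp <;> omega

/-- In one order `φ^-` must pass `x^-` in the first factor, in the other `φ^+` must pass `x^+` in
the second. Both moves produce the same coefficients `gam`, and the two results are the same triple
sum summed in different orders. -/
theorem current_current [FiniteDimensional ℂ E] (hq : ∀ n : ℕ, n ≠ 0 → Complex.exp ħ ^ n ≠ 1)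
    (hc : ∀ a b, Commute (π₁ a) (π₂ b)) (i j : ι) (r s : ℤ) :
    Commute (current π₁ π₂ 1 i r) (current π₂ π₁ (-1) j s) := by
  apply expand_injective
  rw [map_mul, map_mul, expand_current hq hc, expand_current hq fun a b => (hc b a).symm, ← map_mul,
    ← map_mul]
  congr 1
  ext N
  rw [PowerSeries.coeff_mul, PowerSeries.coeff_mul]
  conv_rhs => rw [← Finset.Nat.sum_antidiagonal_swap]
  simp only [CurrentData.series, PowerSeries.coeff_mk, Prod.fst_swap, Prod.snd_swap]
  have e1 (p : ℕ × ℕ) : π₁ (U.phi D ħ (-1) i p.1) * π₂ (U.x D ħ 1 i ((1 : ℤˣ) * (r + p.1))) *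
        (π₂ (U.phi D ħ (- -1) j p.2) * π₁ (U.x D ħ (-1) j ((-1 : ℤˣ) * (s + p.2)))) =
      ∑ p' ∈ Finset.HasAntidiagonal.antidiagonal p.1, gam (kap D ħ 1 i j) p'.1 •
        (π₁ (U.x D ħ (-1) j (-s - p.2 - p'.1) * U.phi D ħ (-1) i p'.2) *
          π₂ (U.x D ħ 1 i (r + p'.2 + p'.1) * U.phi D ħ 1 j p.2)) := by
    rw [← (hc _ _).eq, (hc _ _).symm.mul_mul_mul_comm, ← map_mul, ← map_mul, U.phi_mul_x hq, map_sum,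
      Finset.sum_mul]
    refine Finset.sum_congr rfl fun p' hp' => ?_
    have hp' := Finset.HasAntidiagonal.mem_antidiagonal.1 hp'
    rw [map_smul, smul_mul_assoc]
    simp only [Units.val_neg, Units.val_one, neg_mul, one_mul, neg_neg]
    rw [show -(s + (p.2 : ℤ)) + -(p'.1 : ℤ) = -s - p.2 - p'.1 by ring,
      show r + (p.1 : ℤ) = r + p'.2 + p'.1 by omega]
  have e2 (p : ℕ × ℕ) :
      π₂ (U.phi D ħ (- -1) j p.2) * π₁ (U.x D ħ (-1) j ((-1 : ℤˣ) * (s + p.2))) *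
        (π₁ (U.phi D ħ (-1) i p.1) * π₂ (U.x D ħ 1 i ((1 : ℤˣ) * (r + p.1)))) =
      ∑ p' ∈ Finset.HasAntidiagonal.antidiagonal p.2, gam (kap D ħ 1 i j) p'.1 •
        (π₁ (U.x D ħ (-1) j (-s - p'.2 - p'.1) * U.phi D ħ (-1) i p.1) *
          π₂ (U.x D ħ 1 i (r + p.1 + p'.1) * U.phi D ħ 1 j p'.2)) := by
    rw [← (hc _ _).eq, (hc _ _).symm.mul_mul_mul_comm, ← map_mul, ← map_mul, U.phi_mul_x hq, map_sum,
      Finset.mul_sum]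
    refine Finset.sum_congr rfl fun p' hp' => ?_
    have hp' := Finset.HasAntidiagonal.mem_antidiagonal.1 hp'
    rw [map_smul, mul_smul_comm, kap_symm D ħ]
    simp only [Units.val_neg, Units.val_one, neg_mul, one_mul, neg_neg, mul_one]
    rw [show -(s + (p.2 : ℤ)) = -s - p'.2 - p'.1 by omega]
  refine (Finset.sum_congr rfl fun p _ => e1 p).trans
    (Eq.trans ?_ (Finset.sum_congr rfl fun p _ => (e2 p).symm))
  exact sum_antidiagonal_assoc N fun b a t => gam (kap D ħ 1 i j) b •
        (π₁ (U.x D ħ (-1) j (-s - t - b) * U.phi D ħ (-1) i a) *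
          π₂ (U.x D ħ 1 i (r + a + b) * U.phi D ħ 1 j t))

/-- The coefficients of the commutator of `x^+` and `x^-`. -/
theorem expandCoeff_deltaX_commutator [FiniteDimensional ℂ E]
    (hq : ∀ n : ℕ, n ≠ 0 → Complex.exp ħ ^ n ≠ 1)
    (hc : ∀ a b, Commute (π₁ a) (π₂ b)) (i j : ι) (r s n : ℤ) :
    expandCoeff E n (deltaX π₁ π₂ 1 i r * deltaX π₁ π₂ (-1) j s -
      deltaX π₁ π₂ (-1) j s * deltaX π₁ π₂ 1 i r) =
    π₁ (U.x D ħ 1 i r * U.x D ħ (-1) j (s - n) - U.x D ħ (-1) j (s - n) * U.x D ħ 1 i r) *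
        π₂ (U.phiZ D ħ 1 j n) +
      π₁ (U.phiZ D ħ (-1) i (r + s - n)) *
        π₂ (U.x D ħ 1 i (n - s) * U.x D ħ (-1) j s - U.x D ħ (-1) j s * U.x D ħ 1 i (n - s)) := by
  have hc' : ∀ a b, Commute (π₂ a) (π₁ b) := fun a b => (hc b a).symm
  have h1 : deltaX π₁ π₂ 1 i r * deltaX π₁ π₂ (-1) j s -
      deltaX π₁ π₂ (-1) j s * deltaX π₁ π₂ 1 i r =
      ((1 ⊗ₜ π₁ (U.x D ħ 1 i r)) * current π₂ π₁ (-1) j (-s) -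
        current π₂ π₁ (-1) j (-s) * (1 ⊗ₜ π₁ (U.x D ħ 1 i r))) +
      (RatFunc.X ^ (r + s) : K) • (current π₁ π₂ 1 i r * (1 ⊗ₜ π₂ (U.x D ħ (-1) j s)) -
        (1 ⊗ₜ π₂ (U.x D ħ (-1) j s)) * current π₁ π₂ 1 i r) := by
    have h2 : Commute ((1 : K) ⊗ₜ[ℂ] π₁ (U.x D ħ 1 i r)) (1 ⊗ₜ π₂ (U.x D ħ (-1) j s)) := by
      rw [Commute, SemiconjBy, Algebra.TensorProduct.tmul_mul_tmul,
        Algebra.TensorProduct.tmul_mul_tmul, (hc _ _).eq]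
    rw [deltaX_one, deltaX_neg_one]
    simp only [add_mul, mul_add, smul_mul_assoc, mul_smul_comm, h2.eq,
      (current_current hq hc i j r (-s)).eq, zpow_add₀ (RatFunc.X_ne_zero (K := ℂ)), smul_sub, mul_smul, smul_add]
    rw [smul_comm (RatFunc.X ^ s : K) (RatFunc.X ^ r : K)]
    abel
  rw [h1, map_add, expandCoeff_zpow_smul, map_sub, map_sub, expandCoeff_one_tmul_mul,
    expandCoeff_one_tmul_mul, expandCoeff_mul_one_tmul, expandCoeff_mul_one_tmul,
    expandCoeff_current' hq hc, expandCoeff_current' hq hc']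
  simp only [Units.val_neg, Units.val_one, neg_mul, one_mul, neg_neg]
  rw [show -(-s + n) = s - n by ring, show -(n - (r + s)) = r + s - n by ring,
    show r + (n - (r + s)) = n - s by ring, map_sub, map_sub, sub_mul, mul_sub, map_mul, map_mul,
    map_mul, map_mul]
  congr 1
  · rw [(hc' _ _).eq, mul_assoc (π₁ _) (π₂ _) (π₁ _), (hc' _ _).eq]
    simp only [mul_assoc]
  · rw [← mul_assoc (π₂ _) (π₁ _) (π₂ _), (hc' _ _).eq]
    simp only [mul_assoc]

/-- The coefficient telescopes: the first term gives `(φ^+ - φ^-) ⊗ φ^+`, the second `φ^- ⊗ (φ^+ -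
φ^-)`, and the terms `φ^- ⊗ φ^+` cancel. -/
theorem deltaX_x_x_same [FiniteDimensional ℂ E] (hq : ∀ n : ℕ, n ≠ 0 → Complex.exp ħ ^ n ≠ 1)
    (hc : ∀ a b, Commute (π₁ a) (π₂ b)) (i : ι) (r s : ℤ) :
    deltaX π₁ π₂ 1 i r * deltaX π₁ π₂ (-1) i s - deltaX π₁ π₂ (-1) i s * deltaX π₁ π₂ 1 i r =
      (1 / (qPow ħ (D.r i : ℚ) - qPow ħ (-(D.r i : ℚ)))) •
        deltaFree π₁ π₂ (fphiZ D ħ 1 i (r + s) - fphiZ D ħ (-1) i (r + s)) := by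
  apply expandCoeff_ext
  intro n
  rw [expandCoeff_deltaX_commutator hq hc, U.x_x_same, U.x_x_same, map_smul (expandCoeff E n),
    map_sub (deltaFree π₁ π₂), map_sub (expandCoeff E n), expandCoeff_deltaFree_phiZ hc, expandCoeff_deltaFree_phiZ hc, map_smul, map_smul, map_sub,
    map_sub, smul_mul_assoc, mul_smul_comm, ← smul_add, sub_mul, mul_sub, show r + (s - n) = r + s - n by ring,
    show n - s + s = n by ring, sub_add_sub_cancel]

theorem deltaX_x_x_ne [FiniteDimensional ℂ E] (hq : ∀ n : ℕ, n ≠ 0 → Complex.exp ħ ^ n ≠ 1)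
    (hc : ∀ a b, Commute (π₁ a) (π₂ b)) {i j : ι} (hij : i ≠ j) (r s : ℤ) :
    Commute (deltaX π₁ π₂ 1 i r) (deltaX π₁ π₂ (-1) j s) := by
  refine sub_eq_zero.1 (expandCoeff_eq_zero fun n => ?_)
  rw [expandCoeff_deltaX_commutator hq hc, U.x_x_ne hij, U.x_x_ne hij, sub_self, sub_self, map_zero,
    map_zero, zero_mul, mul_zero, add_zero]

end Coproduct

end QAff

namespace QAff

/-! ### The affine quantum Serre relations -/

section LowestWeight

/-- Elements of distinct weights in a finite dimensional algebra: almost all of them vanish. -/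
theorem finite_setOf_ne_zero {F R κ : Type*} [Field F] [Ring R] [Algebra F R] [FiniteDimensional F R]
    {k k' : R} (hk : k * k' = 1) (y : κ → R) (c : κ → F) (hc : Function.Injective c)
    (hy : ∀ m, k * y m = c m • (y m * k)) : {m | y m ≠ 0}.Finite := by
  let A : Module.End F R := LinearMap.mulLeft F k * LinearMap.mulRight F k'
  have h : LinearIndependent F fun m : {m : κ // y m ≠ 0} => y m.1 := by
    refine Module.End.eigenvectors_linearIndependent' A (fun m : {m : κ // y m ≠ 0} => c m.1)
      (hc.comp Subtype.val_injective) _ fun m => ⟨Module.End.mem_eigenspace_iff.2 ?_, m.2⟩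
    change k * (y m * k') = c m • y m
    rw [← mul_assoc, hy, smul_mul_assoc, mul_assoc, hk, mul_one]
  exact Set.finite_coe_iff.1 h.finite

variable {R : Type*} [Ring R] [Algebra ℂ R]

/-- Iterated `q`-commutators. -/
noncomputable def qCommutator (q : ℂ) (n : ℕ) (e y : R) : ℕ → R
  | 0 => y
  | m + 1 => e * qCommutator q n e y m -
      q ^ (2 * (m : ℤ) - n) • (qCommutator q n e y m * e)

/-- The structure constants of the `sl_2`-module generated by a lowest weight vector. -/
noncomputable def lowestCoeff (q : ℂ) (n m : ℕ) : ℂ :=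
  -((q ^ (m : ℤ) - q ^ (-(m : ℤ))) * (q ^ ((n : ℤ) + 1 - m) - q ^ (-((n : ℤ) + 1 - m)))) /
    (q - q⁻¹) ^ 2

theorem lowestCoeff_succ {q : ℂ} (h0 : q ≠ 0) (hd : q - q⁻¹ ≠ 0) (n m : ℕ) :
    lowestCoeff q n (m + 1) = lowestCoeff q n m +
      (q - q⁻¹)⁻¹ * (q ^ (2 * (m : ℤ) - n) - (q ^ (2 * (m : ℤ) - n))⁻¹) := by
  have e1 : q ^ (2 * (m : ℤ) - n) = (q ^ (m : ℤ)) ^ 2 * (q ^ (n : ℤ))⁻¹ := by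
    rw [zpow_sub₀ h0, mul_comm 2, zpow_mul]
    norm_cast
  have e2 : q ^ ((n : ℤ) + 1 - m) = q ^ (n : ℤ) * q * (q ^ (m : ℤ))⁻¹ := by
    rw [zpow_sub₀ h0, zpow_add₀ h0, zpow_one]
    rfl
  have e3 : q ^ ((n : ℤ) + 1 - (m + 1 : ℕ)) = q ^ (n : ℤ) * (q ^ (m : ℤ))⁻¹ := by
    rw [show (n : ℤ) + 1 - (m + 1 : ℕ) = n - m by push_cast; ring, zpow_sub₀ h0]
    rfl
  have e4 : q ^ (((m + 1 : ℕ)) : ℤ) = q ^ (m : ℤ) * q := by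
    rw [Nat.cast_succ, zpow_add₀ h0, zpow_one]
  have hm : q ^ (m : ℤ) ≠ 0 := zpow_ne_zero _ h0
  have hn : q ^ (n : ℤ) ≠ 0 := zpow_ne_zero _ h0
  rw [lowestCoeff, lowestCoeff, zpow_neg, zpow_neg, zpow_neg, zpow_neg, e1, e2, e3, e4]
  have hd' : q ^ 2 - 1 ≠ 0 := by
    intro h
    apply hd
    field_simp
    linear_combination h
  rw [show q - q⁻¹ = (q ^ 2 - 1) / q by field_simp]
  generalize q ^ (m : ℤ) = a at *
  generalize q ^ (n : ℤ) = b at *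
  field_simp
  ring

theorem lowestCoeff_ne_zero {q : ℂ} (h0 : q ≠ 0) (hq : ∀ a : ℤ, q ^ a = 1 → a = 0) {n m : ℕ}
    (hm : m ≠ 0) (hmn : m ≠ n + 1) : lowestCoeff q n m ≠ 0 := by
  have key (a : ℤ) (ha : a ≠ 0) : q ^ a - q ^ (-a) ≠ 0 := by
    intro h
    have h1 : q ^ (a + a) = 1 := by
      rw [zpow_add₀ h0]
      nth_rewrite 2 [sub_eq_zero.1 h]
      rw [← zpow_add₀ h0, add_neg_cancel, zpow_zero]
    have := hq _ h1
    omega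
  have h1 := key 1 one_ne_zero
  rw [zpow_one, zpow_neg, zpow_one] at h1
  exact div_ne_zero (neg_ne_zero.2 (mul_ne_zero (key _ (by omega)) (key _ (by omega))))
    (pow_ne_zero _ h1)

/-- Gaussian binomial coefficients. -/
noncomputable def gaussBinom (q : ℂ) : ℕ → ℕ → ℂ
  | _, 0 => 1
  | 0, _ + 1 => 0
  | m + 1, k + 1 => q ^ (-((k : ℤ) + 1)) * gaussBinom q m (k + 1) + q ^ ((m : ℤ) - k) * gaussBinom q m k

theorem gaussBinom_zero_right (q : ℂ) (m : ℕ) : gaussBinom q m 0 = 1 := by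
  cases m <;> rfl

theorem gaussBinom_eq_zero (q : ℂ) {m k : ℕ} (h : m < k) : gaussBinom q m k = 0 := by
  induction m generalizing k with
  | zero =>
    obtain ⟨k, rfl⟩ := Nat.exists_eq_succ_of_ne_zero h.ne'
    rfl
  | succ m ih =>
    obtain ⟨k, rfl⟩ := Nat.exists_eq_succ_of_ne_zero (n := k) (by omega)
    rw [Nat.succ_eq_add_one, gaussBinom, ih (by omega), ih (by omega), mul_zero, mul_zero, add_zero]

/-- The `q`-binomial theorem for commuting left and right multiplications. The extra power of `q`
has exponent zero for all `k` when `m = n + 1`, which is the Serre case. -/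
theorem qCommutator_eq_sum {q : ℂ} (h0 : q ≠ 0) (n : ℕ) (e y : R) (m : ℕ) :
    qCommutator q n e y m = ∑ k ∈ Finset.range (m + 1),
      ((-1) ^ k * q ^ ((k : ℤ) * (m - 1 - n)) * gaussBinom q m k) • (e ^ (m - k) * y * e ^ k) := by
  induction m with
  | zero => simp [qCommutator, gaussBinom]
  | succ m ih =>
    have h1 : ∑ k ∈ Finset.range (m + 1),
        ((-1) ^ k * q ^ ((k : ℤ) * (m - 1 - n)) * gaussBinom q m k) • (e ^ (m - k) * y * e ^ k) =
        ∑ k ∈ Finset.range (m + 1), ((-1) ^ (k + 1) * q ^ (((k + 1 : ℕ) : ℤ) * (m - 1 - n)) *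
          gaussBinom q m (k + 1)) • (e ^ (m - (k + 1)) * y * e ^ (k + 1)) + e ^ m * y := by
      rw [Finset.sum_range_succ', Finset.sum_range_succ _ m, gaussBinom_eq_zero q (Nat.lt_succ_self m)]
      simp [gaussBinom_zero_right]
    rw [qCommutator]
    nth_rewrite 1 [ih]
    rw [h1, ih, Finset.sum_range_succ' _ (m + 1), mul_add, Finset.mul_sum, Finset.sum_mul, Finset.smul_sum, add_sub_right_comm,
      ← Finset.sum_sub_distrib]
    congr 1
    · refine Finset.sum_congr rfl fun k hk => ?_
      have hkm : k ≤ m := Nat.lt_succ_iff.1 (Finset.mem_range.1 hk)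
      have e1 : q ^ (((k + 1 : ℕ) : ℤ) * ((m + 1 : ℕ) - 1 - n)) =
          q ^ ((k : ℤ) + 1) * q ^ (((k + 1 : ℕ) : ℤ) * (m - 1 - n)) := by
        rw [← zpow_add₀ h0]
        congr 1
        push_cast
        ring
      have e2 : q ^ (2 * (m : ℤ) - n) * q ^ ((k : ℤ) * (m - 1 - n)) =
          q ^ ((k : ℤ) + 1) * q ^ (((k + 1 : ℕ) : ℤ) * (m - 1 - n)) * q ^ ((m : ℤ) - k) := by
        rw [← zpow_add₀ h0, ← zpow_add₀ h0, ← zpow_add₀ h0]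
        congr 1
        push_cast
        ring
      rw [smul_mul_assoc, smul_smul, mul_assoc _ (e ^ k) e, ← pow_succ, gaussBinom, e1, zpow_neg,
        show m + 1 - (k + 1) = m - k by omega, mul_smul_comm, mul_assoc ((-1) ^ k : ℂ),
        mul_left_comm (q ^ (2 * (m : ℤ) - n)), ← mul_assoc (q ^ (2 * (m : ℤ) - n)), e2]
      have h3 : gaussBinom q m (k + 1) • (e * (e ^ (m - (k + 1)) * y * e ^ (k + 1))) =
          gaussBinom q m (k + 1) • (e ^ (m - k) * y * e ^ (k + 1)) := by
        rcases hkm.eq_or_lt with rfl | h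
        · rw [gaussBinom_eq_zero q (Nat.lt_succ_self _), zero_smul, zero_smul]
        · rw [← mul_assoc, ← mul_assoc, ← pow_succ', show m - (k + 1) + 1 = m - k by omega]
      rw [mul_smul, h3, ← mul_smul, ← sub_smul]
      congr 1
      have : q ^ ((k : ℤ) + 1) ≠ 0 := zpow_ne_zero _ h0
      field_simp
      ring
    · simp [gaussBinom_zero_right, pow_succ', mul_assoc]

theorem k_mul_qCommutator {q : ℂ} (h0 : q ≠ 0) {n : ℕ} {e k y : R}
    (hke : k * e = q ^ (2 : ℤ) • (e * k)) (hky : k * y = q ^ (-(n : ℤ)) • (y * k)) (m : ℕ) :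
    k * qCommutator q n e y m = q ^ (2 * (m : ℤ) - n) • (qCommutator q n e y m * k) := by
  induction m with
  | zero => simpa [qCommutator] using hky
  | succ m ih =>
    have e1 : q ^ (2 * ((m + 1 : ℕ) : ℤ) - n) = q ^ (2 : ℤ) * q ^ (2 * (m : ℤ) - n) := by
      rw [← zpow_add₀ h0]
      congr 1
      push_cast
      ring
    rw [qCommutator, e1]
    generalize q ^ (2 * (m : ℤ) - n) = t at *
    generalize q ^ (2 : ℤ) = s at *
    generalize qCommutator q n e y m = y' at *
    have h1 : k * (e * y') = (s * t) • (e * (y' * k)) := by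
      rw [← mul_assoc, hke, smul_mul_assoc, mul_assoc, ih, mul_smul_comm, smul_smul]
    have h2 : k * (y' * e) = (s * t) • (y' * (e * k)) := by
      rw [← mul_assoc, ih, smul_mul_assoc, mul_assoc, hke, mul_smul_comm, smul_smul, mul_comm]
    rw [mul_sub, mul_smul_comm, h1, h2, sub_mul, smul_mul_assoc, smul_sub, smul_comm t, mul_assoc,
      mul_assoc]

/-- The lowering operator applied to the `(m+1)`-st vector above a lowest weight vector. Passing `f`
through one more `e` adds the weight term given by `lowestCoeff_succ`. -/
theorem qCommutator_succ_commutator {q : ℂ} (h0 : q ≠ 0) (hd : q - q⁻¹ ≠ 0) {n : ℕ}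
    {e f k k' y : R} (hk : k * k' = 1) (hk' : k' * k = 1)
    (hke : k * e = q ^ (2 : ℤ) • (e * k)) (hef : e * f - f * e = (q - q⁻¹)⁻¹ • (k - k'))
    (hky : k * y = q ^ (-(n : ℤ)) • (y * k)) (hfy : y * f = f * y) (m : ℕ) :
    qCommutator q n e y (m + 1) * f - f * qCommutator q n e y (m + 1) =
      lowestCoeff q n (m + 1) • (qCommutator q n e y m * k') := by
  have inv {t : ℂ} (ht : t ≠ 0) {z : R} (hz : k * z = t • (z * k)) : k' * z = t⁻¹ • (z * k') := by
    have : z * k' = t • (k' * z) := by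
      calc z * k' = k' * (k * z) * k' := by rw [← mul_assoc, hk', one_mul]
        _ = t • (k' * z * (k * k')) := by
          rw [hz, mul_smul_comm, smul_mul_assoc, mul_assoc, mul_assoc, mul_assoc]
        _ = t • (k' * z) := by rw [hk, mul_one]
    rw [this, smul_smul, inv_mul_cancel₀ ht, one_smul]
  have key (m : ℕ) (a : R) (ha : qCommutator q n e y m * f - f * qCommutator q n e y m = a)
      (ha' : e * a - q ^ (2 * (m : ℤ) - n) • (a * e) =
        lowestCoeff q n m • (qCommutator q n e y m * k')) :
      qCommutator q n e y (m + 1) * f - f * qCommutator q n e y (m + 1) =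
        lowestCoeff q n (m + 1) • (qCommutator q n e y m * k') := by
    have hy := k_mul_qCommutator h0 hke hky m
    have hy' := inv (zpow_ne_zero _ h0) hy
    rw [lowestCoeff_succ h0 hd, add_smul, ← ha', qCommutator]
    have ht : q ^ (2 * (m : ℤ) - n) ≠ 0 := zpow_ne_zero _ h0
    generalize q ^ (2 * (m : ℤ) - n) = t at *
    generalize qCommutator q n e y m = y' at *
    have : (e * y' - t • (y' * e)) * f - f * (e * y' - t • (y' * e)) =
        (e * a - t • (a * e)) + ((e * f - f * e) * y' - t • (y' * (e * f - f * e))) := by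
      rw [← ha]
      simp only [mul_sub, sub_mul, mul_smul_comm, smul_mul_assoc, smul_sub, mul_assoc]
      abel
    rw [this, hef, smul_mul_assoc, mul_smul_comm, sub_mul, hy, hy', mul_sub]
    module
  induction m with
  | zero =>
    -- `y` commutes with `f`, and `lowestCoeff q n 0 = 0`.
    refine key 0 0 (by simp [qCommutator, hfy]) ?_
    simp [lowestCoeff]
  | succ m ih =>
    refine key (m + 1) _ ih ?_
    have hke' := inv (zpow_ne_zero _ h0) hke
    rw [mul_smul_comm, smul_mul_assoc, smul_comm _ (lowestCoeff q n (m + 1)), ← smul_sub, mul_assoc,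
      hke', mul_smul_comm, smul_smul, qCommutator, sub_mul, smul_mul_assoc, ← mul_assoc, ← mul_assoc,
      ← zpow_neg, ← zpow_add₀ h0,
      show 2 * ((m + 1 : ℕ) : ℤ) - n + -2 = 2 * m - n by push_cast; ring]

/-- The iterated `q`-commutators have distinct weights in a finite dimensional algebra, so some of
them vanish. If the first vanishing one had positive index other than `n + 1`, lowering it with `f`
would show that its predecessor vanishes too. -/
theorem qCommutator_eq_zero {F : Type*} [Field F] [Algebra ℂ F] [Algebra F R] [IsScalarTower ℂ F R]
    [FiniteDimensional F R] {q : ℂ} (h0 : q ≠ 0) (hq : ∀ a : ℤ, q ^ a = 1 → a = 0) {n : ℕ}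
    {e f k k' y : R} (hk : k * k' = 1) (hk' : k' * k = 1)
    (hke : k * e = q ^ (2 : ℤ) • (e * k)) (hef : e * f - f * e = (q - q⁻¹)⁻¹ • (k - k'))
    (hky : k * y = q ^ (-(n : ℤ)) • (y * k)) (hfy : y * f = f * y) :
    qCommutator q n e y (n + 1) = 0 := by
  have hd : q - q⁻¹ ≠ 0 := by
    intro h
    have : q ^ (2 : ℤ) = 1 := by
      rw [zpow_ofNat, pow_two]
      nth_rewrite 1 [sub_eq_zero.1 h]
      exact inv_mul_cancel₀ h0
    have := hq 2 this
    omega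
  -- The weights `q ^ (2 m - n)` are pairwise distinct, as `q` is not a root of unity.
  have hfin := finite_setOf_ne_zero (F := F) hk (qCommutator q n e y)
    (fun m => algebraMap ℂ F (q ^ (2 * (m : ℤ) - n))) (fun a b hab => by
      have h1 : q ^ (2 * (a : ℤ) - n) = q ^ (2 * (b : ℤ) - n) := (algebraMap ℂ F).injective hab
      have h2 : q ^ (2 * (a : ℤ) - n - (2 * (b : ℤ) - n)) = 1 := by
        rw [zpow_sub₀ h0, h1, div_self (zpow_ne_zero _ h0)]
      have := hq _ h2
      omega) fun m => by
      rw [algebraMap_smul]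
      exact k_mul_qCommutator h0 hke hky m
  have hex : ∃ N, qCommutator q n e y N = 0 := by
    obtain ⟨N, hN⟩ := hfin.exists_notMem
    exact ⟨N, by simpa using hN⟩
  classical
  have hmono {a b : ℕ} (hab : a ≤ b) (ha : qCommutator q n e y a = 0) :
      qCommutator q n e y b = 0 := by
    induction b, hab using Nat.le_induction with
    | base => exact ha
    | succ b _ ih => rw [qCommutator, ih, mul_zero, zero_mul, smul_zero, sub_zero]
  let M := Nat.find hex
  have hM : qCommutator q n e y M = 0 := Nat.find_spec hex
  rcases hM' : M with _ | a
  · exact hmono (Nat.zero_le _) (hM' ▸ hM)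
  · by_cases ha : a + 1 = n + 1
    · rw [← ha, ← hM']
      exact hM
    · exfalso
      have h1 := qCommutator_succ_commutator h0 hd hk hk' hke hef hky hfy a
      rw [← hM', hM, zero_mul, mul_zero, sub_zero] at h1
      have h2 := (smul_eq_zero.1 h1.symm).resolve_left
        (hM' ▸ lowestCoeff_ne_zero h0 hq (Nat.succ_ne_zero a) ha)
      refine Nat.find_min hex (m := a) (by change a < M; omega) ?_
      rw [← mul_one (qCommutator q n e y a), ← hk', ← mul_assoc, h2, zero_mul]

/-- The Serre relation for a lowest weight vector of the adjoint action of `U_q(sl_2)`. -/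
theorem sum_gaussBinom_eq_zero {F : Type*} [Field F] [Algebra ℂ F] [Algebra F R] [IsScalarTower ℂ F R]
    [FiniteDimensional F R] {q : ℂ} (h0 : q ≠ 0) (hq : ∀ a : ℤ, q ^ a = 1 → a = 0) {n : ℕ}
    {e f k k' y : R} (hk : k * k' = 1) (hk' : k' * k = 1)
    (hke : k * e = q ^ (2 : ℤ) • (e * k)) (hef : e * f - f * e = (q - q⁻¹)⁻¹ • (k - k'))
    (hky : k * y = q ^ (-(n : ℤ)) • (y * k)) (hfy : y * f = f * y) :
    ∑ a ∈ Finset.range (n + 2),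
      ((-1) ^ a * gaussBinom q (n + 1) a) • (e ^ (n + 1 - a) * y * e ^ a) = 0 := by
  rw [← qCommutator_eq_zero (F := F) h0 hq hk hk' hke hef hky hfy, qCommutator_eq_sum h0]
  refine Finset.sum_congr rfl fun a _ => ?_
  rw [show (a : ℤ) * ((n + 1 : ℕ) - 1 - n) = 0 by push_cast; ring, zpow_zero, mul_one]

end LowestWeight

/-! ### Gaussian binomials and the Serre relation in degree zero -/

section Binomial

variable {ħ : ℂ} (hq : ∀ n : ℕ, n ≠ 0 → Complex.exp ħ ^ n ≠ 1)

theorem qPow_intCast (ħ : ℂ) (n : ℤ) : qPow ħ n = qPow ħ 1 ^ n := by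
  rw [qPow, qPow, ← Complex.exp_int_mul]
  congr 1
  push_cast
  ring

theorem qInt_eq (ħ : ℂ) (n : ℤ) :
    qInt ħ n = (qPow ħ 1 ^ n - qPow ħ 1 ^ (-n)) / (qPow ħ 1 - (qPow ħ 1)⁻¹) := by
  rw [qInt, qPow_neg 1, ← qPow_intCast, ← qPow_intCast]
  push_cast
  rfl

theorem qFact_succ (ħ : ℂ) (n : ℕ) : qFact ħ (n + 1) = qFact ħ n * qInt ħ (n + 1) :=
  Finset.prod_range_succ _ _

theorem qFact_ne_zero (hq : ∀ n : ℕ, n ≠ 0 → Complex.exp ħ ^ n ≠ 1) (n : ℕ) : qFact ħ n ≠ 0 :=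
  Finset.prod_ne_zero_iff.2 fun a _ => qInt_ne_zero hq (by omega)

theorem gaussBinom_mul (ħ : ℂ) {m k : ℕ} (h : k ≤ m) :
    gaussBinom (qPow ħ 1) m k * (qFact ħ k * qFact ħ (m - k)) = qFact ħ m := by
  have h0 : qPow ħ 1 ≠ 0 := qPow_ne_zero 1
  induction m generalizing k with
  | zero =>
    obtain rfl : k = 0 := by omega
    simp [gaussBinom, qFact]
  | succ m ih =>
    rcases k with _ | k
    · simp [gaussBinom, qFact]
    · have key : qPow ħ 1 ^ (-((k : ℤ) + 1)) * qInt ħ ((m : ℤ) - k) +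
          qPow ħ 1 ^ ((m : ℤ) - k) * qInt ħ (k + 1) = qInt ħ (m + 1) := by
        rw [qInt_eq, qInt_eq, qInt_eq, mul_div_assoc', mul_div_assoc', ← add_div, mul_sub, mul_sub,
          ← zpow_add₀ h0, ← zpow_add₀ h0, ← zpow_add₀ h0, ← zpow_add₀ h0]
        congr 1
        ring_nf
      have hk : k ≤ m := by omega
      rw [gaussBinom, qFact_succ ħ m, show m + 1 - (k + 1) = m - k by omega]
      rcases hk.eq_or_lt with rfl | h'
      -- The extreme case `k = m`, where one of the two Pascal terms is absent.
      · rw [gaussBinom_eq_zero _ (Nat.lt_succ_self k), qFact_succ]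
        have := ih le_rfl
        rw [sub_self, zpow_zero, mul_zero, zero_add, one_mul, mul_right_comm, ← mul_assoc]
        linear_combination qInt ħ (k + 1) * this
      · have e1 := ih hk
        have e2 := ih (k := k + 1) h'
        obtain ⟨d, rfl⟩ : ∃ d, m = k + 1 + d := ⟨m - (k + 1), by omega⟩
        rw [show k + 1 + d - k = d + 1 by omega, qFact_succ] at *
        rw [show k + 1 + d - (k + 1) = d by omega] at e2
        rw [← key]
        have e3 : ((k + 1 + d : ℕ) : ℤ) - k = (d : ℤ) + 1 := by push_cast; ring
        rw [e3]
        rw [qFact_succ ħ d]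
        linear_combination (qPow ħ 1 ^ ((d : ℤ) + 1)) * qInt ħ (k + 1) * e1 +
          qPow ħ 1 ^ (-((k : ℤ) + 1)) * qInt ħ ((d : ℤ) + 1) * e2

theorem gaussBinom_eq_qBinom (hq : ∀ n : ℕ, n ≠ 0 → Complex.exp ħ ^ n ≠ 1) {m k : ℕ} (h : k ≤ m) :
    gaussBinom (qPow ħ 1) m k = qBinom ħ m k :=
  eq_div_of_mul_eq (mul_ne_zero (qFact_ne_zero hq _) (qFact_ne_zero hq _)) (gaussBinom_mul ħ h)

theorem qBinom_symm (ħ : ℂ) {m k : ℕ} (h : k ≤ m) : qBinom ħ m (m - k) = qBinom ħ m k := by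
  rw [qBinom, qBinom, Nat.sub_sub_self h, mul_comm (qFact ħ k)]

theorem sum_qBinom_eq_zero {R F : Type*} [Ring R] [Algebra ℂ R] [Field F] [Algebra ℂ F] [Algebra F R]
    [IsScalarTower ℂ F R] [FiniteDimensional F R] (hq : ∀ n : ℕ, n ≠ 0 → Complex.exp ħ ^ n ≠ 1) {n : ℕ}
    {e f k k' y : R} (hk : k * k' = 1) (hk' : k' * k = 1)
    (hke : k * e = qPow ħ 2 • (e * k))
    (hef : e * f - f * e = (qPow ħ 1 - qPow ħ (-1))⁻¹ • (k - k'))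
    (hky : k * y = qPow ħ (-n) • (y * k)) (hfy : y * f = f * y) :
    ∑ a ∈ Finset.range (n + 2),
      ((-1) ^ a * qBinom ħ (n + 1) a) • (e ^ a * y * e ^ (n + 1 - a)) = 0 := by
  have h := sum_gaussBinom_eq_zero (F := F) (q := qPow ħ 1) (n := n) (qPow_ne_zero 1)
    (fun a ha => by
      rw [← qPow_intCast] at ha
      exact_mod_cast qPow_eq_one hq ha) hk hk'
    (by rw [← qPow_intCast]; exact_mod_cast hke) (by rw [← qPow_neg]; exact hef)
    (by rw [← qPow_intCast]; push_cast; exact hky) hfy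
  -- The sum obtained has powers `e ^ (n + 1 - a)` on the left; reversing it costs a global sign and
  -- uses the symmetry of the binomials.
  rw [← Finset.sum_range_reflect] at h
  have h2 : ∑ a ∈ Finset.range (n + 2),
      ((-1) ^ a * qBinom ħ (n + 1) a) • (e ^ a * y * e ^ (n + 1 - a)) = (-1 : ℂ) ^ (n + 1) •
      ∑ a ∈ Finset.range (n + 2), ((-1) ^ (n + 2 - 1 - a) *
        gaussBinom (qPow ħ 1) (n + 1) (n + 2 - 1 - a)) •
          (e ^ (n + 1 - (n + 2 - 1 - a)) * y * e ^ (n + 2 - 1 - a)) := by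
    rw [Finset.smul_sum]
    refine Finset.sum_congr rfl fun a ha => ?_
    have ha : a ≤ n + 1 := by
      have := Finset.mem_range.1 ha
      omega
    rw [show n + 2 - 1 - a = n + 1 - a by omega, gaussBinom_eq_qBinom hq (Nat.sub_le _ _),
      qBinom_symm ħ ha, Nat.sub_sub_self ha, smul_smul, ← mul_assoc, ← pow_add]
    congr 2
    rw [show n + 1 + (n + 1 - a) = a + 2 * (n + 1 - a) by omega, pow_add, pow_mul]
    simp
  rw [h2, h, smul_zero]

end Binomial

end QAff

namespace QAff

/-! ### The deformed coproduct as an algebra map -/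

/-! ### Propagation of the Serre relation from degree zero to all degrees -/

section SerreDescent

variable {R : Type*} [Ring R] [Algebra ℂ R]

/-- The product of a list with `z` inserted at position `k`. -/
def insertProd (k : ℕ) (L : List R) (z : R) : R := (L.take k).prod * z * (L.drop k).prod

theorem mul_sub_mul_mul (h a b : R) :
    h * (a * b) - a * b * h = (h * a - a * h) * b + a * (h * b - b * h) := by
  noncomm_ring

theorem prod_ofFn_commutator {h : R} {a : ℤ → R} {α : ℂ} {p : ℤ}
    (ha : ∀ r, h * a r - a r * h = α • a (p + r)) {s : ℕ} (l : Fin s → ℤ) :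
    h * (List.ofFn fun t => a (l t)).prod - (List.ofFn fun t => a (l t)).prod * h =
      α • ∑ t, (List.ofFn fun t' => a (Function.update l t (p + l t) t')).prod := by
  induction s with
  | zero => simp
  | succ s ih =>
    have e (t : Fin s) : (fun t' : Fin s => a (Function.update l t.succ (p + l t.succ) t'.succ)) =
        fun t' => a (Function.update (fun t => l t.succ) t (p + l t.succ) t') := by
      ext t'
      exact congrArg a (congrFun
        (Function.update_comp_eq_of_injective l (Fin.succ_injective s) t (p + l t.succ)) t')
    simp only [List.ofFn_succ, List.prod_cons, Fin.sum_univ_succ, Function.update_self, e]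
    rw [mul_sub_mul_mul, ih fun t => l t.succ, ha]
    simp [Function.update, Fin.succ_ne_zero, (Fin.succ_ne_zero _).symm, Finset.mul_sum, smul_add]

theorem insertProd_commutator {h : R} {a : ℤ → R} {α : ℂ} {p : ℤ}
    (ha : ∀ r, h * a r - a r * h = α • a (p + r)) {s : ℕ} (k : ℕ) (l : Fin s → ℤ) (z : R) :
    h * insertProd k (List.ofFn fun t => a (l t)) z -
        insertProd k (List.ofFn fun t => a (l t)) z * h =
      α • ∑ t, insertProd k (List.ofFn fun t' => a (Function.update l t (p + l t) t')) z +
        insertProd k (List.ofFn fun t => a (l t)) (h * z - z * h) := by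
  induction k generalizing s with
  | zero =>
    simp only [insertProd, List.take_zero, List.prod_nil, one_mul, List.drop_zero]
    rw [mul_sub_mul_mul, prod_ofFn_commutator ha, mul_smul_comm, Finset.mul_sum, add_comm]
  | succ k ih =>
    cases s with
    | zero => simp [insertProd]
    | succ s =>
      have hc (b : R) (L : List R) (z : R) : insertProd (k + 1) (b :: L) z = b * insertProd k L z := by
        simp [insertProd, mul_assoc]
      have e (t : Fin s) :
          (fun t' : Fin s => a (Function.update l t.succ (p + l t.succ) t'.succ)) =
          fun t' => a (Function.update (fun t => l t.succ) t (p + l t.succ) t') := by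
        ext t'
        exact congrArg a (congrFun
          (Function.update_comp_eq_of_injective l (Fin.succ_injective s) t (p + l t.succ)) t')
      simp only [List.ofFn_succ, hc, Fin.sum_univ_succ, Function.update_self, e]
      rw [mul_sub_mul_mul, ih fun t => l t.succ, ha]
      simp [Function.update, Fin.succ_ne_zero, (Fin.succ_ne_zero _).symm, Finset.mul_sum, smul_add,
        mul_add, add_assoc]

/-- The shape of the affine quantum Serre relations. -/
def serreSum (c : ℕ → ℂ) {s : ℕ} (a : ℤ → R) (l : Fin s → ℤ) (z : R) : R :=
  ∑ π : Equiv.Perm (Fin s), ∑ k ∈ Finset.range (s + 1),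
    c k • insertProd k (List.ofFn fun t => a (l (π t))) z

theorem serreSum_smul (c : ℕ → ℂ) {s : ℕ} (a : ℤ → R) (l : Fin s → ℤ) (b : ℂ) (z : R) :
    serreSum c a l (b • z) = b • serreSum c a l z := by
  simp only [serreSum, insertProd, mul_smul_comm, smul_mul_assoc, Finset.smul_sum]
  exact Finset.sum_congr rfl fun _ _ => Finset.sum_congr rfl fun _ _ => smul_comm _ _ _

theorem serreSum_perm (c : ℕ → ℂ) {s : ℕ} (a : ℤ → R) (l : Fin s → ℤ) (z : R)
    (σ : Equiv.Perm (Fin s)) : serreSum c a (fun t => l (σ t)) z = serreSum c a l z :=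
  Fintype.sum_equiv (Equiv.mulLeft σ) _ _ fun _ => rfl

/-- Leibniz rule. The position of the shifted letter in the permuted word is translated back by `π`
to the position in `l`. -/
theorem serreSum_commutator (c : ℕ → ℂ) {h : R} {a : ℤ → R} {α : ℂ} {p : ℤ}
    (ha : ∀ r, h * a r - a r * h = α • a (p + r)) {s : ℕ} (l : Fin s → ℤ) (z : R) :
    h * serreSum c a l z - serreSum c a l z * h =
      α • ∑ t, serreSum c a (Function.update l t (p + l t)) z +
        serreSum c a l (h * z - z * h) := by
  have e (π : Equiv.Perm (Fin s)) (k : ℕ) :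
      h * (c k • insertProd k (List.ofFn fun t => a (l (π t))) z) -
        (c k • insertProd k (List.ofFn fun t => a (l (π t))) z) * h =
      α • ∑ t, c k • insertProd k (List.ofFn fun t' => a (Function.update l t (p + l t) (π t'))) z +
        c k • insertProd k (List.ofFn fun t => a (l (π t))) (h * z - z * h) := by
    rw [mul_smul_comm, smul_mul_assoc, ← smul_sub, insertProd_commutator ha k (fun t => l (π t)),
      smul_add, ← Finset.smul_sum, smul_comm (c k)]
    congr 3
    refine Fintype.sum_equiv π _ _ fun t => ?_
    congr 2
    ext t'
    exact congrArg a (congrFun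
      (Function.update_comp_eq_of_injective l π.injective t (p + l (π t))) t').symm
  simp only [serreSum]
  rw [Finset.mul_sum, Finset.sum_mul, ← Finset.sum_sub_distrib]
  have e' (π : Equiv.Perm (Fin s)) :
      h * (∑ k ∈ Finset.range (s + 1), c k • insertProd k (List.ofFn fun t => a (l (π t))) z) -
        (∑ k ∈ Finset.range (s + 1), c k • insertProd k (List.ofFn fun t => a (l (π t))) z) * h =
      α • ∑ t, ∑ k ∈ Finset.range (s + 1), c k • insertProd k
          (List.ofFn fun t' => a (Function.update l t (p + l t) (π t'))) z +
        ∑ k ∈ Finset.range (s + 1),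
          c k • insertProd k (List.ofFn fun t => a (l (π t))) (h * z - z * h) := by
    rw [Finset.mul_sum, Finset.sum_mul, ← Finset.sum_sub_distrib, Finset.sum_comm, Finset.smul_sum,
      ← Finset.sum_add_distrib]
    exact Finset.sum_congr rfl fun k _ => e π k
  rw [Finset.sum_congr rfl fun π _ => e' π, Finset.sum_add_distrib, ← Finset.smul_sum,
    Finset.sum_comm]

/-- If the Heisenberg elements separate the two currents, then the Serre relation in one degree
implies it in all degrees. -/
theorem serreSum_eq_zero (c : ℕ → ℂ) {s : ℕ} {a b : ℤ → R} {h h' : ℤ → R}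
    {α α' β β' : ℤ → ℂ}
    (ha : ∀ p r, p ≠ 0 → h p * a r - a r * h p = α p • a (p + r))
    (hb : ∀ p r, p ≠ 0 → h p * b r - b r * h p = β p • b (p + r))
    (ha' : ∀ p r, p ≠ 0 → h' p * a r - a r * h' p = α' p • a (p + r))
    (hb' : ∀ p r, p ≠ 0 → h' p * b r - b r * h' p = β' p • b (p + r))
    (hdet : ∀ p, p ≠ 0 → α p * β' p ≠ β p * α' p)
    (h0 : serreSum c a (fun _ : Fin s => 0) (b 0) = 0) (l : Fin s → ℤ) (m : ℤ) :
    serreSum c a l (b m) = 0 := by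
  -- Bracketing a valid relation with `h p` and `h' p` yields two linear equations in the same two
  -- unknowns; their determinant is the one in `hdet`, so both unknowns vanish.
  have step (l : Fin s → ℤ) (m p : ℤ) (hp : p ≠ 0) (hl : serreSum c a l (b m) = 0) :
      ∑ t, serreSum c a (Function.update l t (p + l t)) (b m) = 0 ∧
        serreSum c a l (b (p + m)) = 0 := by
    have e1 := serreSum_commutator c (ha p · hp) l (b m)
    have e2 := serreSum_commutator c (ha' p · hp) l (b m)
    rw [hl, mul_zero, zero_mul, sub_zero, hb p m hp, serreSum_smul] at e1
    rw [hl, mul_zero, zero_mul, sub_zero, hb' p m hp, serreSum_smul] at e2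
    have hd := sub_ne_zero.2 (hdet p hp)
    generalize ∑ t, serreSum c a (Function.update l t (p + l t)) (b m) = A at *
    generalize serreSum c a l (b (p + m)) = B at *
    constructor
    · refine (smul_eq_zero.1 (?_ : (α p * β' p - β p * α' p) • A = 0)).resolve_left hd
      calc (α p * β' p - β p * α' p) • A = β' p • (α p • A + β p • B) -
            β p • (α' p • A + β' p • B) := by module
        _ = 0 := by rw [← e1, ← e2, smul_zero, smul_zero, sub_zero]
    · refine (smul_eq_zero.1 (?_ : (α p * β' p - β p * α' p) • B = 0)).resolve_left hd
      calc (α p * β' p - β p * α' p) • B = α p • (α' p • A + β' p • B) -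
            α' p • (α p • A + β p • B) := by module
        _ = 0 := by rw [← e1, ← e2, smul_zero, smul_zero, sub_zero]
  have hm : serreSum c a (fun _ : Fin s => 0) (b m) = 0 := by
    rcases eq_or_ne m 0 with rfl | hm
    · exact h0
    · simpa using (step _ 0 m hm h0).2
  -- Induction on the number of letters of nonzero degree.
  induction hn : (Finset.univ.filter fun t => l t ≠ 0).card using Nat.strong_induction_on
    generalizing l with
  | _ n ih =>
  by_cases hl : ∀ t, l t = 0
  · rwa [show l = fun _ => 0 from funext hl]
  push Not at hl
  obtain ⟨t₀, ht₀⟩ := hl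
  have hlt (l' : Fin s → ℤ) (hl' : ∀ t, l' t ≠ 0 → l t ≠ 0 ∧ t ≠ t₀) :
      serreSum c a l' (b m) = 0 := by
    refine ih _ ?_ l' rfl
    rw [← hn]
    refine Finset.card_lt_card ⟨fun t ht => ?_, fun hsub => ?_⟩
    · simp only [Finset.mem_filter, Finset.mem_univ, true_and] at ht ⊢
      exact (hl' t ht).1
    · have := hsub (show t₀ ∈ _ by simpa using ht₀)
      simp only [Finset.mem_filter, Finset.mem_univ, true_and] at this
      exact (hl' t₀ this).2 rfl
  -- Put one nonzero degree back to zero, then bracket in degree `l t₀`. Wherever this hits a letter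
  -- of degree zero it yields a permutation of `l`.
  let l' := Function.update l t₀ 0
  have h1 := (step l' m (l t₀) ht₀ (hlt l' fun t ht => by
    by_cases h : t = t₀
    · subst h
      simp [l'] at ht
    · simp only [l', Function.update_of_ne h] at ht
      exact ⟨ht, h⟩)).1
  rw [← Finset.sum_filter_add_sum_filter_not _ (fun t => l' t = 0)] at h1
  have h2 : ∑ t with l' t = 0, serreSum c a (Function.update l' t (l t₀ + l' t)) (b m) =
      ∑ t with l' t = 0, serreSum c a l (b m) := by
    refine Finset.sum_congr rfl fun t ht => ?_
    rw [(Finset.mem_filter.1 ht).2, add_zero, ← serreSum_perm c a l (b m) (Equiv.swap t₀ t)]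
    congr 1
    ext t'
    have ht' := (Finset.mem_filter.1 ht).2
    by_cases h : t' = t
    · subst h
      simp
    · rw [Function.update_of_ne h]
      by_cases h' : t' = t₀
      · subst h'
        simp only [l', Function.update_self, Equiv.swap_apply_left]
        simp only [l', Function.update_of_ne (Ne.symm h)] at ht'
        exact ht'.symm
      · rw [Equiv.swap_apply_of_ne_of_ne h' h]
        simp only [l', Function.update_of_ne h']
  -- Hitting a letter of nonzero degree creates no new nonzero entry, so the induction hypothesis
  -- applies.
  have h3 : ∑ t with ¬ l' t = 0, serreSum c a (Function.update l' t (l t₀ + l' t)) (b m) = 0 := by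
    refine Finset.sum_eq_zero fun t ht => hlt _ fun t' ht' => ?_
    have ht := (Finset.mem_filter.1 ht).2
    have hne : t ≠ t₀ := by
      rintro rfl
      simp [l'] at ht
    have ht'' : l' t' ≠ 0 := by
      by_cases h : t' = t
      · rwa [h]
      · rwa [Function.update_of_ne h] at ht'
    by_cases h : t' = t₀
    · subst h
      simp [l'] at ht''
    · simp only [l', Function.update_of_ne h] at ht''
      exact ⟨ht'', h⟩
  rw [h2, h3, add_zero, Finset.sum_const, ← Nat.cast_smul_eq_nsmul ℂ] at h1
  -- The Serre sum is multiplied by the number of letters of degree zero in `l'`, at least one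
  -- because of `t₀`.
  refine (smul_eq_zero.1 h1).resolve_left (Nat.cast_ne_zero.2 (Finset.card_ne_zero.2 ⟨t₀, ?_⟩))
  simp [l']

end SerreDescent

/-! ### The quantum Cartan determinants of rank two -/

section Determinant

/-- For `d = 1, 2, 3` the difference is, up to powers of `T`, a product of cyclotomic polynomials.
The relevant factors are those of order `3` and `6`, then `12`, then `24`, so every zero would be a
root of unity. -/
theorem sq_sub_ne {T : ℂ} (h0 : T ≠ 0) (hT : ∀ n : ℕ, n ≠ 0 → T ^ n ≠ 1) {d : ℕ} (hd : d ≠ 0)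
    (hd' : d ≤ 3) : (T ^ (2 * d) - (T ^ (2 * d))⁻¹) * (T ^ 2 - (T ^ 2)⁻¹) ≠
      (T ^ d - (T ^ d)⁻¹) ^ 2 := by
  intro h
  have h2 := sub_ne_zero.2 (hT 2 two_ne_zero)
  have h24 : T ^ 24 - 1 ≠ 0 := sub_ne_zero.2 (hT 24 (by norm_num))
  have h4 := sub_ne_zero.2 (hT 4 (by norm_num))
  have h6 := sub_ne_zero.2 (hT 6 (by norm_num))
  obtain rfl | rfl | rfl : d = 1 ∨ d = 2 ∨ d = 3 := by omega
  · field_simp at h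
    have : (T ^ 2 - 1) * (T ^ 6 - 1) = 0 := by linear_combination h
    exact (mul_ne_zero h2 h6) this
  · field_simp at h
    have : T ^ 2 * (T ^ 4 - 1) * (T ^ 4 - T ^ 2 + 1) = 0 := by linear_combination h
    have h' := (mul_eq_zero.1 this).resolve_left (mul_ne_zero (pow_ne_zero 2 h0) h4)
    refine h24 ?_
    linear_combination (T ^ 2 + 1) * (T ^ 12 + 1) * (T ^ 6 - 1) * h'
  · field_simp at h
    have : T ^ 4 * ((T ^ 6 - 1) * (T ^ 2 - 1)) * (T ^ 8 - T ^ 4 + 1) = 0 := by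
      linear_combination h
    have h' := (mul_eq_zero.1 this).resolve_left
      (mul_ne_zero (pow_ne_zero 4 h0) (mul_ne_zero h6 h2))
    refine h24 ?_
    linear_combination (T ^ 4 + 1) * (T ^ 12 - 1) * h'

variable {ι : Type w₁} [Fintype ι] [DecidableEq ι] {𝔥 : Type w₂} [AddCommGroup 𝔥] [Module ℚ 𝔥]
variable {D : CartanDatum ι 𝔥} {ħ : ℂ}

/-- Symmetrizability gives `r_i = d r_j`, so all exponents are multiples of `p r_j` and the claim is
`sq_sub_ne` for `T = q ^ (p r_j)`. -/
theorem qInt_det_aux (hq : ∀ n : ℕ, n ≠ 0 → Complex.exp ħ ^ n ≠ 1) {i j : ι} {d : ℕ}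
    (hd : d ≠ 0) (hd' : d ≤ 3) (hij : D.C i j = -1) (hji : D.C j i = -d) {p : ℤ} (hp : p ≠ 0) :
    qInt ħ (p * (D.r i * 2)) * qInt ħ (p * (D.r j * 2)) ≠ qInt ħ (p * (D.r i * D.C i j)) ^ 2 := by
  have hr : (D.r i : ℤ) = d * D.r j := by
    have := D.symm i j
    rw [hij, hji] at this
    linarith
  set T : ℂ := qPow ħ ((p * D.r j : ℤ) : ℚ) with hTdef
  have h0 : T ≠ 0 := qPow_ne_zero _
  have hT (n : ℕ) (hn : n ≠ 0) : T ^ n ≠ 1 := by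
    rw [hTdef, qPow_pow]
    intro h
    have h1 := qPow_eq_one hq h
    have hrj := D.r_pos j
    have : (n : ℤ) * (p * D.r j) = 0 := by exact_mod_cast h1
    exact (mul_ne_zero (Int.natCast_ne_zero.2 hn) (mul_ne_zero hp (by omega))) this
  have e (n : ℕ) : qInt ħ (n * (p * D.r j)) =
      (T ^ n - (T ^ n)⁻¹) / (qPow ħ 1 - qPow ħ (-1)) := by
    rw [qInt, hTdef, qPow_pow, ← qPow_neg]
    push_cast
    rfl
  have e' (n : ℕ) : qInt ħ (-(n * (p * D.r j))) =
      -((T ^ n - (T ^ n)⁻¹) / (qPow ħ 1 - qPow ħ (-1))) := by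
    rw [← e, qInt, qInt]
    push_cast
    rw [neg_neg, ← neg_div, neg_sub]
  rw [hij, show p * ((D.r i : ℤ) * -1) = -((d : ℕ) * (p * D.r j)) by rw [hr]; ring,
    show p * ((D.r i : ℤ) * 2) = ((2 * d : ℕ) : ℤ) * (p * D.r j) by rw [hr]; push_cast; ring,
    show p * ((D.r j : ℤ) * 2) = ((2 : ℕ) : ℤ) * (p * D.r j) by push_cast; ring, e, e, e', neg_sq,
    div_mul_div_comm, div_pow, ← pow_two]
  intro h
  have hq1 := pow_ne_zero 2 (qPow_sub_qPow_neg_ne_zero hq (x := 1) one_ne_zero)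
  exact sq_sub_ne h0 hT hd hd' ((div_left_inj' hq1).1 h)

/-- As `C_{i,j} C_{j,i} ≤ 3`, either both entries vanish or one of them is `-1`. This is the point
where the smallness of the Cartan matrix enters. -/
theorem hxCoeff_det (hq : ∀ n : ℕ, n ≠ 0 → Complex.exp ħ ^ n ≠ 1) (hD : D.IsSmall) {i j : ι}
    (hij : i ≠ j) (ε : ℤˣ) {p : ℤ} (hp : p ≠ 0) :
    hxCoeff D ħ p ε i i * hxCoeff D ħ p ε j j ≠ hxCoeff D ħ p ε i j * hxCoeff D ħ p ε j i := by
  have key : qInt ħ (p * (D.r i * 2)) * qInt ħ (p * (D.r j * 2)) ≠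
      qInt ħ (p * (D.r i * D.C i j)) ^ 2 := by
    have h1 := D.nonpos i j hij
    have h2 := D.nonpos j i hij.symm
    have h3 := hD i j hij
    have h4 := D.zero_iff i j
    by_cases h5 : D.C i j = 0
    · rw [h5, mul_zero, mul_zero]
      have hi := D.r_pos i
      have hj := D.r_pos j
      have h6 : qInt ħ 0 = 0 := by simp [qInt]
      rw [h6, zero_pow two_ne_zero]
      exact mul_ne_zero (qInt_ne_zero hq (mul_ne_zero hp (by omega)))
        (qInt_ne_zero hq (mul_ne_zero hp (by omega)))
    · have h6 : D.C j i ≠ 0 := fun h => h5 (h4.2 h)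
      obtain ⟨a, ha⟩ := Int.exists_eq_neg_ofNat h1
      obtain ⟨b, hb⟩ := Int.exists_eq_neg_ofNat h2
      have ha0 : a ≠ 0 := by rintro rfl; simp [ha] at h5
      have hb0 : b ≠ 0 := by rintro rfl; simp [hb] at h6
      have hab : a * b ≤ 3 := by
        rw [ha, hb, neg_mul_neg] at h3
        exact_mod_cast h3
      have hab' : a = 1 ∨ b = 1 := by
        by_contra hcon
        push Not at hcon
        have : 2 * 2 ≤ a * b := Nat.mul_le_mul (by omega) (by omega)
        omega
      rcases hab' with rfl | rfl
      · exact qInt_det_aux hq hb0 (by omega) (by simpa using ha) hb hp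
      · have := qInt_det_aux (D := D) hq ha0 (by omega) (by simpa using hb) ha hp
        rwa [mul_comm, D.symm i j]
  rw [hxCoeff, hxCoeff, hxCoeff, hxCoeff, D.diag, D.diag, D.symm j i]
  intro h
  have hu : (((ε : ℤ) : ℂ) * (1 / (p : ℂ))) ≠ 0 :=
    mul_ne_zero (Int.cast_ne_zero.2 ε.ne_zero) (one_div_ne_zero (Int.cast_ne_zero.2 hp))
  apply key
  refine mul_left_cancel₀ (mul_ne_zero hu hu) ?_
  linear_combination h

end Determinant

end QAff

namespace QAff

/-! ### The Serre relations for the coproduct, and descent to the quotient algebra -/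

section DeltaAlgHom

variable {ι : Type w₁} [Fintype ι] [DecidableEq ι] {𝔥 : Type w₂} [AddCommGroup 𝔥] [Module ℚ 𝔥]
variable {D : CartanDatum ι 𝔥} {ħ : ℂ}
variable {E : Type*} [Ring E] [Algebra ℂ E]

theorem fphiZ_zero (ε : ℤˣ) (i : ι) : fphiZ D ħ ε i 0 = fphi D ħ ε i 0 := by
  simp [fphiZ]

theorem qPow_mul (ħ : ℂ) (r : ℕ) (x : ℚ) : qPow (ħ * r) x = qPow ħ (r * x) := by
  rw [qPow, qPow]
  congr 1
  push_cast
  ring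

variable {π₁ π₂ : U D ħ →ₐ[ℂ] E}

theorem deltaK_mul (hc : ∀ a b, Commute (π₁ a) (π₂ b)) (h h' : 𝔥) :
    deltaK π₁ π₂ h * deltaK π₁ π₂ h' = deltaK π₁ π₂ (h + h') := by
  rw [deltaK, deltaK, deltaK, Algebra.TensorProduct.tmul_mul_tmul, one_mul, (hc _ _).symm.mul_mul_mul_comm,
    ← map_mul, ← map_mul, U.k_add]

theorem deltaK_zero : deltaK π₁ π₂ 0 = 1 := by
  rw [deltaK, U.k_zero, map_one, map_one, one_mul, Algebra.TensorProduct.one_def]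

theorem deltaX_commutator_zero [FiniteDimensional ℂ E]
    (hq : ∀ n : ℕ, n ≠ 0 → Complex.exp ħ ^ n ≠ 1)
    (hc : ∀ a b, Commute (π₁ a) (π₂ b)) (ε : ℤˣ) (i : ι) :
    deltaX π₁ π₂ ε i 0 * deltaX π₁ π₂ (-ε) i 0 - deltaX π₁ π₂ (-ε) i 0 * deltaX π₁ π₂ ε i 0 =
      (qPow ħ (D.r i : ℚ) - qPow ħ (-(D.r i : ℚ)))⁻¹ •
        (deltaK π₁ π₂ ((((ε : ℤ) : ℚ) * (D.r i : ℚ)) • D.coroot i) -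
          deltaK π₁ π₂ (-((((ε : ℤ) : ℚ) * (D.r i : ℚ)) • D.coroot i))) := by
  have h := deltaX_x_x_same hq hc i 0 0
  rw [add_zero, fphiZ_zero, fphiZ_zero, map_sub, Free.map_fphi_zero, Free.map_fphi_zero, deltaFree_k,
    deltaFree_k, one_div] at h
  rcases Int.units_eq_one_or ε with rfl | rfl
  · simpa [neg_smul] using h
  · rw [← neg_inj, neg_sub, neg_neg, h, ← smul_neg, neg_sub]
    simp [neg_smul]

/-- The images of `h_{i,p}` and `h_{j,p}` reduce all degrees to degree zero. There `x^ε_{i,0}` and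
`x^{-ε}_{i,0}` generate a copy of `U_q(sl_2)` at `q_i`, and `x^ε_{j,0}` commutes with
`x^{-ε}_{i,0}`. -/
theorem deltaFree_serre [FiniteDimensional ℂ E]
    (hq : ∀ n : ℕ, n ≠ 0 → Complex.exp ħ ^ n ≠ 1)
    (hc : ∀ a b, Commute (π₁ a) (π₂ b)) (hD : D.IsSmall) (ε : ℤˣ) {i j : ι} (hij : i ≠ j)
    (l : Fin (1 - D.C i j).toNat → ℤ) (m : ℤ) :
    deltaFree π₁ π₂ (fserre D ħ ε i j l m) = 0 := by
  have h1 : deltaFree π₁ π₂ (fserre D ħ ε i j l m) =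
      serreSum (fun k => (-1 : ℂ) ^ k * qBinom (ħ * (D.r i : ℂ)) (1 - D.C i j).toNat k)
        (deltaX π₁ π₂ ε i) l (deltaX π₁ π₂ ε j m) := by
    simp only [fserre, serreSum, insertProd, map_sum, map_smul, map_mul, map_list_prod, List.map_take,
      List.map_drop, List.map_ofFn, deltaFree_x, Function.comp_def]
  rw [h1]
  refine serreSum_eq_zero _ (a := deltaX π₁ π₂ ε i) (b := deltaX π₁ π₂ ε j)
    (h := fun p => if hp : p ≠ 0 then deltaH π₁ π₂ i ⟨p, hp⟩ else 0)
    (h' := fun p => if hp : p ≠ 0 then deltaH π₁ π₂ j ⟨p, hp⟩ else 0)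
    (α := fun p => hxCoeff D ħ p ε i i) (β := fun p => hxCoeff D ħ p ε i j)
    (α' := fun p => hxCoeff D ħ p ε j i) (β' := fun p => hxCoeff D ħ p ε j j)
    ?_ ?_ ?_ ?_ (fun p hp => hxCoeff_det hq hD hij ε hp) ?_ l m
  · intro p r hp
    rw [dif_pos hp, deltaH_deltaX hq hc]
  · intro p r hp
    rw [dif_pos hp, deltaH_deltaX hq hc]
  · intro p r hp
    rw [dif_pos hp, deltaH_deltaX hq hc]
  · intro p r hp
    rw [dif_pos hp, deltaH_deltaX hq hc]
  · obtain ⟨n, hn⟩ := Int.exists_eq_neg_ofNat (D.nonpos i j hij)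
    have hn' : (1 - D.C i j).toNat = n + 1 := by omega
    rw [hn']
    have hεε : (((ε : ℤ) : ℚ)) * ((ε : ℤ) : ℚ) = 1 := by exact_mod_cast units_coe_mul_coe ε
    have hq' : ∀ a : ℕ, a ≠ 0 → Complex.exp (ħ * (D.r i : ℂ)) ^ a ≠ 1 := by
      intro a ha
      rw [mul_comm ħ, Complex.exp_nat_mul, ← pow_mul]
      exact hq _ (mul_ne_zero (D.r_pos i).ne' ha)
    set κ : 𝔥 := (((ε : ℤ) : ℚ) * (D.r i : ℚ)) • D.coroot i with hκ
    have hk : deltaK π₁ π₂ κ * deltaK π₁ π₂ (-κ) = 1 := by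
      rw [deltaK_mul hc, add_neg_cancel, deltaK_zero]
    have hk' : deltaK π₁ π₂ (-κ) * deltaK π₁ π₂ κ = 1 := by
      rw [deltaK_mul hc, neg_add_cancel, deltaK_zero]
    have hroot (j' : ι) : ((ε : ℤ) : ℚ) * D.root j' κ = D.r i * D.C i j' := by
      rw [hκ, map_smul, D.pairing, smul_eq_mul]
      linear_combination (D.r i * D.C i j' : ℚ) * hεε
    have key := sum_qBinom_eq_zero (ħ := ħ * (D.r i : ℂ)) (F := K) (n := n) hq' hk hk'
      (e := deltaX π₁ π₂ ε i 0) (f := deltaX π₁ π₂ (-ε) i 0) (y := deltaX π₁ π₂ ε j 0)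
      (by rw [deltaK_deltaX hq hc, hroot, qPow_mul, D.diag]; push_cast; rfl)
      (by rw [deltaX_commutator_zero hq hc, qPow_mul, qPow_mul, mul_one, mul_neg_one])
      (by rw [deltaK_deltaX hq hc, hroot, qPow_mul, hn]; push_cast; rfl)
      (by
        rcases Int.units_eq_one_or ε with rfl | rfl
        · exact (deltaX_x_x_ne hq hc hij.symm 0 0).eq
        · rw [neg_neg]
          exact (deltaX_x_x_ne hq hc hij 0 0).eq.symm)
    -- All letters are equal in degree zero, so each permutation contributes the same vanishing sum.
    rw [serreSum]
    refine Finset.sum_eq_zero fun π _ => Eq.trans ?_ key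
    refine Finset.sum_congr rfl fun k hk => ?_
    have hk : k ≤ n + 1 := by
      have := Finset.mem_range.1 hk
      omega
    rw [insertProd, List.ofFn_const, List.take_replicate, List.drop_replicate, List.prod_replicate,
      List.prod_replicate, min_eq_left hk]

/-- The deformed Drinfeld coproduct, composed with a pair of commuting representations. -/
noncomputable def delta [FiniteDimensional ℂ E] (hq : ∀ n : ℕ, n ≠ 0 → Complex.exp ħ ^ n ≠ 1)
    (hc : ∀ a b, Commute (π₁ a) (π₂ b)) : U D ħ →ₐ[ℂ] K ⊗[ℂ] E :=
  RingQuot.liftAlgHom ℂ ⟨deltaFree π₁ π₂, by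
    intro a b hab
    have hcc := deltaFree_cartanCommute hc
    cases hab with
    | k_zero => rw [deltaFree_k, deltaK_zero, map_one]
    | k_add h h' => rw [map_mul, deltaFree_k, deltaFree_k, deltaFree_k, deltaK_mul hc]
    | k_h h i m => rw [map_mul, map_mul, (hcc.k_h h i m).eq]
    | h_h i j m m' => rw [map_mul, map_mul, (hcc.h_h i j m m').eq]
    | k_x h ε j r =>
      rw [map_mul, map_smul, map_mul, deltaFree_k, deltaFree_x, deltaK_deltaX hq hc]
    | h_x i m ε j r =>
      rw [map_sub, map_mul, map_mul, map_smul, deltaFree_h, deltaFree_x, deltaFree_x,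
        deltaH_deltaX hq hc]
      rfl
    | x_x_same i r s =>
      rw [map_sub, map_mul, map_mul, map_smul, deltaFree_x, deltaFree_x, deltaX_x_x_same hq hc]
    | x_x_ne i j hij r s =>
      rw [map_mul, map_mul, deltaFree_x, deltaFree_x, (deltaX_x_x_ne hq hc hij r s).eq]
    | x_x ε i j r s =>
      simp only [map_sub, map_mul, map_smul, deltaFree_x]
      exact deltaX_x_x hq hc ε i j r s
    | serre hD ε i j hij l m => rw [deltaFree_serre hq hc hD ε hij, map_zero]⟩

variable [FiniteDimensional ℂ E] (hq : ∀ n : ℕ, n ≠ 0 → Complex.exp ħ ^ n ≠ 1)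
  (hc : ∀ a b, Commute (π₁ a) (π₂ b))

theorem delta_mk (a : Free ι 𝔥) : delta hq hc (U.mk D ħ a) = deltaFree π₁ π₂ a :=
  RingQuot.liftAlgHom_mkAlgHom_apply ℂ _ _ _

theorem delta_x (ε : ℤˣ) (i : ι) (r : ℤ) : delta hq hc (U.x D ħ ε i r) = deltaX π₁ π₂ ε i r := by
  rw [U.x, delta_mk, deltaFree_x]

theorem delta_k (h : 𝔥) : delta hq hc (U.k D ħ h) = deltaK π₁ π₂ h := by
  rw [U.k, delta_mk, deltaFree_k]

theorem delta_h (i : ι) (m) : delta hq hc (U.h D ħ i m) = deltaH π₁ π₂ i m := by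
  rw [U.h, delta_mk, deltaFree_h]

theorem delta_phi (ε : ℤˣ) (i : ι) (m : ℕ) : delta hq hc (U.phi D ħ ε i m) =
    ∑ p ∈ Finset.HasAntidiagonal.antidiagonal m,
      (RatFunc.X ^ ((ε : ℤ) * (p.2 : ℤ)) : K) ⊗ₜ[ℂ]
        (π₁ (U.phi D ħ ε i p.1) * π₂ (U.phi D ħ ε i p.2)) := by
  rw [U.phi, delta_mk, deltaFree_phi hc]

end DeltaAlgHom

end QAff

namespace QAff

/-! ### The fusion action -/

section FusionAction

variable {ι : Type w₁} [Fintype ι] [DecidableEq ι] {𝔥 : Type w₂} [AddCommGroup 𝔥] [Module ℚ 𝔥]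
variable {D : CartanDatum ι 𝔥} {ħ : ℂ}
variable (V₁ V₂ : Type v)
  [AddCommGroup V₁] [Module ℂ V₁] [Module (U D ħ) V₁] [IsScalarTower ℂ (U D ħ) V₁]
  [AddCommGroup V₂] [Module ℂ V₂] [Module (U D ħ) V₂] [IsScalarTower ℂ (U D ħ) V₂]

/-- The action of `𝒰_q(ĝ)` on the first tensor factor. -/
noncomputable def actLeft : U D ħ →ₐ[ℂ] Module.End ℂ (V₁ ⊗[ℂ] V₂) :=
  (Module.End.rTensorAlgHom ℂ V₁ V₂).comp (Algebra.lsmul ℂ ℂ V₁)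

/-- The action of `𝒰_q(ĝ)` on the second tensor factor. -/
noncomputable def actRight : U D ħ →ₐ[ℂ] Module.End ℂ (V₁ ⊗[ℂ] V₂) :=
  (Module.End.lTensorAlgHom ℂ V₂ V₁).comp (Algebra.lsmul ℂ ℂ V₂)

variable {V₁ V₂}

theorem actLeft_commute_actRight (a b : U D ħ) :
    Commute (actLeft V₁ V₂ a) (actRight V₁ V₂ b) :=
  TensorProduct.ext' fun _ _ => rfl

theorem fusionSpace_ext {X : Type*} [AddCommGroup X] [Module K X]
    {f g : FusionSpace V₁ V₂ →ₗ[K] X}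
    (h : ∀ v₁ v₂, f (1 ⊗ₜ (v₁ ⊗ₜ v₂)) = g (1 ⊗ₜ (v₁ ⊗ₜ v₂))) : f = g := by
  ext x
  induction x using TensorProduct.induction_on with
  | zero => rw [map_zero, map_zero]
  | add x y hx hy => rw [map_add, map_add, hx, hy]
  | tmul a w =>
    have e (w : V₁ ⊗[ℂ] V₂) : (a ⊗ₜ w : FusionSpace V₁ V₂) = a • ((1 : K) ⊗ₜ w) := by
      rw [smul_tmul', smul_eq_mul, mul_one]
    rw [e, map_smul, map_smul]
    congr 1
    induction w with
    | zero => rw [tmul_zero, map_zero, map_zero]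
    | add x y hx hy => rw [tmul_add, map_add, map_add, hx, hy]
    | tmul v₁ v₂ => exact h v₁ v₂

variable (V₁ V₂)

/-- The action of `𝒰_q(ĝ)` on `(V₁ ⊗ V₂) ⊗ ℂ(u)` through the deformed Drinfeld coproduct. -/
noncomputable def fusionAction [FiniteDimensional ℂ V₁] [FiniteDimensional ℂ V₂]
    (hq : ∀ n : ℕ, n ≠ 0 → Complex.exp ħ ^ n ≠ 1) :
    U D ħ →ₐ[ℂ] Module.End K (FusionSpace V₁ V₂) :=
  ((LinearMap.tensorProductEnd ℂ K (V₁ ⊗[ℂ] V₂)).restrictScalars ℂ).comp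
    (delta hq (actLeft_commute_actRight (D := D) (ħ := ħ) (V₁ := V₁) (V₂ := V₂)))

variable {V₁ V₂}

theorem expandCoeff_fusionAction [FiniteDimensional ℂ V₁] [FiniteDimensional ℂ V₂]
    (hq : ∀ n : ℕ, n ≠ 0 → Complex.exp ħ ^ n ≠ 1) (a : U D ħ) (w : V₁ ⊗[ℂ] V₂) (n : ℤ) :
    expandCoeff (V₁ ⊗[ℂ] V₂) n (fusionAction (D := D) V₁ V₂ hq a (1 ⊗ₜ w)) =
      expandCoeff (Module.End ℂ (V₁ ⊗[ℂ] V₂)) n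
        (delta hq (actLeft_commute_actRight (D := D) (ħ := ħ) (V₁ := V₁) (V₂ := V₂)) a) w :=
  expandCoeff_tensorProductEnd _ _ _

theorem fusionAction_isFusionAction [FiniteDimensional ℂ V₁] [FiniteDimensional ℂ V₂]
    (hq : ∀ n : ℕ, n ≠ 0 → Complex.exp ħ ^ n ≠ 1) : IsFusionAction (fusionAction (D := D) V₁ V₂ hq) := by
  have hc := actLeft_commute_actRight (D := D) (ħ := ħ) (V₁ := V₁) (V₂ := V₂)
  refine ⟨fun i r v₁ v₂ n => ?_, fun i r v₁ v₂ n => ?_, fun ε i m v₁ v₂ => ?_, fun h v₁ v₂ => ?_⟩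
  · rw [expandCoeff_fusionAction, delta_x, deltaX_one, map_add, expandCoeff_one_tmul,
      expandCoeff_zpow_smul, expandCoeff_current hq hc, deltaXPlus, LinearMap.add_apply,
      Units.val_one, one_mul, add_sub_cancel]
    congr 1
    · split_ifs <;> rfl
    · by_cases h : r ≤ n
      · rw [if_pos h, if_pos (by omega)]
        rfl
      · rw [if_neg h, if_neg (by omega)]
        rfl
  · rw [expandCoeff_fusionAction, delta_x, deltaX_neg_one, map_add, expandCoeff_zpow_smul,
      expandCoeff_one_tmul, expandCoeff_current hq fun a b => (hc b a).symm, deltaXMinus,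
      LinearMap.add_apply, neg_neg, Units.val_neg, Units.val_one, neg_one_mul, neg_add_rev, neg_neg,
      neg_add_eq_sub, ← (hc _ _).eq]
    congr 1
    · by_cases h : n = r
      · rw [if_pos h, if_pos (by omega)]
        rfl
      · rw [if_neg h, if_neg (by omega)]
        rfl
    · split_ifs <;> rfl
  · apply expandCoeff_ext
    intro n
    rw [expandCoeff_fusionAction, delta_phi, map_sum, LinearMap.sum_apply, map_sum,
      Finset.Nat.sum_antidiagonal_eq_sum_range_succ_mk, ← Finset.sum_range_reflect]
    refine Finset.sum_congr rfl fun s hs => ?_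
    have hs : s ≤ m := Nat.lt_succ_iff.1 (Finset.mem_range.1 hs)
    rw [show m - (m + 1 - 1 - s) = s by omega, show m + 1 - 1 - s = m - s by omega,
      expandCoeff_tmul, expandCoeff_tmul]
    rfl
  · apply expandCoeff_ext
    intro n
    rw [expandCoeff_fusionAction, delta_k, deltaK, expandCoeff_one_tmul, expandCoeff_tmul, ratCoeff_one]
    split_ifs
    · rw [one_smul]
      rfl
    · rw [zero_smul]
      rfl

/-- The prescribed coefficients determine the operators of `x`, `k` and `φ`, which generate the
algebra. -/
theorem IsFusionAction.unique (hq : ∀ n : ℕ, n ≠ 0 → Complex.exp ħ ^ n ≠ 1)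
    {ρ ρ' : U D ħ →ₐ[ℂ] Module.End K (FusionSpace V₁ V₂)} (h : IsFusionAction ρ)
    (h' : IsFusionAction ρ') : ρ = ρ' := by
  have : AlgHom.equalizer ρ ρ' = ⊤ := by
    refine U.eq_top_of_phi hq (fun ε i r => ?_) (fun h₀ => ?_) fun ε i m => ?_
    · refine fusionSpace_ext fun v₁ v₂ => expandCoeff_ext fun n => ?_
      rcases Int.units_eq_one_or ε with rfl | rfl
      · exact (h.x_plus i r v₁ v₂ n).trans (h'.x_plus i r v₁ v₂ n).symm
      · exact (h.x_minus i r v₁ v₂ n).trans (h'.x_minus i r v₁ v₂ n).symm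
    · exact fusionSpace_ext fun v₁ v₂ => (h.k h₀ v₁ v₂).trans (h'.k h₀ v₁ v₂).symm
    · exact fusionSpace_ext fun v₁ v₂ => (h.phi ε i m v₁ v₂).trans (h'.phi ε i m v₁ v₂).symm
  ext1 a
  exact (this.ge (Algebra.mem_top (x := a)) : _)

end FusionAction

end QAff

namespace QAff

/-! ### Rational functions without pole at `u = 1`, and pole orders -/

section RegularAtOne

theorem algebraMap_mem_regularAtOne (f : ℂ[X]) : algebraMap ℂ[X] K f ∈ regularAtOne :=
  ⟨f, 1, by simp, by rw [map_one, div_one]⟩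

theorem zpow_X_mem_regularAtOne (n : ℤ) : (RatFunc.X ^ n : K) ∈ regularAtOne := by
  rcases n with n | n
  · refine ⟨Polynomial.X ^ n, 1, by simp, ?_⟩
    rw [map_one, div_one, map_pow, RatFunc.algebraMap_X, Int.ofNat_eq_natCast, zpow_natCast]
  · refine ⟨1, Polynomial.X ^ (n + 1), by simp, ?_⟩
    rw [map_one, map_pow, RatFunc.algebraMap_X, zpow_negSucc, one_div]

theorem X_sub_one_ne_zero : (RatFunc.X - 1 : K) ≠ 0 := by
  rw [← RatFunc.algebraMap_X, ← map_one (algebraMap ℂ[X] K), ← map_sub]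
  exact RatFunc.algebraMap_ne_zero (Polynomial.X_sub_C_ne_zero (1 : ℂ))

theorem X_sub_one_mem_regularAtOne : (RatFunc.X - 1 : K) ∈ regularAtOne := by
  rw [← RatFunc.algebraMap_X, ← map_one (algebraMap ℂ[X] K), ← map_sub]
  exact algebraMap_mem_regularAtOne _

theorem exists_pow_mul_mem_regularAtOne (f : K) :
    ∃ N : ℕ, (RatFunc.X - 1 : K) ^ N * f ∈ regularAtOne := by
  obtain ⟨N, g, hg, hN⟩ : ∃ (N : ℕ) (g : ℂ[X]),
      f.denom = (Polynomial.X - Polynomial.C 1) ^ N * g ∧ ¬ (Polynomial.X - Polynomial.C 1) ∣ g :=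
    ⟨_, Polynomial.exists_eq_pow_rootMultiplicity_mul_and_not_dvd f.denom f.denom_ne_zero (1 : ℂ)⟩
  refine ⟨N, f.num, g, fun h => hN (Polynomial.dvd_iff_isRoot.2 h), ?_⟩
  have hX : (RatFunc.X - 1 : K) = algebraMap ℂ[X] K (Polynomial.X - Polynomial.C 1) := by
    rw [map_sub, RatFunc.algebraMap_X, map_one, map_one]
  have h0 : algebraMap ℂ[X] K g ≠ 0 := RatFunc.algebraMap_ne_zero (by
    rintro rfl
    simp at hN)
  conv_lhs => rw [← RatFunc.num_div_denom f, hg, map_mul, map_pow, ← hX]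
  have := pow_ne_zero N X_sub_one_ne_zero
  field_simp

variable (W : Type*) [AddCommGroup W] [Module ℂ W]

/-- The lattice `𝒜 ⊗ W` in `ℂ(u) ⊗ W`. -/
noncomputable def baseLattice : Submodule regularAtOne (K ⊗[ℂ] W) :=
  Submodule.span regularAtOne (Set.range fun w : W => (1 : K) ⊗ₜ[ℂ] w)

variable {W}

theorem regular_smul_mem {X : Type*} [AddCommGroup X] [Module K X] {L : Submodule regularAtOne X}
    {a : K} (ha : a ∈ regularAtOne) {x : X} (hx : x ∈ L) : a • x ∈ L :=
  L.smul_mem ⟨a, ha⟩ hx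

theorem one_tmul_mem_baseLattice (w : W) : (1 : K) ⊗ₜ[ℂ] w ∈ baseLattice W :=
  Submodule.subset_span ⟨w, rfl⟩

theorem tmul_mem_baseLattice {a : K} (ha : a ∈ regularAtOne) (w : W) :
    a ⊗ₜ[ℂ] w ∈ baseLattice W := by
  have := regular_smul_mem ha (one_tmul_mem_baseLattice w)
  rwa [smul_tmul', smul_eq_mul, mul_one] at this

theorem exists_pow_smul_mem_baseLattice (y : K ⊗[ℂ] W) :
    ∃ N : ℕ, (RatFunc.X - 1 : K) ^ N • y ∈ baseLattice W := by
  induction y using TensorProduct.induction_on with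
  | zero => exact ⟨0, by rw [smul_zero]; exact zero_mem _⟩
  | tmul f w =>
    obtain ⟨N, hN⟩ := exists_pow_mul_mem_regularAtOne f
    exact ⟨N, by rw [smul_tmul', smul_eq_mul]; exact tmul_mem_baseLattice hN w⟩
  | add y z hy hz =>
    obtain ⟨N, hN⟩ := hy
    obtain ⟨N', hN'⟩ := hz
    refine ⟨N + N', ?_⟩
    rw [smul_add]
    refine add_mem ?_ ?_
    · rw [add_comm, pow_add, mul_smul]
      exact regular_smul_mem (pow_mem X_sub_one_mem_regularAtOne _) hN
    · rw [pow_add, mul_smul]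
      exact regular_smul_mem (pow_mem X_sub_one_mem_regularAtOne _) hN'

variable {E : Type*} [Ring E] [Algebra ℂ E]

theorem mul_mem_baseLattice {y z : K ⊗[ℂ] E} (hy : y ∈ baseLattice E) (hz : z ∈ baseLattice E) :
    y * z ∈ baseLattice E := by
  induction hy using Submodule.span_induction with
  | zero => rw [zero_mul]; exact zero_mem _
  | add a b _ _ ha hb => rw [add_mul]; exact add_mem ha hb
  | smul c a _ ha =>
    change (c : K) • a * z ∈ _
    rw [smul_mul_assoc]
    exact regular_smul_mem c.2 ha
  | mem a ha =>
    obtain ⟨e, rfl⟩ := ha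
    induction hz using Submodule.span_induction with
    | zero => rw [mul_zero]; exact zero_mem _
    | add a b _ _ ha hb => rw [mul_add]; exact add_mem ha hb
    | smul c a _ ha =>
      change _ * (c : K) • a ∈ _
      rw [mul_smul_comm]
      exact regular_smul_mem c.2 ha
    | mem a ha =>
      obtain ⟨e', rfl⟩ := ha
      rw [Algebra.TensorProduct.tmul_mul_tmul, one_mul]
      exact one_tmul_mem_baseLattice _

variable (E)

/-- The elements with poles of order at most `N` at `u = 1`. -/
noncomputable def poleFiltration (N : ℕ) : Submodule ℂ (K ⊗[ℂ] E) where
  carrier := {y | (RatFunc.X - 1 : K) ^ N • y ∈ baseLattice E}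
  add_mem' ha hb := by
    rw [Set.mem_ofPred_eq] at *
    rw [smul_add]
    exact add_mem ha hb
  zero_mem' := by
    rw [Set.mem_ofPred_eq]
    rw [smul_zero]
    exact zero_mem _
  smul_mem' c y hy := by
    rw [Set.mem_ofPred_eq] at *
    rw [smul_comm, ← algebraMap_smul K c]
    exact regular_smul_mem (regularAtOne.algebraMap_mem c) hy

variable {E}

theorem mem_poleFiltration {N : ℕ} {y : K ⊗[ℂ] E} :
    y ∈ poleFiltration E N ↔ (RatFunc.X - 1 : K) ^ N • y ∈ baseLattice E := Iff.rfl

theorem poleFiltration_mono {N M : ℕ} (h : N ≤ M) : poleFiltration E N ≤ poleFiltration E M := by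
  intro y hy
  obtain ⟨d, rfl⟩ := Nat.exists_eq_add_of_le' h
  rw [mem_poleFiltration, pow_add, mul_smul]
  exact regular_smul_mem (pow_mem X_sub_one_mem_regularAtOne _) hy

theorem mul_mem_poleFiltration {N M : ℕ} {y z : K ⊗[ℂ] E} (hy : y ∈ poleFiltration E N)
    (hz : z ∈ poleFiltration E M) : y * z ∈ poleFiltration E (N + M) := by
  rw [mem_poleFiltration, pow_add, ← smul_mul_smul_comm]
  exact mul_mem_baseLattice hy hz

theorem baseLattice_le_poleFiltration {y : K ⊗[ℂ] E} (hy : y ∈ baseLattice E) (N : ℕ) :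
    y ∈ poleFiltration E N :=
  regular_smul_mem (pow_mem X_sub_one_mem_regularAtOne _) hy

theorem list_prod_mem_poleFiltration {N : ℕ} (l : List (K ⊗[ℂ] E))
    (hl : ∀ y ∈ l, y ∈ poleFiltration E N) : l.prod ∈ poleFiltration E (N * l.length) := by
  induction l with
  | nil => exact baseLattice_le_poleFiltration (one_tmul_mem_baseLattice 1) _
  | cons y l ih =>
    rw [List.prod_cons, List.length_cons, mul_add, mul_one, add_comm]
    exact mul_mem_poleFiltration (hl y (by simp)) (ih fun z hz => hl z (by simp [hz]))

theorem tensorProductEnd_mem_baseLattice {y : K ⊗[ℂ] Module.End ℂ W}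
    (hy : y ∈ baseLattice (Module.End ℂ W)) {x : K ⊗[ℂ] W} (hx : x ∈ baseLattice W) :
    LinearMap.tensorProductEnd ℂ K W y x ∈ baseLattice W := by
  induction hy using Submodule.span_induction with
  | zero => rw [map_zero]; exact zero_mem _
  | add a b _ _ ha hb => rw [map_add]; exact add_mem ha hb
  | smul c a _ ha =>
    change LinearMap.tensorProductEnd ℂ K W ((c : K) • a) x ∈ _
    rw [map_smul]
    exact regular_smul_mem c.2 ha
  | mem a ha =>
    obtain ⟨e, rfl⟩ := ha
    change ((1 : K) • LinearMap.baseChange K e) x ∈ _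
    rw [one_smul]
    induction hx using Submodule.span_induction with
    | zero => rw [map_zero]; exact zero_mem _
    | add a b _ _ ha hb => rw [map_add]; exact add_mem ha hb
    | smul c a _ ha =>
      change LinearMap.baseChange K e ((c : K) • a) ∈ _
      rw [map_smul]
      exact regular_smul_mem c.2 ha
    | mem a ha =>
      obtain ⟨w, rfl⟩ := ha
      exact one_tmul_mem_baseLattice _

end RegularAtOne

/-! ### The triangular decomposition -/

section Triangular

variable {ι : Type w₁} [Fintype ι] [DecidableEq ι] {𝔥 : Type w₂} [AddCommGroup 𝔥] [Module ℚ 𝔥]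
variable (D : CartanDatum ι 𝔥) (ħ : ℂ)

/-- The subalgebra generated by the `x^ε_{i,r}`, for fixed `ε`. -/
noncomputable def U.nilpotentPart (ε : ℤˣ) : Subalgebra ℂ (U D ħ) :=
  Algebra.adjoin ℂ {a | ∃ i r, a = U.x D ħ ε i r}

/-- The subalgebra generated by the `k_h` and the `h_{i,m}`. -/
noncomputable def U.cartanPart : Subalgebra ℂ (U D ħ) :=
  Algebra.adjoin ℂ ({a | ∃ h, a = U.k D ħ h} ∪ {a | ∃ i m, a = U.h D ħ i m})

variable {D ħ}

theorem U.x_mem_nilpotentPart (ε : ℤˣ) (i : ι) (r : ℤ) :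
    U.x D ħ ε i r ∈ U.nilpotentPart D ħ ε := Algebra.subset_adjoin ⟨i, r, rfl⟩

theorem U.k_mem_cartanPart (h : 𝔥) : U.k D ħ h ∈ U.cartanPart D ħ :=
  Algebra.subset_adjoin (Or.inl ⟨h, rfl⟩)

theorem U.h_mem_cartanPart (i : ι) (m) : U.h D ħ i m ∈ U.cartanPart D ħ :=
  Algebra.subset_adjoin (Or.inr ⟨i, m, rfl⟩)

theorem U.phiZ_mem_cartanPart (ε : ℤˣ) (i : ι) (m : ℤ) : U.phiZ D ħ ε i m ∈ U.cartanPart D ħ := by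
  rw [U.phiZ]
  split_ifs
  · exact U.phi_mem U.k_mem_cartanPart U.h_mem_cartanPart ε i _
  · exact zero_mem _

theorem U.h_commutator_mem {ε : ℤˣ} (i : ι) (m) {w : U D ħ} (hw : w ∈ U.nilpotentPart D ħ ε) :
    U.h D ħ i m * w - w * U.h D ħ i m ∈ U.nilpotentPart D ħ ε := by
  induction hw using Algebra.adjoin_induction with
  | mem a ha =>
    obtain ⟨j, r, rfl⟩ := ha
    rw [U.h_x]
    exact (U.nilpotentPart D ħ ε).smul_mem (U.x_mem_nilpotentPart ε _ _) _
  | algebraMap c => rw [Algebra.commutes, sub_self]; exact zero_mem _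
  | add a b _ _ ha hb =>
    rw [mul_add, add_mul, add_sub_add_comm]
    exact add_mem ha hb
  | mul a b ha' hb' ha hb =>
    rw [mul_sub_mul_mul]
    exact add_mem (mul_mem ha hb') (mul_mem ha' hb)

theorem U.k_conj_mem {ε : ℤˣ} (h : 𝔥) {w : U D ħ} (hw : w ∈ U.nilpotentPart D ħ ε) :
    U.k D ħ h * w * U.k D ħ (-h) ∈ U.nilpotentPart D ħ ε := by
  have hkk : U.k D ħ h * U.k D ħ (-h) = 1 := by rw [← U.k_add, add_neg_cancel, U.k_zero]
  have hkk' : U.k D ħ (-h) * U.k D ħ h = 1 := by rw [← U.k_add, neg_add_cancel, U.k_zero]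
  induction hw using Algebra.adjoin_induction with
  | mem a ha =>
    obtain ⟨j, r, rfl⟩ := ha
    rw [U.k_mul_x, smul_mul_assoc, mul_assoc, hkk, mul_one]
    exact (U.nilpotentPart D ħ ε).smul_mem (U.x_mem_nilpotentPart ε _ _) _
  | algebraMap c =>
    rw [← Algebra.commutes, mul_assoc, hkk, mul_one]
    exact Subalgebra.algebraMap_mem _ c
  | add a b _ _ ha hb =>
    rw [mul_add, add_mul]
    exact add_mem ha hb
  | mul a b _ _ ha hb =>
    rw [show U.k D ħ h * (a * b) * U.k D ħ (-h) =
      (U.k D ħ h * a * U.k D ħ (-h)) * (U.k D ħ h * b * U.k D ħ (-h)) by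
        rw [mul_assoc (U.k D ħ h * a), mul_assoc (U.k D ħ h) b, ← mul_assoc (U.k D ħ (-h)), hkk',
          one_mul]
        simp only [mul_assoc]]
    exact mul_mem ha hb

variable (D ħ) in
/-- The underlying subspace of `U.nilpotentPart`. -/
noncomputable abbrev U.nilSubmodule (ε : ℤˣ) : Submodule ℂ (U D ħ) :=
  Subalgebra.toSubmodule (U.nilpotentPart D ħ ε)

variable (D ħ) in
/-- The underlying subspace of `U.cartanPart`. -/
noncomputable abbrev U.cartanSubmodule : Submodule ℂ (U D ħ) :=
  Subalgebra.toSubmodule (U.cartanPart D ħ)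

theorem Subalgebra.toSubmodule_mul_self {R A : Type*} [CommSemiring R] [Semiring A] [Algebra R A]
    (S : Subalgebra R A) : Subalgebra.toSubmodule S * Subalgebra.toSubmodule S =
      Subalgebra.toSubmodule S := S.isIdempotentElem_toSubmodule

/-- Conjugation by `k_h` and commutators with `h_{i,m}` preserve the nilpotent part, so Cartan
generators can be moved to the right one at a time. -/
theorem U.cartanPart_mul_nilpotentPart (ε : ℤˣ) : U.cartanSubmodule D ħ * U.nilSubmodule D ħ ε ≤ U.nilSubmodule D ħ ε * U.cartanSubmodule D ħ := by
  rw [Submodule.mul_le]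
  intro a ha w hw
  induction ha using Algebra.adjoin_induction generalizing w with
  | mem a ha =>
    rcases ha with ⟨h, rfl⟩ | ⟨i, m, rfl⟩
    · have hkk' : U.k D ħ (-h) * U.k D ħ h = 1 := by rw [← U.k_add, neg_add_cancel, U.k_zero]
      rw [← mul_one (U.k D ħ h * w), ← hkk', ← mul_assoc]
      exact Submodule.mul_mem_mul (U.k_conj_mem h hw) (U.k_mem_cartanPart h)
    · rw [← sub_add_cancel (U.h D ħ i m * w) (w * U.h D ħ i m)]
      refine add_mem ?_ (Submodule.mul_mem_mul hw (U.h_mem_cartanPart i m))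
      rw [← mul_one (_ - _)]
      exact Submodule.mul_mem_mul (U.h_commutator_mem i m hw) (one_mem (U.cartanPart D ħ))
  | algebraMap c =>
    rw [Algebra.commutes]
    exact Submodule.mul_mem_mul hw (Subalgebra.algebraMap_mem _ c)
  | add a b _ _ ha hb =>
    rw [add_mul]
    exact add_mem (ha w hw) (hb w hw)
  | mul a b _ hb' ha hb =>
    rw [mul_assoc]
    have := hb w hw
    generalize b * w = z at this ⊢
    induction this using Submodule.mul_induction_on' with
    | mem_mul_mem w' hw' b' hb'' =>
      rw [← mul_assoc]
      have := Submodule.mul_mem_mul (ha w' hw') hb''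
      rwa [mul_assoc, Subalgebra.toSubmodule_mul_self] at this
    | add x _ y _ hx hy => rw [mul_add]; exact add_mem hx hy

theorem U.nilpotentPart_mul_cartanPart (ε : ℤˣ) : U.nilSubmodule D ħ ε * U.cartanSubmodule D ħ ≤ U.cartanSubmodule D ħ * U.nilSubmodule D ħ ε := by
  rw [Submodule.mul_le]
  intro w hw a ha
  induction ha using Algebra.adjoin_induction generalizing w with
  | mem a ha =>
    rcases ha with ⟨h, rfl⟩ | ⟨i, m, rfl⟩
    · have hkk : U.k D ħ h * U.k D ħ (-h) = 1 := by rw [← U.k_add, add_neg_cancel, U.k_zero]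
      have := U.k_conj_mem (-h) hw
      rw [neg_neg] at this
      rw [← one_mul (w * U.k D ħ h), ← hkk, mul_assoc (U.k D ħ h), ← mul_assoc (U.k D ħ (-h))]
      exact Submodule.mul_mem_mul (U.k_mem_cartanPart h) this
    · rw [← sub_sub_cancel (U.h D ħ i m * w) (w * U.h D ħ i m)]
      refine sub_mem (Submodule.mul_mem_mul (U.h_mem_cartanPart i m) hw) ?_
      rw [← one_mul (_ - _)]
      exact Submodule.mul_mem_mul (one_mem (U.cartanPart D ħ)) (U.h_commutator_mem i m hw)
  | algebraMap c =>
    rw [← Algebra.commutes]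
    exact Submodule.mul_mem_mul (Subalgebra.algebraMap_mem _ c) hw
  | add a b _ _ ha hb =>
    rw [mul_add]
    exact add_mem (ha w hw) (hb w hw)
  | mul a b _ hb' ha hb =>
    rw [← mul_assoc]
    have := ha w hw
    generalize w * a = z at this ⊢
    induction this using Submodule.mul_induction_on' with
    | mem_mul_mem b' hb'' w' hw' =>
      rw [mul_assoc]
      have := Submodule.mul_mem_mul hb'' (hb w' hw')
      rwa [← mul_assoc, Subalgebra.toSubmodule_mul_self] at this
    | add x _ y _ hx hy => rw [add_mul]; exact add_mem hx hy

/-- On a generator the commutator lies in the Cartan part. The Leibniz rule then leaves Cartan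
elements inside the word, which are moved to the right. -/
theorem U.x_commutator_mem (i : ι) (r : ℤ) {w : U D ħ} (hw : w ∈ U.nilpotentPart D ħ (-1)) :
    U.x D ħ 1 i r * w - w * U.x D ħ 1 i r ∈ U.nilSubmodule D ħ (-1) * U.cartanSubmodule D ħ := by
  induction hw using Algebra.adjoin_induction with
  | mem a ha =>
    obtain ⟨j, s, rfl⟩ := ha
    rw [← one_mul (_ - _)]
    refine Submodule.mul_mem_mul (one_mem (U.nilpotentPart D ħ (-1))) ?_
    rcases eq_or_ne i j with rfl | hij
    · rw [U.x_x_same]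
      exact Submodule.smul_mem _ _ (sub_mem (U.phiZ_mem_cartanPart _ _ _) (U.phiZ_mem_cartanPart _ _ _))
    · rw [U.x_x_ne hij, sub_self]
      exact zero_mem _
  | algebraMap c => rw [Algebra.commutes, sub_self]; exact zero_mem _
  | add a b _ _ ha hb =>
    rw [mul_add, add_mul, add_sub_add_comm]
    exact add_mem ha hb
  | mul a b ha' hb' ha hb =>
    rw [mul_sub_mul_mul]
    refine add_mem ?_ ?_
    · have h1 := Submodule.mul_mem_mul ha ((Subalgebra.mem_toSubmodule _).2 hb')
      rw [mul_assoc] at h1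
      have h2 := mul_le_mul_right (U.cartanPart_mul_nilpotentPart (D := D) (ħ := ħ) (-1))
        (U.nilSubmodule D ħ (-1)) h1
      rwa [← mul_assoc, Subalgebra.toSubmodule_mul_self] at h2
    · have ha'' : a ∈ U.nilSubmodule D ħ (-1) := ha'
      have h1 := Submodule.mul_mem_mul ha'' hb
      rw [← mul_assoc (U.nilSubmodule D ħ (-1)), Subalgebra.toSubmodule_mul_self] at h1
      exact h1

/-- The elements whose left multiplication preserves `M`. -/
def leftStabilizer {R A : Type*} [CommSemiring R] [Semiring A] [Algebra R A] (M : Submodule R A) :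
    Subalgebra R A where
  carrier := {a | ∀ m ∈ M, a * m ∈ M}
  mul_mem' := fun {a b} ha hb m hm => by rw [mul_assoc a b m]; exact ha _ (hb m hm)
  add_mem' := fun ha hb m hm => by rw [add_mul]; exact add_mem (ha m hm) (hb m hm)
  algebraMap_mem' := fun c m hm => by
    rw [← Algebra.smul_def]
    exact Submodule.smul_mem _ c hm

/-- The product of the three parts contains `1` and is stable under left multiplication by all
generators. Only spanning is needed here, not freeness. -/
theorem U.triangular : U.nilSubmodule D ħ (-1) * U.cartanSubmodule D ħ * U.nilSubmodule D ħ 1 = ⊤ := by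
  let S := leftStabilizer (U.nilSubmodule D ħ (-1) * U.cartanSubmodule D ħ * U.nilSubmodule D ħ 1)
  have hH (a : U D ħ) (ha : a ∈ U.cartanPart D ħ) : a ∈ S := by
    intro m hm
    have h1 := Submodule.mul_mem_mul ((Subalgebra.mem_toSubmodule _).2 ha) hm
    rw [← mul_assoc, ← mul_assoc] at h1
    have h2 := mul_le_mul_left (mul_le_mul_left
      (U.cartanPart_mul_nilpotentPart (D := D) (ħ := ħ) (-1)) (U.cartanSubmodule D ħ))
      (U.nilSubmodule D ħ 1)
    have h3 := h2 h1
    rwa [mul_assoc (U.nilSubmodule D ħ (-1)), Subalgebra.toSubmodule_mul_self] at h3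
  have hS : S = ⊤ := by
    refine U.eq_top_of_gen (S := S) ?_ (fun h => hH _ (U.k_mem_cartanPart h))
      fun i m => hH _ (U.h_mem_cartanPart i m)
    intro ε i r
    rcases Int.units_eq_one_or ε with rfl | rfl
    · intro m hm
      rw [mul_assoc] at hm
      induction hm using Submodule.mul_induction_on' with
      | add x _ y _ hx hy => rw [mul_add]; exact add_mem hx hy
      | mem_mul_mem w hw b hb =>
        -- Move `x^+` past `w`: the commutator is absorbed by the negative and Cartan parts, and the
        -- remaining `x^+` passes the Cartan part to join the positive part.
        rw [← mul_assoc, ← sub_add_cancel (U.x D ħ 1 i r * w) (w * U.x D ħ 1 i r), add_mul]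
        refine add_mem ?_ ?_
        · have h1 := Submodule.mul_mem_mul (U.x_commutator_mem i r hw) hb
          rwa [mul_assoc, ← mul_assoc (U.cartanSubmodule D ħ), Subalgebra.toSubmodule_mul_self, ← mul_assoc] at h1
        · rw [mul_assoc, mul_assoc]
          refine Submodule.mul_mem_mul hw ?_
          have h1 := Submodule.mul_mem_mul
            ((Subalgebra.mem_toSubmodule _).2 (U.x_mem_nilpotentPart (D := D) (ħ := ħ) 1 i r)) hb
          rw [← mul_assoc] at h1
          have h2 := mul_le_mul_left (U.nilpotentPart_mul_cartanPart (D := D) (ħ := ħ) 1)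
            (U.nilSubmodule D ħ 1)
          have h3 := h2 h1
          rwa [mul_assoc, Subalgebra.toSubmodule_mul_self] at h3
    · intro m hm
      have h1 := Submodule.mul_mem_mul
        ((Subalgebra.mem_toSubmodule _).2 (U.x_mem_nilpotentPart (D := D) (ħ := ħ) (-1) i r)) hm
      rwa [← mul_assoc, ← mul_assoc, Subalgebra.toSubmodule_mul_self] at h1
  rw [eq_top_iff]
  intro a _
  have ha : a ∈ S := hS ▸ Algebra.mem_top
  have := ha 1 (by
    have := Submodule.mul_mem_mul (Submodule.mul_mem_mul
      ((Subalgebra.mem_toSubmodule _).2 (one_mem (U.nilpotentPart D ħ (-1))))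
      ((Subalgebra.mem_toSubmodule _).2 (one_mem (U.cartanPart D ħ))))
      ((Subalgebra.mem_toSubmodule _).2 (one_mem (U.nilpotentPart D ħ 1)))
    rwa [mul_one, mul_one] at this)
  rwa [mul_one] at this

/-- Independent functionals take arbitrary prescribed values. The resulting `k_h` detects the length
of a word in the `x^ε`. -/
theorem CartanDatum.exists_root_eq_one (D : CartanDatum ι 𝔥) : ∃ h : 𝔥, ∀ i, D.root i h = 1 := by
  let f : 𝔥 →ₗ[ℚ] ι → ℚ := LinearMap.pi D.root
  have hf : LinearMap.range f = ⊤ := by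
    by_contra hne
    obtain ⟨g, hg, hg'⟩ := Submodule.exists_le_ker_of_lt_top _ (lt_top_iff_ne_top.2 hne)
    apply hg
    have h0 : ∑ i, g (Pi.single i 1) • D.root i = 0 := by
      ext h
      have h1 : g (f h) = 0 := hg' ⟨h, rfl⟩
      rw [LinearMap.pi_apply_eq_sum_univ] at h1
      rw [LinearMap.sum_apply, LinearMap.zero_apply, ← h1]
      refine Finset.sum_congr rfl fun i _ => ?_
      rw [LinearMap.smul_apply, smul_eq_mul, smul_eq_mul, mul_comm]
      congr 2
      ext j
      simp [Pi.single_apply, eq_comm]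
    have h1 := Fintype.linearIndependent_iff.1 D.root_indep _ h0
    exact LinearMap.pi_ext' fun i => LinearMap.ext_ring (by simpa using h1 i)
  obtain ⟨h, hh⟩ := LinearMap.range_eq_top.1 hf fun _ => 1
  exact ⟨h, fun i => congrFun hh i⟩

end Triangular

end QAff

namespace QAff

/-! ### Uniform bound for the poles at `u = 1` -/

section BoundedPoles

variable {ι : Type w₁} [Fintype ι] [DecidableEq ι] {𝔥 : Type w₂} [AddCommGroup 𝔥] [Module ℚ 𝔥]
variable {D : CartanDatum ι 𝔥} {ħ : ℂ}
variable {E : Type*} [Ring E] [Algebra ℂ E] {π₁ π₂ : U D ħ →ₐ[ℂ] E}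

theorem deltaH_mem_baseLattice (i : ι) (m) : deltaH π₁ π₂ i m ∈ baseLattice E :=
  add_mem (one_tmul_mem_baseLattice _) (tmul_mem_baseLattice (zpow_X_mem_regularAtOne _) _)

theorem deltaK_mem_baseLattice (h : 𝔥) : deltaK π₁ π₂ h ∈ baseLattice E :=
  one_tmul_mem_baseLattice _

variable [FiniteDimensional ℂ E] (hq : ∀ n : ℕ, n ≠ 0 → Complex.exp ħ ^ n ≠ 1)
  (hc : ∀ a b, Commute (π₁ a) (π₂ b))

/-- Commutators with `Δ(h_{i,±1})`, which are regular at `u = 1`, reach every `Δ(x_r)` from `Δ(x_0)`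
without raising the pole order. -/
theorem deltaX_mem_poleFiltration_of_zero (hq : ∀ n : ℕ, n ≠ 0 → Complex.exp ħ ^ n ≠ 1)
    (hc : ∀ a b, Commute (π₁ a) (π₂ b)) {N : ℕ} {ε : ℤˣ} {i : ι}
    (h0 : deltaX π₁ π₂ ε i 0 ∈ poleFiltration E N) (r : ℤ) :
    deltaX π₁ π₂ ε i r ∈ poleFiltration E N := by
  have step (m r : ℤ) (hm : m ≠ 0) (hr : deltaX π₁ π₂ ε i r ∈ poleFiltration E N) :
      deltaX π₁ π₂ ε i (m + r) ∈ poleFiltration E N := by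
    have h1 := deltaH_deltaX hq hc i ⟨m, hm⟩ ε i r
    have h2 : deltaX π₁ π₂ ε i (m + r) = (hxCoeff D ħ m ε i i)⁻¹ •
        (deltaH π₁ π₂ i ⟨m, hm⟩ * deltaX π₁ π₂ ε i r -
          deltaX π₁ π₂ ε i r * deltaH π₁ π₂ i ⟨m, hm⟩) := by
      rw [h1, smul_smul, inv_mul_cancel₀ (hxCoeff_self_ne_zero hq hm ε i), one_smul]
    have hH : deltaH π₁ π₂ i ⟨m, hm⟩ ∈ poleFiltration E 0 :=
      baseLattice_le_poleFiltration (deltaH_mem_baseLattice i _) 0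
    rw [h2]
    refine Submodule.smul_mem _ _ (sub_mem ?_ ?_)
    · simpa using mul_mem_poleFiltration hH hr
    · simpa using mul_mem_poleFiltration hr hH
  induction r using Int.induction_on with
  | zero => exact h0
  | succ n ih => rw [add_comm]; exact step 1 n one_ne_zero ih
  | pred n ih => rw [sub_eq_neg_add]; exact step (-1) (-n) (by norm_num) ih

theorem exists_deltaX_mem_poleFiltration (hq : ∀ n : ℕ, n ≠ 0 → Complex.exp ħ ^ n ≠ 1)
    (hc : ∀ a b, Commute (π₁ a) (π₂ b)) :
    ∃ N, ∀ ε i r, deltaX π₁ π₂ ε i r ∈ poleFiltration E N := by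
  choose f hf using fun p : ℤˣ × ι => exists_pow_smul_mem_baseLattice (deltaX π₁ π₂ p.1 p.2 0)
  refine ⟨Finset.univ.sup f, fun ε i r => deltaX_mem_poleFiltration_of_zero hq hc ?_ r⟩
  exact poleFiltration_mono (Finset.le_sup (f := f) (Finset.mem_univ (ε, i))) (hf (ε, i))

/-- The product of the `x^ε_{i,r}` over a list of indices `(i, r)`. -/
noncomputable def deltaWord (π₁ π₂ : U D ħ →ₐ[ℂ] E) (ε : ℤˣ) (l : List (ι × ℤ)) : K ⊗[ℂ] E :=
  (l.map fun p => deltaX π₁ π₂ ε p.1 p.2).prod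

theorem deltaK_mul_deltaWord (hq : ∀ n : ℕ, n ≠ 0 → Complex.exp ħ ^ n ≠ 1)
    (hc : ∀ a b, Commute (π₁ a) (π₂ b)) {h : 𝔥} (hh : ∀ i, D.root i h = 1) (ε : ℤˣ)
    (l : List (ι × ℤ)) : deltaK π₁ π₂ h * deltaWord π₁ π₂ ε l =
      qPow ħ (((ε : ℤ) : ℚ) * l.length) • (deltaWord π₁ π₂ ε l * deltaK π₁ π₂ h) := by
  induction l with
  | nil => simp [deltaWord, qPow_zero]
  | cons p l ih =>
    rw [deltaWord, List.map_cons, List.prod_cons, ← mul_assoc, deltaK_deltaX hq hc, hh,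
      smul_mul_assoc, mul_assoc, ← deltaWord, ih, mul_smul_comm, smul_smul, ← qPow_add, mul_assoc,
      List.length_cons]
    congr 2
    push_cast
    ring

/-- Words of different lengths have different weights in an algebra of finite dimension over `K`, so
nonzero words exist for finitely many lengths only. -/
theorem exists_deltaWord_eq_zero (hq : ∀ n : ℕ, n ≠ 0 → Complex.exp ħ ^ n ≠ 1)
    (hc : ∀ a b, Commute (π₁ a) (π₂ b)) (ε : ℤˣ) :
    ∃ N, ∀ l : List (ι × ℤ), N ≤ l.length → deltaWord π₁ π₂ ε l = 0 := by
  classical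
  obtain ⟨h, hh⟩ := D.exists_root_eq_one
  let L : ℕ → List (ι × ℤ) → Prop := fun n l => l.length = n ∧ deltaWord π₁ π₂ ε l ≠ 0
  -- One nonzero word is chosen for each length that admits one; the value is zero exactly for the
  -- other lengths.
  let y : ℕ → K ⊗[ℂ] E := fun n =>
    if hn : ∃ l, L n l then deltaWord π₁ π₂ ε hn.choose else 0
  have hkk : deltaK π₁ π₂ h * deltaK π₁ π₂ (-h) = 1 := by
    rw [deltaK_mul hc, add_neg_cancel, deltaK_zero]
  have hfin := finite_setOf_ne_zero (F := K) hkk y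
    (fun n => algebraMap ℂ K (qPow ħ (((ε : ℤ) : ℚ) * n))) (fun a b hab => by
      have h1 := qPow_injective hq ((algebraMap ℂ K).injective hab)
      have h2 : (((ε : ℤ) : ℚ)) ≠ 0 := Int.cast_ne_zero.2 ε.ne_zero
      exact_mod_cast mul_left_cancel₀ h2 h1) fun n => by
      rw [algebraMap_smul]
      by_cases hn : ∃ l, L n l
      · simp only [y, dif_pos hn]
        rw [deltaK_mul_deltaWord hq hc hh, hn.choose_spec.1]
      · simp only [y, dif_neg hn, mul_zero, zero_mul, smul_zero]
  obtain ⟨N, hN⟩ := hfin.exists_notMem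
  have hN0 (l : List (ι × ℤ)) (hl : l.length = N) : deltaWord π₁ π₂ ε l = 0 := by
    by_contra hne
    have hn : ∃ l, L N l := ⟨l, hl, hne⟩
    apply hN
    change y N ≠ 0
    simp only [y, dif_pos hn]
    exact hn.choose_spec.2
  refine ⟨N, fun l hl => ?_⟩
  rw [← List.take_append_drop N l, deltaWord, List.map_append, List.prod_append, ← deltaWord,
    hN0 _ (by simpa using hl), zero_mul]

/-- A word of length less than `M` has a pole of order at most `N M`, and longer words act by zero.
-/
theorem delta_nilpotentPart_mem (hq : ∀ n : ℕ, n ≠ 0 → Complex.exp ħ ^ n ≠ 1)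
    (hc : ∀ a b, Commute (π₁ a) (π₂ b)) (ε : ℤˣ) :
    ∃ N, ∀ a ∈ U.nilSubmodule D ħ ε, delta hq hc a ∈ poleFiltration E N := by
  obtain ⟨N, hN⟩ := exists_deltaX_mem_poleFiltration hq hc
  obtain ⟨M, hM⟩ := exists_deltaWord_eq_zero hq hc ε
  refine ⟨N * M, fun a ha => ?_⟩
  have hw (l : List (ι × ℤ)) : deltaWord π₁ π₂ ε l ∈ poleFiltration E (N * M) := by
    by_cases hl : M ≤ l.length
    · rw [hM l hl]
      exact zero_mem _
    · refine poleFiltration_mono (N := N * l.length) (Nat.mul_le_mul_left N (by omega)) ?_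
      have := list_prod_mem_poleFiltration (N := N) (l.map fun p => deltaX π₁ π₂ ε p.1 p.2) (by
        intro y hy
        obtain ⟨p, -, rfl⟩ := List.mem_map.1 hy
        exact hN _ _ _)
      rwa [List.length_map] at this
  have ha' : a ∈ Submodule.span ℂ
      (Submonoid.closure {a | ∃ i r, a = U.x D ħ ε i r} : Set (U D ħ)) := by
    rw [← Algebra.adjoin_eq_span]
    exact ha
  have hle : Submodule.span ℂ (Submonoid.closure {a | ∃ i r, a = U.x D ħ ε i r} : Set (U D ħ)) ≤
      (poleFiltration E (N * M)).comap (delta hq hc).toLinearMap := by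
    refine Submodule.span_le.2 fun b hb => ?_
    obtain ⟨l, hl, rfl⟩ := Submonoid.exists_list_of_mem_closure hb
    obtain ⟨l', rfl⟩ : ∃ l' : List (ι × ℤ), l = l'.map fun p => U.x D ħ ε p.1 p.2 := by
      clear hb
      induction l with
      | nil => exact ⟨[], rfl⟩
      | cons z l ih =>
        obtain ⟨l', rfl⟩ := ih fun y hy => hl y (by simp [hy])
        obtain ⟨i, r, rfl⟩ := hl z (by simp)
        exact ⟨(i, r) :: l', rfl⟩
    change delta hq hc _ ∈ poleFiltration E (N * M)
    rw [map_list_prod, List.map_map]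
    have : (delta hq hc ∘ fun p : ι × ℤ => U.x D ħ ε p.1 p.2) =
        fun p : ι × ℤ => deltaX π₁ π₂ ε p.1 p.2 := funext fun p => delta_x hq hc _ _ _
    rw [this]
    exact hw l'
  exact hle ha'

theorem delta_cartanPart_mem {a : U D ħ} (ha : a ∈ U.cartanSubmodule D ħ) :
    delta hq hc a ∈ baseLattice E := by
  induction ha using Algebra.adjoin_induction with
  | mem a ha =>
    rcases ha with ⟨h, rfl⟩ | ⟨i, m, rfl⟩
    · rw [delta_k]
      exact deltaK_mem_baseLattice h
    · rw [delta_h]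
      exact deltaH_mem_baseLattice i m
  | algebraMap c =>
    rw [AlgHom.commutes, Algebra.TensorProduct.algebraMap_apply]
    exact tmul_mem_baseLattice (regularAtOne.algebraMap_mem c) 1
  | add a b _ _ ha hb => rw [map_add]; exact add_mem ha hb
  | mul a b _ _ ha hb => rw [map_mul]; exact mul_mem_baseLattice ha hb

/-- The poles at `u = 1` of the action of all elements of `𝒰_q(ĝ)` have bounded order. -/
theorem exists_delta_mem_poleFiltration : ∃ N, ∀ a, delta hq hc a ∈ poleFiltration E N := by
  obtain ⟨N, hN⟩ := delta_nilpotentPart_mem hq hc (-1)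
  obtain ⟨M, hM⟩ := delta_nilpotentPart_mem hq hc 1
  refine ⟨N + 0 + M, fun a => ?_⟩
  have ha : a ∈ U.nilSubmodule D ħ (-1) * U.cartanSubmodule D ħ * U.nilSubmodule D ħ 1 := by
    rw [U.triangular]
    trivial
  induction ha using Submodule.mul_induction_on' with
  | add x _ y _ hx hy => rw [map_add]; exact add_mem hx hy
  | mem_mul_mem w hw b hb =>
    rw [map_mul]
    refine mul_mem_poleFiltration ?_ (hM b hb)
    induction hw using Submodule.mul_induction_on' with
    | add x _ y _ hx hy => rw [map_add]; exact add_mem hx hy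
    | mem_mul_mem w' hw' b' hb' =>
      rw [map_mul]
      exact mul_mem_poleFiltration (hN w' hw')
        (baseLattice_le_poleFiltration (delta_cartanPart_mem hq hc hb') 0)

end BoundedPoles

/-! ### The ring `𝒜` is Noetherian with residue field `ℂ` -/

section Noetherian

/-- `𝒜` is a localization of `ℂ[X]`: every ideal is generated by its contraction to polynomials. -/
instance regularAtOne_isNoetherianRing : IsNoetherianRing regularAtOne := by
  let φ : ℂ[X] →+* regularAtOne := (algebraMap ℂ[X] K).codRestrict regularAtOne.toSubring
    algebraMap_mem_regularAtOne
  refine (isNoetherianRing_iff_ideal_fg _).2 fun I => ?_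
  have : I = (I.comap φ).map φ := by
    refine le_antisymm (fun a ha => ?_) Ideal.map_comap_le
    obtain ⟨f, g, hg, hfg⟩ := a.2
    have hg0 : algebraMap ℂ[X] K g ≠ 0 := RatFunc.algebraMap_ne_zero (by rintro rfl; simp at hg)
    have h1 : φ f = φ g * a := Subtype.ext (by
      change algebraMap ℂ[X] K f = algebraMap ℂ[X] K g * a
      rw [hfg, mul_div_cancel₀ _ hg0])
    have h2 : f ∈ I.comap φ := by
      rw [Ideal.mem_comap, h1]
      exact I.mul_mem_left _ ha
    let b : regularAtOne := ⟨(algebraMap ℂ[X] K g)⁻¹, 1, g, hg, by rw [map_one, one_div]⟩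
    have h3 : a = b * φ f := by
      rw [h1, ← mul_assoc]
      have : b * φ g = 1 := Subtype.ext (inv_mul_cancel₀ hg0)
      rw [this, one_mul]
    rw [h3]
    exact Ideal.mul_mem_left _ _ (Ideal.mem_map_of_mem φ h2)
  rw [this]
  exact Ideal.FG.map (IsNoetherian.noetherian _) φ

/-- Modulo `u - 1`, every element of `𝒜` is a constant. -/
theorem exists_eq_const_add {a : K} (ha : a ∈ regularAtOne) :
    ∃ c : ℂ, ∃ b ∈ regularAtOne, a = algebraMap ℂ K c + (RatFunc.X - 1) * b := by
  obtain ⟨f, g, hg, rfl⟩ := ha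
  have hg0 : algebraMap ℂ[X] K g ≠ 0 := RatFunc.algebraMap_ne_zero (by rintro rfl; simp at hg)
  obtain ⟨p, hp⟩ : (Polynomial.X - Polynomial.C (1 : ℂ)) ∣
      f - Polynomial.C (f.eval 1 / g.eval 1) * g :=
    Polynomial.dvd_iff_isRoot.2 (by simp [Polynomial.IsRoot, hg])
  refine ⟨f.eval 1 / g.eval 1, algebraMap ℂ[X] K p / algebraMap ℂ[X] K g, ⟨p, g, hg, rfl⟩, ?_⟩
  have h1 := congrArg (algebraMap ℂ[X] K) hp
  rw [map_sub, map_mul, map_mul, map_sub, RatFunc.algebraMap_X, map_one, map_one,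
    show algebraMap ℂ[X] K (Polynomial.C (f.eval 1 / g.eval 1)) =
      algebraMap ℂ K (f.eval 1 / g.eval 1) from (IsScalarTower.algebraMap_apply ℂ ℂ[X] K _).symm] at h1
  rw [eq_comm, mul_div_assoc', ← h1]
  field_simp
  ring

variable (W : Type*) [AddCommGroup W] [Module ℂ W]

instance baseLattice_finite [FiniteDimensional ℂ W] : Module.Finite regularAtOne (baseLattice W) := by
  classical
  refine Module.Finite.iff_fg.2 ?_
  let b := Module.finBasis ℂ W
  refine ⟨Finset.univ.image fun i => (1 : K) ⊗ₜ[ℂ] b i, le_antisymm ?_ ?_⟩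
  · refine Submodule.span_le.2 fun y hy => ?_
    simp only [Finset.coe_image, Finset.coe_univ, Set.image_univ] at hy
    obtain ⟨i, rfl⟩ := hy
    exact one_tmul_mem_baseLattice _
  · refine Submodule.span_le.2 ?_
    rintro _ ⟨w, rfl⟩
    change (1 : K) ⊗ₜ[ℂ] w ∈ _
    rw [← b.sum_repr w, tmul_sum]
    refine sum_mem fun i _ => ?_
    rw [tmul_smul, ← algebraMap_smul K (b.repr w i)]
    refine regular_smul_mem (regularAtOne.algebraMap_mem _) (Submodule.subset_span ?_)
    simp

end Noetherian

end QAff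

namespace QAff

/-! ### Weights of finite dimensional modules -/

section Weights

variable {ι : Type w₁} [Fintype ι] [DecidableEq ι] {𝔥 : Type w₂} [AddCommGroup 𝔥] [Module ℚ 𝔥]
variable {D : CartanDatum ι 𝔥} {ħ : ℂ}
variable (V : Type v) [AddCommGroup V] [Module ℂ V] [Module (U D ħ) V] [IsScalarTower ℂ (U D ħ) V]

/-- These are simultaneous eigenspaces of the commuting `k_h`. Distinct weights give distinct
systems of eigenvalues because `x ↦ q ^ x` is injective on `ℚ`. -/
theorem weightSpace_iSupIndep (hq : ∀ n : ℕ, n ≠ 0 → Complex.exp ħ ^ n ≠ 1) :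
    iSupIndep (weightSpace D ħ V) := by
  let f : 𝔥 → Module.End ℂ V := fun h => Algebra.lsmul ℂ ℂ V (U.k D ħ h)
  have hf (i j : 𝔥) : Commute (f i) (f j) := by
    have : Commute (U.k D ħ i) (U.k D ħ j) := by
      rw [Commute, SemiconjBy, ← U.k_add, ← U.k_add, add_comm]
    exact this.map (Algebra.lsmul ℂ ℂ V)
  have h1 := Module.End.independent_iInf_maxGenEigenspace_of_forall_mapsTo f fun i j φ =>
    Module.End.mapsTo_maxGenEigenspace_of_comm (hf j i) φ
  have hinj : Function.Injective fun (ω : Module.Dual ℚ 𝔥) (h : 𝔥) => qPow ħ (ω h) :=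
    fun ω ω' h => LinearMap.ext fun x => qPow_injective hq (congrFun h x)
  refine (h1.comp hinj).mono fun ω v hv => ?_
  rw [Function.comp_apply, Submodule.mem_iInf]
  intro h
  exact ((f h).genEigenspace _).monotone le_top (Module.End.mem_eigenspace_iff.2 (hv h))

variable {V}

theorem U.x_smul_mem_weightSpace (ε : ℤˣ) (i : ι) (r : ℤ) {ω : Module.Dual ℚ 𝔥} {v : V}
    (hv : v ∈ weightSpace D ħ V ω) :
    U.x D ħ ε i r • v ∈ weightSpace D ħ V (ω + ((ε : ℤ) : ℚ) • D.root i) := by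
  intro h
  rw [← mul_smul, U.k_mul_x, smul_assoc, mul_smul, hv h, smul_comm (U.x D ħ ε i r), smul_smul,
    ← qPow_add]
  congr 2
  rw [LinearMap.add_apply, LinearMap.smul_apply, smul_eq_mul, add_comm]

theorem smul_mem_weightSpace_of_commute {a : U D ħ} (ha : ∀ h, Commute (U.k D ħ h) a)
    {ω : Module.Dual ℚ 𝔥} {v : V} (hv : v ∈ weightSpace D ħ V ω) :
    a • v ∈ weightSpace D ħ V ω := by
  intro h
  rw [← mul_smul, (ha h).eq, mul_smul, hv h, smul_comm]

theorem smul_mem_iSup_weightSpace (a : U D ħ) {v : V} (hv : v ∈ ⨆ ω, weightSpace D ħ V ω) :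
    a • v ∈ ⨆ ω, weightSpace D ħ V ω := by
  let S : Subalgebra ℂ (U D ħ) :=
    { carrier := {a | ∀ v ∈ ⨆ ω, weightSpace D ħ V ω, a • v ∈ ⨆ ω, weightSpace D ħ V ω}
      mul_mem' := fun {a b} ha hb v hv => by rw [mul_smul]; exact ha _ (hb v hv)
      add_mem' := fun {a b} ha hb v hv => by rw [add_smul]; exact add_mem (ha v hv) (hb v hv)
      algebraMap_mem' := fun c v hv => by
        rw [algebraMap_smul]
        exact Submodule.smul_mem _ c hv }
  have key (a : U D ħ) (g : Module.Dual ℚ 𝔥 → Module.Dual ℚ 𝔥)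
      (h : ∀ ω, ∀ v ∈ weightSpace D ħ V ω, a • v ∈ weightSpace D ħ V (g ω)) : a ∈ S := by
    intro v hv
    induction hv using Submodule.iSup_induction' with
    | mem ω v hv => exact Submodule.mem_iSup_of_mem (g ω) (h ω v hv)
    | zero => rw [smul_zero]; exact zero_mem _
    | add x y _ _ hx hy => rw [smul_add]; exact add_mem hx hy
  have hS : S = ⊤ := U.eq_top_of_gen (S := S)
    (fun ε i r => key _ _ fun ω v hv => U.x_smul_mem_weightSpace ε i r hv)
    (fun h => key _ id fun ω v hv => smul_mem_weightSpace_of_commute (fun h' => U.k_mul_k h' h) hv)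
    fun i m => key _ id fun ω v hv => smul_mem_weightSpace_of_commute (fun h' => U.k_mul_h h' i m) hv
  have ha : a ∈ S := hS ▸ Algebra.mem_top
  exact ha v hv

theorem finite_setOf_weightSpace_ne_bot [FiniteDimensional ℂ V]
    (hq : ∀ n : ℕ, n ≠ 0 → Complex.exp ħ ^ n ≠ 1) : {ω | weightSpace D ħ V ω ≠ ⊥}.Finite :=
  WellFoundedGT.finite_ne_bot_of_iSupIndep (weightSpace_iSupIndep V hq)

theorem isIntegrable_of_iSup_eq_top [FiniteDimensional ℂ V]
    (hq : ∀ n : ℕ, n ≠ 0 → Complex.exp ħ ^ n ≠ 1) (h : ⨆ ω, weightSpace D ħ V ω = ⊤) :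
    IsIntegrable D ħ V := by
  refine ⟨⟨weightSpace_iSupIndep V hq, h⟩, fun ω => inferInstance, fun ω i => ?_⟩
  have hα : D.root i ≠ 0 := D.root_indep.ne_zero i
  have hfin := finite_setOf_weightSpace_ne_bot (D := D) (V := V) hq
  have hinj (c : ℚ) (hc : c ≠ 0) : Function.Injective fun r : ℕ => ω + c • (r • D.root i) := by
    intro a b hab
    have h1 := smul_right_injective _ hc (add_left_cancel hab)
    simp only [← Nat.cast_smul_eq_nsmul ℚ] at h1
    exact_mod_cast smul_left_injective ℚ hα h1
  have key (c : ℚ) (hc : c ≠ 0) : ∃ R : ℕ, ∀ r, R ≤ r →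
      weightSpace D ħ V (ω + c • (r • D.root i)) = ⊥ := by
    obtain ⟨R, hR⟩ := (hfin.preimage (hinj c hc).injOn).bddAbove
    refine ⟨R + 1, fun r hr => ?_⟩
    by_contra hne
    have := hR (show r ∈ _ from hne)
    omega
  obtain ⟨R₁, h₁⟩ := key 1 one_ne_zero
  obtain ⟨R₂, h₂⟩ := key (-1) (by norm_num)
  refine ⟨max R₁ R₂, fun r hr => ⟨?_, ?_⟩⟩
  · simpa using h₁ r (le_trans (le_max_left _ _) hr)
  · simpa [sub_eq_add_neg] using h₂ r (le_trans (le_max_right _ _) hr)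

theorem inCategoryO_of_iSup_eq_top [FiniteDimensional ℂ V]
    (hq : ∀ n : ℕ, n ≠ 0 → Complex.exp ħ ^ n ≠ 1) (h : ⨆ ω, weightSpace D ħ V ω = ⊤) :
    InCategoryO D ħ V := by
  refine ⟨⟨weightSpace_iSupIndep V hq, h⟩, fun ω => inferInstance,
    (finite_setOf_weightSpace_ne_bot (D := D) (V := V) hq).toFinset, fun ω hω => ⟨ω, ?_, 0, ?_⟩⟩
  · simpa using hω
  · simp

/-- A finite dimensional module has finitely many weights, so the root string and boundedness
conditions are automatic; only diagonalizability remains to be checked. -/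
theorem isModf_of_iSup_eq_top (hq : ∀ n : ℕ, n ≠ 0 → Complex.exp ħ ^ n ≠ 1)
    (M : ModuleCat.{v} (U D ħ)) (hM : FiniteDimensional ℂ M)
    (h : ⨆ ω, weightSpace D ħ M ω = ⊤) : isModf D ħ M :=
  ⟨isIntegrable_of_iSup_eq_top hq h, inCategoryO_of_iSup_eq_top hq h, hM⟩

end Weights

/-! ### The `𝒜`-form -/

section Lattice

variable {ι : Type w₁} [Fintype ι] [DecidableEq ι] {𝔥 : Type w₂} [AddCommGroup 𝔥] [Module ℚ 𝔥]
variable {D : CartanDatum ι 𝔥} {ħ : ℂ}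

section

variable {X : Type v} [AddCommGroup X] [Module ℂ X] [Module K X] [IsScalarTower ℂ K X]
variable {ρ : U D ħ →ₐ[ℂ] Module.End K X}

theorem lattice_smul_mem {S : Set X} {a : K} (ha : a ∈ regularAtOne) {x : RepSpace ρ}
    (hx : x ∈ lattice ρ S) : a • x ∈ lattice ρ S := by
  induction hx using Submodule.span_induction with
  | zero => rw [smul_zero]; exact zero_mem _
  | add x y _ _ hx hy => rw [smul_add]; exact add_mem hx hy
  | smul g x _ hx =>
    have : a • g • x = g • a • x := ((ρ g).map_smul a x).symm
    rw [this]
    exact Submodule.smul_mem _ g hx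
  | mem x hx =>
    obtain ⟨b, hb, s, hs, rfl⟩ := hx
    exact Submodule.subset_span ⟨a * b, mul_mem ha hb, s, hs, (mul_smul a b s).symm⟩

/-- The lattice as an `𝒜`-submodule. -/
noncomputable def latticeRegular (ρ : U D ħ →ₐ[ℂ] Module.End K X) (S : Set X) :
    Submodule regularAtOne X where
  carrier := {x | (show RepSpace ρ from x) ∈ lattice ρ S}
  add_mem' ha hb := (lattice ρ S).add_mem ha hb
  zero_mem' := (lattice ρ S).zero_mem
  smul_mem' c _ hx := lattice_smul_mem c.2 hx

theorem mem_latticeRegular {S : Set X} {x : X} :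
    x ∈ latticeRegular ρ S ↔ (show RepSpace ρ from x) ∈ lattice ρ S := Iff.rfl

theorem algebraMap_smul_repSpace (c : ℂ) (x : RepSpace ρ) :
    algebraMap ℂ (U D ħ) c • x = algebraMap ℂ K c • x := by
  change ρ (algebraMap ℂ (U D ħ) c) x = _
  rw [AlgHom.commutes]
  exact (algebraMap_smul K c (show X from x)).symm

/-- The specialization of a finitely generated lattice is finite dimensional. -/
theorem finiteDimensional_of_surjective {S : Set X} (hfg : (latticeRegular ρ S).FG)
    {Q : Type v} [AddCommGroup Q] [Module ℂ Q] [Module (U D ħ) Q] [IsScalarTower ℂ (U D ħ) Q]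
    (p : lattice ρ S →ₗ[U D ħ] Q) (hp : Function.Surjective p)
    (hp0 : ∀ x y : lattice ρ S, (x : RepSpace ρ) = (RatFunc.X - 1 : K) • (y : RepSpace ρ) → p x = 0) :
    FiniteDimensional ℂ Q := by
  obtain ⟨T, hT⟩ := hfg
  have hTL (t : X) (ht : t ∈ T) : (show RepSpace ρ from t) ∈ lattice ρ S := by
    rw [← mem_latticeRegular, ← hT]
    exact Submodule.subset_span ht
  let T' : Set Q := Set.range fun t : T => p ⟨t.1, hTL t.1 t.2⟩
  have hfin : T'.Finite := Set.finite_range _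
  refine Module.finite_def.2 ⟨hfin.toFinset, ?_⟩
  rw [Set.Finite.coe_toFinset, eq_top_iff]
  rintro y -
  obtain ⟨⟨x, hx⟩, rfl⟩ := hp y
  have hx' : (show X from x) ∈ Submodule.span regularAtOne (T : Set X) := by
    rw [hT]
    exact hx
  suffices h : ∀ (x : X) (_ : x ∈ Submodule.span regularAtOne (T : Set X)),
      ∃ hx : (show RepSpace ρ from x) ∈ lattice ρ S, p ⟨x, hx⟩ ∈ Submodule.span ℂ T' from
    (h x hx').2
  intro x hx
  induction hx using Submodule.span_induction with
  | zero =>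
    refine ⟨zero_mem _, ?_⟩
    have : p ⟨_, zero_mem (lattice ρ S)⟩ = 0 := map_zero p
    exact this ▸ zero_mem _
  | add x y _ _ hx hy =>
    obtain ⟨hx, hx'⟩ := hx
    obtain ⟨hy, hy'⟩ := hy
    refine ⟨(lattice ρ S).add_mem hx hy, ?_⟩
    have h1 := add_mem hx' hy'
    rwa [← map_add] at h1
  | mem t ht => exact ⟨hTL t ht, Submodule.subset_span ⟨⟨t, ht⟩, rfl⟩⟩
  | smul a x _ hx =>
    obtain ⟨hx, hx'⟩ := hx
    refine ⟨lattice_smul_mem a.2 hx, ?_⟩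
    -- Modulo `u - 1` the coefficient `a` acts as the constant `c`, so generators over `𝒜` become
    -- generators over `ℂ`.
    obtain ⟨c, b, hb, hab⟩ := exists_eq_const_add a.2
    have h1 := (Submodule.span ℂ T').smul_mem c hx'
    convert h1 using 1
    rw [← algebraMap_smul (U D ħ) c, ← map_smul, ← sub_eq_zero, ← map_sub]
    refine hp0 _ ⟨_, lattice_smul_mem hb hx⟩ ?_
    change (a : K) • (show RepSpace ρ from x) - algebraMap ℂ (U D ħ) c • (show RepSpace ρ from x) = _
    rw [algebraMap_smul_repSpace, hab, add_smul, add_sub_cancel_left, mul_smul]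

end

variable {V₁ V₂ : Type v}
  [AddCommGroup V₁] [Module ℂ V₁] [Module (U D ħ) V₁] [IsScalarTower ℂ (U D ħ) V₁]
  [AddCommGroup V₂] [Module ℂ V₂] [Module (U D ħ) V₂] [IsScalarTower ℂ (U D ħ) V₂]

/-- One exponent serves for the whole lattice, since the pole bound is uniform over the algebra. -/
theorem exists_pow_smul_mem_of_mem_tensorLattice [FiniteDimensional ℂ V₁] [FiniteDimensional ℂ V₂]
    (hq : ∀ n : ℕ, n ≠ 0 → Complex.exp ħ ^ n ≠ 1) :
    ∃ N : ℕ, ∀ x ∈ tensorLattice (fusionAction (D := D) V₁ V₂ hq),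
      ((RatFunc.X - 1 : K) ^ N • (show K ⊗[ℂ] (V₁ ⊗[ℂ] V₂) from x)) ∈
        baseLattice (V₁ ⊗[ℂ] V₂) := by
  obtain ⟨N, hN⟩ := exists_delta_mem_poleFiltration hq
    (actLeft_commute_actRight (D := D) (ħ := ħ) (V₁ := V₁) (V₂ := V₂))
  refine ⟨N, fun x hx => ?_⟩
  induction hx using Submodule.closure_induction with
  | zero =>
    have : (RatFunc.X - 1 : K) ^ N • (0 : K ⊗[ℂ] (V₁ ⊗[ℂ] V₂)) ∈ baseLattice (V₁ ⊗[ℂ] V₂) := by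
      rw [smul_zero]
      exact zero_mem _
    exact this
  | add x y _ _ hx hy =>
    have := add_mem hx hy
    rwa [← smul_add] at this
  | smul_mem g x hx =>
    obtain ⟨a, ha, _, ⟨w, rfl⟩, rfl⟩ := hx
    have h1 := tensorProductEnd_mem_baseLattice (hN g) (one_tmul_mem_baseLattice w)
    have h2 := regular_smul_mem ha h1
    convert h2 using 1
    rw [map_smul, LinearMap.smul_apply, smul_comm, ← map_smul]
    rfl

/-- Multiplication by `(u - 1) ^ N` embeds the lattice into a finitely generated module over a
Noetherian ring. -/
theorem isNoetherian_latticeRegular [FiniteDimensional ℂ V₁] [FiniteDimensional ℂ V₂]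
    (hq : ∀ n : ℕ, n ≠ 0 → Complex.exp ħ ^ n ≠ 1) :
    IsNoetherian regularAtOne (latticeRegular (fusionAction (D := D) V₁ V₂ hq)
      (Set.range fun t : V₁ ⊗[ℂ] V₂ => (1 : K) ⊗ₜ[ℂ] t)) := by
  obtain ⟨N, hN⟩ := exists_pow_smul_mem_of_mem_tensorLattice (D := D) (V₁ := V₁) (V₂ := V₂) hq
  let f : latticeRegular (fusionAction (D := D) V₁ V₂ hq)
      (Set.range fun t : V₁ ⊗[ℂ] V₂ => (1 : K) ⊗ₜ[ℂ] t) →ₗ[regularAtOne]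
      baseLattice (V₁ ⊗[ℂ] V₂) :=
    { toFun := fun x => ⟨(RatFunc.X - 1 : K) ^ N • x.1, hN x.1 x.2⟩
      map_add' := fun x y => Subtype.ext (smul_add _ x.1 y.1)
      map_smul' := fun c x => Subtype.ext (smul_comm ((RatFunc.X - 1 : K) ^ N) (c : K) x.1) }
  refine isNoetherian_of_injective f fun x y hxy => Subtype.ext ?_
  exact smul_right_injective _ (pow_ne_zero N X_sub_one_ne_zero) (congrArg Subtype.val hxy)

theorem tensorLattice_isAForm [FiniteDimensional ℂ V₁] [FiniteDimensional ℂ V₂]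
    (hq : ∀ n : ℕ, n ≠ 0 → Complex.exp ħ ^ n ≠ 1) :
    IsAForm (fusionAction (D := D) V₁ V₂ hq) (tensorLattice (fusionAction (D := D) V₁ V₂ hq)) := by
  set ρ := fusionAction (D := D) V₁ V₂ hq with hρ
  refine ⟨fun a ha x hx => lattice_smul_mem ha hx, ?_, fun ω => ?_⟩
  · rw [eq_top_iff]
    rintro x -
    have h1 (w : V₁ ⊗[ℂ] V₂) : ((1 : K) ⊗ₜ[ℂ] w : FusionSpace V₁ V₂) ∈ tensorLattice ρ :=
      Submodule.subset_span ⟨1, one_mem _, _, ⟨w, rfl⟩, (one_smul K _).symm⟩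
    change (show FusionSpace V₁ V₂ from x) ∈
      (Submodule.span K (tensorLattice ρ : Set (RepSpace ρ)) : Submodule K (RepSpace ρ))
    induction (show FusionSpace V₁ V₂ from x) using TensorProduct.induction_on with
    | zero => exact zero_mem _
    | add a b ha hb => exact add_mem ha hb
    | tmul a w =>
      have := Submodule.smul_mem (Submodule.span K (tensorLattice ρ : Set (RepSpace ρ))) a
        (Submodule.subset_span (h1 w))
      have e : (a ⊗ₜ[ℂ] w : FusionSpace V₁ V₂) = a • ((1 : K) ⊗ₜ[ℂ] w) := by
        rw [smul_tmul', smul_eq_mul, mul_one]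
      rw [e]
      exact this
  -- The intersection with a weight space is an `𝒜`-submodule of a Noetherian module.
  · let T : Submodule regularAtOne (FusionSpace V₁ V₂) :=
      latticeRegular ρ (Set.range fun t : V₁ ⊗[ℂ] V₂ => (1 : K) ⊗ₜ[ℂ] t) ⊓
        { carrier := {x | ∀ h : 𝔥, ρ (U.k D ħ h) x = algebraMap ℂ K (qPow ħ (ω h)) • x}
          add_mem' := fun ha hb h => by rw [map_add, smul_add, ha h, hb h]
          zero_mem' := fun h => by rw [map_zero, smul_zero]
          smul_mem' := fun c x hx h => by
            change ρ (U.k D ħ h) ((c : K) • x) = _ • (c : K) • x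
            rw [map_smul, hx h, smul_comm] }
    obtain ⟨S, hS⟩ := isNoetherian_submodule.1 (isNoetherian_latticeRegular (D := D) hq) T inf_le_left
    exact ⟨S, S.finite_toSet, by rw [hS]; rfl⟩

/-- The lattice is generated by multiples of pure tensors of weight vectors. Their images have
weight `ω₁ + ω₂`, and the algebra preserves the sum of the weight spaces. -/
theorem iSup_weightSpace_eq_top_of_surjective
    {ρ : U D ħ →ₐ[ℂ] Module.End K (FusionSpace V₁ V₂)} (hfus : IsFusionAction ρ)
    (h₁ : ⨆ ω, weightSpace D ħ V₁ ω = ⊤) (h₂ : ⨆ ω, weightSpace D ħ V₂ ω = ⊤)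
    {Q : Type v} [AddCommGroup Q] [Module ℂ Q] [Module (U D ħ) Q] [IsScalarTower ℂ (U D ħ) Q]
    (p : tensorLattice ρ →ₗ[U D ħ] Q) (hp : Function.Surjective p) :
    ⨆ ω, weightSpace D ħ Q ω = ⊤ := by
  have hgen (a : K) (ha : a ∈ regularAtOne) (w : V₁ ⊗[ℂ] V₂) :
      (show RepSpace ρ from a • ((1 : K) ⊗ₜ[ℂ] w)) ∈ tensorLattice ρ :=
    Submodule.subset_span ⟨a, ha, _, ⟨w, rfl⟩, rfl⟩
  -- For fixed `a`, the class of `a ⊗ w` is `ℂ`-linear in `w`, which allows a reduction to pure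
  -- tensors of weight vectors.
  let cl (a : K) (ha : a ∈ regularAtOne) : V₁ ⊗[ℂ] V₂ →ₗ[ℂ] Q :=
    { toFun := fun w => p ⟨_, hgen a ha w⟩
      map_add' := fun w w' => by
        have e : (a • ((1 : K) ⊗ₜ[ℂ] (w + w')) : FusionSpace V₁ V₂) =
            a • ((1 : K) ⊗ₜ[ℂ] w) + a • ((1 : K) ⊗ₜ[ℂ] w') := by
          rw [tmul_add, smul_add]
        rw [← map_add]
        exact congrArg p (Subtype.ext e)
      map_smul' := fun c w => by
        have e : (a • ((1 : K) ⊗ₜ[ℂ] (c • w)) : FusionSpace V₁ V₂) =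
            algebraMap ℂ K c • (a • ((1 : K) ⊗ₜ[ℂ] w)) := by
          rw [tmul_smul, algebraMap_smul, smul_comm]
        refine Eq.trans ?_ (algebraMap_smul (U D ħ) c (p ⟨_, hgen a ha w⟩))
        rw [← map_smul]
        exact congrArg p (Subtype.ext (e.trans (algebraMap_smul_repSpace c
          (show RepSpace ρ from a • ((1 : K) ⊗ₜ[ℂ] w))).symm)) }
  have hcl (a : K) (ha : a ∈ regularAtOne) (w : V₁ ⊗[ℂ] V₂) :
      cl a ha w ∈ ⨆ ω, weightSpace D ħ Q ω := by
    induction w using TensorProduct.induction_on with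
    | zero => rw [map_zero]; exact zero_mem _
    | add x y hx hy => rw [map_add]; exact add_mem hx hy
    | tmul v₁ v₂ =>
      have hv₁ : v₁ ∈ ⨆ ω, weightSpace D ħ V₁ ω := h₁ ▸ Submodule.mem_top
      have hv₂ : v₂ ∈ ⨆ ω, weightSpace D ħ V₂ ω := h₂ ▸ Submodule.mem_top
      induction hv₁ using Submodule.iSup_induction' with
      | zero => rw [zero_tmul, map_zero]; exact zero_mem _
      | add x y _ _ hx hy => rw [add_tmul, map_add]; exact add_mem hx hy
      | mem ω₁ v₁ hv₁ =>
        induction hv₂ using Submodule.iSup_induction' with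
        | zero => rw [tmul_zero, map_zero]; exact zero_mem _
        | add x y _ _ hx hy => rw [tmul_add, map_add]; exact add_mem hx hy
        | mem ω₂ v₂ hv₂ =>
          refine Submodule.mem_iSup_of_mem (ω₁ + ω₂) fun h => ?_
          rw [← map_smul (cl a ha)]
          change U.k D ħ h • p ⟨_, _⟩ = p ⟨_, _⟩
          rw [← map_smul]
          congr 1
          refine Subtype.ext ?_
          change ρ (U.k D ħ h) (a • ((1 : K) ⊗ₜ[ℂ] (v₁ ⊗ₜ[ℂ] v₂))) = a • _
          rw [map_smul, hfus.k, hv₁ h, hv₂ h, smul_tmul_smul, LinearMap.add_apply, qPow_add]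
  rw [eq_top_iff]
  rintro y -
  obtain ⟨⟨x, hx⟩, rfl⟩ := hp y
  induction hx using Submodule.closure_induction with
  | zero =>
    have : p ⟨_, zero_mem (tensorLattice ρ)⟩ = 0 := map_zero p
    exact this ▸ zero_mem _
  | add x y hx' hy' hx hy =>
    have h1 := add_mem hx hy
    rwa [← map_add] at h1
  | smul_mem g x hx =>
    obtain ⟨a, ha, _, ⟨w, rfl⟩, rfl⟩ := hx
    have h1 := smul_mem_iSup_weightSpace g (hcl a ha w)
    change g • p ⟨_, _⟩ ∈ _ at h1
    rwa [← map_smul] at h1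

theorem isModf_of_surjective [FiniteDimensional ℂ V₁] [FiniteDimensional ℂ V₂]
    (hq : ∀ n : ℕ, n ≠ 0 → Complex.exp ħ ^ n ≠ 1)
    (h₁ : ⨆ ω, weightSpace D ħ V₁ ω = ⊤) (h₂ : ⨆ ω, weightSpace D ħ V₂ ω = ⊤)
    (M : ModuleCat.{v} (U D ħ)) (p : tensorLattice (fusionAction (D := D) V₁ V₂ hq) →ₗ[U D ħ] M)
    (hp : Function.Surjective p)
    (hp0 : ∀ x y : tensorLattice (fusionAction (D := D) V₁ V₂ hq),
      (x : RepSpace (fusionAction (D := D) V₁ V₂ hq)) = (RatFunc.X - 1 : K) • y.1 → p x = 0) :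
    isModf D ħ M := by
  have hN := isNoetherian_latticeRegular (D := D) (V₁ := V₁) (V₂ := V₂) hq
  refine isModf_of_iSup_eq_top hq M ?_ ?_
  · exact finiteDimensional_of_surjective (isNoetherian_submodule.1 hN _ le_rfl) p hp hp0
  · exact iSup_weightSpace_eq_top_of_surjective (fusionAction_isFusionAction hq) h₁ h₂ p hp

theorem tensorD_isModf [FiniteDimensional ℂ V₁] [FiniteDimensional ℂ V₂]
    (hq : ∀ n : ℕ, n ≠ 0 → Complex.exp ħ ^ n ≠ 1)
    (h₁ : ⨆ ω, weightSpace D ħ V₁ ω = ⊤) (h₂ : ⨆ ω, weightSpace D ħ V₂ ω = ⊤) :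
    isModf D ħ (ModuleCat.of (U D ħ) (TensorD (fusionAction (D := D) V₁ V₂ hq))) :=
  isModf_of_surjective hq h₁ h₂ (ModuleCat.of (U D ħ) (TensorD (fusionAction (D := D) V₁ V₂ hq)))
    (Submodule.mkQ _) (Submodule.mkQ_surjective _) fun _ y hxy =>
      (Submodule.Quotient.mk_eq_zero _).2 ⟨y, y.2, hxy.symm⟩

end Lattice

end QAff

namespace QAff

/-! ### The bifunctor -/

section Functor

variable {ι : Type w₁} [Fintype ι] [DecidableEq ι] {𝔥 : Type w₂} [AddCommGroup 𝔥] [Module ℚ 𝔥]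
variable {D : CartanDatum ι 𝔥} {ħ : ℂ}

section

variable {V₁ V₂ V₁' V₂' V₁'' V₂'' : Type v}
  [AddCommGroup V₁] [Module ℂ V₁] [Module (U D ħ) V₁] [IsScalarTower ℂ (U D ħ) V₁]
  [AddCommGroup V₂] [Module ℂ V₂] [Module (U D ħ) V₂] [IsScalarTower ℂ (U D ħ) V₂]
  [AddCommGroup V₁'] [Module ℂ V₁'] [Module (U D ħ) V₁'] [IsScalarTower ℂ (U D ħ) V₁']
  [AddCommGroup V₂'] [Module ℂ V₂'] [Module (U D ħ) V₂'] [IsScalarTower ℂ (U D ħ) V₂']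
  [AddCommGroup V₁''] [Module ℂ V₁''] [Module (U D ħ) V₁''] [IsScalarTower ℂ (U D ħ) V₁'']
  [AddCommGroup V₂''] [Module ℂ V₂''] [Module (U D ħ) V₂''] [IsScalarTower ℂ (U D ħ) V₂'']

theorem fusionMap_tmul (f₁ : V₁ →ₗ[U D ħ] V₁') (f₂ : V₂ →ₗ[U D ħ] V₂') (a : K) (v₁ : V₁) (v₂ : V₂) :
    fusionMap f₁ f₂ (a ⊗ₜ (v₁ ⊗ₜ v₂)) = a ⊗ₜ (f₁ v₁ ⊗ₜ f₂ v₂) := rfl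

theorem fusionMap_id : fusionMap (LinearMap.id : V₁ →ₗ[U D ħ] V₁) (LinearMap.id : V₂ →ₗ[U D ħ] V₂) =
    LinearMap.id :=
  fusionSpace_ext fun _ _ => rfl

theorem fusionMap_comp (f₁ : V₁ →ₗ[U D ħ] V₁') (f₂ : V₂ →ₗ[U D ħ] V₂') (g₁ : V₁' →ₗ[U D ħ] V₁'')
    (g₂ : V₂' →ₗ[U D ħ] V₂'') :
    fusionMap (g₁ ∘ₗ f₁) (g₂ ∘ₗ f₂) = fusionMap g₁ g₂ ∘ₗ fusionMap f₁ f₂ :=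
  fusionSpace_ext fun _ _ => rfl

variable {ρ : U D ħ →ₐ[ℂ] Module.End K (FusionSpace V₁ V₂)}
  {ρ' : U D ħ →ₐ[ℂ] Module.End K (FusionSpace V₁' V₂')}

/-- The elements that are intertwined form a subalgebra. On `x`, `k`, `φ` the coproduct formulas are
natural in both modules, and expansion at `u = 0` is natural too. -/
theorem fusionMap_comp_action (hq : ∀ n : ℕ, n ≠ 0 → Complex.exp ħ ^ n ≠ 1)
    (hρ : IsFusionAction ρ) (hρ' : IsFusionAction ρ') (f₁ : V₁ →ₗ[U D ħ] V₁')
    (f₂ : V₂ →ₗ[U D ħ] V₂') (a : U D ħ) :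
    fusionMap f₁ f₂ ∘ₗ ρ a = ρ' a ∘ₗ fusionMap f₁ f₂ := by
  let S : Subalgebra ℂ (U D ħ) :=
    { carrier := {a | fusionMap f₁ f₂ ∘ₗ ρ a = ρ' a ∘ₗ fusionMap f₁ f₂}
      mul_mem' := fun {a b} ha hb => by
        change fusionMap f₁ f₂ ∘ₗ ρ (a * b) = ρ' (a * b) ∘ₗ fusionMap f₁ f₂
        rw [map_mul, map_mul, Module.End.mul_eq_comp, Module.End.mul_eq_comp, LinearMap.comp_assoc,
          ← hb, ← LinearMap.comp_assoc, ha, LinearMap.comp_assoc]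
      add_mem' := fun {a b} ha hb => by
        change fusionMap f₁ f₂ ∘ₗ ρ (a + b) = ρ' (a + b) ∘ₗ fusionMap f₁ f₂
        rw [map_add, map_add, LinearMap.comp_add, LinearMap.add_comp, ha, hb]
      algebraMap_mem' := fun c => by
        change fusionMap f₁ f₂ ∘ₗ ρ (algebraMap _ _ c) = ρ' (algebraMap _ _ c) ∘ₗ fusionMap f₁ f₂
        rw [AlgHom.commutes, AlgHom.commutes]
        refine LinearMap.ext fun x => ?_
        change fusionMap f₁ f₂ (c • x) = c • fusionMap f₁ f₂ x
        rw [← algebraMap_smul K c, map_smul, algebraMap_smul] }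
  have key (w : V₁ ⊗[ℂ] V₂) (y : FusionSpace V₁ V₂) (n : ℤ) :
      expandCoeff (V₁' ⊗[ℂ] V₂') n (fusionMap f₁ f₂ y) =
      TensorProduct.map (f₁.restrictScalars ℂ) (f₂.restrictScalars ℂ)
        (expandCoeff (V₁ ⊗[ℂ] V₂) n y) := expandCoeff_natural _ _ _
  have hS : S = ⊤ := by
    refine U.eq_top_of_phi (S := S) hq (fun ε i r => ?_) (fun h => ?_) fun ε i m => ?_
    · refine fusionSpace_ext fun v₁ v₂ => expandCoeff_ext fun n => ?_
      rw [LinearMap.comp_apply, LinearMap.comp_apply, key (v₁ ⊗ₜ v₂), fusionMap_tmul]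
      rcases Int.units_eq_one_or ε with rfl | rfl
      · rw [hρ.x_plus, hρ'.x_plus, deltaXPlus, deltaXPlus, map_add]
        congr 1
        · split_ifs
          · rw [map_tmul, LinearMap.restrictScalars_apply, LinearMap.restrictScalars_apply, map_smul]
          · rw [map_zero]
        · split_ifs
          · rw [map_tmul, LinearMap.restrictScalars_apply, LinearMap.restrictScalars_apply, map_smul,
              map_smul]
          · rw [map_zero]
      · rw [hρ.x_minus, hρ'.x_minus, deltaXMinus, deltaXMinus, map_add]
        congr 1
        · split_ifs
          · rw [map_tmul, LinearMap.restrictScalars_apply, LinearMap.restrictScalars_apply, map_smul]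
          · rw [map_zero]
        · split_ifs
          · rw [map_tmul, LinearMap.restrictScalars_apply, LinearMap.restrictScalars_apply, map_smul,
              map_smul]
          · rw [map_zero]
    · refine fusionSpace_ext fun v₁ v₂ => ?_
      rw [LinearMap.comp_apply, LinearMap.comp_apply, fusionMap_tmul, hρ.k, hρ'.k, fusionMap_tmul,
        map_smul, map_smul]
    · refine fusionSpace_ext fun v₁ v₂ => ?_
      rw [LinearMap.comp_apply, LinearMap.comp_apply, fusionMap_tmul, hρ.phi, hρ'.phi, map_sum]
      refine Finset.sum_congr rfl fun s _ => ?_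
      rw [fusionMap_tmul, map_smul, map_smul]
  have ha : a ∈ S := hS ▸ Algebra.mem_top
  exact ha

/-- `fusionMap` as a `𝒰_q(ĝ)`-linear map. -/
noncomputable def fusionMapHom (hq : ∀ n : ℕ, n ≠ 0 → Complex.exp ħ ^ n ≠ 1)
    (hρ : IsFusionAction ρ) (hρ' : IsFusionAction ρ') (f₁ : V₁ →ₗ[U D ħ] V₁')
    (f₂ : V₂ →ₗ[U D ħ] V₂') : RepSpace ρ →ₗ[U D ħ] RepSpace ρ' where
  toFun := fusionMap f₁ f₂
  map_add' := map_add (fusionMap f₁ f₂)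
  map_smul' a x := LinearMap.congr_fun (fusionMap_comp_action hq hρ hρ' f₁ f₂ a) x

theorem fusionMap_mem_tensorLattice (hq : ∀ n : ℕ, n ≠ 0 → Complex.exp ħ ^ n ≠ 1)
    (hρ : IsFusionAction ρ) (hρ' : IsFusionAction ρ') (f₁ : V₁ →ₗ[U D ħ] V₁')
    (f₂ : V₂ →ₗ[U D ħ] V₂') {x : RepSpace ρ} (hx : x ∈ tensorLattice ρ) :
    fusionMapHom hq hρ hρ' f₁ f₂ x ∈ tensorLattice ρ' := by
  have : tensorLattice ρ ≤ (tensorLattice ρ').comap (fusionMapHom hq hρ hρ' f₁ f₂) := by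
    refine Submodule.span_le.2 ?_
    rintro _ ⟨a, ha, _, ⟨w, rfl⟩, rfl⟩
    refine Submodule.subset_span ⟨a, ha, _,
      ⟨TensorProduct.map (f₁.restrictScalars ℂ) (f₂.restrictScalars ℂ) w, rfl⟩, ?_⟩
    exact (fusionMap f₁ f₂).map_smul a _
  exact this hx

/-- `f₁ ⊗_d f₂`. -/
noncomputable def tensorDMap (hq : ∀ n : ℕ, n ≠ 0 → Complex.exp ħ ^ n ≠ 1)
    (hρ : IsFusionAction ρ) (hρ' : IsFusionAction ρ') (f₁ : V₁ →ₗ[U D ħ] V₁')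
    (f₂ : V₂ →ₗ[U D ħ] V₂') : TensorD ρ →ₗ[U D ħ] TensorD ρ' :=
  Submodule.mapQ _ _
    ((fusionMapHom hq hρ hρ' f₁ f₂).restrict fun _ hx =>
      fusionMap_mem_tensorLattice hq hρ hρ' f₁ f₂ hx) <| by
    rintro ⟨x, hx⟩ ⟨y, hy, hxy⟩
    refine ⟨fusionMap f₁ f₂ y, fusionMap_mem_tensorLattice hq hρ hρ' f₁ f₂ hy, ?_⟩
    have hxy' : (RatFunc.X - 1 : K) • (show FusionSpace V₁ V₂ from y) = x := hxy
    change (RatFunc.X - 1 : K) • fusionMap f₁ f₂ y = fusionMap f₁ f₂ x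
    rw [← hxy', map_smul]

theorem tensorDMap_mk (hq : ∀ n : ℕ, n ≠ 0 → Complex.exp ħ ^ n ≠ 1)
    (hρ : IsFusionAction ρ) (hρ' : IsFusionAction ρ') (f₁ : V₁ →ₗ[U D ħ] V₁')
    (f₂ : V₂ →ₗ[U D ħ] V₂') (x : RepSpace ρ) (hx : x ∈ tensorLattice ρ) :
    tensorDMap hq hρ hρ' f₁ f₂ (Submodule.Quotient.mk ⟨x, hx⟩) =
      Submodule.Quotient.mk ⟨fusionMap f₁ f₂ x,
        fusionMap_mem_tensorLattice hq hρ hρ' f₁ f₂ hx⟩ := rfl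

theorem tensorDMap_id (hq : ∀ n : ℕ, n ≠ 0 → Complex.exp ħ ^ n ≠ 1) (hρ : IsFusionAction ρ) :
    tensorDMap hq hρ hρ LinearMap.id LinearMap.id = LinearMap.id := by
  refine LinearMap.ext fun y => ?_
  obtain ⟨⟨x, hx⟩, rfl⟩ := Submodule.Quotient.mk_surjective _ y
  refine (tensorDMap_mk hq hρ hρ _ _ x hx).trans ?_
  exact congrArg _ (Subtype.ext (LinearMap.congr_fun (fusionMap_id (D := D) (ħ := ħ)) x))

theorem tensorDMap_comp {ρ'' : U D ħ →ₐ[ℂ] Module.End K (FusionSpace V₁'' V₂'')}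
    (hq : ∀ n : ℕ, n ≠ 0 → Complex.exp ħ ^ n ≠ 1) (hρ : IsFusionAction ρ) (hρ' : IsFusionAction ρ')
    (hρ'' : IsFusionAction ρ'') (f₁ : V₁ →ₗ[U D ħ] V₁') (f₂ : V₂ →ₗ[U D ħ] V₂')
    (g₁ : V₁' →ₗ[U D ħ] V₁'') (g₂ : V₂' →ₗ[U D ħ] V₂'') :
    tensorDMap hq hρ hρ'' (g₁ ∘ₗ f₁) (g₂ ∘ₗ f₂) =
      tensorDMap hq hρ' hρ'' g₁ g₂ ∘ₗ tensorDMap hq hρ hρ' f₁ f₂ := by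
  refine LinearMap.ext fun y => ?_
  obtain ⟨⟨x, hx⟩, rfl⟩ := Submodule.Quotient.mk_surjective _ y
  refine (tensorDMap_mk hq hρ hρ'' _ _ x hx).trans ?_
  exact congrArg _ (Subtype.ext (LinearMap.congr_fun (fusionMap_comp f₁ f₂ g₁ g₂) x))

end

variable (hq : ∀ n : ℕ, n ≠ 0 → Complex.exp ħ ^ n ≠ 1)

/-- The fusion action on the tensor product of two modules in `Modf`. -/
noncomputable def modfAction (V₁ V₂ : Modf.{v} D ħ) :
    U D ħ →ₐ[ℂ] Module.End K (FusionSpace V₁.obj V₂.obj) :=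
  haveI := V₁.property.2.2
  haveI := V₂.property.2.2
  fusionAction V₁.obj V₂.obj hq

theorem modfAction_isFusionAction (V₁ V₂ : Modf.{v} D ħ) : IsFusionAction (modfAction hq V₁ V₂) :=
  haveI := V₁.property.2.2
  haveI := V₂.property.2.2
  fusionAction_isFusionAction hq

theorem modfAction_isAForm (V₁ V₂ : Modf.{v} D ħ) :
    IsAForm (modfAction hq V₁ V₂) (tensorLattice (modfAction hq V₁ V₂)) :=
  haveI := V₁.property.2.2
  haveI := V₂.property.2.2
  tensorLattice_isAForm hq

theorem modfAction_tensorD_isModf (V₁ V₂ : Modf.{v} D ħ) :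
    isModf D ħ (ModuleCat.of (U D ħ) (TensorD (modfAction hq V₁ V₂))) :=
  haveI := V₁.property.2.2
  haveI := V₂.property.2.2
  tensorD_isModf hq V₁.property.1.1.2 V₂.property.1.1.2

/-- The bifunctor `⊗_d`. -/
noncomputable def tensorDFunctor : Modf.{v} D ħ × Modf.{v} D ħ ⥤ Modf.{v} D ħ where
  obj P := ⟨ModuleCat.of (U D ħ) (TensorD (modfAction hq P.1 P.2)),
    modfAction_tensorD_isModf hq P.1 P.2⟩
  map {P P'} f := ObjectProperty.homMk (ModuleCat.ofHom
    (tensorDMap hq (modfAction_isFusionAction hq P.1 P.2) (modfAction_isFusionAction hq P'.1 P'.2)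
      f.1.hom.hom f.2.hom.hom))
  map_id P := ObjectProperty.hom_ext _
    (ModuleCat.hom_ext (tensorDMap_id hq (modfAction_isFusionAction hq P.1 P.2)))
  map_comp {P P' P''} f g := ObjectProperty.hom_ext _
    (ModuleCat.hom_ext (tensorDMap_comp hq (modfAction_isFusionAction hq P.1 P.2)
      (modfAction_isFusionAction hq P'.1 P'.2) (modfAction_isFusionAction hq P''.1 P''.2)
      f.1.hom.hom f.2.hom.hom g.1.hom.hom g.2.hom.hom))

theorem exists_tensorD_bifunctor (D : CartanDatum ι 𝔥) (ħ : ℂ)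
    (hq : ∀ n : ℕ, n ≠ 0 → Complex.exp ħ ^ n ≠ 1) :
    ∃ ρ : ∀ V₁ V₂ : Modf.{v} D ħ, U D ħ →ₐ[ℂ] Module.End K (FusionSpace V₁.obj V₂.obj),
      (∀ V₁ V₂ ρ', IsFusionAction ρ' ↔ ρ' = ρ V₁ V₂) ∧
      (∀ V₁ V₂, IsAForm (ρ V₁ V₂) (tensorLattice (ρ V₁ V₂))) ∧
      ∃ (F : Modf.{v} D ħ × Modf.{v} D ħ ⥤ Modf.{v} D ħ)
        (e : ∀ V₁ V₂ : Modf.{v} D ħ, (F.obj (V₁, V₂)).obj ≃ₗ[U D ħ] TensorD (ρ V₁ V₂)),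
        ∀ (V₁ V₂ V₁' V₂' : Modf.{v} D ħ) (f₁ : V₁ ⟶ V₁') (f₂ : V₂ ⟶ V₂')
          (x : RepSpace (ρ V₁ V₂)) (hx : x ∈ tensorLattice (ρ V₁ V₂)),
          ∃ hx' : (fusionMap f₁.hom.hom f₂.hom.hom x : RepSpace (ρ V₁' V₂')) ∈
              tensorLattice (ρ V₁' V₂'),
            e V₁' V₂' ((F.map (Prod.mkHom f₁ f₂)).hom
                ((e V₁ V₂).symm (Submodule.Quotient.mk ⟨x, hx⟩))) =
              Submodule.Quotient.mk ⟨fusionMap f₁.hom.hom f₂.hom.hom x, hx'⟩ := by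
  refine ⟨modfAction hq, fun V₁ V₂ ρ' => ⟨fun h => h.unique hq (modfAction_isFusionAction hq V₁ V₂), ?_⟩,
    modfAction_isAForm hq, tensorDFunctor hq, fun V₁ V₂ => LinearEquiv.refl _ _, ?_⟩
  · rintro rfl
    exact modfAction_isFusionAction hq V₁ V₂
  · intro V₁ V₂ V₁' V₂' f₁ f₂ x hx
    exact ⟨fusionMap_mem_tensorLattice hq (modfAction_isFusionAction hq V₁ V₂)
      (modfAction_isFusionAction hq V₁' V₂') f₁.hom.hom f₂.hom.hom hx, rfl⟩

end Functor

end QAff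

namespace QAff

/-! ### Two-dimensional evaluation modules in type `A_1` -/

section Evaluation

variable (ħ b : ℂ)

/-- The weights of the standard basis. -/
def evalSign : Fin 2 → ℤˣ := ![1, -1]

/-- The spectral parameters of the standard basis. -/
noncomputable def evalParam : Fin 2 → ℂ := ![b, b * qPow ħ 2]

/-- The matrices of the generators. -/
noncomputable def evalGen : Gen (Fin 1) ℚ → Matrix (Fin 2) (Fin 2) ℂ
  | .x ε _ r => (qPow ħ 1 * b) ^ r • if ε = 1 then !![0, 1; 0, 0] else !![0, 0; 1, 0]
  | .k h => Matrix.diagonal fun j => qPow ħ (((evalSign j : ℤ) : ℚ) * h)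
  | .h _ m => Matrix.diagonal fun j =>
      ((evalSign j : ℤ) : ℂ) * evalParam ħ b j ^ (m : ℤ) * qInt ħ m / ((m : ℤ) : ℂ)

/-- The representation of the free algebra. -/
noncomputable def evalFree : Free (Fin 1) ℚ →ₐ[ℂ] Matrix (Fin 2) (Fin 2) ℂ :=
  FreeAlgebra.lift ℂ (evalGen ħ b)

theorem evalFree_x (ε : ℤˣ) (i : Fin 1) (r : ℤ) : evalFree ħ b (fx ε i r) =
    (qPow ħ 1 * b) ^ r • if ε = 1 then !![0, 1; 0, 0] else !![0, 0; 1, 0] :=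
  FreeAlgebra.lift_ι_apply _ _

theorem evalFree_k (h : ℚ) : evalFree ħ b (fk h) =
    Matrix.diagonal fun j => qPow ħ (((evalSign j : ℤ) : ℚ) * h) :=
  FreeAlgebra.lift_ι_apply _ _

theorem evalFree_h (i : Fin 1) (m : {m : ℤ // m ≠ 0}) : evalFree ħ b (fh i m) =
    Matrix.diagonal fun j =>
      ((evalSign j : ℤ) : ℂ) * evalParam ħ b j ^ (m : ℤ) * qInt ħ m / ((m : ℤ) : ℂ) :=
  FreeAlgebra.lift_ι_apply _ _

theorem evalFree_cartanCommute : CartanCommute (evalFree ħ b) where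
  k_h h i m := by
    rw [evalFree_k, evalFree_h, Commute, SemiconjBy, Matrix.diagonal_mul_diagonal,
      Matrix.diagonal_mul_diagonal]
    simp only [mul_comm]
  h_h i j m m' := by
    rw [evalFree_h, evalFree_h, Commute, SemiconjBy, Matrix.diagonal_mul_diagonal,
      Matrix.diagonal_mul_diagonal]
    simp only [mul_comm]

variable {ħ b}

/-- On each basis vector the series of the `φ` is `(κ - t) / (1 - κ t)` with `κ = q ^ {±1}` and `t`
a rescaling of `z ^ ε`; this is again the uniqueness of solutions of the Euler equation. -/
theorem evalFree_fphi (hq : ∀ n : ℕ, n ≠ 0 → Complex.exp ħ ^ n ≠ 1) (hb : b ≠ 0) (ε : ℤˣ)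
    (i : Fin 1) (m : ℕ) : evalFree ħ b (fphi sl2Datum ħ ε i m) =
      Matrix.diagonal fun j => gam (qPow ħ (((ε * evalSign j : ℤˣ) : ℤ) : ℚ)) m *
        evalParam ħ b j ^ ((ε : ℤ) * m) := by
  have hparam (j : Fin 2) : evalParam ħ b j ≠ 0 := by
    fin_cases j
    · exact hb
    · exact mul_ne_zero hb (qPow_ne_zero _)
  let H := PowerSeries.map (evalFree ħ b : Free (Fin 1) ℚ →+* Matrix (Fin 2) (Fin 2) ℂ)
    (hSeries ℚ ε i)
  let g : PowerSeries (Matrix (Fin 2) (Fin 2) ℂ) := PowerSeries.mk fun m =>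
    Matrix.diagonal fun j => gam (qPow ħ (((ε * evalSign j : ℤˣ) : ℤ) : ℚ)) m *
      evalParam ħ b j ^ ((ε : ℤ) * m)
  have hH (p : ℕ) : PowerSeries.coeff p
      ((((ε : ℤ) : ℂ) * (qPow ħ 1 - qPow ħ (-1))) • euler H) = Matrix.diagonal fun j =>
        (qPow ħ (((ε * evalSign j : ℤˣ) : ℤ) : ℚ) ^ p -
          (qPow ħ (((ε * evalSign j : ℤˣ) : ℤ) : ℚ))⁻¹ ^ p) * evalParam ħ b j ^ ((ε : ℤ) * p) := by
    rw [PowerSeries.coeff_smul, coeff_euler]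
    rcases Nat.eq_zero_or_pos p with rfl | hp
    · simp
    · have hp' : (p : ℂ) ≠ 0 := Nat.cast_ne_zero.2 hp.ne'
      have hε : (((ε : ℤ) : ℂ)) * ((ε : ℤ) : ℂ) = 1 := by
        rw [← Int.cast_mul, ← Units.val_mul, Int.units_mul_self, Units.val_one, Int.cast_one]
      have hε' : (((ε : ℤ) : ℂ)) ≠ 0 := Int.cast_ne_zero.2 ε.ne_zero
      rw [Free.coeff_map_hSeries _ _ _ _ (mul_ne_zero ε.ne_zero (by omega)), evalFree_h,
        ← Matrix.diagonal_smul, ← Matrix.diagonal_smul]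
      congr 1
      funext j
      simp only [Pi.smul_apply, smul_eq_mul]
      have h1 : (qPow ħ 1 - qPow ħ (-1)) * qInt ħ ((ε : ℤ) * p) =
          ((evalSign j : ℤ) : ℂ) * (qPow ħ (((ε * evalSign j : ℤˣ) : ℤ) : ℚ) ^ p -
          (qPow ħ (((ε * evalSign j : ℤˣ) : ℤ) : ℚ))⁻¹ ^ p) := by
        rw [mul_qInt hq, ← qPow_neg, qPow_pow, qPow_pow]
        rcases Int.units_eq_one_or ε with rfl | rfl <;>
        rcases Int.units_eq_one_or (evalSign j) with h | h <;> simp [h]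
      have h2 : ((evalSign j : ℤ) : ℂ) * ((evalSign j : ℤ) : ℂ) = 1 := by
        rw [← Int.cast_mul, ← Units.val_mul, Int.units_mul_self, Units.val_one, Int.cast_one]
      rw [Int.cast_mul, Int.cast_natCast]
      field_simp
      linear_combination ((evalSign j : ℤ) : ℂ) * evalParam ħ b j ^ ((ε : ℤ) * p) * h1 +
        evalParam ħ b j ^ ((ε : ℤ) * p) * (qPow ħ (((ε * evalSign j : ℤˣ) : ℤ) : ℚ) ^ p -
          (qPow ħ (((ε * evalSign j : ℤˣ) : ℤ) : ℚ))⁻¹ ^ p) * h2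
  have key : (PowerSeries.mk fun m => evalFree ħ b (fphi sl2Datum ħ ε i m)) = g := by
    refine eq_of_euler_eq (a := (((ε : ℤ) : ℂ) * (qPow ħ 1 - qPow ħ (-1))) • euler H) ?_
      ((evalFree_cartanCommute ħ b).euler_phi ε i) ?_ ?_
    · rw [hH]
      simp
    · ext m : 1
      rw [coeff_euler, PowerSeries.coeff_mul]
      simp only [hH, g, PowerSeries.coeff_mk, Matrix.diagonal_mul_diagonal]
      rw [← Matrix.diagonal_smul]
      change _ = ∑ p ∈ _, Matrix.diagonalAddMonoidHom (Fin 2) ℂ _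
      rw [← map_sum]
      change _ = Matrix.diagonal _
      congr 1
      funext j
      rw [Finset.sum_apply, Pi.smul_apply, smul_eq_mul, ← mul_assoc, ← gam_rec (qPow_ne_zero _),
        Finset.sum_mul]
      refine Finset.sum_congr rfl fun p hp => ?_
      have hp := Finset.HasAntidiagonal.mem_antidiagonal.1 hp
      rw [← hp, Nat.cast_add, mul_add, zpow_add₀ (hparam j)]
      ring
    · simp only [g, PowerSeries.coeff_mk, Free.map_fphi_zero, evalFree_k, gam]
      congr 1
      funext j
      simp [sl2Datum, mul_comm]
  have := congrArg (PowerSeries.coeff m) key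
  rwa [PowerSeries.coeff_mk, PowerSeries.coeff_mk] at this

theorem evalFree_k_eq (h : ℚ) :
    evalFree ħ b (fk h) = !![qPow ħ h, 0; 0, qPow ħ (-h)] := by
  rw [evalFree_k]
  ext i j
  fin_cases i <;> fin_cases j <;> simp [evalSign]

theorem qPow_intCast_mul (x : ℚ) (n : ℤ) : qPow ħ (x * n) = qPow ħ x ^ n := by
  rw [qPow, qPow, ← Complex.exp_int_mul]
  congr 1
  push_cast
  ring

theorem qInt_mul_two (m : ℤ) : qInt ħ (m * 2) = qInt ħ m * (qPow ħ m + qPow ħ (-m)) := by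
  have h1 : qPow ħ ((m * 2 : ℤ) : ℚ) = qPow ħ m * qPow ħ m := by
    rw [← qPow_add]
    push_cast
    congr 1
    ring
  have h2 : qPow ħ (-((m * 2 : ℤ) : ℚ)) = qPow ħ (-m) * qPow ħ (-m) := by
    rw [← qPow_add]
    push_cast
    congr 1
    ring
  rw [qInt, qInt, h1, h2]
  ring

theorem gam_eq {κ : ℂ} (hκ : κ ≠ 0) {n : ℕ} (hn : n ≠ 0) : gam κ n = κ ^ n * (κ - κ⁻¹) := by
  obtain ⟨n, rfl⟩ := Nat.exists_eq_succ_of_ne_zero hn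
  rw [gam, Nat.succ_eq_add_one]
  field_simp
  ring

theorem evalFree_rel (hq : ∀ n : ℕ, n ≠ 0 → Complex.exp ħ ^ n ≠ 1) (hb : b ≠ 0)
    ⦃x y : Free (Fin 1) ℚ⦄ (h : Rel sl2Datum ħ x y) : evalFree ħ b x = evalFree ħ b y := by
  have ha : qPow ħ 1 * b ≠ 0 := mul_ne_zero (qPow_ne_zero _) hb
  cases h with
  | k_zero =>
    rw [evalFree_k, map_one]
    simp [qPow_zero]
  | k_add h h' =>
    rw [map_mul, evalFree_k, evalFree_k, evalFree_k, Matrix.diagonal_mul_diagonal]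
    simp only [mul_add, qPow_add]
  | k_h h i m =>
    rw [map_mul, map_mul]
    exact ((evalFree_cartanCommute ħ b).k_h h i m).eq
  | h_h i j m m' =>
    rw [map_mul, map_mul]
    exact ((evalFree_cartanCommute ħ b).h_h i j m m').eq
  | k_x h ε j r =>
    rw [map_mul, map_smul, map_mul, evalFree_k_eq, evalFree_x, mul_smul_comm, smul_mul_assoc,
      smul_comm]
    congr 1
    have e (s : ℚ) : qPow ħ (s * (2 * h)) * qPow ħ (-(s * h)) = qPow ħ (s * h) := by
      rw [← qPow_add]
      congr 1
      ring
    have e1 := e 1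
    have e2 := e (-1)
    rcases Int.units_eq_one_or ε with rfl | rfl <;>
    · ext i j
      fin_cases i <;> fin_cases j <;> simp_all [sl2Datum]
  | h_x i m ε j r =>
    have hm : ((m : ℤ) : ℂ) ≠ 0 := Int.cast_ne_zero.2 m.2
    have e1 : evalFree ħ b (fh i m) = ((qPow ħ 0 * b ^ (m : ℤ) * qInt ħ m / ((m : ℤ) : ℂ))) •
        !![1, 0; 0, -qPow ħ 2 ^ (m : ℤ)] := by
      rw [evalFree_h]
      ext i j
      fin_cases i <;> fin_cases j <;> simp [evalSign, evalParam, qPow_zero, mul_zpow]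
      ring
    have e2 : (1 + qPow ħ 2 ^ (m : ℤ)) = qPow ħ 1 ^ (m : ℤ) * (qPow ħ m + qPow ħ (-m)) := by
      rw [← qPow_intCast_mul, ← qPow_intCast_mul, mul_add, ← qPow_add, ← qPow_add, ← qPow_zero (ħ := ħ),
        add_comm]
      congr 2 <;> ring
    have e3 : sl2Datum.C i j = 2 := by
      rw [Subsingleton.elim i 0, Subsingleton.elim j 0]
      rfl
    rw [map_sub, map_mul, map_mul, map_smul, evalFree_x, evalFree_x, e1, e3,
      show ((sl2Datum.r i : ℤ) * 2) = 2 from rfl, qInt_mul_two, qPow_zero, zpow_add₀ ha, mul_zpow _ _ (m : ℤ)]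
    rcases Int.units_eq_one_or ε with rfl | rfl
    · ext i j
      fin_cases i <;> fin_cases j <;> simp
      linear_combination b ^ (m : ℤ) * qInt ħ m / ((m : ℤ) : ℂ) * (qPow ħ 1 * b) ^ r * e2
    · ext i j
      fin_cases i <;> fin_cases j <;> simp
      linear_combination -b ^ (m : ℤ) * qInt ħ m / ((m : ℤ) : ℂ) * (qPow ħ 1 * b) ^ r * e2
  | x_x_same i r s =>
    have hd : qPow ħ 1 - (qPow ħ 1)⁻¹ ≠ 0 := by
      rw [← qPow_neg]
      exact qPow_sub_qPow_neg_ne_zero hq one_ne_zero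
    -- The two parameters `b` and `b q²` differ so that all modes of `φ^+ - φ^-` become powers of
    -- the single number `q b`, as the products of the rank one matrices require.
    have e (n : ℤ) : evalFree ħ b (fphiZ sl2Datum ħ 1 i n - fphiZ sl2Datum ħ (-1) i n) =
        ((qPow ħ 1 - (qPow ħ 1)⁻¹) * (qPow ħ 1 * b) ^ n) • !![1, 0; 0, -1] := by
      have h2 : qPow ħ 2 = qPow ħ 1 * qPow ħ 1 := by
        rw [← qPow_add]
        norm_num
      have hq0 := qPow_ne_zero (ħ := ħ) 1
      rcases lt_trichotomy n 0 with hn | rfl | hn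
      · obtain ⟨m, rfl⟩ : ∃ m : ℕ, n = -(m : ℤ) := ⟨n.natAbs, by omega⟩
        have hm : m ≠ 0 := by omega
        rw [fphiZ, fphiZ, if_neg (by rw [Units.val_one]; omega),
          if_pos (by rw [Units.val_neg, Units.val_one]; omega),
          show (((-1 : ℤˣ) : ℤ) * -(m : ℤ)).toNat = m by rw [Units.val_neg, Units.val_one]; omega,
          zero_sub, map_neg, evalFree_fphi hq hb]
        ext i j
        fin_cases i <;> fin_cases j <;>
          simp [evalSign, evalParam, gam_eq, hm, qPow_ne_zero, qPow_neg, h2, mul_pow] <;>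
          (field_simp; try ring)
      · rw [fphiZ, fphiZ, mul_zero, mul_zero, if_pos le_rfl, if_pos le_rfl, Int.toNat_zero, map_sub,
          evalFree_fphi hq hb, evalFree_fphi hq hb]
        ext i j
        fin_cases i <;> fin_cases j <;> simp [evalSign, gam, qPow_neg]
      · obtain ⟨m, rfl⟩ : ∃ m : ℕ, n = (m : ℤ) := ⟨n.natAbs, by omega⟩
        have hm : m ≠ 0 := by omega
        rw [fphiZ, fphiZ, if_pos (by rw [Units.val_one]; omega),
          if_neg (by rw [Units.val_neg, Units.val_one]; omega),
          show (((1 : ℤˣ) : ℤ) * (m : ℤ)).toNat = m by rw [Units.val_one]; omega,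
          sub_zero, evalFree_fphi hq hb]
        ext i j
        fin_cases i <;> fin_cases j <;>
          simp [evalSign, evalParam, gam_eq, hm, qPow_ne_zero, qPow_neg, h2, mul_pow] <;>
          (field_simp; try ring)
    rw [map_sub, map_mul, map_mul, map_smul, e, evalFree_x, evalFree_x, smul_smul,
      show ((sl2Datum.r i : ℕ) : ℚ) = 1 from Nat.cast_one, qPow_neg, one_div,
      inv_mul_cancel_left₀ hd, zpow_add₀ ha]
    ext i j
    fin_cases i <;> fin_cases j <;> simp [mul_comm]
  | x_x_ne i j hij r s => exact absurd (Subsingleton.elim i j) hij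
  | x_x ε i j r s =>
    simp only [map_sub, map_smul, map_mul, evalFree_x, mul_smul_comm, smul_mul_assoc]
    -- The matrices of two `x` of the same sign have product zero.
    rcases Int.units_eq_one_or ε with rfl | rfl <;> simp
  | serre hD ε i j hij l m => exact absurd (Subsingleton.elim i j) hij

/-- The evaluation representation. -/
noncomputable def evalRep (hq : ∀ n : ℕ, n ≠ 0 → Complex.exp ħ ^ n ≠ 1) (hb : b ≠ 0) :
    U sl2Datum ħ →ₐ[ℂ] Matrix (Fin 2) (Fin 2) ℂ :=
  RingQuot.liftAlgHom ℂ ⟨evalFree ħ b, evalFree_rel hq hb⟩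

theorem evalRep_mk (hq : ∀ n : ℕ, n ≠ 0 → Complex.exp ħ ^ n ≠ 1) (hb : b ≠ 0)
    (a : Free (Fin 1) ℚ) : evalRep hq hb (U.mk sl2Datum ħ a) = evalFree ħ b a :=
  RingQuot.liftAlgHom_mkAlgHom_apply _ _ _ _

/-- The evaluation module. -/
noncomputable def evalModule (hq : ∀ n : ℕ, n ≠ 0 → Complex.exp ħ ^ n ≠ 1) (hb : b ≠ 0) :
    ModuleCat.{0} (U sl2Datum ħ) :=
  letI : Module (U sl2Datum ħ) (Fin 2 → ℂ) :=
    Module.compHom _ ((Matrix.toLinAlgEquiv' (R := ℂ) (n := Fin 2)).toAlgHom.comp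
      (evalRep hq hb)).toRingHom
  ModuleCat.of (U sl2Datum ħ) (Fin 2 → ℂ)

theorem evalModule_smul (hq : ∀ n : ℕ, n ≠ 0 → Complex.exp ħ ^ n ≠ 1) (hb : b ≠ 0)
    (a : U sl2Datum ħ) (v : Fin 2 → ℂ) :
    (a • (show evalModule hq hb from v) : evalModule hq hb) = (evalRep hq hb a).mulVec v := rfl

/-- A basis of a module on which the generators act as on the standard basis of the evaluation
module with parameter `b`. -/
structure IsEvalBasis (ħ b : ℂ) {V : Type*} [AddCommGroup V] [Module ℂ V] [Module (U sl2Datum ħ) V]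
    (e : Module.Basis (Fin 2) ℂ V) : Prop where
  x_plus_zero : ∀ i r, U.x sl2Datum ħ 1 i r • e 0 = 0
  x_plus_one : ∀ i r, U.x sl2Datum ħ 1 i r • e 1 = (qPow ħ 1 * b) ^ r • e 0
  x_minus_zero : ∀ i r, U.x sl2Datum ħ (-1) i r • e 0 = (qPow ħ 1 * b) ^ r • e 1
  x_minus_one : ∀ i r, U.x sl2Datum ħ (-1) i r • e 1 = 0
  k : ∀ h j, U.k sl2Datum ħ h • e j = qPow ħ (((evalSign j : ℤ) : ℚ) * h) • e j
  phi : ∀ ε i m j, U.phi sl2Datum ħ ε i m • e j =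
    (gam (qPow ħ (((ε * evalSign j : ℤˣ) : ℤ) : ℚ)) m * evalParam ħ b j ^ ((ε : ℤ) * m)) • e j

theorem evalModule_algebraMap_smul (hq : ∀ n : ℕ, n ≠ 0 → Complex.exp ħ ^ n ≠ 1) (hb : b ≠ 0)
    (c : ℂ) (v : Fin 2 → ℂ) :
    (c • (show evalModule hq hb from v) : evalModule hq hb) = c • v := by
  change (evalRep hq hb (algebraMap _ _ c)).mulVec v = _
  rw [AlgHom.commutes, Algebra.algebraMap_eq_smul_one, Matrix.smul_mulVec, Matrix.one_mulVec]

/-- The standard basis of the evaluation module. -/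
noncomputable def evalBasis (hq : ∀ n : ℕ, n ≠ 0 → Complex.exp ħ ^ n ≠ 1) (hb : b ≠ 0) :
    Module.Basis (Fin 2) ℂ (evalModule hq hb) :=
  Module.Basis.ofEquivFun
    { toFun := fun v => v
      invFun := fun v => v
      map_add' := fun _ _ => rfl
      map_smul' := fun c v => evalModule_algebraMap_smul hq hb c v
      left_inv := fun _ => rfl
      right_inv := fun _ => rfl }

theorem evalBasis_apply (hq : ∀ n : ℕ, n ≠ 0 → Complex.exp ħ ^ n ≠ 1) (hb : b ≠ 0) (j : Fin 2) :
    evalBasis hq hb j = (Pi.single j 1 : Fin 2 → ℂ) := by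
  rw [evalBasis, Module.Basis.coe_ofEquivFun]
  rfl

theorem evalBasis_isEvalBasis (hq : ∀ n : ℕ, n ≠ 0 → Complex.exp ħ ^ n ≠ 1) (hb : b ≠ 0) :
    IsEvalBasis ħ b (evalBasis hq hb) := by
  have key (a : Free (Fin 1) ℚ) (j : Fin 2) (w : Fin 2 → ℂ)
      (h : (evalFree ħ b a).mulVec (Pi.single j 1) = w) :
      U.mk sl2Datum ħ a • evalBasis hq hb j = (show evalModule hq hb from w) := by
    rw [evalBasis_apply]
    refine (evalModule_smul hq hb _ _).trans ?_
    rw [evalRep_mk]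
    exact h
  have key' (a : Free (Fin 1) ℚ) (j j' : Fin 2) (c : ℂ)
      (h : (evalFree ħ b a).mulVec (Pi.single j 1) = c • Pi.single j' 1) :
      U.mk sl2Datum ħ a • evalBasis hq hb j = c • evalBasis hq hb j' := by
    rw [key a j _ h, evalBasis_apply hq hb j']
    exact (evalModule_algebraMap_smul hq hb _ _).symm
  refine ⟨fun i r => ?_, fun i r => key' _ _ _ _ ?_, fun i r => key' _ _ _ _ ?_, fun i r => ?_,
    fun h j => key' _ _ _ _ ?_, fun ε i m j => key' _ _ _ _ ?_⟩
  · refine key _ _ 0 ?_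
    rw [evalFree_x]
    ext j
    fin_cases j <;> simp
  · rw [evalFree_x]
    ext j
    fin_cases j <;> simp
  · rw [evalFree_x]
    ext j
    fin_cases j <;> simp
  · refine key _ _ 0 ?_
    rw [evalFree_x]
    ext j
    fin_cases j <;> simp
  · rw [evalFree_k, Matrix.diagonal_mulVec_single, mul_one, ← Pi.single_smul, smul_eq_mul, mul_one]
  · rw [evalFree_fphi hq hb, Matrix.diagonal_mulVec_single, mul_one, ← Pi.single_smul, smul_eq_mul,
      mul_one]

section Properties

variable {V : Type*} [AddCommGroup V] [Module ℂ V] [Module (U sl2Datum ħ) V]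
  [IsScalarTower ℂ (U sl2Datum ħ) V] {e : Module.Basis (Fin 2) ℂ V}

theorem IsEvalBasis.mem_weightSpace (he : IsEvalBasis ħ b e) (j : Fin 2) :
    e j ∈ weightSpace sl2Datum ħ V (((evalSign j : ℤ) : ℚ) • LinearMap.id) :=
  fun h => he.k h j

theorem IsEvalBasis.iSup_weightSpace_eq_top (he : IsEvalBasis ħ b e) :
    ⨆ ω, weightSpace sl2Datum ħ V ω = ⊤ := by
  rw [eq_top_iff, ← e.span_eq, Submodule.span_le]
  rintro _ ⟨j, rfl⟩
  exact Submodule.mem_iSup_of_mem _ (he.mem_weightSpace j)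

/-- Any nonzero vector reaches a multiple of `e 0`, after applying `x^+` if its second coordinate is
nonzero, and then `x^-` produces `e 1`. -/
theorem IsEvalBasis.eq_top_of_mem (he : IsEvalBasis ħ b e) (hb : b ≠ 0)
    {N : Submodule (U sl2Datum ħ) V} {v : V} (hv : v ∈ N) (h0 : v ≠ 0) : N = ⊤ := by
  have hsm (c : ℂ) {w : V} (hw : w ∈ N) : c • w ∈ N := N.smul_of_tower_mem c hw
  have ha (r : ℤ) : (qPow ħ 1 * b) ^ r ≠ 0 := zpow_ne_zero _ (mul_ne_zero (qPow_ne_zero _) hb)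
  have h01 (h : e 0 ∈ N) : N = ⊤ := by
    have h1 : e 1 ∈ N := by
      have := N.smul_mem (U.x sl2Datum ħ (-1) 0 0) h
      rwa [he.x_minus_zero, zpow_zero, one_smul] at this
    refine eq_top_iff.2 fun w _ => ?_
    rw [← e.sum_repr w, Fin.sum_univ_two]
    exact N.add_mem (hsm _ h) (hsm _ h1)
  obtain ⟨c₀, c₁, rfl⟩ : ∃ c₀ c₁ : ℂ, v = c₀ • e 0 + c₁ • e 1 :=
    ⟨_, _, by rw [← Fin.sum_univ_two fun j => e.repr v j • e j, e.sum_repr]⟩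
  by_cases hc : c₁ = 0
  · rw [hc, zero_smul, add_zero] at hv h0
    have hc0 : c₀ ≠ 0 := fun h => h0 (by rw [h, zero_smul])
    refine h01 ?_
    have := hsm c₀⁻¹ hv
    rwa [inv_smul_smul₀ hc0] at this
  · refine h01 ?_
    have := hsm c₁⁻¹ (N.smul_mem (U.x sl2Datum ħ 1 0 0) hv)
    rwa [smul_add, smul_comm _ c₀, smul_comm _ c₁, he.x_plus_zero, he.x_plus_one, smul_zero,
      zero_add, zpow_zero, one_smul, inv_smul_smul₀ hc] at this

theorem IsEvalBasis.isSimpleModule (he : IsEvalBasis ħ b e) (hb : b ≠ 0) :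
    IsSimpleModule (U sl2Datum ħ) V := by
  have : Nontrivial V := ⟨e 0, 0, e.ne_zero 0⟩
  refine (isSimpleModule_iff _ _).2 ⟨fun N => or_iff_not_imp_left.2 fun h => ?_⟩
  obtain ⟨v, hv, h0⟩ := N.exists_mem_ne_zero_of_ne_bot h
  exact he.eq_top_of_mem hb hv h0

theorem IsEvalBasis.isLHighestWeightVector (he : IsEvalBasis ħ b e) (hb : b ≠ 0) :
    IsLHighestWeightVector sl2Datum ħ V LinearMap.id
      (fun ε _ m => gam (qPow ħ ((ε : ℤ) : ℚ)) m * b ^ ((ε : ℤ) * m)) (e 0) := by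
  refine ⟨e.ne_zero 0, fun i => ⟨1, by simp [sl2Datum]⟩, fun h => ?_,
    he.eq_top_of_mem hb (Submodule.mem_span_singleton_self _) (e.ne_zero 0), he.x_plus_zero,
    fun ε i m => ?_⟩
  · rw [he.k]
    simp [evalSign]
  · rw [he.phi]
    simp [evalSign, evalParam]

end Properties

theorem reverse_one_sub_C_mul_X {c : ℂ} (hc : c ≠ 0) :
    (1 - Polynomial.C c * Polynomial.X : ℂ[X]).reverse = Polynomial.X - Polynomial.C c := by
  have hd : (1 - Polynomial.C c * Polynomial.X : ℂ[X]).natDegree = 1 := by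
    compute_degree!
  ext n
  rw [Polynomial.coeff_reverse, hd]
  rcases n with _ | _ | n
  · rw [Polynomial.revAt_le (by omega)]
    simp [Polynomial.coeff_one]
  · rw [Polynomial.revAt_le (by omega)]
    simp [Polynomial.coeff_C]
  · rw [Polynomial.revAt_eq_self_of_lt (by omega)]
    simp [Polynomial.coeff_one, Polynomial.coeff_X]

/-- For `P = 1 - b z` the quotient is `(q - b z) / (1 - q b z)`; with `t = (b z)⁻¹` it reads `(q⁻¹ -
t) / (1 - q⁻¹ t)`. Both expansions are given by `gam`. -/
theorem hasDrinfeldPolynomials_eval (hb : b ≠ 0) :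
    HasDrinfeldPolynomials sl2Datum ħ (fun ε _ m => gam (qPow ħ ((ε : ℤ) : ℚ)) m * b ^ ((ε : ℤ) * m))
      (fun _ => 1 - Polynomial.C b * Polynomial.X) := by
  have hq0 := qPow_ne_zero (ħ := ħ) 1
  have hcomp (c : ℂ) : (1 - Polynomial.C b * Polynomial.X : ℂ[X]).comp
      (Polynomial.C c * Polynomial.X) = 1 - Polynomial.C (b * c) * Polynomial.X := by
    simp [mul_assoc]
  have hd : (1 - Polynomial.C b * Polynomial.X : ℂ[X]).natDegree = 1 := by
    compute_degree!
  intro i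
  rw [show ((sl2Datum.r i : ℕ) : ℚ) = 1 from Nat.cast_one, hcomp, hcomp, hd, qPow_neg, pow_one,
    reverse_one_sub_C_mul_X (mul_ne_zero hb hq0),
    reverse_one_sub_C_mul_X (mul_ne_zero hb (inv_ne_zero hq0))]
  refine ⟨by simp, ?_, ?_⟩
  · ext n
    simp only [Polynomial.coe_sub, Polynomial.coe_mul, Polynomial.coe_C, Polynomial.coe_X,
      Polynomial.coe_one, mul_sub, mul_one, ← mul_assoc]
    rcases n with _ | _ | n
    · simp [gam]
    · have := gam_sub_zero (qPow ħ 1)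
      simp [PowerSeries.coeff_succ_mul_X]
      field_simp
      linear_combination this
    · have := gam_sub_succ (qPow ħ 1) n
      simp [PowerSeries.coeff_succ_mul_X, ← mul_assoc, PowerSeries.coeff_mul_C]
      linear_combination b ^ (n + 2) * this
  · ext n
    simp only [Polynomial.coe_sub, Polynomial.coe_mul, Polynomial.coe_C, Polynomial.coe_X, mul_sub]
    rcases n with _ | _ | n
    · simp [gam, qPow_neg]
      field_simp
    · have := gam_sub_zero (qPow ħ 1)⁻¹
      simp [PowerSeries.coeff_succ_mul_X, qPow_neg, ← mul_assoc, PowerSeries.coeff_mul_C]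
      rw [mul_assoc (gam _ 1), inv_mul_cancel₀ hb, mul_one]
      linear_combination -qPow ħ 1 * this - gam (qPow ħ 1)⁻¹ 0 * mul_inv_cancel₀ hq0
    · have := gam_sub_succ (qPow ħ 1)⁻¹ n
      simp [PowerSeries.coeff_succ_mul_X, qPow_neg, ← mul_assoc,
        PowerSeries.coeff_mul_C]
      rw [pow_succ b (n + 1), mul_inv, mul_assoc (gam _ (n + 1 + 1)), mul_assoc (_ : ℂ)⁻¹,
        inv_mul_cancel₀ hb, mul_one]
      linear_combination -qPow ħ 1 * (b ^ (n + 1))⁻¹ * this -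
        (b ^ (n + 1))⁻¹ * gam (qPow ħ 1)⁻¹ (n + 1) * mul_inv_cancel₀ hq0

theorem evalModule_isModf (hq : ∀ n : ℕ, n ≠ 0 → Complex.exp ħ ^ n ≠ 1) (hb : b ≠ 0) :
    isModf sl2Datum ħ (evalModule hq hb) :=
  isModf_of_iSup_eq_top hq _ (Module.Basis.finiteDimensional_of_finite (evalBasis hq hb))
    (evalBasis_isEvalBasis hq hb).iSup_weightSpace_eq_top

end Evaluation

end QAff

namespace QAff

/-! ### The fusion of two evaluation modules -/

section EvaluationFusion

/-- The rational function `(κ - c u) / (1 - κ c u)`. -/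
noncomputable def gamFrac (κ c : ℂ) : K :=
  (algebraMap ℂ K κ - algebraMap ℂ K c * RatFunc.X) / (1 - algebraMap ℂ K (κ * c) * RatFunc.X)

theorem algebraMap_polynomial_C (c : ℂ) :
    algebraMap ℂ[X] K (Polynomial.C c) = algebraMap ℂ K c :=
  (IsScalarTower.algebraMap_apply ℂ ℂ[X] K c).symm

theorem one_sub_mul_X_ne_zero (d : ℂ) : (1 - algebraMap ℂ K d * RatFunc.X : K) ≠ 0 := by
  have : (1 - algebraMap ℂ K d * RatFunc.X : K) =
      algebraMap ℂ[X] K (1 - Polynomial.C d * Polynomial.X) := by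
    rw [map_sub, map_mul, map_one, algebraMap_polynomial_C, RatFunc.algebraMap_X]
  rw [this]
  refine RatFunc.algebraMap_ne_zero fun h => ?_
  have := congrArg (Polynomial.eval 0) h
  simp at this

theorem ratCoeff_algebraMap_mul (c : ℂ) (n : ℤ) (f : K) :
    ratCoeff ℂ n (algebraMap ℂ K c * f) = c * ratCoeff ℂ n f := by
  rw [← Algebra.smul_def, map_smul, smul_eq_mul]

theorem ratCoeff_X_mul (n : ℤ) (f : K) : ratCoeff ℂ n (RatFunc.X * f) = ratCoeff ℂ (n - 1) f := by
  rw [← ratCoeff_zpow_mul, zpow_one]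

/-- Clearing the denominator gives a first order recursion for the coefficients, with source terms
in degrees `0` and `1` only. -/
theorem ratCoeff_gamFrac (κ c : ℂ) (n : ℤ) :
    ratCoeff ℂ n (gamFrac κ c) = if 0 ≤ n then gam κ n.toNat * c ^ n.toNat else 0 := by
  have hrec (n : ℤ) : ratCoeff ℂ n (gamFrac κ c) = κ * c * ratCoeff ℂ (n - 1) (gamFrac κ c) +
      ((if n = 0 then κ else 0) - (if n = 1 then c else 0)) := by
    have h : gamFrac κ c = algebraMap ℂ K (κ * c) * (RatFunc.X * gamFrac κ c) +
        (algebraMap ℂ K κ * 1 - algebraMap ℂ K c * RatFunc.X ^ (1 : ℤ)) := by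
      have := one_sub_mul_X_ne_zero (κ * c)
      rw [zpow_one, mul_one, ← sub_eq_iff_eq_add', ← mul_assoc, ← one_sub_mul, gamFrac,
        mul_div_cancel₀ _ this]
    conv_lhs => rw [h]
    rw [map_add, map_sub, ratCoeff_algebraMap_mul, ratCoeff_X_mul, ratCoeff_algebraMap_mul,
      ratCoeff_one, ratCoeff_algebraMap_mul, ratCoeff_zpow]
    simp only [mul_ite, mul_one, mul_zero]
  have hneg (n : ℤ) (hn : n < 0) : ratCoeff ℂ n (gamFrac κ c) = 0 := by
    obtain ⟨N, hN⟩ := ratCoeff_eq_zero_of_lt (gamFrac κ c)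
    rcases lt_or_ge n N with h | h
    · exact hN n h
    · induction n, h using Int.leInduction with
      | base =>
        rw [hrec, hN _ (by omega), if_neg (by omega), if_neg (by omega)]
        simp
      | succ m hm ih =>
        rw [hrec, add_sub_cancel_right, ih (by omega), if_neg (by omega), if_neg (by omega)]
        simp
  have hnat (m : ℕ) : ratCoeff ℂ (m : ℤ) (gamFrac κ c) = gam κ m * c ^ m := by
    induction m with
    | zero =>
      rw [hrec, hneg _ (by simp)]
      simp [gam]
    | succ m ih =>
      rw [hrec, Nat.cast_succ, add_sub_cancel_right, ih, if_neg (by omega)]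
      rcases m with _ | m
      · rw [if_pos (by simp)]
        linear_combination -c * gam_sub_zero κ
      · rw [if_neg (by omega)]
        linear_combination -c ^ (m + 2) * gam_sub_succ κ m
  split_ifs with h
  · obtain ⟨m, rfl⟩ := Int.eq_ofNat_of_zero_le h
    exact hnat m
  · exact hneg n (by omega)

variable {ħ b₁ b₂ : ℂ}
variable {V₁ V₂ : Type} [AddCommGroup V₁] [Module ℂ V₁] [Module (U sl2Datum ħ) V₁]
  [IsScalarTower ℂ (U sl2Datum ħ) V₁] [AddCommGroup V₂] [Module ℂ V₂] [Module (U sl2Datum ħ) V₂]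
  [IsScalarTower ℂ (U sl2Datum ħ) V₂]
  {e₁ : Module.Basis (Fin 2) ℂ V₁} {e₂ : Module.Basis (Fin 2) ℂ V₂}
  {ρ : U sl2Datum ħ →ₐ[ℂ] Module.End K (FusionSpace V₁ V₂)}

/-- The basis of the fusion space. -/
noncomputable def fusionBasis (e₁ : Module.Basis (Fin 2) ℂ V₁) (e₂ : Module.Basis (Fin 2) ℂ V₂) :
    Module.Basis (Fin 2 × Fin 2) K (FusionSpace V₁ V₂) :=
  Algebra.TensorProduct.basis K (e₁.tensorProduct e₂)

theorem fusionBasis_apply (i j : Fin 2) :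
    fusionBasis e₁ e₂ (i, j) = (1 : K) ⊗ₜ (e₁ i ⊗ₜ e₂ j) := by
  rw [fusionBasis, Algebra.TensorProduct.basis_apply, Module.Basis.tensorProduct_apply]

theorem expandCoeff_smul_fusionBasis (f : K) (i j : Fin 2) (n : ℤ) :
    expandCoeff (V₁ ⊗[ℂ] V₂) n (f • fusionBasis e₁ e₂ (i, j)) =
      ratCoeff ℂ n f • (e₁ i ⊗ₜ e₂ j) := by
  rw [fusionBasis_apply, smul_tmul', smul_eq_mul, mul_one, expandCoeff_tmul]

/-- The rational functions in the action of the currents. -/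
noncomputable def fusionFactor (ħ β : ℂ) (x : ℚ) : K := gamFrac (qPow ħ (-x)) (qPow ħ x * β)

theorem evalParam_eq (b : ℂ) (j : Fin 2) :
    evalParam ħ b j = qPow ħ 1 * b * qPow ħ (-((evalSign j : ℤ) : ℚ)) := by
  fin_cases j
  · simp [evalParam, evalSign, qPow_neg, mul_right_comm _ b, qPow_ne_zero]
  · simp only [evalParam, evalSign]
    simp
    rw [show (2 : ℚ) = 1 + 1 by norm_num, qPow_add]
    ring

theorem x_plus_fusionBasis_zero (hρ : IsFusionAction ρ) (h₂ : IsEvalBasis ħ b₂ e₂) (i : Fin 1) (r : ℤ)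
    (j : Fin 2) : ρ (U.x sl2Datum ħ 1 i r) (fusionBasis e₁ e₂ (j, 0)) =
      1 ⊗ₜ ((U.x sl2Datum ħ 1 i r • e₁ j) ⊗ₜ e₂ 0) := by
  refine expandCoeff_ext fun n => ?_
  rw [fusionBasis_apply, hρ.x_plus, deltaXPlus, expandCoeff_tmul, ratCoeff_one, h₂.x_plus_zero,
    tmul_zero, ite_self, add_zero, ite_smul, one_smul, zero_smul]

/-- The eigenvalues of the modes of `φ^-` on `e₁ j`, combined with the powers of `q b₂` from `x^+`,
form the series of `(q ^ {-s} - q ^ s β u) / (1 - β u)`, where `s` is the sign of `j` and `β = b₂ /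
b₁`. -/
theorem x_plus_fusionBasis_one (hρ : IsFusionAction ρ) (hb₁ : b₁ ≠ 0) (hb₂ : b₂ ≠ 0)
    (h₁ : IsEvalBasis ħ b₁ e₁) (h₂ : IsEvalBasis ħ b₂ e₂) (i : Fin 1) (r : ℤ) (j : Fin 2) :
    ρ (U.x sl2Datum ħ 1 i r) (fusionBasis e₁ e₂ (j, 1)) =
      1 ⊗ₜ ((U.x sl2Datum ħ 1 i r • e₁ j) ⊗ₜ e₂ 1) + (RatFunc.X ^ r *
        (algebraMap ℂ K ((qPow ħ 1 * b₂) ^ r) * fusionFactor ħ (b₂ / b₁) (evalSign j : ℤ))) •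
          fusionBasis e₁ e₂ (j, 0) := by
  have ha : qPow ħ 1 * b₂ ≠ 0 := mul_ne_zero (qPow_ne_zero _) hb₂
  have hq0 := qPow_ne_zero (ħ := ħ) 1
  refine expandCoeff_ext fun n => ?_
  rw [map_add, expandCoeff_smul_fusionBasis, fusionBasis_apply, hρ.x_plus, deltaXPlus,
    expandCoeff_tmul, ratCoeff_one, ite_smul, one_smul, zero_smul]
  congr 1
  rw [h₂.x_plus_one, h₁.phi, ratCoeff_zpow_mul, ratCoeff_algebraMap_mul, fusionFactor,
    ratCoeff_gamFrac]
  by_cases h : r ≤ n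
  · rw [if_pos h, if_pos (by omega), smul_tmul_smul]
    congr 1
    obtain ⟨m, rfl⟩ := Int.le.dest h
    have hs := qPow_ne_zero (ħ := ħ) (evalSign j : ℤ)
    rw [add_sub_cancel_left, Int.toNat_natCast, zpow_add₀ ha, neg_one_mul, Units.val_neg,
      Int.cast_neg, evalParam_eq, Units.val_neg, Units.val_one, neg_one_mul, zpow_neg, zpow_natCast,
      zpow_natCast, qPow_neg]
    have e : (qPow ħ (evalSign j : ℤ) * (b₂ / b₁)) ^ m =
        ((qPow ħ 1 * b₁ * (qPow ħ (evalSign j : ℤ))⁻¹) ^ m)⁻¹ * (qPow ħ 1 * b₂) ^ m := by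
      rw [← inv_pow, ← mul_pow]
      congr 1
      field_simp
    rw [e]
    ring
  · rw [if_neg h, if_neg (by omega), mul_zero, zero_smul]

theorem x_minus_fusionBasis_one (hρ : IsFusionAction ρ) (h₁ : IsEvalBasis ħ b₁ e₁) (i : Fin 1) (r : ℤ)
    (j : Fin 2) : ρ (U.x sl2Datum ħ (-1) i r) (fusionBasis e₁ e₂ (1, j)) =
      (RatFunc.X ^ r : K) ⊗ₜ (e₁ 1 ⊗ₜ (U.x sl2Datum ħ (-1) i r • e₂ j)) := by
  refine expandCoeff_ext fun n => ?_
  rw [fusionBasis_apply, hρ.x_minus, deltaXMinus, expandCoeff_tmul, ratCoeff_zpow, h₁.x_minus_one,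
    zero_tmul, ite_self, add_zero, ite_smul, one_smul, zero_smul]

theorem x_minus_fusionBasis_zero (hρ : IsFusionAction ρ) (hb₁ : b₁ ≠ 0)
    (h₁ : IsEvalBasis ħ b₁ e₁) (h₂ : IsEvalBasis ħ b₂ e₂) (i : Fin 1) (r : ℤ) (j : Fin 2) :
    ρ (U.x sl2Datum ħ (-1) i r) (fusionBasis e₁ e₂ (0, j)) =
      (RatFunc.X ^ r : K) ⊗ₜ (e₁ 0 ⊗ₜ (U.x sl2Datum ħ (-1) i r • e₂ j)) +
        (algebraMap ℂ K ((qPow ħ 1 * b₁) ^ r) * fusionFactor ħ (b₂ / b₁) (-(evalSign j : ℤ))) •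
          fusionBasis e₁ e₂ (1, j) := by
  have ha : qPow ħ 1 * b₁ ≠ 0 := mul_ne_zero (qPow_ne_zero _) hb₁
  have hq0 := qPow_ne_zero (ħ := ħ) 1
  refine expandCoeff_ext fun n => ?_
  rw [map_add, expandCoeff_smul_fusionBasis, fusionBasis_apply, hρ.x_minus, deltaXMinus,
    expandCoeff_tmul, ratCoeff_zpow, ite_smul, one_smul, zero_smul]
  congr 1
  rw [h₁.x_minus_zero, h₂.phi, ratCoeff_algebraMap_mul, fusionFactor, ratCoeff_gamFrac]
  by_cases h : 0 ≤ n
  · rw [if_pos h, if_pos h, smul_tmul_smul]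
    congr 1
    obtain ⟨m, rfl⟩ := Int.eq_ofNat_of_zero_le h
    have hs := qPow_ne_zero (ħ := ħ) (evalSign j : ℤ)
    rw [Int.toNat_natCast, zpow_sub₀ ha, one_mul, evalParam_eq, Units.val_one, one_mul,
      zpow_natCast, zpow_natCast, neg_neg, div_eq_mul_inv, mul_assoc]
    congr 1
    rw [mul_left_comm, ← inv_pow, ← mul_pow]
    congr 2
    field_simp
  · rw [if_neg h, if_neg h, mul_zero, zero_smul]

theorem k_fusionBasis (hρ : IsFusionAction ρ) (h₁ : IsEvalBasis ħ b₁ e₁) (h₂ : IsEvalBasis ħ b₂ e₂)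
    (h : ℚ) (i j : Fin 2) : ρ (U.k sl2Datum ħ h) (fusionBasis e₁ e₂ (i, j)) =
      algebraMap ℂ K (qPow ħ ((((evalSign i : ℤ) : ℚ) + ((evalSign j : ℤ) : ℚ)) * h)) •
        fusionBasis e₁ e₂ (i, j) := by
  rw [fusionBasis_apply, hρ.k, h₁.k, h₂.k, smul_tmul_smul, tmul_smul, algebraMap_smul, add_mul,
    qPow_add]

theorem exists_phi_fusionBasis (hρ : IsFusionAction ρ) (h₁ : IsEvalBasis ħ b₁ e₁)
    (h₂ : IsEvalBasis ħ b₂ e₂) (ε : ℤˣ) (l : Fin 1) (m : ℕ) (i j : Fin 2) :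
    ∃ f ∈ regularAtOne, ρ (U.phi sl2Datum ħ ε l m) (fusionBasis e₁ e₂ (i, j)) =
      f • fusionBasis e₁ e₂ (i, j) := by
  have key (s : ℕ) (c : ℂ) : (RatFunc.X ^ ((ε : ℤ) * (s : ℤ)) : K) ⊗ₜ[ℂ] (c • (e₁ i ⊗ₜ[ℂ] e₂ j)) =
      (algebraMap ℂ K c * RatFunc.X ^ ((ε : ℤ) * (s : ℤ))) • fusionBasis e₁ e₂ (i, j) := by
    rw [tmul_smul, fusionBasis_apply, smul_tmul', smul_tmul', smul_eq_mul, mul_one, Algebra.smul_def]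
  rw [fusionBasis_apply, hρ.phi]
  simp only [h₁.phi, h₂.phi, smul_tmul_smul, key]
  rw [← Finset.sum_smul, ← fusionBasis_apply]
  exact ⟨_, sum_mem fun s _ => mul_mem (regularAtOne.algebraMap_mem _) (zpow_X_mem_regularAtOne _), rfl⟩

end EvaluationFusion

end QAff

namespace QAff

/-! ### Non-commutativity of `⊗_d` and comparison with `*_f` -/

section Generators

variable {ι : Type w₁} [Fintype ι] [DecidableEq ι] {𝔥 : Type w₂} [AddCommGroup 𝔥] [Module ℚ 𝔥]
variable {D : CartanDatum ι 𝔥} {ħ : ℂ}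

/-- The module is generated by a vector of weight `ω`. -/
def IsGeneratedInWeight (D : CartanDatum ι 𝔥) (ħ : ℂ) (ω : Module.Dual ℚ 𝔥) (Y : Type v)
    [AddCommGroup Y] [Module (U D ħ) Y] : Prop :=
  ∃ y : Y, (∀ h, U.k D ħ h • y = algebraMap ℂ (U D ħ) (qPow ħ (ω h)) • y) ∧
    Submodule.span (U D ħ) {y} = ⊤

theorem IsGeneratedInWeight.of_equiv {ω : Module.Dual ℚ 𝔥} {Y Y' : Type v} [AddCommGroup Y]
    [Module (U D ħ) Y] [AddCommGroup Y'] [Module (U D ħ) Y'] (e : Y ≃ₗ[U D ħ] Y')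
    (h : IsGeneratedInWeight D ħ ω Y') : IsGeneratedInWeight D ħ ω Y := by
  obtain ⟨y, hy, hs⟩ := h
  refine ⟨e.symm y, fun h => ?_, ?_⟩
  · rw [← map_smul, hy, map_smul]
  · rw [← Set.image_singleton]
    have := Submodule.map_span (e.symm : Y' →ₗ[U D ħ] Y) {y}
    rw [hs, Submodule.map_top, LinearMap.range_eq_top.2 e.symm.surjective] at this
    exact this.symm

variable {X : Type v} [AddCommGroup X] [Module ℂ X] [Module K X] [IsScalarTower ℂ K X]
variable {ρ : U D ħ →ₐ[ℂ] Module.End K X}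

theorem mem_lattice_of_mem {S : Set X} {s : X} (hs : s ∈ S) : (s : RepSpace ρ) ∈ lattice ρ S :=
  Submodule.subset_span ⟨1, one_mem _, s, hs, (one_smul K s).symm⟩

theorem action_mem_latticeRegular {S : Set X} {x : X} (hx : x ∈ latticeRegular ρ S) (a : U D ħ) :
    ρ a x ∈ latticeRegular ρ S :=
  mem_latticeRegular.2 ((lattice ρ S).smul_mem a (mem_latticeRegular.1 hx))

theorem action_algebraMap (c : ℂ) (x : X) :
    ρ (algebraMap ℂ (U D ħ) c) x = algebraMap ℂ K c • x := by
  rw [AlgHom.commutes, algebraMap_smul]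
  rfl

/-- Elements of `𝒜` are constants modulo `u - 1`, so the image of `s` alone generates. -/
theorem isGeneratedInWeight_specialization {ω : Module.Dual ℚ 𝔥} {s : X}
    (hs : ∀ h, ρ (U.k D ħ h) s = algebraMap ℂ K (qPow ħ (ω h)) • s) :
    IsGeneratedInWeight D ħ ω (Specialization ρ (lattice ρ {s})) := by
  let s' : lattice ρ {s} := ⟨s, mem_lattice_of_mem (X := X) (Set.mem_singleton s)⟩
  refine ⟨Submodule.Quotient.mk s', fun h => ?_, ?_⟩
  · rw [← Submodule.Quotient.mk_smul, ← Submodule.Quotient.mk_smul]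
    congr 1
    exact Subtype.ext ((hs h).trans (action_algebraMap (X := X) (ρ := ρ) _ s).symm)
  · set N := Submodule.span (U D ħ)
      {(Submodule.Quotient.mk s' : Specialization ρ (lattice ρ {s}))}
    have hN : (Submodule.Quotient.mk s' : Specialization ρ (lattice ρ {s})) ∈ N :=
      Submodule.mem_span_singleton_self _
    have key : lattice ρ {s} ≤ (N.comap (Submodule.mkQ _)).map (lattice ρ {s}).subtype := by
      refine Submodule.span_le.2 ?_
      rintro _ ⟨a, ha, t, ht, rfl⟩
      rw [show t = s from ht]
      obtain ⟨c, b, hb, rfl⟩ := exists_eq_const_add ha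
      have hmem {f : K} (hf : f ∈ regularAtOne) : (f • s : X) ∈ latticeRegular ρ {s} :=
        regular_smul_mem hf (mem_latticeRegular.2 (mem_lattice_of_mem (X := X) (Set.mem_singleton s)))
      refine ⟨⟨_, mem_latticeRegular.1 (hmem ha)⟩, ?_, rfl⟩
      have : (Submodule.Quotient.mk ⟨_, mem_latticeRegular.1 (hmem ha)⟩ :
          Specialization ρ (lattice ρ {s})) =
          algebraMap ℂ (U D ħ) c • Submodule.Quotient.mk s' := by
        rw [← Submodule.Quotient.mk_smul]
        refine (Submodule.Quotient.eq _).2 ⟨(b • s : X), mem_latticeRegular.1 (hmem hb), ?_⟩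
        have e2 : (RatFunc.X - 1 : K) • b • s =
            (algebraMap ℂ K c + (RatFunc.X - 1) * b) • s - ρ (algebraMap ℂ _ c) s := by
          rw [action_algebraMap, add_smul, add_sub_cancel_left, mul_smul]
        exact e2
      change (Submodule.Quotient.mk _ : Specialization ρ (lattice ρ {s})) ∈ N
      rw [this]
      exact N.smul_mem _ hN
    refine eq_top_iff.2 fun y _ => ?_
    obtain ⟨⟨x, hx⟩, rfl⟩ := Submodule.Quotient.mk_surjective _ y
    obtain ⟨z, hz, rfl⟩ := key hx
    exact hz

/-- An `𝒜`-submodule stable under `𝒰_q(ĝ)`. -/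
def stableSubmodule (ρ : U D ħ →ₐ[ℂ] Module.End K X) (Q : Submodule regularAtOne X)
    (hQ : ∀ a, ∀ x ∈ Q, ρ a x ∈ Q) : Submodule (U D ħ) (RepSpace ρ) where
  carrier := {x | (show X from x) ∈ Q}
  add_mem' := Q.add_mem
  zero_mem' := Q.zero_mem
  smul_mem' a x hx := hQ a x hx

theorem lattice_le_stableSubmodule {Q : Submodule regularAtOne X}
    (hQ : ∀ a, ∀ x ∈ Q, ρ a x ∈ Q) {S : Set X} (hS : ∀ s ∈ S, s ∈ Q) {x : X}
    (hx : x ∈ latticeRegular ρ S) : x ∈ Q := by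
  have : lattice ρ S ≤ stableSubmodule ρ Q hQ := by
    refine Submodule.span_le.2 ?_
    rintro _ ⟨a, ha, s, hs, rfl⟩
    exact regular_smul_mem ha (hS s hs)
  exact this hx

end Generators

/-! ### Lattices spanned by a basis, and the sublattice vanishing at one coordinate -/

section Lattices

variable {X : Type*} [AddCommGroup X] [Module K X]

theorem one_ne_X_sub_one_mul {g : K} (hg : g ∈ regularAtOne) : 1 ≠ (RatFunc.X - 1) * g := by
  obtain ⟨p, r, hr, rfl⟩ := hg
  intro h
  have hr0 : algebraMap ℂ[X] K r ≠ 0 := RatFunc.algebraMap_ne_zero (by rintro rfl; simp at hr)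
  have h1 : algebraMap ℂ[X] K r = algebraMap ℂ[X] K ((Polynomial.X - 1) * p) := by
    rw [map_mul, map_sub, map_one, RatFunc.algebraMap_X]
    field_simp at h
    exact h
  have h2 := RatFunc.algebraMap_injective ℂ h1
  apply hr
  rw [h2]
  simp

/-- The `𝒜`-submodule spanned by a basis. -/
noncomputable def basisLattice (w : Module.Basis (Fin 2 × Fin 2) K X) : Submodule regularAtOne X :=
  Submodule.span regularAtOne (Set.range w)

/-- The elements of `basisLattice w` whose coordinate at `(1, 0)` vanishes at `u = 1`. -/
noncomputable def vanishingLattice (w : Module.Basis (Fin 2 × Fin 2) K X) : Submodule regularAtOne X :=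
  Submodule.span regularAtOne {w (0, 0), w (0, 1), w (1, 1), (RatFunc.X - 1 : K) • w (1, 0)}

variable {w : Module.Basis (Fin 2 × Fin 2) K X}

theorem basis_mem_basisLattice (p) : w p ∈ basisLattice w := Submodule.subset_span ⟨p, rfl⟩

theorem mem_vanishingLattice :
    w (0, 0) ∈ vanishingLattice w ∧ w (0, 1) ∈ vanishingLattice w ∧ w (1, 1) ∈ vanishingLattice w ∧
      (RatFunc.X - 1 : K) • w (1, 0) ∈ vanishingLattice w :=
  ⟨Submodule.subset_span (by simp), Submodule.subset_span (by simp),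
    Submodule.subset_span (by simp), Submodule.subset_span (by simp)⟩

theorem vanishingLattice_le : vanishingLattice w ≤ basisLattice w := by
  refine Submodule.span_le.2 ?_
  rintro _ (rfl | rfl | rfl | rfl)
  · exact basis_mem_basisLattice _
  · exact basis_mem_basisLattice _
  · exact basis_mem_basisLattice _
  · exact regular_smul_mem X_sub_one_mem_regularAtOne (basis_mem_basisLattice _)

theorem X_sub_one_smul_mem_vanishingLattice {x : X} (hx : x ∈ basisLattice w) :
    (RatFunc.X - 1 : K) • x ∈ vanishingLattice w := by
  induction hx using Submodule.span_induction with
  | zero => rw [smul_zero]; exact zero_mem _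
  | add x y _ _ hx hy => rw [smul_add]; exact add_mem hx hy
  | smul a x _ hx =>
    rw [smul_comm]
    exact Submodule.smul_mem _ a hx
  | mem x hx =>
    obtain ⟨h1, h2, h3, h4⟩ := mem_vanishingLattice (w := w)
    obtain ⟨⟨i, j⟩, rfl⟩ := hx
    have hX := X_sub_one_mem_regularAtOne
    fin_cases i <;> fin_cases j
    · exact regular_smul_mem hX h1
    · exact regular_smul_mem hX h2
    · exact h4
    · exact regular_smul_mem hX h3

theorem exists_eq_smul_add {x : X} (hx : x ∈ basisLattice w) :
    ∃ f ∈ regularAtOne, ∃ p ∈ vanishingLattice w, x = f • w (1, 0) + p := by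
  have hle : basisLattice w ≤ regularAtOne ∙ w (1, 0) ⊔ vanishingLattice w := by
    refine Submodule.span_le.2 ?_
    obtain ⟨h1, h2, h3, -⟩ := mem_vanishingLattice (w := w)
    rintro _ ⟨⟨i, j⟩, rfl⟩
    fin_cases i <;> fin_cases j
    · exact Submodule.mem_sup_right h1
    · exact Submodule.mem_sup_right h2
    · exact Submodule.mem_sup_left (Submodule.mem_span_singleton_self _)
    · exact Submodule.mem_sup_right h3
  obtain ⟨y, hy, p, hp, rfl⟩ := Submodule.mem_sup.1 (hle hx)
  obtain ⟨f, rfl⟩ := Submodule.mem_span_singleton.1 hy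
  exact ⟨f, f.2, p, hp, rfl⟩

/-- The `(1, 0)` coordinate of every element is divisible by `u - 1` in `𝒜`, and `1` is not. -/
theorem basis_notMem_vanishingLattice : w (1, 0) ∉ vanishingLattice w := by
  have key {x : X} (hx : x ∈ vanishingLattice w) :
      ∃ g ∈ regularAtOne, w.repr x (1, 0) = (RatFunc.X - 1) * g := by
    induction hx using Submodule.span_induction with
    | zero => exact ⟨0, zero_mem _, by simp⟩
    | add x y _ _ hx hy =>
      obtain ⟨g, hg, hx⟩ := hx
      obtain ⟨g', hg', hy⟩ := hy
      exact ⟨g + g', add_mem hg hg', by rw [map_add, Finsupp.add_apply, hx, hy, mul_add]⟩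
    | smul a x _ hx =>
      obtain ⟨g, hg, hx⟩ := hx
      refine ⟨a * g, mul_mem a.2 hg, ?_⟩
      change w.repr ((a : K) • x) (1, 0) = _
      rw [map_smul, Finsupp.smul_apply, hx, smul_eq_mul, mul_left_comm]
    | mem x hx =>
      rcases hx with rfl | rfl | rfl | rfl
      · exact ⟨0, zero_mem _, by simp⟩
      · exact ⟨0, zero_mem _, by simp⟩
      · exact ⟨0, zero_mem _, by simp⟩
      · exact ⟨1, one_mem _, by simp⟩
  intro h
  obtain ⟨g, hg, h⟩ := key h
  rw [Module.Basis.repr_self, Finsupp.single_eq_same] at h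
  exact one_ne_X_sub_one_mul hg h

/-- As `(u - 1) • basisLattice w` lies in `vanishingLattice w`, the image of `w (1, 0)` is only
required to be in the larger lattice. -/
theorem map_mem_of_basis {T : Module.End K X} (h00 : T (w (0, 0)) ∈ vanishingLattice w)
    (h01 : T (w (0, 1)) ∈ vanishingLattice w) (h11 : T (w (1, 1)) ∈ vanishingLattice w)
    (h10 : T (w (1, 0)) ∈ basisLattice w) :
    (∀ x ∈ vanishingLattice w, T x ∈ vanishingLattice w) ∧
      ∀ x ∈ basisLattice w, T x ∈ basisLattice w := by
  constructor
  · intro x hx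
    induction hx using Submodule.span_induction with
    | zero => rw [map_zero]; exact zero_mem _
    | add x y _ _ hx hy => rw [map_add]; exact add_mem hx hy
    | smul a x _ hx =>
      change T ((a : K) • x) ∈ _
      rw [map_smul]
      exact regular_smul_mem a.2 hx
    | mem x hx =>
      rcases hx with rfl | rfl | rfl | rfl
      · exact h00
      · exact h01
      · exact h11
      · rw [map_smul]
        exact X_sub_one_smul_mem_vanishingLattice h10
  · intro x hx
    induction hx using Submodule.span_induction with
    | zero => rw [map_zero]; exact zero_mem _
    | add x y _ _ hx hy => rw [map_add]; exact add_mem hx hy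
    | smul a x _ hx =>
      change T ((a : K) • x) ∈ _
      rw [map_smul]
      exact regular_smul_mem a.2 hx
    | mem x hx =>
      obtain ⟨⟨i, j⟩, rfl⟩ := hx
      fin_cases i <;> fin_cases j
      · exact vanishingLattice_le h00
      · exact vanishingLattice_le h01
      · exact h10
      · exact vanishingLattice_le h11

/-- A quotient of linear polynomials is regular at `u = 1` if the denominator does not vanish. -/
theorem linear_div_mem_regularAtOne (a b : ℂ) {c d : ℂ} (h : c ≠ d) :
    (algebraMap ℂ K a - algebraMap ℂ K b * RatFunc.X) /
      (algebraMap ℂ K c - algebraMap ℂ K d * RatFunc.X) ∈ regularAtOne := by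
  refine ⟨Polynomial.C a - Polynomial.C b * Polynomial.X,
    Polynomial.C c - Polynomial.C d * Polynomial.X, by simpa [sub_eq_zero] using h, ?_⟩
  simp only [map_sub, map_mul, RatFunc.algebraMap_X, algebraMap_polynomial_C]

theorem linear_ne_zero {c d : ℂ} (h : c ≠ d) :
    (algebraMap ℂ K c - algebraMap ℂ K d * RatFunc.X : K) ≠ 0 := by
  have : (algebraMap ℂ K c - algebraMap ℂ K d * RatFunc.X : K) =
      algebraMap ℂ[X] K (Polynomial.C c - Polynomial.C d * Polynomial.X) := by
    simp only [map_sub, map_mul, RatFunc.algebraMap_X, algebraMap_polynomial_C]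
  rw [this]
  refine RatFunc.algebraMap_ne_zero fun h' => h ?_
  have := congrArg (Polynomial.eval 1) h'
  simpa [sub_eq_zero] using this

theorem gamFrac_mem_regularAtOne {κ c : ℂ} (h : κ * c ≠ 1) : gamFrac κ c ∈ regularAtOne := by
  rw [gamFrac, ← map_one (algebraMap ℂ K)]
  exact linear_div_mem_regularAtOne κ c h.symm

theorem exists_mul_gamFrac_eq_one {κ c : ℂ} (h : κ ≠ c) :
    ∃ g ∈ regularAtOne, g * gamFrac κ c = 1 := by
  refine ⟨_, linear_div_mem_regularAtOne 1 (κ * c) h, ?_⟩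
  rw [gamFrac, map_one, div_mul_div_comm, mul_comm]
  exact div_self (mul_ne_zero (linear_ne_zero h) (one_sub_mul_X_ne_zero _))

theorem exists_gamFrac_eq {κ : ℂ} (h : κ * κ ≠ 1) :
    ∃ g ∈ regularAtOne, gamFrac κ κ = (RatFunc.X - 1) * g := by
  refine ⟨_, linear_div_mem_regularAtOne (-κ) 0 h.symm, ?_⟩
  rw [gamFrac, map_one, map_zero, zero_mul, sub_zero, map_neg, mul_div_assoc']
  congr 1
  ring

end Lattices

end QAff

namespace QAff

/-! ### The lattice for two evaluation modules with distinct parameters -/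

section EvaluationTensor

variable {ħ b₁ b₂ : ℂ}
variable {V₁ V₂ : Type} [AddCommGroup V₁] [Module ℂ V₁] [Module (U sl2Datum ħ) V₁]
  [IsScalarTower ℂ (U sl2Datum ħ) V₁] [AddCommGroup V₂] [Module ℂ V₂] [Module (U sl2Datum ħ) V₂]
  [IsScalarTower ℂ (U sl2Datum ħ) V₂]
  {e₁ : Module.Basis (Fin 2) ℂ V₁} {e₂ : Module.Basis (Fin 2) ℂ V₂}
  {ρ : U sl2Datum ħ →ₐ[ℂ] Module.End K (FusionSpace V₁ V₂)}

theorem tmul_smul_left_eq (f : K) (c : ℂ) (i j : Fin 2) :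
    (f ⊗ₜ ((c • e₁ i) ⊗ₜ e₂ j) : FusionSpace V₁ V₂) =
      (f * algebraMap ℂ K c) • fusionBasis e₁ e₂ (i, j) := by
  rw [← smul_tmul' c (e₁ i), tmul_smul, fusionBasis_apply, smul_tmul', smul_tmul', smul_eq_mul,
    mul_one, mul_comm f, Algebra.smul_def]

theorem tmul_smul_right_eq (f : K) (c : ℂ) (i j : Fin 2) :
    (f ⊗ₜ (e₁ i ⊗ₜ (c • e₂ j)) : FusionSpace V₁ V₂) =
      (f * algebraMap ℂ K c) • fusionBasis e₁ e₂ (i, j) := by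
  rw [tmul_smul c (e₁ i), smul_tmul', tmul_smul_left_eq]

theorem fusionFactor_mem_regularAtOne {β : ℂ} (hβ : β ≠ 1) (x : ℚ) :
    fusionFactor ħ β x ∈ regularAtOne := by
  refine gamFrac_mem_regularAtOne ?_
  rwa [← mul_assoc, ← qPow_add, neg_add_cancel, qPow_zero, one_mul]

theorem one_tmul_mem_basisLattice (t : V₁ ⊗[ℂ] V₂) :
    ((1 : K) ⊗ₜ[ℂ] t : FusionSpace V₁ V₂) ∈ basisLattice (fusionBasis e₁ e₂) := by
  rw [← (e₁.tensorProduct e₂).sum_repr t, tmul_sum]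
  refine sum_mem fun p _ => ?_
  rw [tmul_smul, Module.Basis.tensorProduct_apply', ← fusionBasis_apply, ← algebraMap_smul K]
  exact regular_smul_mem (regularAtOne.algebraMap_mem _) (basis_mem_basisLattice _)

/-- If the parameters differ, then the lattice is generated by the tensor product of the highest
weight vectors, unless the fusion factor vanishes at `u = 1`. -/
theorem tensorLattice_eq_lattice (hρ : IsFusionAction ρ) (hb₁ : b₁ ≠ 0) (hb : b₁ ≠ b₂)
    (h₁ : IsEvalBasis ħ b₁ e₁) (h₂ : IsEvalBasis ħ b₂ e₂)
    (hF : ∃ g ∈ regularAtOne, g * fusionFactor ħ (b₂ / b₁) (-1) = 1) :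
    tensorLattice ρ = lattice ρ {(1 : K) ⊗ₜ[ℂ] (e₁ 0 ⊗ₜ[ℂ] e₂ 0)} := by
  let N := latticeRegular ρ {(1 : K) ⊗ₜ[ℂ] (e₁ 0 ⊗ₜ[ℂ] e₂ 0)}
  have hq0 := qPow_ne_zero (ħ := ħ) 1
  have h00 : fusionBasis e₁ e₂ (0, 0) ∈ N := by
    rw [fusionBasis_apply]
    exact mem_latticeRegular.2 (mem_lattice_of_mem (X := FusionSpace V₁ V₂) (Set.mem_singleton _))
  have hx (r : ℤ) : (RatFunc.X ^ r * algebraMap ℂ K ((qPow ħ 1 * b₂) ^ r)) •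
      fusionBasis e₁ e₂ (0, 1) + (algebraMap ℂ K ((qPow ħ 1 * b₁) ^ r) *
        fusionFactor ħ (b₂ / b₁) (-1)) • fusionBasis e₁ e₂ (1, 0) ∈ N := by
    have := action_mem_latticeRegular h00 (U.x sl2Datum ħ (-1) 0 r)
    rw [x_minus_fusionBasis_zero hρ hb₁ h₁ h₂, h₂.x_minus_zero, tmul_smul_right_eq] at this
    simpa [evalSign] using this
  have h0 := hx 0
  have h1 := hx 1
  simp only [zpow_zero, zpow_one, map_one, one_mul, one_smul] at h0 h1
  have hne : qPow ħ 1 * b₁ ≠ qPow ħ 1 * b₂ := fun h => hb (mul_left_cancel₀ hq0 h)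
  -- Eliminating `w_{10}` from the modes `0` and `1` leaves `(q b₁ - q b₂ u) w_{01}`, whose
  -- coefficient is invertible in `𝒜` because `b₁ ≠ b₂`.
  have h01 : fusionBasis e₁ e₂ (0, 1) ∈ N := by
    have h3 := sub_mem (regular_smul_mem (regularAtOne.algebraMap_mem (qPow ħ 1 * b₁)) h0) h1
    have h4 := regular_smul_mem (linear_div_mem_regularAtOne 1 0 hne) h3
    rw [smul_add, smul_smul, add_sub_add_right_eq_sub, ← sub_smul, smul_smul, map_one, map_zero,
      zero_mul, sub_zero, mul_comm RatFunc.X, one_div_mul_cancel (linear_ne_zero hne), one_smul] at h4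
    exact h4
  have h10 : fusionBasis e₁ e₂ (1, 0) ∈ N := by
    obtain ⟨g, hg, hgF⟩ := hF
    have h3 := regular_smul_mem hg (sub_mem h0 h01)
    rwa [add_sub_cancel_left, smul_smul, hgF, one_smul] at h3
  have h11 : fusionBasis e₁ e₂ (1, 1) ∈ N := by
    have := action_mem_latticeRegular h10 (U.x sl2Datum ħ (-1) 0 0)
    rwa [x_minus_fusionBasis_one hρ h₁, h₂.x_minus_zero, tmul_smul_right_eq, zpow_zero, zpow_zero,
      map_one, mul_one, one_smul] at this
  have hle : basisLattice (fusionBasis e₁ e₂) ≤ N := by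
    refine Submodule.span_le.2 ?_
    rintro _ ⟨⟨i, j⟩, rfl⟩
    fin_cases i <;> fin_cases j
    exacts [h00, h01, h10, h11]
  refine le_antisymm (Submodule.span_le.2 ?_) (Submodule.span_mono ?_)
  · rintro _ ⟨a, ha, _, ⟨t, rfl⟩, rfl⟩
    exact (mem_latticeRegular (x := a • ((1 : K) ⊗ₜ[ℂ] t))).1
      (regular_smul_mem ha (hle (one_tmul_mem_basisLattice t)))
  · rintro _ ⟨a, ha, _, rfl, rfl⟩
    exact ⟨a, ha, _, ⟨_, rfl⟩, rfl⟩

/-- From the other basis vectors, `w_{10}` is reached only with the factor `fusionFactor` at `-1`,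
which `hF` makes divisible by `u - 1`. The other fusion factor has its only pole at `u = b₁ / b₂ ≠
1`. -/
theorem action_mem_vanishingLattice (hq : ∀ n : ℕ, n ≠ 0 → Complex.exp ħ ^ n ≠ 1)
    (hρ : IsFusionAction ρ) (hb₁ : b₁ ≠ 0) (hb₂ : b₂ ≠ 0) (hb : b₁ ≠ b₂)
    (h₁ : IsEvalBasis ħ b₁ e₁) (h₂ : IsEvalBasis ħ b₂ e₂)
    (hF : ∃ g ∈ regularAtOne, fusionFactor ħ (b₂ / b₁) (-1) = (RatFunc.X - 1) * g) (a : U sl2Datum ħ) :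
    (∀ x ∈ vanishingLattice (fusionBasis e₁ e₂), ρ a x ∈ vanishingLattice (fusionBasis e₁ e₂)) ∧
      ∀ x ∈ basisLattice (fusionBasis e₁ e₂), ρ a x ∈ basisLattice (fusionBasis e₁ e₂) := by
  obtain ⟨w00, w01, w11, w10⟩ := mem_vanishingLattice (w := fusionBasis e₁ e₂)
  have w10' := basis_mem_basisLattice (w := fusionBasis e₁ e₂) (1, 0)
  have hC (c : ℂ) : algebraMap ℂ K c ∈ regularAtOne := regularAtOne.algebraMap_mem c
  have hX := zpow_X_mem_regularAtOne
  have hβ : b₂ / b₁ ≠ 1 := fun h => hb ((div_eq_one_iff_eq hb₁).1 h).symm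
  have hF1 := fusionFactor_mem_regularAtOne (ħ := ħ) hβ 1
  have hwF : fusionFactor ħ (b₂ / b₁) (-1) • fusionBasis e₁ e₂ (1, 0) ∈
      vanishingLattice (fusionBasis e₁ e₂) := by
    obtain ⟨g, hg, hgF⟩ := hF
    rw [hgF, mul_comm, mul_smul]
    exact regular_smul_mem hg w10
  have s0 : ((evalSign 0 : ℤ) : ℚ) = 1 := by simp [evalSign]
  have s1 : ((evalSign 1 : ℤ) : ℚ) = -1 := by simp [evalSign]
  let S : Subalgebra ℂ (U sl2Datum ħ) :=
    { carrier := {a | (∀ x ∈ vanishingLattice (fusionBasis e₁ e₂),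
          ρ a x ∈ vanishingLattice (fusionBasis e₁ e₂)) ∧
          ∀ x ∈ basisLattice (fusionBasis e₁ e₂), ρ a x ∈ basisLattice (fusionBasis e₁ e₂)}
      mul_mem' := fun {a b} ha hb => by
        refine ⟨fun x hx => ?_, fun x hx => ?_⟩
        · rw [map_mul]
          exact ha.1 _ (hb.1 x hx)
        · rw [map_mul]
          exact ha.2 _ (hb.2 x hx)
      add_mem' := fun {a b} ha hb => by
        refine ⟨fun x hx => ?_, fun x hx => ?_⟩
        · rw [map_add]
          exact add_mem (ha.1 x hx) (hb.1 x hx)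
        · rw [map_add]
          exact add_mem (ha.2 x hx) (hb.2 x hx)
      algebraMap_mem' := fun c => by
        refine ⟨fun x hx => ?_, fun x hx => ?_⟩
        · rw [action_algebraMap]
          exact regular_smul_mem (hC c) hx
        · rw [action_algebraMap]
          exact regular_smul_mem (hC c) hx }
  have hS : S = ⊤ := by
    refine U.eq_top_of_phi (S := S) hq (fun ε i r => ?_) (fun h => ?_) fun ε i m => ?_
    · rcases Int.units_eq_one_or ε with rfl | rfl
      · refine map_mem_of_basis ?_ ?_ ?_ ?_
        · rw [x_plus_fusionBasis_zero hρ h₂, h₁.x_plus_zero, zero_tmul, tmul_zero]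
          exact zero_mem _
        · rw [x_plus_fusionBasis_one hρ hb₁ hb₂ h₁ h₂, h₁.x_plus_zero, zero_tmul, tmul_zero, zero_add,
            s0]
          exact regular_smul_mem (mul_mem (hX r) (mul_mem (hC _) hF1)) w00
        · rw [x_plus_fusionBasis_one hρ hb₁ hb₂ h₁ h₂, h₁.x_plus_one, tmul_smul_left_eq, one_mul, s1,
            ← mul_assoc, mul_smul _ (fusionFactor _ _ _)]
          exact add_mem (regular_smul_mem (hC _) w01)
            (regular_smul_mem (mul_mem (hX r) (hC _)) hwF)
        · rw [x_plus_fusionBasis_zero hρ h₂, h₁.x_plus_one, tmul_smul_left_eq, one_mul]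
          exact regular_smul_mem (hC _) (basis_mem_basisLattice _)
      · refine map_mem_of_basis ?_ ?_ ?_ ?_
        · rw [x_minus_fusionBasis_zero hρ hb₁ h₁ h₂, h₂.x_minus_zero,
            tmul_smul_right_eq, s0, mul_smul _ (fusionFactor _ _ _)]
          exact add_mem (regular_smul_mem (mul_mem (hX r) (hC _)) w01)
            (regular_smul_mem (hC _) hwF)
        · rw [x_minus_fusionBasis_zero hρ hb₁ h₁ h₂, h₂.x_minus_one, tmul_zero, tmul_zero, zero_add,
            s1, neg_neg]
          exact regular_smul_mem (mul_mem (hC _) hF1) w11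
        · rw [x_minus_fusionBasis_one hρ h₁, h₂.x_minus_one, tmul_zero, tmul_zero]
          exact zero_mem _
        · rw [x_minus_fusionBasis_one hρ h₁, h₂.x_minus_zero, tmul_smul_right_eq]
          exact regular_smul_mem (mul_mem (hX r) (hC _)) (basis_mem_basisLattice _)
    · refine map_mem_of_basis ?_ ?_ ?_ ?_ <;> rw [k_fusionBasis hρ h₁ h₂] <;>
        refine regular_smul_mem (hC _) ?_ <;> assumption
    · refine map_mem_of_basis ?_ ?_ ?_ ?_
      · obtain ⟨f, hf, h⟩ := exists_phi_fusionBasis hρ h₁ h₂ ε i m 0 0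
        exact h ▸ regular_smul_mem hf w00
      · obtain ⟨f, hf, h⟩ := exists_phi_fusionBasis hρ h₁ h₂ ε i m 0 1
        exact h ▸ regular_smul_mem hf w01
      · obtain ⟨f, hf, h⟩ := exists_phi_fusionBasis hρ h₁ h₂ ε i m 1 1
        exact h ▸ regular_smul_mem hf w11
      · obtain ⟨f, hf, h⟩ := exists_phi_fusionBasis hρ h₁ h₂ ε i m 1 0
        exact h ▸ regular_smul_mem hf w10'
  have ha : a ∈ S := hS ▸ Algebra.mem_top
  exact ha

/-- The vector `w_{10}` has weight zero, so a representative of a vector of nonzero weight has no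
component along it modulo `u - 1`. It lies in the invariant vanishing lattice, and so does
everything it generates, up to `(u - 1) L`; but `w_{10}` does not. -/
theorem not_isGeneratedInWeight_tensorD (hq : ∀ n : ℕ, n ≠ 0 → Complex.exp ħ ^ n ≠ 1)
    (hρ : IsFusionAction ρ) (hb₁ : b₁ ≠ 0) (hb₂ : b₂ ≠ 0) (hb : b₁ ≠ b₂)
    (h₁ : IsEvalBasis ħ b₁ e₁) (h₂ : IsEvalBasis ħ b₂ e₂)
    (hF : ∃ g ∈ regularAtOne, fusionFactor ħ (b₂ / b₁) (-1) = (RatFunc.X - 1) * g)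
    {ω : Module.Dual ℚ ℚ} (hω : ω ≠ 0) :
    ¬ IsGeneratedInWeight sl2Datum ħ ω (TensorD ρ) := by
  have hstab := action_mem_vanishingLattice hq hρ hb₁ hb₂ hb h₁ h₂ hF
  have hL {x : FusionSpace V₁ V₂} (hx : (x : RepSpace ρ) ∈ tensorLattice ρ) :
      x ∈ basisLattice (fusionBasis e₁ e₂) :=
    lattice_le_stableSubmodule (fun a => (hstab a).2)
      (by rintro _ ⟨t, rfl⟩; exact one_tmul_mem_basisLattice t) (mem_latticeRegular.2 hx)
  obtain ⟨h, hωh⟩ : ∃ h, ω h ≠ 0 := by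
    by_contra! h0
    exact hω (LinearMap.ext h0)
  rintro ⟨y, hy, hspan⟩
  obtain ⟨⟨x, hx⟩, rfl⟩ := Submodule.Quotient.mk_surjective _ y
  have hsub {x x' : RepSpace ρ} (hx : x ∈ tensorLattice ρ) (hx' : x' ∈ tensorLattice ρ)
      (e : (Submodule.Quotient.mk ⟨x, hx⟩ : TensorD ρ) = Submodule.Quotient.mk ⟨x', hx'⟩) :
      (show FusionSpace V₁ V₂ from x) - (show FusionSpace V₁ V₂ from x') ∈
        vanishingLattice (fusionBasis e₁ e₂) := by
    obtain ⟨z, hz, hzx⟩ := (Submodule.Quotient.eq _).1 e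
    have : (RatFunc.X - 1 : K) • (show FusionSpace V₁ V₂ from z) =
      (show FusionSpace V₁ V₂ from x) - (show FusionSpace V₁ V₂ from x') := hzx
    rw [← this]
    exact X_sub_one_smul_mem_vanishingLattice (hL hz)
  have hxP : (show FusionSpace V₁ V₂ from x) ∈ vanishingLattice (fusionBasis e₁ e₂) := by
    have e := hy h
    rw [← Submodule.Quotient.mk_smul, ← Submodule.Quotient.mk_smul] at e
    have h1 : ρ (U.k sl2Datum ħ h) x - ρ (algebraMap ℂ _ (qPow ħ (ω h))) x ∈ _ :=
      hsub ((tensorLattice ρ).smul_mem _ hx) ((tensorLattice ρ).smul_mem _ hx) e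
    obtain ⟨f, hf, p, hp, hxp⟩ := exists_eq_smul_add (hL hx)
    -- The defect `k_h x - q ^ ω(h) x`, which lies in the vanishing lattice, with the contribution
    -- of `p` removed. The scalar `1 - q ^ ω(h)` is a nonzero constant and can be divided out.
    have h2 : (1 - algebraMap ℂ K (qPow ħ (ω h))) • f • fusionBasis e₁ e₂ (1, 0) ∈
        vanishingLattice (fusionBasis e₁ e₂) := by
      have h3 := sub_mem h1 (sub_mem ((hstab (U.k sl2Datum ħ h)).1 p hp)
        ((hstab (algebraMap ℂ _ (qPow ħ (ω h)))).1 p hp))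
      rw [hxp, map_add, map_add, map_smul, map_smul, k_fusionBasis hρ h₁ h₂, action_algebraMap] at h3
      convert h3 using 1
      simp [evalSign, qPow_zero, sub_smul, smul_comm f]
      abel
    have h4 : (1 : ℂ) - qPow ħ (ω h) ≠ 0 := fun h0 =>
      hωh (qPow_eq_one hq (sub_eq_zero.1 h0).symm)
    have h5 := regular_smul_mem (regularAtOne.algebraMap_mem (1 - qPow ħ (ω h))⁻¹) h2
    rw [← map_one (algebraMap ℂ K), ← map_sub, smul_smul, ← map_mul, inv_mul_cancel₀ h4, map_one,
      one_smul] at h5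
    change x ∈ _
    rw [hxp]
    exact add_mem h5 hp
  have hw : (fusionBasis e₁ e₂ (1, 0) : RepSpace ρ) ∈ tensorLattice ρ := by
    rw [fusionBasis_apply]
    exact mem_lattice_of_mem (X := FusionSpace V₁ V₂) ⟨_, rfl⟩
  have hm : (Submodule.Quotient.mk ⟨_, hw⟩ : TensorD ρ) ∈
      Submodule.span (U sl2Datum ħ) {(Submodule.Quotient.mk ⟨x, hx⟩ : TensorD ρ)} :=
    hspan ▸ Submodule.mem_top
  obtain ⟨a, ha⟩ := Submodule.mem_span_singleton.1 hm
  rw [← Submodule.Quotient.mk_smul] at ha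
  have h1 : ρ a x - fusionBasis e₁ e₂ (1, 0) ∈ _ := hsub ((tensorLattice ρ).smul_mem _ hx) hw ha
  have h2 := sub_mem ((hstab a).1 x hxP) h1
  rw [sub_sub_cancel] at h2
  exact basis_notMem_vanishingLattice h2

end EvaluationTensor

theorem exists_not_equiv_tensorD (ħ : ℂ) (hq : ∀ n : ℕ, n ≠ 0 → Complex.exp ħ ^ n ≠ 1) :
    ∃ (V₁ V₂ : Modf.{0} sl2Datum ħ) (v₁ : V₁.obj) (v₂ : V₂.obj)
      (ω₁ ω₂ : Module.Dual ℚ ℚ) (Ψ₁ Ψ₂ : ℤˣ → Fin 1 → ℕ → ℂ)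
      (ρ₁₂ : U sl2Datum ħ →ₐ[ℂ] Module.End K (FusionSpace V₁.obj V₂.obj))
      (ρ₂₁ : U sl2Datum ħ →ₐ[ℂ] Module.End K (FusionSpace V₂.obj V₁.obj)),
      IsSimpleModule (U sl2Datum ħ) V₁.obj ∧
      IsSimpleModule (U sl2Datum ħ) V₂.obj ∧
      IsLHighestWeightVector sl2Datum ħ V₁.obj ω₁ Ψ₁ v₁ ∧
      IsLHighestWeightVector sl2Datum ħ V₂.obj ω₂ Ψ₂ v₂ ∧
      HasDrinfeldPolynomials sl2Datum ħ Ψ₁ (fun _ => 1 - Polynomial.X) ∧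
      HasDrinfeldPolynomials sl2Datum ħ Ψ₂
        (fun _ => 1 - Polynomial.C (Complex.exp ħ ^ 2) * Polynomial.X) ∧
      IsFusionAction ρ₁₂ ∧ IsFusionAction ρ₂₁ ∧
      IsEmpty (TensorD ρ₁₂ ≃ₗ[U sl2Datum ħ] TensorD ρ₂₁) ∧
      IsEmpty (TensorD ρ₁₂ ≃ₗ[U sl2Datum ħ] FusionProduct ρ₁₂ v₁ v₂) := by
  have hb₁ : (1 : ℂ) ≠ 0 := one_ne_zero
  have hb₂ : Complex.exp ħ ^ 2 ≠ 0 := pow_ne_zero _ (Complex.exp_ne_zero _)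
  have hb : (1 : ℂ) ≠ Complex.exp ħ ^ 2 := (hq 2 two_ne_zero).symm
  have hq2 : Complex.exp ħ ^ 2 = qPow ħ 2 := by
    rw [qPow, ← Complex.exp_nat_mul]
    congr 1
    push_cast
    ring
  have h₁ := evalBasis_isEvalBasis hq hb₁
  have h₂ := evalBasis_isEvalBasis hq hb₂
  let V₁ : Modf.{0} sl2Datum ħ := ⟨evalModule hq hb₁, evalModule_isModf hq hb₁⟩
  let V₂ : Modf.{0} sl2Datum ħ := ⟨evalModule hq hb₂, evalModule_isModf hq hb₂⟩
  have hρ₁₂ := modfAction_isFusionAction hq V₁ V₂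
  have hρ₂₁ := modfAction_isFusionAction hq V₂ V₁
  have hω : (2 : ℚ) • (LinearMap.id : ℚ →ₗ[ℚ] ℚ) ≠ 0 := fun h => by
    have := LinearMap.congr_fun h (1 : ℚ)
    simp at this
  have hgen {b b' : ℂ} {hb : b ≠ 0} {hb' : b' ≠ 0}
      {ρ : U sl2Datum ħ →ₐ[ℂ] Module.End K (FusionSpace (evalModule hq hb) (evalModule hq hb'))}
      (hρ : IsFusionAction ρ) : IsGeneratedInWeight sl2Datum ħ ((2 : ℚ) • LinearMap.id)
        (FusionProduct ρ (evalBasis hq hb 0) (evalBasis hq hb' 0)) := by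
    refine isGeneratedInWeight_specialization fun h => ?_
    have := k_fusionBasis hρ (evalBasis_isEvalBasis hq hb) (evalBasis_isEvalBasis hq hb') h 0 0
    rw [fusionBasis_apply] at this
    rw [this]
    simp [evalSign, one_add_one_eq_two]
  -- Here `b₂ / b₁ = q²`, so the fusion factor at `-1` is `(q - q u) / (1 - q² u)`, which vanishes
  -- at `u = 1`.
  have hnot : ¬ IsGeneratedInWeight sl2Datum ħ ((2 : ℚ) • LinearMap.id)
      (TensorD (modfAction hq V₁ V₂)) := by
    refine not_isGeneratedInWeight_tensorD hq hρ₁₂ hb₁ hb₂ hb h₁ h₂ ?_ hω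
    rw [div_one, hq2, fusionFactor, ← qPow_add]
    norm_num
    refine exists_gamFrac_eq fun h => ?_
    rw [← qPow_add] at h
    have := qPow_eq_one hq h
    norm_num at this
  have hgen₂₁ : IsGeneratedInWeight sl2Datum ħ ((2 : ℚ) • LinearMap.id)
      (TensorD (modfAction hq V₂ V₁)) := by
    have := tensorLattice_eq_lattice hρ₂₁ hb₂ hb.symm h₂ h₁ ?_
    · change IsGeneratedInWeight _ _ _ (Specialization _ (tensorLattice _))
      rw [this]
      exact hgen hρ₂₁
    -- In the opposite order the ratio is `q⁻²`, and the numerator `q - q⁻³ u` does not vanish at `u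
    -- = 1`.
    · refine exists_mul_gamFrac_eq_one ?_
      rw [hq2, one_div, ← qPow_neg, ← qPow_add]
      intro h
      have := qPow_injective hq h
      norm_num at this
  refine ⟨V₁, V₂, evalBasis hq hb₁ 0, evalBasis hq hb₂ 0, LinearMap.id, LinearMap.id, _, _,
    modfAction hq V₁ V₂, modfAction hq V₂ V₁, h₁.isSimpleModule hb₁, h₂.isSimpleModule hb₂,
    h₁.isLHighestWeightVector hb₁, h₂.isLHighestWeightVector hb₂, ?_,
    hasDrinfeldPolynomials_eval hb₂, hρ₁₂, hρ₂₁, ⟨fun e => hnot (hgen₂₁.of_equiv e)⟩,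
    ⟨fun e => hnot ((hgen hρ₁₂).of_equiv e)⟩⟩
  have := hasDrinfeldPolynomials_eval (ħ := ħ) hb₁
  rwa [Polynomial.C_1, one_mul] at this

end QAff

theorem theorem4p13 :
    -- the bifunctor, for every quantum affinization
    (∀ {ι : Type w₁} [Fintype ι] [DecidableEq ι] {𝔥 : Type w₂} [AddCommGroup 𝔥] [Module ℚ 𝔥]
      (D : QAff.CartanDatum ι 𝔥) (ħ : ℂ)
      (_hq : ∀ n : ℕ, n ≠ 0 → Complex.exp ħ ^ n ≠ 1),
      ∃ ρ : ∀ V₁ V₂ : QAff.Modf.{v} D ħ,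
          QAff.U D ħ →ₐ[ℂ] Module.End QAff.K (QAff.FusionSpace V₁.obj V₂.obj),
        -- `ρ V₁ V₂` is the fusion action, and the only one
        (∀ V₁ V₂ ρ', QAff.IsFusionAction ρ' ↔ ρ' = ρ V₁ V₂) ∧
        (∀ V₁ V₂, QAff.IsAForm (ρ V₁ V₂) (QAff.tensorLattice (ρ V₁ V₂))) ∧
        ∃ (F : QAff.Modf.{v} D ħ × QAff.Modf.{v} D ħ ⥤ QAff.Modf.{v} D ħ)
          (e : ∀ V₁ V₂ : QAff.Modf.{v} D ħ,
            (F.obj (V₁, V₂)).obj ≃ₗ[QAff.U D ħ] QAff.TensorD (ρ V₁ V₂)),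
          ∀ (V₁ V₂ V₁' V₂' : QAff.Modf.{v} D ħ) (f₁ : V₁ ⟶ V₁') (f₂ : V₂ ⟶ V₂')
            (x : QAff.RepSpace (ρ V₁ V₂)) (hx : x ∈ QAff.tensorLattice (ρ V₁ V₂)),
            ∃ hx' : (QAff.fusionMap f₁.hom.hom f₂.hom.hom x : QAff.RepSpace (ρ V₁' V₂')) ∈
                QAff.tensorLattice (ρ V₁' V₂'),
              e V₁' V₂' ((F.map (Prod.mkHom f₁ f₂)).hom
                  ((e V₁ V₂).symm (Submodule.Quotient.mk ⟨x, hx⟩))) =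
                Submodule.Quotient.mk ⟨QAff.fusionMap f₁.hom.hom f₂.hom.hom x, hx'⟩) ∧
    -- the fundamental modules `L_1`, `L_{q^2}` of the quantum affine algebra of type `A_1`
    (∀ (ħ : ℂ) (_hq : ∀ n : ℕ, n ≠ 0 → Complex.exp ħ ^ n ≠ 1),
      ∃ (V₁ V₂ : QAff.Modf.{0} QAff.sl2Datum ħ) (v₁ : V₁.obj) (v₂ : V₂.obj)
        (ω₁ ω₂ : Module.Dual ℚ ℚ) (Ψ₁ Ψ₂ : ℤˣ → Fin 1 → ℕ → ℂ)
        (ρ₁₂ : QAff.U QAff.sl2Datum ħ →ₐ[ℂ] Module.End QAff.K (QAff.FusionSpace V₁.obj V₂.obj))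
        (ρ₂₁ : QAff.U QAff.sl2Datum ħ →ₐ[ℂ] Module.End QAff.K (QAff.FusionSpace V₂.obj V₁.obj)),
        IsSimpleModule (QAff.U QAff.sl2Datum ħ) V₁.obj ∧
        IsSimpleModule (QAff.U QAff.sl2Datum ħ) V₂.obj ∧
        QAff.IsLHighestWeightVector QAff.sl2Datum ħ V₁.obj ω₁ Ψ₁ v₁ ∧
        QAff.IsLHighestWeightVector QAff.sl2Datum ħ V₂.obj ω₂ Ψ₂ v₂ ∧
        QAff.HasDrinfeldPolynomials QAff.sl2Datum ħ Ψ₁ (fun _ => 1 - Polynomial.X) ∧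
        QAff.HasDrinfeldPolynomials QAff.sl2Datum ħ Ψ₂
          (fun _ => 1 - Polynomial.C (Complex.exp ħ ^ 2) * Polynomial.X) ∧
        QAff.IsFusionAction ρ₁₂ ∧ QAff.IsFusionAction ρ₂₁ ∧
        IsEmpty (QAff.TensorD ρ₁₂ ≃ₗ[QAff.U QAff.sl2Datum ħ] QAff.TensorD ρ₂₁) ∧
        IsEmpty (QAff.TensorD ρ₁₂ ≃ₗ[QAff.U QAff.sl2Datum ħ]
          QAff.FusionProduct ρ₁₂ v₁ v₂)) :=
  ⟨fun D ħ hq => QAff.exists_tensorD_bifunctor D ħ hq, QAff.exists_not_equiv_tensorD⟩
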